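/- **Theorem 6.2 (Virasoro constraints).** *Setting.* Let $U\subset\mathbb R$ be open (the interior of the support of $e^V$) and let $f(z)=\sum_{i\ge 0}a_iz^i$, $g(z)=\sum_{i\ge0}b_iz^i$ be real power series that converge on $U$. Let $V:U\to\mathbb R$ be differentiable with $fV'=g$ on $U$ (that is, $V'=g/f$), and put $e^{V}:=0$ outside $U$. Write $t=(t_1,t_2,\dots)$, $s=(s_1,s_2,\dots)$, $\varepsilon(x)=\operatorname{sign}(x)$, and let $\Delta_n$ be the Vandermonde determinant. For a finitely supported real sequence $T=(T_1,T_2,\dots)$ put $w_T(x)=e^{V(x)+\sum_iT_ix^i}$. Call $T$ *admissible* if, for all $p\ge 0$, the functions $|x|^pw_T$, $|x|^p\sum_i(i+1)|a_i||x|^i\,w_T$ and $|x|^p\sum_i|b_i||x|^i\,w_T$ are integrable, and $x^pf(x)w_T(x)\to0$ as $x\in U$ tends to a boundary point of $U$ or to $\pm\infty$. (If $f,g$ are polynomials, finiteness of all moments of $w_T$ suffices for the integrability conditions.) Functions of $(t,s)$ are considered as formal power series in $(t-T,s-S)$ at a base point $(T,S)$ for which $T$ and $-S$ are admissible, the exponentials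 being expanded under the integral signs; integrals of such series are taken coefficient by coefficient and converge absolutely. All equations below hold for these series at every such base point (for functions of $t$ alone: at every admissible $T$). The series in $i$ and $\ell$ in the Virasoro constraints converge coefficient by coefficient. Whenever the moments of the weight stay finite for all small real changes (of both signs) of one time variable, the partial derivative in that variable, coefficient by coefficient, is the actual derivative with respect to the base point. *Notation.* With $i,j\ge1$, $J_n^{(0)}=\delta_{n0}$; $J^{(1)}_n=\partial/\partial t_n$ for $n>0$, $J^{(1)}_n=(-n)t_{-n}$ for $n<0$, $J^{(1)}_0=0$; $$J_n^{(2)}=\sum_{i+j=n}\frac{\partial^2}{\partial t_i\partial t_j}+2\sum_{-i+j=n}it_i\frac{\partial}{\partial t_j}+\sum_{-i-j=n}(it_i)(jt_j);$$ $\tilde J^{(k)}_n$ is $J^{(k)}_n$ with $t$ replaced by $s$; $\mathbb J^{(1)}_{k,N}=J^{(1)}_k+NJ^{(0)}_k$ and $\mathbb J^{(2)}_{k,N}=J_k^{(2)}+(2N+k+1)J_k^{(1)}+N(N+1)J_k^{(0)}$. Further $[\alpha]=(\alpha,\alpha^2/2,\alpha^3/3,\dots)$, $e^{\sum_{i\ge1}t_iz^i}=\sum_{k\ge0}p_k(t)z^k$,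 $\tilde\partial=(\frac{\partial}{\partial t_1},\frac12\frac{\partial}{\partial t_2},\frac13\frac\partial{\partial t_3},\dots)$, $P(\partial)\,\varphi\circ\psi=P(\partial_y)\,\varphi(t+y)\psi(t-y)|_{y=0}$, $\{\varphi,\psi\}=\frac{\partial \varphi}{\partial t_1}\psi-\varphi\frac{\partial \psi}{\partial t_1}$. *(1) The 2-Toda part.* Let $\mu_{k\ell}(t,s)=\iint_{U^2}x^ky^\ell e^{V(x)+V(y)+\sum_i(t_ix^i-s_iy^i)}\varepsilon(x-y)\,dx\,dy$. Then, for all $n\ge0$, $$\tau_n(t,s):=\det(\mu_{ij}(t,s))_{0\le i,j\le n-1}=\frac1{n!}\int_{U^{2n}}\prod_{k=1}^n\Big(e^{V(x_k)+V(y_k)+\sum_i(t_ix_k^i-s_iy_k^i)}\varepsilon(x_k-y_k)\Big)\Delta_n(x)\Delta_n(y)\,dx\,dy .$$ The sequence $(\tau_n)_{n\ge0}$ is a (semi-infinite) $\tau$-vector of the 2-Toda lattice: $\tau_0=1$ and, for all $n,m\ge0$, $$\oint_{z=\infty}\tau_n(t-[z^{-1}],s)\tau_{m+1}(t'+[z^{-1}],s')e^{\sum(t_i-t_i')z^i}z^{n-m-1}dz=\oint_{z=0}\tau_{n+1}(t,s-[z])\tau_m(t',s'+[z])e^{\sum(s_i-s_i')z^{-i}}z^{n-m-1}dz,$$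 both sides meaning the coefficient of $z^{-1}$ of the integrand. For all $k\ge-1$ and $n\ge0$, $$\sum_{i\ge0}\Big\{\tfrac{a_i}2\Big(J^{(2)}_{i+k}+\tilde J^{(2)}_{i+k}+(2n+i+k+1)(J^{(1)}_{i+k}-\tilde J^{(1)}_{i+k})+2n(n+1)J^{(0)}_{i+k}\Big)+b_i\Big(J^{(1)}_{i+k+1}-\tilde J^{(1)}_{i+k+1}+2nJ^{(0)}_{i+k+1}\Big)\Big\}\tau_n=0.$$ *(2) The Pfaffian part.* For even $N\ge0$ let $$\tilde\tau_N(t)=\frac1{N!}\int_{U^N}\prod_{k=1}^N e^{V(x_k)+\sum_it_ix_k^i}\,|\Delta_N(x)|\,dx .$$ Then $\tilde\tau_N(t)=\tau_N(t,-t)^{1/2}$: one has $\tilde\tau_N(t)^2=\tau_N(t,-t)$, and $\tilde\tau_N(T)>0$ at every admissible $T$ if $U\ne\emptyset$. Moreover $\tilde\tau_N(t)=(-1)^{N/2}\operatorname{pf}(\mu_{ij}(t,-t))_{0\le i,j\le N-1}$. These functions satisfy the Pfaffian KP hierarchy: for all $n\ge0$ (with $\tilde\tau_{-2}=0$) the differential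 Fay identity $$\{\tilde\tau_{2n}(t-[u]),\tilde\tau_{2n}(t-[v])\}+(u^{-1}-v^{-1})\big(\tilde\tau_{2n}(t-[u])\tilde\tau_{2n}(t-[v])-\tilde\tau_{2n}(t)\tilde\tau_{2n}(t-[u]-[v])\big)=uv(u-v)\,\tilde\tau_{2n-2}(t-[u]-[v])\,\tilde\tau_{2n+2}(t)$$ and, for all $k\ge0$, $$\Big(p_{k+4}(\tilde\partial)-\tfrac12\tfrac{\partial^2}{\partial t_1\partial t_{k+3}}\Big)\tilde\tau_{2n}\circ\tilde\tau_{2n}=p_k(\tilde\partial)\,\tilde\tau_{2n+2}\circ\tilde\tau_{2n-2}.$$ They satisfy the Virasoro constraints, for all $k\ge-1$ and even $N\ge0$: $$\sum_{\ell\ge0}\Big(\tfrac{a_\ell}2\,\mathbb J^{(2)}_{k+\ell,N}+b_\ell\,\mathbb J^{(1)}_{k+\ell+1,N}\Big)\tilde\tau_N(t)=0 .$$ -/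

import Mathlib

open MeasureTheory Filter Topology

noncomputable section

namespace PfaffToda

/-! ### The weight -/

/-- The power series `∑_{i ≥ 0} a_i x^i`. -/
def pser (a : ℕ → ℝ) (x : ℝ) : ℝ := ∑' i, a i * x ^ i

/-- `∑_{i ≥ 1} T_i x^i` for a finitely supported sequence of times. -/
def timePoly (T : ℕ+ →₀ ℝ) (x : ℝ) : ℝ := T.sum fun i c => c * x ^ (i : ℕ)

/-- The function `e^{V(x) + ∑ T_i x^i}` on `U`, and `0` outside `U`. -/
def weight (U : Set ℝ) (V : ℝ → ℝ) (T : ℕ+ →₀ ℝ) (x : ℝ) : ℝ :=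
  U.indicator (fun x => Real.exp (V x + timePoly T x)) x

/-- All moments of `e^{V(x) + ∑ T_i x^i}` on `U` are finite. -/
def HasMoments (U : Set ℝ) (V : ℝ → ℝ) (T : ℕ+ →₀ ℝ) : Prop :=
  ∀ p : ℕ, Integrable fun x : ℝ => x ^ p * weight U V T x

/-- `e^{V(x) + ∑ T_i x^i}` decays fast enough at the boundary of its support `U` (`±∞` included):
its moments are finite, also against the (absolute) power series `f = ∑ a_i x^i` and
`g = ∑ b_i x^i`, and `x^p f(x) e^{V(x) + ∑ T_i x^i}` tends to `0` at the boundary.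
For polynomials `f` and `g` the second and third condition follow from the first. -/
structure DecaysFast (U : Set ℝ) (V : ℝ → ℝ) (a b : ℕ → ℝ) (T : ℕ+ →₀ ℝ) : Prop where
  moments : HasMoments U V T
  moments_f : ∀ p : ℕ, Integrable fun x : ℝ =>
    |x| ^ p * (∑' i : ℕ, ((i : ℝ) + 1) * |a i| * |x| ^ i) * weight U V T x
  moments_g : ∀ p : ℕ, Integrable fun x : ℝ =>
    |x| ^ p * (∑' i : ℕ, |b i| * |x| ^ i) * weight U V T x
  boundary : ∀ p : ℕ, ∀ c ∈ frontier U,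
    Tendsto (fun x => x ^ p * pser a x * weight U V T x) (𝓝[U] c) (𝓝 0)
  infinity : ∀ p : ℕ,
    Tendsto (fun x => x ^ p * pser a x * weight U V T x) (cocompact ℝ ⊓ 𝓟 U) (𝓝 0)

/-! ### Formal power series in the times

A function of the times near a base point is represented by its formal power series at that point,
so the variable `X_i` stands for `t_i - T_i`. -/

/-- `e^{∑ c_i X_i}`. -/
def linExp {σ : Type*} (c : σ → ℝ) : MvPowerSeries σ ℝ :=
  fun m => m.prod fun i e => c i ^ e / (e.factorial : ℝ)

/-- The integral of a power series that depends on a parameter, coefficient by coefficient. -/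
def formalIntegral {α σ : Type*} [MeasureSpace α] (F : α → MvPowerSeries σ ℝ) :
    MvPowerSeries σ ℝ :=
  fun m => ∫ x, MvPowerSeries.coeff m (F x)

def FormallyIntegrable {α σ : Type*} [MeasureSpace α] (F : α → MvPowerSeries σ ℝ) : Prop :=
  ∀ m, Integrable fun x => MvPowerSeries.coeff m (F x)

/-- The sum of a family of power series in which every monomial occurs only finitely often. -/
def fsum {β σ : Type*} (F : β → MvPowerSeries σ ℝ) : MvPowerSeries σ ℝ :=
  fun m => ∑ᶠ q, MvPowerSeries.coeff m (F q)

/-- The series `∑_i F_i` converges to `0`, coefficient by coefficient. -/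
def SumsToZero {σ : Type*} (F : ℕ → MvPowerSeries σ ℝ) : Prop :=
  ∀ m, HasSum (fun i => MvPowerSeries.coeff m (F i)) 0

/-! ### The integrals

The variables are `t` (`Sum.inl`) and `s` (`Sum.inr`), at the base point `(T, S)`. -/

/-- `e^{V(x) + V(y) + ∑ (t_i x^i - s_i y^i)} ε(x - y)` with `t = T + X`, `s = S + Y`. -/
def skewWeight (U : Set ℝ) (V : ℝ → ℝ) (T S : ℕ+ →₀ ℝ) (x y : ℝ) :
    MvPowerSeries (ℕ+ ⊕ ℕ+) ℝ :=
  (weight U V T x * weight U V (-S) y * Real.sign (x - y)) •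
    linExp (Sum.elim (fun i : ℕ+ => x ^ (i : ℕ)) (fun i : ℕ+ => -y ^ (i : ℕ)))

def momentIntegrand (U : Set ℝ) (V : ℝ → ℝ) (T S : ℕ+ →₀ ℝ) (k l : ℕ) (p : ℝ × ℝ) :
    MvPowerSeries (ℕ+ ⊕ ℕ+) ℝ :=
  (p.1 ^ k * p.2 ^ l) • skewWeight U V T S p.1 p.2

/-- The moments `μ_{kl}(t, s)`. -/
def moment (U : Set ℝ) (V : ℝ → ℝ) (T S : ℕ+ →₀ ℝ) (k l : ℕ) : MvPowerSeries (ℕ+ ⊕ ℕ+) ℝ :=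
  formalIntegral (momentIntegrand U V T S k l)

/-- The moment matrix `m_n(t, s)`. -/
def momentMatrix (U : Set ℝ) (V : ℝ → ℝ) (T S : ℕ+ →₀ ℝ) (n : ℕ) :
    Matrix (Fin n) (Fin n) (MvPowerSeries (ℕ+ ⊕ ℕ+) ℝ) :=
  Matrix.of fun i j => moment U V T S i j

/-- `τ_n(t, s) = det m_n(t, s)`. -/
def tau (U : Set ℝ) (V : ℝ → ℝ) (T S : ℕ+ →₀ ℝ) (n : ℕ) : MvPowerSeries (ℕ+ ⊕ ℕ+) ℝ :=
  (momentMatrix U V T S n).det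

/-- `∏_k (e^{V(x_k) + V(y_k) + ∑ (t_i x_k^i - s_i y_k^i)} ε(x_k - y_k)) Δ_n(x) Δ_n(y)`. -/
def multiIntegrand (U : Set ℝ) (V : ℝ → ℝ) (T S : ℕ+ →₀ ℝ) (n : ℕ)
    (p : (Fin n → ℝ) × (Fin n → ℝ)) : MvPowerSeries (ℕ+ ⊕ ℕ+) ℝ :=
  ((Matrix.vandermonde p.1).det * (Matrix.vandermonde p.2).det) •
    ∏ k, skewWeight U V T S (p.1 k) (p.2 k)

/-- `∏_k e^{V(x_k) + ∑ t_i x_k^i} |Δ_N(x)|` with `t = T + X`. -/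
def pfIntegrand (U : Set ℝ) (V : ℝ → ℝ) (T : ℕ+ →₀ ℝ) (N : ℕ) (x : Fin N → ℝ) :
    MvPowerSeries ℕ+ ℝ :=
  |(Matrix.vandermonde x).det| •
    ∏ k, weight U V T (x k) • linExp fun i : ℕ+ => x k ^ (i : ℕ)

/-- `τ̃_N(t) = (1 / N!) ∫ ∏_k e^{V(x_k) + ∑ t_i x_k^i} |Δ_N(x)| dx`. -/
def pfTau (U : Set ℝ) (V : ℝ → ℝ) (T : ℕ+ →₀ ℝ) (N : ℕ) : MvPowerSeries ℕ+ ℝ :=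
  (1 / (N.factorial : ℝ)) • formalIntegral (pfIntegrand U V T N)

/-- The restriction `φ(t, -t)`; the base point has to be of the form `(T, -T)`. -/
def restrictDiag (φ : MvPowerSeries (ℕ+ ⊕ ℕ+) ℝ) : MvPowerSeries ℕ+ ℝ :=
  φ.subst (Sum.elim (fun i => MvPowerSeries.X i) (fun i => -MvPowerSeries.X i) :
    ℕ+ ⊕ ℕ+ → MvPowerSeries ℕ+ ℝ)

/-- The Pfaffian
`(1 / (2^n n!)) ∑_σ sign(σ) ∏_{i < n} A_{σ(2i), σ(2i+1)}` of a matrix of size `2n`. -/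
def pfaffian {R : Type*} [CommRing R] [Algebra ℝ R] {n : ℕ}
    (A : Matrix (Fin (2 * n)) (Fin (2 * n)) R) : R :=
  (1 / (2 ^ n * (n.factorial : ℝ))) • ∑ σ : Equiv.Perm (Fin (2 * n)),
    ((Equiv.Perm.sign σ : ℤ) : R) *
      ∏ i : Fin n, A (σ ⟨2 * i, by omega⟩) (σ ⟨2 * i + 1, by omega⟩)

/-! ### The Virasoro generators

`ι` names the variables of the chosen set of times, `T` is their base point. -/

section Virasoro

variable {σ : Type*} (ι : ℕ+ → σ) (T : ℕ+ →₀ ℝ)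

/-- The time `t_i`, as a power series at the base point. -/
def timeVar (i : ℕ+) : MvPowerSeries σ ℝ := MvPowerSeries.C (T i) + MvPowerSeries.X (ι i)

/-- `J_n^{(0)} = δ_{n0}`. -/
def J0 (n : ℤ) : ℝ := if n = 0 then 1 else 0

/-- `J_n^{(1)} = ∂/∂t_n` for `n > 0`, `J_n^{(1)} = (-n) t_{-n}` for `n < 0`, `J_0^{(1)} = 0`. -/
def J1 (n : ℤ) (φ : MvPowerSeries σ ℝ) : MvPowerSeries σ ℝ :=
  if h : 0 < n then MvPowerSeries.pderiv ℝ (ι ⟨n.toNat, by omega⟩) φ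
  else if h : n < 0 then (-(n : ℝ)) • (timeVar ι T ⟨(-n).toNat, by omega⟩ * φ)
  else 0

/-- `J_n^{(2)} = ∑_{i+j=n} ∂²/∂t_i∂t_j + 2 ∑_{-i+j=n} i t_i ∂/∂t_j + ∑_{-i-j=n} (i t_i)(j t_j)`,
with `i, j ≥ 1` throughout. -/
def J2 (n : ℤ) (φ : MvPowerSeries σ ℝ) : MvPowerSeries σ ℝ :=
  fsum (fun q : ℕ+ × ℕ+ => if (q.1 : ℤ) + (q.2 : ℤ) = n then
      MvPowerSeries.pderiv ℝ (ι q.1) (MvPowerSeries.pderiv ℝ (ι q.2) φ) else 0) +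
  (2 : ℝ) • fsum (fun q : ℕ+ × ℕ+ => if -(q.1 : ℤ) + (q.2 : ℤ) = n then
      (q.1 : ℝ) • (timeVar ι T q.1 * MvPowerSeries.pderiv ℝ (ι q.2) φ) else 0) +
  fsum (fun q : ℕ+ × ℕ+ => if -(q.1 : ℤ) - (q.2 : ℤ) = n then
      ((q.1 : ℝ) * (q.2 : ℝ)) • (timeVar ι T q.1 * timeVar ι T q.2 * φ) else 0)

/-- `𝕁_{k,N}^{(1)} = J_k^{(1)} + N J_k^{(0)}`. -/
def BJ1 (k : ℤ) (N : ℕ) (φ : MvPowerSeries σ ℝ) : MvPowerSeries σ ℝ :=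
  J1 ι T k φ + ((N : ℝ) * J0 k) • φ

/-- `𝕁_{k,N}^{(2)} = J_k^{(2)} + (2N + k + 1) J_k^{(1)} + N (N + 1) J_k^{(0)}`. -/
def BJ2 (k : ℤ) (N : ℕ) (φ : MvPowerSeries σ ℝ) : MvPowerSeries σ ℝ :=
  J2 ι T k φ + (2 * (N : ℝ) + (k : ℝ) + 1) • J1 ι T k φ + ((N : ℝ) * ((N : ℝ) + 1) * J0 k) • φ

end Virasoro

/-- The term with index `i` of the constraint for `τ_n(t, s)`. -/
def todaVirasoroTerm (a b : ℕ → ℝ) (T S : ℕ+ →₀ ℝ) (k : ℤ) (n i : ℕ)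
    (φ : MvPowerSeries (ℕ+ ⊕ ℕ+) ℝ) : MvPowerSeries (ℕ+ ⊕ ℕ+) ℝ :=
  (a i / 2) •
    (J2 Sum.inl T (i + k) φ + J2 Sum.inr S (i + k) φ
      + (2 * (n : ℝ) + (i : ℝ) + (k : ℝ) + 1) •
          (J1 Sum.inl T (i + k) φ - J1 Sum.inr S (i + k) φ)
      + (2 * (n : ℝ) * ((n : ℝ) + 1) * J0 (i + k)) • φ) +
  b i •
    (J1 Sum.inl T (i + k + 1) φ - J1 Sum.inr S (i + k + 1) φ
      + (2 * (n : ℝ) * J0 (i + k + 1)) • φ)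

/-- The term with index `ℓ` of the constraint for `τ̃_N(t)`. -/
def pfVirasoroTerm (a b : ℕ → ℝ) (T : ℕ+ →₀ ℝ) (k : ℤ) (N l : ℕ)
    (φ : MvPowerSeries ℕ+ ℝ) : MvPowerSeries ℕ+ ℝ :=
  (a l / 2) • BJ2 id T (k + l) N φ + b l • BJ1 id T (k + l + 1) N φ

/-! ### The 2-Toda lattice -/

/-- The elementary Schur polynomials: `e^{∑_{i ≥ 1} x_i z^i} = ∑_{k ≥ 0} p_k(x) z^k`. -/
def schur {A : Type*} [CommRing A] [Algebra ℝ A] (x : ℕ+ → A) (k : ℕ) : A :=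
  PowerSeries.coeff k
    ((PowerSeries.exp ℝ).subst
      (PowerSeries.mk fun i => if h : 0 < i then x ⟨i, h⟩ else 0 : PowerSeries A))

/-- `[α] = (α, α²/2, α³/3, …)`. -/
def miwa {σ : Type*} (α : MvPowerSeries σ ℝ) (i : ℕ+) : MvPowerSeries σ ℝ :=
  (1 / (i : ℝ)) • α ^ (i : ℕ)

/-- The variables of the bilinear identities: two copies `(t, s)`, `(t', s')` of the times and the
local parameter `w` of the contour integral (`w = z⁻¹` at `z = ∞`, `w = z` at `z = 0`). -/
inductive BVar : Type
  | t (i : ℕ+)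
  | s (i : ℕ+)
  | t' (i : ℕ+)
  | s' (i : ℕ+)
  | w

/-- `φ(x, y)` for power series `x`, `y` without constant terms. -/
def evalTimes {σ : Type*} (φ : MvPowerSeries (ℕ+ ⊕ ℕ+) ℝ) (x y : ℕ+ → MvPowerSeries σ ℝ) :
    MvPowerSeries σ ℝ :=
  φ.subst (Sum.elim x y)

/-- The coefficient of `w^k`, a power series in the other variables. -/
def coeffW (k : ℕ) (φ : MvPowerSeries BVar ℝ) : MvPowerSeries BVar ℝ :=
  open Classical in
  fun m => if m BVar.w = 0 then MvPowerSeries.coeff (m + Finsupp.single BVar.w k) φ else 0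

/-- `∑_{c - a = N} A_a B_c`: the coefficient of `z^N` in `(∑_a A_a z^{-a}) (∑_c B_c z^c)`. -/
def resPair (N : ℤ) (A B : ℕ → MvPowerSeries BVar ℝ) : MvPowerSeries BVar ℝ :=
  fsum fun q : ℕ × ℕ => if (q.2 : ℤ) - (q.1 : ℤ) = N then A q.1 * B q.2 else 0

/-- A semi-infinite vector of 2-Toda `τ`-functions (as formal series at a base point): `τ_0 = 1`
and the bilinear identities
`∮_{z=∞} τ_n(t - [z⁻¹], s) τ_{m+1}(t' + [z⁻¹], s') e^{∑ (t_i - t'_i) z^i} z^{n-m-1} dz`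
`  = ∮_{z=0} τ_{n+1}(t, s - [z]) τ_m(t', s' + [z]) e^{∑ (s_i - s'_i) z^{-i}} z^{n-m-1} dz`
for all `n, m ≥ 0`; each side is the coefficient of `z⁻¹` of the integrand. -/
def IsTwoTodaTauVector (τ : ℕ → MvPowerSeries (ℕ+ ⊕ ℕ+) ℝ) : Prop :=
  let t : ℕ+ → MvPowerSeries BVar ℝ := fun i => MvPowerSeries.X (BVar.t i)
  let s : ℕ+ → MvPowerSeries BVar ℝ := fun i => MvPowerSeries.X (BVar.s i)
  let t' : ℕ+ → MvPowerSeries BVar ℝ := fun i => MvPowerSeries.X (BVar.t' i)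
  let s' : ℕ+ → MvPowerSeries BVar ℝ := fun i => MvPowerSeries.X (BVar.s' i)
  let W : ℕ+ → MvPowerSeries BVar ℝ := miwa (MvPowerSeries.X BVar.w)
  τ 0 = 1 ∧ ∀ n m : ℕ,
    resPair ((m : ℤ) - n)
        (fun j => coeffW j (evalTimes (τ n) (t - W) s * evalTimes (τ (m + 1)) (t' + W) s'))
        (schur (t - t')) =
      resPair ((n : ℤ) - m)
        (fun j => coeffW j (evalTimes (τ (n + 1)) t (s - W) * evalTimes (τ m) t' (s' + W)))
        (schur (s - s'))

/-! ### The Pfaffian KP hierarchy -/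

/-- Times `t` and two parameters `u`, `v`. -/
inductive FayVar : Type
  | t (i : ℕ+)
  | u
  | v

/-- The differential Fay identity for `τ = τ̃_{2n}`, `τm = τ̃_{2n-2}`, `τp = τ̃_{2n+2}`, with
`{f, g} = f' g - f g'`, `' = ∂/∂t_1`:
`{τ(t-[u]), τ(t-[v])} + (u⁻¹ - v⁻¹) (τ(t-[u]) τ(t-[v]) - τ(t) τ(t-[u]-[v]))`
`  = u v (u - v) τm(t-[u]-[v]) τp(t)`,
as an identity of formal power series, multiplied by `u v`. -/
def FayIdentity (τm τ τp : MvPowerSeries ℕ+ ℝ) : Prop :=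
  let t : ℕ+ → MvPowerSeries FayVar ℝ := fun i => MvPowerSeries.X (FayVar.t i)
  let u : MvPowerSeries FayVar ℝ := MvPowerSeries.X FayVar.u
  let v : MvPowerSeries FayVar ℝ := MvPowerSeries.X FayVar.v
  let D : MvPowerSeries FayVar ℝ → MvPowerSeries FayVar ℝ := fun φ =>
    MvPowerSeries.pderiv ℝ (FayVar.t 1) φ
  let F : MvPowerSeries FayVar ℝ := τ.subst (t - miwa u)
  let G : MvPowerSeries FayVar ℝ := τ.subst (t - miwa v)
  let H : MvPowerSeries FayVar ℝ := τ.subst (t - miwa u - miwa v)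
  let Hm : MvPowerSeries FayVar ℝ := τm.subst (t - miwa u - miwa v)
  u * v * (D F * G - F * D G) + (v - u) * (F * G - τ.subst t * H) =
    u * v * (u * v * (u - v) * Hm * τp.subst t)

/-- The iterated partial derivative `∂^m`, `m` a multi-index. -/
def iterDeriv {σ : Type*} (m : σ →₀ ℕ) (φ : MvPowerSeries σ ℝ) : MvPowerSeries σ ℝ :=
  fun d => (m.prod fun i e => (((d i + e).descFactorial e : ℕ) : ℝ)) *
    MvPowerSeries.coeff (d + m) φ

theorem iterDeriv_zero {σ : Type*} (φ : MvPowerSeries σ ℝ) : iterDeriv 0 φ = φ := by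
  funext d
  simp only [iterDeriv, Finsupp.prod_zero_index, add_zero, one_mul]
  rfl

theorem iterDeriv_single {σ : Type*} (i : σ) (φ : MvPowerSeries σ ℝ) :
    iterDeriv (Finsupp.single i 1) φ = MvPowerSeries.pderiv ℝ i φ := by
  ext d
  rw [MvPowerSeries.coeff_pderiv, mul_comm]
  show ((Finsupp.single i 1).prod fun j e => (((d j + e).descFactorial e : ℕ) : ℝ)) * _ = _
  rw [Finsupp.prod_single_index (by simp)]
  simp

/-- The constant coefficient differential operator `P(∂/∂y_1, ∂/∂y_2, …)`, where `ι` names the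
variables `y_i`. -/
def diffOp {σ : Type*} (ι : ℕ+ → σ) (P : MvPolynomial ℕ+ ℝ) (φ : MvPowerSeries σ ℝ) :
    MvPowerSeries σ ℝ :=
  ∑ m ∈ P.support, MvPolynomial.coeff m P • iterDeriv (m.mapDomain ι) φ

/-- The Hirota operation `P(∂) f ∘ g = P(∂/∂y) f(t + y) g(t - y) |_{y = 0}`. -/
def hirota (P : MvPolynomial ℕ+ ℝ) (f g : MvPowerSeries ℕ+ ℝ) : MvPowerSeries ℕ+ ℝ :=
  let t : ℕ+ → MvPowerSeries (ℕ+ ⊕ ℕ+) ℝ := fun i => MvPowerSeries.X (Sum.inl i)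
  let y : ℕ+ → MvPowerSeries (ℕ+ ⊕ ℕ+) ℝ := fun i => MvPowerSeries.X (Sum.inr i)
  evalTimes (diffOp Sum.inr P (f.subst (t + y) * g.subst (t - y)))
    (fun i => MvPowerSeries.X i) (fun _ => 0)

/-- `p_k(∂̃)`, `∂̃ = (∂_1, ∂_2 / 2, ∂_3 / 3, …)`, as a polynomial in the `∂_i`. -/
def schurTilde (k : ℕ) : MvPolynomial ℕ+ ℝ :=
  schur (fun i : ℕ+ => MvPolynomial.C (1 / (i : ℝ)) * MvPolynomial.X i) k

/-- The Hirota bilinear equations for `τ = τ̃_{2n}`, `τm = τ̃_{2n-2}`, `τp = τ̃_{2n+2}`: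
`(p_{k+4}(∂̃) - (1/2) ∂²/∂t_1∂t_{k+3}) τ ∘ τ = p_k(∂̃) τp ∘ τm` for all `k ≥ 0`. -/
def HirotaEquations (τm τ τp : MvPowerSeries ℕ+ ℝ) : Prop :=
  ∀ k : ℕ, hirota (schurTilde (k + 4) -
      MvPolynomial.C (1 / 2) * MvPolynomial.X 1 * MvPolynomial.X ⟨k + 3, by omega⟩) τ τ =
    hirota (schurTilde k) τp τm

end PfaffToda

end

/-!
Expanding the weight in the times at a base point turns every function of `(t, s)` in question into
a formal power series in moments `M_{kl} = ∬ x^k y^l w₁(x) w₂(y) ε(x - y) dx dy` of the weight at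
the base point: the moments are `μ_{kl}(t, s) = ∑ M_{k+r, l+q} p_r(t) p_q(-s)` (`formalMoment`,
`momentPairing`), with elementary Schur polynomials `p_r`. A Miwa shift `t ↦ t - [u]` multiplies the
integrand by `1 - u x`, the shift `t ↦ t + [u]` divides it by `1 - u x`, and `∂/∂t_i` shifts the
index `k` by `i`. The integrable structure is linear algebra on top of these three rules.

*2-Toda.* The multiple integral is the determinant of the moments by Andréief's formula
(`tau_eq_formalIntegral`). In the bilinear identity, the shifted determinants are bordered
determinants: `τ_n(t - [z⁻¹], s)` is a polynomial in `z⁻¹` with cofactors `P_i` as coefficients, and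
`τ_{n+1}(t, s - [z])` pairs the same cofactors with moments. Both residues are equal to
`∑ P_i Q_j μ_{ij}(t, s')` (`isTwoTodaTauVector_det`).

*Pfaffians.* On an ordered set of points `pf(ε(x_j - x_i)) = 1`, so `|Δ| = Δ · pf(ε)`, and de Bruijn's
formula makes `τ̃_{2n}` the Pfaffian of the moments at `s = -t` (`pfTau_eq_pfSeries`). The constant
term of `τ̃_{2n}` is the integral of a positive function, so Gram matrices with this Pfaffian can be
inverted: vectors may be made orthogonal to the family, which proves both the three-term Plücker
relation (`gramPf_pluecker`) and, by induction on `n`, that the Pfaffian squares to the determinant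
(`gramPf_desc_sq`, `pfTau_sq`). The differential Fay identity is the Plücker relation for the moment
vectors `x_0, …, x_{2n-1}` and the four vectors `p_v, p_u, x_{2n+1}, x_{2n}`, where `p_u` is
orthogonal to all `x_i - u x_{i+1}`; the derivative `∂/∂t_1` appears because it trades `x_{2n}` for
`x_{2n+1}` (`fay_of_derivation`). The Hirota equations are the coefficients of the `v`-derivative of
the Fay identity at `v = u` (`bilinear_of_fayIdentity`, `hirotaEquations_of_fayIdentity`).

*Virasoro constraints.* Since `f V' = g`, the function `x^p f(x) e^V` has a derivative that is a
series in the `x^i e^V`, and it vanishes at the boundary of the support. Integration by parts in `x`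
and in `y` against `ε(x - y)` produces two boundary integrals from the jump of `ε`, which cancel; this
leaves linear relations between the moments (`hasSum_momentRelation`). They say that the vector field
`∑_r (f(x_r) x_r^{k+1} ∂/∂x_r + f(y_r) y_r^{k+1} ∂/∂y_r)` annihilates the integral of any polynomial
in the `x_r`, `y_r` (`SumsToZero.pairVariation`). Applied to products of Vandermonde determinants,
whose logarithmic derivatives along `∑ x_r^P ∂/∂x_r` are quadratic in the power sums
(`two_mul_derivation_vandermonde`), the terms of this relation are the operators
`J^{(2)} + (2N + k + 1) J^{(1)} + N(N + 1) J^{(0)}` acting on the integral (`J2_pairFunctional`). The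
Pfaffian constraints come from the same relations restricted to `s = -t`.
-/

noncomputable section

namespace PfaffToda

/-! ### Elementary Schur polynomials -/

section Schur

variable {A : Type*} [CommRing A]

/-- The power series `∑_{i ≥ 1} x_i z^i`. -/
def timeSeries (x : ℕ+ → A) : PowerSeries A :=
  PowerSeries.mk fun i => if h : 0 < i then x ⟨i, h⟩ else 0

theorem hasSubst_timeSeries (x : ℕ+ → A) : PowerSeries.HasSubst (timeSeries x) :=
  PowerSeries.HasSubst.of_constantCoeff_zero' (by
    simp [timeSeries, ← PowerSeries.coeff_zero_eq_constantCoeff_apply])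

theorem coeff_succ_timeSeries (x : ℕ+ → A) (i : ℕ) :
    PowerSeries.coeff (i + 1) (timeSeries x) = x i.succPNat := by
  rw [timeSeries, PowerSeries.coeff_mk, dif_pos i.succ_pos]
  rfl

variable [Algebra ℝ A]

/-- The generating series `e^{∑ x_i z^i} = ∑ p_k(x) z^k`. -/
def schurSeries (x : ℕ+ → A) : PowerSeries A :=
  (PowerSeries.exp ℝ).subst (timeSeries x)

theorem coeff_schurSeries (x : ℕ+ → A) (k : ℕ) :
    PowerSeries.coeff k (schurSeries x) = schur x k := rfl

theorem schurSeries_eq_map (x : ℕ+ → A) :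
    schurSeries x =
      ((PowerSeries.exp ℝ).map (algebraMap ℝ A)).subst (timeSeries x) := by
  ext n
  rw [schurSeries, PowerSeries.coeff_subst' (hasSubst_timeSeries x),
    PowerSeries.coeff_subst' (hasSubst_timeSeries x)]
  refine finsum_congr fun d => ?_
  rw [PowerSeries.coeff_map, algebraMap_smul]

theorem derivative_schurSeries (x : ℕ+ → A) :
    PowerSeries.derivative A (schurSeries x) =
      schurSeries x * PowerSeries.derivative A (timeSeries x) := by
  rw [schurSeries_eq_map, PowerSeries.derivative_subst (hasSubst_timeSeries x)]
  congr 2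
  ext n
  rw [PowerSeries.coeff_derivative, PowerSeries.coeff_map, PowerSeries.coeff_map,
    PowerSeries.coeff_exp, PowerSeries.coeff_exp]
  have : (n : A) + 1 = algebraMap ℝ A ((n : ℝ) + 1) := by simp
  rw [this, ← map_mul]
  congr 1
  rw [Nat.factorial_succ]
  push_cast
  have h1 : (n : ℝ) + 1 ≠ 0 := by positivity
  have h2 : (n.factorial : ℝ) ≠ 0 := by positivity
  simp
  field_simp

theorem schur_zero (x : ℕ+ → A) : schur x 0 = 1 := by
  rw [← coeff_schurSeries, schurSeries, PowerSeries.coeff_zero_eq_constantCoeff_apply]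
  have := PowerSeries.constantCoeff_subst (hasSubst_timeSeries x) (PowerSeries.exp ℝ)
  erw [this]
  rw [finsum_eq_single _ 0]
  · simp
  · intro n hn
    have : MvPowerSeries.constantCoeff (timeSeries x) = 0 := by
      have : PowerSeries.constantCoeff (timeSeries x) = 0 := by
        simp [timeSeries, ← PowerSeries.coeff_zero_eq_constantCoeff_apply]
      exact this
    rw [map_pow, this, zero_pow hn, smul_zero]

theorem schur_succ (x : ℕ+ → A) (k : ℕ) :
    ((k : A) + 1) * schur x (k + 1) =
      ∑ i ∈ Finset.range (k + 1), ((i : A) + 1) * x i.succPNat * schur x (k - i) := by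
  have h := congrArg (PowerSeries.coeff k) (derivative_schurSeries x)
  rw [PowerSeries.coeff_derivative, coeff_schurSeries, PowerSeries.coeff_mul,
    ← Finset.Nat.sum_antidiagonal_swap, Finset.Nat.sum_antidiagonal_eq_sum_range_succ_mk] at h
  rw [mul_comm, h]
  refine Finset.sum_congr rfl fun i _ => ?_
  simp only [Prod.swap, PowerSeries.coeff_derivative, coeff_schurSeries, coeff_succ_timeSeries]
  ring

/-- The recursion `k p_k = ∑ i x_i p_{k - i}` determines the elementary Schur polynomials. -/
theorem eq_schur_of_recursion (x : ℕ+ → A) (q : ℕ → A) (h0 : q 0 = 1)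
    (hq : ∀ k : ℕ, ((k : A) + 1) * q (k + 1) =
      ∑ i ∈ Finset.range (k + 1), ((i : A) + 1) * x i.succPNat * q (k - i)) (k : ℕ) :
    q k = schur x k := by
  induction k using Nat.strong_induction_on with
  | _ k ih =>
    cases k with
    | zero => rw [h0, schur_zero]
    | succ k =>
      have h1 : ((k : A) + 1) * q (k + 1) = ((k : A) + 1) * schur x (k + 1) := by
        rw [hq, schur_succ]
        exact Finset.sum_congr rfl fun i _ => by rw [ih (k - i) (by omega)]
      have h2 : algebraMap ℝ A (((k : ℝ) + 1)⁻¹) * ((k : A) + 1) = 1 := by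
        have : (k : A) + 1 = algebraMap ℝ A ((k : ℝ) + 1) := by simp
        rw [this, ← map_mul, inv_mul_cancel₀ (by positivity), map_one]
      calc q (k + 1) = algebraMap ℝ A (((k : ℝ) + 1)⁻¹) * (((k : A) + 1) * q (k + 1)) := by
            rw [← mul_assoc, h2, one_mul]
        _ = schur x (k + 1) := by rw [h1, ← mul_assoc, h2, one_mul]

theorem schur_add (x y : ℕ+ → A) (k : ℕ) :
    schur (x + y) k = ∑ p ∈ Finset.HasAntidiagonal.antidiagonal k, schur x p.1 * schur y p.2 := by
  have hts : timeSeries (x + y) = timeSeries x + timeSeries y := by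
    ext n
    simp only [timeSeries, PowerSeries.coeff_mk, map_add]
    split_ifs
    · rfl
    · simp
  refine (eq_schur_of_recursion (x + y)
    (fun k : ℕ => PowerSeries.coeff k (schurSeries x * schurSeries y)) ?_ ?_ k).symm.trans
    (PowerSeries.coeff_mul _ _ _)
  · simp [PowerSeries.coeff_mul, coeff_schurSeries, schur_zero]
  · intro k
    have hd : PowerSeries.derivative A (schurSeries x * schurSeries y) =
        PowerSeries.derivative A (timeSeries (x + y)) * (schurSeries x * schurSeries y) := by
      rw [Derivation.leibniz, derivative_schurSeries, derivative_schurSeries, hts, map_add,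
        smul_eq_mul, smul_eq_mul]
      ring
    have h := congrArg (PowerSeries.coeff k) hd
    rw [PowerSeries.coeff_derivative, PowerSeries.coeff_mul k,
      Finset.Nat.sum_antidiagonal_eq_sum_range_succ_mk] at h
    rw [mul_comm, h]
    refine Finset.sum_congr rfl fun i _ => ?_
    simp only [PowerSeries.coeff_derivative, coeff_succ_timeSeries]
    ring

theorem schur_map {B : Type*} [CommRing B] [Algebra ℝ B] (f : A →ₐ[ℝ] B) (x : ℕ+ → A) (k : ℕ) :
    f (schur x k) = schur (fun i => f (x i)) k := by
  refine eq_schur_of_recursion _ (fun k : ℕ => f (schur x k)) ?_ ?_ k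
  · rw [schur_zero, map_one]
  · intro k
    have := congrArg f (schur_succ x k)
    simpa using this

/-- `e^{∑ α^i z^i / i} = 1 / (1 - α z)`. -/
theorem schur_inv_nat_mul_pow (α : A) (k : ℕ) :
    schur (fun i : ℕ+ => (1 / (i : ℝ)) • α ^ (i : ℕ)) k = α ^ k := by
  refine (eq_schur_of_recursion _ (fun k : ℕ => α ^ k) (pow_zero _) ?_ k).symm
  intro k
  have : ∀ i ∈ Finset.range (k + 1), ((i : A) + 1) *
      ((1 / ((i.succPNat : ℕ) : ℝ)) • α ^ (i.succPNat : ℕ)) *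
        α ^ (k - i) = α ^ (k + 1) := by
    intro i hi
    have h1 : (i : A) + 1 = algebraMap ℝ A ((i : ℝ) + 1) := by simp
    rw [h1, Nat.succPNat_coe, Nat.succ_eq_add_one, mul_smul_comm, ← Algebra.smul_def, smul_smul, smul_mul_assoc, ← pow_add]
    have : i + 1 + (k - i) = k + 1 := by have := Finset.mem_range.1 hi; omega
    rw [this]
    push_cast
    rw [one_div, inv_mul_cancel₀ (by positivity), one_smul]
  rw [Finset.sum_congr rfl this]
  simp

/-- `e^{-∑ α^i z^i / i} = 1 - α z`. -/
theorem schur_neg_inv_nat_mul_pow (α : A) (k : ℕ) :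
    schur (fun i : ℕ+ => -((1 / (i : ℝ)) • α ^ (i : ℕ))) k =
      if k = 0 then 1 else if k = 1 then -α else 0 := by
  -- the coefficients of the inverse `1 - α z` of the geometric series
  have hinv : schurSeries (fun i : ℕ+ => -((1 / (i : ℝ)) • α ^ (i : ℕ))) *
      PowerSeries.mk (fun k : ℕ => α ^ k) = 1 := by
    ext k
    rw [PowerSeries.coeff_mul]
    have h := schur_add (fun i : ℕ+ => -((1 / (i : ℝ)) • α ^ (i : ℕ)))
      (fun i : ℕ+ => ((1 / (i : ℝ)) • α ^ (i : ℕ))) k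
    simp only [schur_inv_nat_mul_pow] at h
    have h0 : ((fun i : ℕ+ => -((1 / (i : ℝ)) • α ^ (i : ℕ))) +
      (fun i : ℕ+ => ((1 / (i : ℝ)) • α ^ (i : ℕ)))) = 0 := by
      funext i; simp
    simp only [coeff_schurSeries, PowerSeries.coeff_mk]
    rw [← h, h0, PowerSeries.coeff_one]
    refine (eq_schur_of_recursion (0 : ℕ+ → A) (fun k : ℕ => if k = 0 then 1 else 0) ?_ ?_ k).symm
    · simp
    · intro k
      simp only [Pi.zero_apply, mul_zero, zero_mul, Finset.sum_const_zero]
      simp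
  have hgeo : PowerSeries.mk (fun k : ℕ => α ^ k) * (1 - PowerSeries.C α * PowerSeries.X) = 1 := by
    ext k
    rw [mul_sub, mul_one, mul_left_comm, ← mul_assoc, mul_comm, ← mul_assoc]
    cases k with
    | zero => simp
    | succ k =>
      rw [map_sub, mul_comm PowerSeries.X, mul_assoc, PowerSeries.coeff_C_mul,
        PowerSeries.coeff_succ_X_mul]
      simp [PowerSeries.coeff_one, pow_succ']
  have : schurSeries (fun i : ℕ+ => -((1 / (i : ℝ)) • α ^ (i : ℕ))) =
      1 - PowerSeries.C α * PowerSeries.X := by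
    calc _ = schurSeries (fun i : ℕ+ => -((1 / (i : ℝ)) • α ^ (i : ℕ))) *
          (PowerSeries.mk (fun k : ℕ => α ^ k) * (1 - PowerSeries.C α * PowerSeries.X)) := by
            rw [hgeo, mul_one]
      _ = _ := by rw [← mul_assoc, hinv, one_mul]
  rw [← coeff_schurSeries, this, map_sub, PowerSeries.coeff_one, PowerSeries.coeff_C_mul,
    PowerSeries.coeff_X]
  rcases k with _ | _ | k <;> simp

end Schur

/-! ### Locally finite sums and substitution of formal power series -/

section LocallyFinite

variable {σ τ β γ : Type*}

/-- Every monomial occurs in only finitely many members of the family. -/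
def LocallyFinite (F : β → MvPowerSeries σ ℝ) : Prop :=
  ∀ m, (Function.support fun q => MvPowerSeries.coeff m (F q)).Finite

/-- A map of power series (necessarily linear) each of whose output coefficients is a linear
combination of finitely many input coefficients. -/
def CoeffFinite (Φ : MvPowerSeries σ ℝ → MvPowerSeries τ ℝ) : Prop :=
  ∀ e, ∃ (D : Finset (σ →₀ ℕ)) (c : (σ →₀ ℕ) → ℝ), ∀ φ,
    MvPowerSeries.coeff e (Φ φ) = ∑ d ∈ D, c d * MvPowerSeries.coeff d φ

theorem coeff_fsum (F : β → MvPowerSeries σ ℝ) (m : σ →₀ ℕ) :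
    MvPowerSeries.coeff m (fsum F) = ∑ᶠ q, MvPowerSeries.coeff m (F q) := rfl

theorem LocallyFinite.mono {F G : β → MvPowerSeries σ ℝ} (hF : LocallyFinite F)
    (h : ∀ m q, MvPowerSeries.coeff m (F q) = 0 → MvPowerSeries.coeff m (G q) = 0) :
    LocallyFinite G :=
  fun m => (hF m).subset fun q hq h0 => hq (h m q h0)

theorem LocallyFinite.smul {F : β → MvPowerSeries σ ℝ} (hF : LocallyFinite F) (c : β → ℝ) :
    LocallyFinite fun q => c q • F q :=
  hF.mono fun m q h => by rw [map_smul, h, smul_zero]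

theorem LocallyFinite.comp {F : β → MvPowerSeries σ ℝ} (hF : LocallyFinite F) {g : γ → β}
    (hg : Function.Injective g) : LocallyFinite fun q => F (g q) := fun m =>
  (hF m).preimage hg.injOn

theorem LocallyFinite.of_finite_support {F : β → MvPowerSeries σ ℝ}
    (h : (Function.support F).Finite) : LocallyFinite F := fun m =>
  h.subset fun q hq h0 => hq (by simp only [h0, map_zero])

theorem LocallyFinite.finsetSum {ι : Type*} {s : Finset ι} {F : ι → β → MvPowerSeries σ ℝ}
    (hF : ∀ i ∈ s, LocallyFinite (F i)) : LocallyFinite fun q => ∑ i ∈ s, F i q := fun m => by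
  refine (s.finite_toSet.biUnion fun i hi => hF i hi m).subset fun q hq => ?_
  simp only [Function.mem_support, map_sum] at hq
  obtain ⟨i, hi, h⟩ := Finset.exists_ne_zero_of_sum_ne_zero hq
  exact Set.mem_biUnion hi h

theorem fsum_add {F G : β → MvPowerSeries σ ℝ} (hF : LocallyFinite F) (hG : LocallyFinite G) :
    fsum (fun q => F q + G q) = fsum F + fsum G := by
  ext m
  simp only [coeff_fsum, map_add]
  exact finsum_add_distrib (hF m) (hG m)

theorem fsum_finsetSum {ι : Type*} (s : Finset ι) {F : ι → β → MvPowerSeries σ ℝ}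
    (hF : ∀ i ∈ s, LocallyFinite (F i)) :
    fsum (fun q => ∑ i ∈ s, F i q) = ∑ i ∈ s, fsum (F i) := by
  ext m
  simp only [coeff_fsum, map_sum]
  exact finsum_sum_comm s _ fun i hi => hF i hi m

theorem fsum_eq_sum {F : β → MvPowerSeries σ ℝ} (s : Finset β) (h : ∀ q ∉ s, F q = 0) :
    fsum F = ∑ q ∈ s, F q := by
  ext m
  rw [coeff_fsum, map_sum, finsum_eq_sum_of_support_subset]
  intro q hq
  by_contra hs
  exact hq (by simp only [h q hs, map_zero])

theorem fsum_eq_single {F : β → MvPowerSeries σ ℝ} (q₀ : β) (h : ∀ q, q ≠ q₀ → F q = 0) :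
    fsum F = F q₀ := by
  rw [fsum_eq_sum {q₀} fun q hq => h q (by simpa using hq), Finset.sum_singleton]

theorem fsum_comp_equiv (e : γ ≃ β) (F : β → MvPowerSeries σ ℝ) :
    fsum (fun q => F (e q)) = fsum F := by
  ext m
  exact finsum_comp_equiv (M := ℝ) (f := fun q => MvPowerSeries.coeff m (F q)) e

theorem fsum_prod {F : β × γ → MvPowerSeries σ ℝ} (hF : LocallyFinite F) :
    fsum F = fsum fun b => fsum fun c => F (b, c) := by
  ext m
  exact finsum_curry _ (hF m)

theorem CoeffFinite.map_zero {Φ : MvPowerSeries σ ℝ → MvPowerSeries τ ℝ} (h : CoeffFinite Φ) :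
    Φ 0 = 0 := by
  ext e
  obtain ⟨D, c, hc⟩ := h e
  simp [hc]

theorem CoeffFinite.map_add {Φ : MvPowerSeries σ ℝ → MvPowerSeries τ ℝ} (h : CoeffFinite Φ)
    (φ ψ : MvPowerSeries σ ℝ) : Φ (φ + ψ) = Φ φ + Φ ψ := by
  ext e
  obtain ⟨D, c, hc⟩ := h e
  simp [hc, mul_add, Finset.sum_add_distrib]

theorem CoeffFinite.map_smul {Φ : MvPowerSeries σ ℝ → MvPowerSeries τ ℝ} (h : CoeffFinite Φ)
    (r : ℝ) (φ : MvPowerSeries σ ℝ) : Φ (r • φ) = r • Φ φ := by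
  ext e
  obtain ⟨D, c, hc⟩ := h e
  simp [hc, Finset.mul_sum, mul_left_comm]

theorem CoeffFinite.map_sum {Φ : MvPowerSeries σ ℝ → MvPowerSeries τ ℝ} (h : CoeffFinite Φ)
    {ι : Type*} (s : Finset ι) (φ : ι → MvPowerSeries σ ℝ) :
    Φ (∑ i ∈ s, φ i) = ∑ i ∈ s, Φ (φ i) := by
  classical
  induction s using Finset.induction_on with
  | empty => simp [h.map_zero]
  | insert i s hi ih => rw [Finset.sum_insert hi, h.map_add, ih, Finset.sum_insert hi]

theorem CoeffFinite.locallyFinite {Φ : MvPowerSeries σ ℝ → MvPowerSeries τ ℝ}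
    (h : CoeffFinite Φ) {F : β → MvPowerSeries σ ℝ} (hF : LocallyFinite F) :
    LocallyFinite fun q => Φ (F q) := fun e => by
  obtain ⟨D, c, hc⟩ := h e
  refine (D.finite_toSet.biUnion fun d _ => hF d).subset fun q hq => ?_
  simp only [Function.mem_support, hc] at hq
  obtain ⟨d, hd, h⟩ := Finset.exists_ne_zero_of_sum_ne_zero hq
  exact Set.mem_biUnion hd (right_ne_zero_of_mul h)

theorem CoeffFinite.map_fsum {Φ : MvPowerSeries σ ℝ → MvPowerSeries τ ℝ}
    (h : CoeffFinite Φ) {F : β → MvPowerSeries σ ℝ} (hF : LocallyFinite F) :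
    Φ (fsum F) = fsum fun q => Φ (F q) := by
  ext e
  obtain ⟨D, c, hc⟩ := h e
  simp only [coeff_fsum, hc]
  rw [finsum_sum_comm D]
  · exact Finset.sum_congr rfl fun d _ => mul_finsum _ _
  · exact fun d _ => (hF d).subset fun q hq => right_ne_zero_of_mul hq

theorem CoeffFinite.sumsToZero {Φ : MvPowerSeries σ ℝ → MvPowerSeries τ ℝ}
    (h : CoeffFinite Φ) {F : ℕ → MvPowerSeries σ ℝ} (hF : SumsToZero F) :
    SumsToZero fun q => Φ (F q) := fun e => by
  obtain ⟨D, c, hc⟩ := h e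
  simp only [hc]
  have := hasSum_sum (s := D) fun d _ => (hF d).mul_left (c d)
  simpa using this

theorem SumsToZero.finsetSum {ι : Type*} {s : Finset ι} {F : ι → ℕ → MvPowerSeries σ ℝ}
    (hF : ∀ i ∈ s, SumsToZero (F i)) : SumsToZero fun q => ∑ i ∈ s, F i q := fun m => by
  simp only [map_sum]
  have := hasSum_sum (s := s) fun i hi => hF i hi m
  simpa using this

/-- Two coefficientwise finite maps that agree on monomials are equal. -/
theorem CoeffFinite.ext {Φ Ψ : MvPowerSeries σ ℝ → MvPowerSeries τ ℝ} (hΦ : CoeffFinite Φ)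
    (hΨ : CoeffFinite Ψ)
    (h : ∀ d, Φ (MvPowerSeries.monomial d 1) = Ψ (MvPowerSeries.monomial d 1)) : Φ = Ψ := by
  classical
  funext φ
  ext e
  obtain ⟨D, c, hc⟩ := hΦ e
  obtain ⟨D', c', hc'⟩ := hΨ e
  set p : MvPowerSeries σ ℝ :=
    ∑ d ∈ D ∪ D', MvPowerSeries.coeff d φ • MvPowerSeries.monomial d (1 : ℝ) with hp
  have hcoeff : ∀ d ∈ D ∪ D', MvPowerSeries.coeff d p = MvPowerSeries.coeff d φ := by
    intro d hd
    rw [hp, _root_.map_sum, Finset.sum_eq_single d]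
    · simp
    · intro d' _ hne
      rw [_root_.map_smul, MvPowerSeries.coeff_monomial_ne hne.symm, smul_zero]
    · exact fun h => absurd hd h
  have h1 : MvPowerSeries.coeff e (Φ φ) = MvPowerSeries.coeff e (Φ p) := by
    rw [hc, hc]
    exact Finset.sum_congr rfl fun d hd => by rw [hcoeff d (Finset.mem_union_left _ hd)]
  have h2 : MvPowerSeries.coeff e (Ψ φ) = MvPowerSeries.coeff e (Ψ p) := by
    rw [hc', hc']
    exact Finset.sum_congr rfl fun d hd => by rw [hcoeff d (Finset.mem_union_right _ hd)]
  rw [h1, h2, hp, hΦ.map_sum, hΨ.map_sum]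
  simp only [hΦ.map_smul, hΨ.map_smul, h]

theorem CoeffFinite.comp {υ : Type*} {Φ : MvPowerSeries σ ℝ → MvPowerSeries τ ℝ}
    {Ψ : MvPowerSeries τ ℝ → MvPowerSeries υ ℝ} (hΨ : CoeffFinite Ψ) (hΦ : CoeffFinite Φ) :
    CoeffFinite fun φ => Ψ (Φ φ) := fun e => by
  classical
  obtain ⟨D, c, hc⟩ := hΨ e
  choose D' c' hc' using hΦ
  refine ⟨D.biUnion D', fun d => ∑ i ∈ D, c i * (if d ∈ D' i then c' i d else 0), fun φ => ?_⟩
  rw [hc]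
  simp only [Finset.sum_mul]
  rw [Finset.sum_comm]
  refine Finset.sum_congr rfl fun i hi => ?_
  rw [hc', Finset.mul_sum]
  rw [← Finset.sum_subset (Finset.subset_biUnion_of_mem D' hi)]
  · exact Finset.sum_congr rfl fun d hd => by rw [if_pos hd, mul_assoc]
  · intro d _ hd
    rw [if_neg hd, mul_zero, zero_mul]

theorem CoeffFinite.add {Φ Ψ : MvPowerSeries σ ℝ → MvPowerSeries τ ℝ} (hΦ : CoeffFinite Φ)
    (hΨ : CoeffFinite Ψ) : CoeffFinite fun φ => Φ φ + Ψ φ := fun e => by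
  classical
  obtain ⟨D, c, hc⟩ := hΦ e
  obtain ⟨D', c', hc'⟩ := hΨ e
  refine ⟨D ∪ D', fun d => (if d ∈ D then c d else 0) + (if d ∈ D' then c' d else 0),
    fun φ => ?_⟩
  rw [_root_.map_add, hc, hc']
  simp only [add_mul, Finset.sum_add_distrib]
  congr 1
  · rw [← Finset.sum_subset (Finset.subset_union_left : D ⊆ D ∪ D')]
    · exact Finset.sum_congr rfl fun d hd => by rw [if_pos hd]
    · intro d _ hd
      rw [if_neg hd, zero_mul]
  · rw [← Finset.sum_subset (Finset.subset_union_right : D' ⊆ D ∪ D')]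
    · exact Finset.sum_congr rfl fun d hd => by rw [if_pos hd]
    · intro d _ hd
      rw [if_neg hd, zero_mul]

theorem coeffFinite_zero : CoeffFinite fun _ : MvPowerSeries σ ℝ => (0 : MvPowerSeries τ ℝ) :=
  fun _ => ⟨∅, 0, fun φ => by simp⟩

theorem CoeffFinite.finsetSum {ι : Type*} {s : Finset ι}
    {Φ : ι → MvPowerSeries σ ℝ → MvPowerSeries τ ℝ} (h : ∀ i ∈ s, CoeffFinite (Φ i)) :
    CoeffFinite fun φ => ∑ i ∈ s, Φ i φ := by
  classical
  induction s using Finset.induction_on with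
  | empty => simpa using coeffFinite_zero
  | insert i s hi ih =>
    simp only [Finset.sum_insert hi]
    exact (h i (Finset.mem_insert_self _ _)).add
      (ih fun j hj => h j (Finset.mem_insert_of_mem hj))

theorem coeffFinite_id : CoeffFinite fun φ : MvPowerSeries σ ℝ => φ :=
  fun e => ⟨{e}, fun _ => 1, fun φ => by simp⟩

theorem coeffFinite_mul_left (ψ : MvPowerSeries σ ℝ) : CoeffFinite fun φ => ψ * φ := fun e => by
  classical
  refine ⟨(Finset.HasAntidiagonal.antidiagonal e).image Prod.snd,
    fun d => MvPowerSeries.coeff (e - d) ψ, fun φ => ?_⟩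
  rw [MvPowerSeries.coeff_mul, Finset.sum_image]
  · refine Finset.sum_congr rfl fun p hp => ?_
    have h := Finset.HasAntidiagonal.mem_antidiagonal.1 hp
    have : e - p.2 = p.1 := by rw [← h, add_tsub_cancel_right]
    simp only [this]
  · intro p hp q hq h
    have hp := Finset.HasAntidiagonal.mem_antidiagonal.1 hp
    have hq := Finset.HasAntidiagonal.mem_antidiagonal.1 hq
    refine Prod.ext ?_ h
    rw [← hq, h] at hp
    exact add_right_cancel hp

theorem coeffFinite_mul_right (ψ : MvPowerSeries σ ℝ) : CoeffFinite fun φ => φ * ψ := by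
  simp only [mul_comm _ ψ]
  exact coeffFinite_mul_left ψ

theorem coeffFinite_pderiv (i : σ) :
    CoeffFinite fun φ : MvPowerSeries σ ℝ => MvPowerSeries.pderiv ℝ i φ :=
  fun e => ⟨{e + Finsupp.single i 1}, fun _ => (e i : ℝ) + 1, fun φ => by
    simp [MvPowerSeries.coeff_pderiv, mul_comm]⟩

theorem coeffFinite_subst {a : σ → MvPowerSeries τ ℝ} (ha : MvPowerSeries.HasSubst a) :
    CoeffFinite fun φ : MvPowerSeries σ ℝ => φ.subst a := fun e => by
  have hfin := MvPowerSeries.coeff_subst_finite ha (fun _ => 1 : MvPowerSeries σ ℝ) e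
  have hfin' : (Function.support fun d : σ →₀ ℕ =>
      MvPowerSeries.coeff e (d.prod fun s n => a s ^ n)).Finite := by
    refine hfin.subset fun d hd => ?_
    have : MvPowerSeries.coeff d (fun _ => 1 : MvPowerSeries σ ℝ) = 1 := rfl
    simpa only [Function.mem_support, this, one_smul] using hd
  refine ⟨hfin'.toFinset, fun d => MvPowerSeries.coeff e (d.prod fun s n => a s ^ n),
    fun φ => ?_⟩
  rw [MvPowerSeries.coeff_subst ha, finsum_eq_sum_of_support_subset]
  · exact Finset.sum_congr rfl fun d _ => by rw [smul_eq_mul, mul_comm]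
  · intro d hd
    simp only [Set.Finite.coe_toFinset, Function.mem_support] at hd ⊢
    exact right_ne_zero_of_mul hd

theorem LocallyFinite.mul {F : β → MvPowerSeries σ ℝ} {G : γ → MvPowerSeries σ ℝ}
    (hF : LocallyFinite F) (hG : LocallyFinite G) :
    LocallyFinite fun q : β × γ => F q.1 * G q.2 := fun m => by
  classical
  refine ((Finset.HasAntidiagonal.antidiagonal m).finite_toSet.biUnion
    fun p _ => (hF p.1).prod (hG p.2)).subset fun q hq => ?_
  simp only [Function.mem_support, MvPowerSeries.coeff_mul] at hq
  obtain ⟨p, hp, h⟩ := Finset.exists_ne_zero_of_sum_ne_zero hq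
  exact Set.mem_biUnion hp ⟨left_ne_zero_of_mul h, right_ne_zero_of_mul h⟩

theorem LocallyFinite.mul_left {F : β → MvPowerSeries σ ℝ} (hF : LocallyFinite F)
    (ψ : MvPowerSeries σ ℝ) : LocallyFinite fun q => ψ * F q :=
  (coeffFinite_mul_left ψ).locallyFinite hF

theorem fsum_mul_left {F : β → MvPowerSeries σ ℝ} (hF : LocallyFinite F)
    (ψ : MvPowerSeries σ ℝ) : ψ * fsum F = fsum fun q => ψ * F q :=
  (coeffFinite_mul_left ψ).map_fsum hF

theorem LocallyFinite.mul_right {F : β → MvPowerSeries σ ℝ} (hF : LocallyFinite F)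
    (ψ : MvPowerSeries σ ℝ) : LocallyFinite fun q => F q * ψ :=
  (coeffFinite_mul_right ψ).locallyFinite hF

theorem fsum_mul_right {F : β → MvPowerSeries σ ℝ} (hF : LocallyFinite F)
    (ψ : MvPowerSeries σ ℝ) : fsum F * ψ = fsum fun q => F q * ψ :=
  (coeffFinite_mul_right ψ).map_fsum hF

theorem locallyFinite_of_hasSubst {a : σ → MvPowerSeries τ ℝ} (ha : MvPowerSeries.HasSubst a) :
    LocallyFinite a := fun m => ha.coeff_zero m

/-- The chain rule. -/
theorem pderiv_subst {a : σ → MvPowerSeries τ ℝ} (ha : MvPowerSeries.HasSubst a) (j : τ)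
    (φ : MvPowerSeries σ ℝ) :
    MvPowerSeries.pderiv ℝ j (φ.subst a) =
      fsum fun i => (MvPowerSeries.pderiv ℝ i φ).subst a * MvPowerSeries.pderiv ℝ j (a i) := by
  classical
  have hLFa : LocallyFinite fun i => MvPowerSeries.pderiv ℝ j (a i) :=
    (coeffFinite_pderiv j).locallyFinite (locallyFinite_of_hasSubst ha)
  -- for a given monomial only finitely many variables matter, uniformly in `φ`
  have hI : ∀ e : τ →₀ ℕ, ∃ I : Finset σ, ∀ i ∉ I, ∀ ψ : MvPowerSeries τ ℝ,
      MvPowerSeries.coeff e (ψ * MvPowerSeries.pderiv ℝ j (a i)) = 0 := by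
    intro e
    have hfin := (Finset.HasAntidiagonal.antidiagonal e).finite_toSet.biUnion
      fun p _ => hLFa p.2
    refine ⟨hfin.toFinset, fun i hi ψ => ?_⟩
    rw [MvPowerSeries.coeff_mul]
    refine Finset.sum_eq_zero fun p hp => ?_
    by_contra hne
    exact hi (hfin.mem_toFinset.2 (Set.mem_biUnion hp (right_ne_zero_of_mul hne)))
  have hLF : ∀ φ : σ → MvPowerSeries τ ℝ,
      LocallyFinite fun i => φ i * MvPowerSeries.pderiv ℝ j (a i) := by
    intro φ e
    obtain ⟨I, hI⟩ := hI e
    refine I.finite_toSet.subset fun i hi => ?_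
    by_contra hiI
    exact hi (hI i hiI _)
  have hR : CoeffFinite fun φ : MvPowerSeries σ ℝ => fsum fun i =>
      (MvPowerSeries.pderiv ℝ i φ).subst a * MvPowerSeries.pderiv ℝ j (a i) := by
    intro e
    obtain ⟨I, hI⟩ := hI e
    obtain ⟨D, c, hc⟩ := CoeffFinite.finsetSum (s := I) (fun i _ =>
      (coeffFinite_mul_right (MvPowerSeries.pderiv ℝ j (a i))).comp
        ((coeffFinite_subst ha).comp (coeffFinite_pderiv i))) e
    refine ⟨D, c, fun φ => ?_⟩
    rw [← hc, coeff_fsum, map_sum, finsum_eq_sum_of_support_subset]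
    intro i hi
    by_contra hiI
    exact hi (hI i hiI _)
  have hL := (coeffFinite_pderiv j).comp (coeffFinite_subst ha)
  refine congrFun (hL.ext hR fun d => ?_) φ
  -- both sides are derivations
  induction d using Finsupp.induction_linear with
  | zero =>
    rw [MvPowerSeries.monomial_zero_one, ← MvPowerSeries.coe_substAlgHom ha, map_one,
      MvPowerSeries.pderiv_one]
    have : (fun i : σ => MvPowerSeries.substAlgHom ha (MvPowerSeries.pderiv ℝ i 1) *
        MvPowerSeries.pderiv ℝ j (a i)) = fun _ => 0 := by
      funext i
      rw [MvPowerSeries.pderiv_one, map_zero, zero_mul]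
    rw [this, fsum_eq_sum ∅ (by simp), Finset.sum_empty]
  | add d d' h h' =>
    rw [← one_mul (1 : ℝ), ← MvPowerSeries.monomial_mul_monomial, MvPowerSeries.subst_mul ha,
      Derivation.leibniz, h, h', smul_eq_mul, smul_eq_mul, fsum_mul_left (hLF _),
      fsum_mul_left (hLF _), ← fsum_add ((hLF _).mul_left _) ((hLF _).mul_left _)]
    congr 1
    funext i
    rw [Derivation.leibniz, smul_eq_mul, smul_eq_mul, MvPowerSeries.subst_add ha,
      MvPowerSeries.subst_mul ha, MvPowerSeries.subst_mul ha]
    ring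
  | single i n =>
    rw [← MvPowerSeries.X_pow_eq, MvPowerSeries.subst_pow ha, MvPowerSeries.subst_X ha,
      fsum_eq_single i, MvPowerSeries.pderiv_pow, MvPowerSeries.pderiv_pow,
      MvPowerSeries.pderiv_X_self, ← MvPowerSeries.coe_substAlgHom ha, mul_one, map_mul, map_pow,
      map_natCast, MvPowerSeries.substAlgHom_X ha]
    intro i' hi'
    rw [MvPowerSeries.pderiv_pow, MvPowerSeries.pderiv_X_of_ne hi'.symm, mul_zero,
      ← MvPowerSeries.coe_substAlgHom ha, map_zero, zero_mul]

end LocallyFinite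

/-! ### Series of moments -/

section Moments

variable {σ τ : Type*}

/-- The weighted degree `∑ i d_{ι i}` of an exponent, the variable `ι i` having weight `i`. -/
def wt {ι : ℕ+ → σ} (hι : Function.Injective ι) (d : σ →₀ ℕ) : ℕ :=
  (d.comapDomain ι hι.injOn).sum fun i e => (i : ℕ) * e

theorem wt_zero {ι : ℕ+ → σ} (hι : Function.Injective ι) : wt hι 0 = 0 := by
  simp [wt]

theorem wt_add {ι : ℕ+ → σ} (hι : Function.Injective ι) (d d' : σ →₀ ℕ) :
    wt hι (d + d') = wt hι d + wt hι d' := by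
  rw [wt, Finsupp.comapDomain_add_of_injective hι, Finsupp.sum_add_index']
  · rfl
  · simp
  · intros; ring

theorem wt_single {ι : ℕ+ → σ} (hι : Function.Injective ι) (i : ℕ+) (n : ℕ) :
    wt hι (Finsupp.single (ι i) n) = i * n := by
  rw [wt, Finsupp.comapDomain_single, Finsupp.sum_single_index (by simp)]

theorem wt_single_of_notMem {ι : ℕ+ → σ} (hι : Function.Injective ι) {s : σ}
    (hs : s ∉ Set.range ι) (n : ℕ) : wt hι (Finsupp.single s n) = 0 := by
  have : (Finsupp.single s n).comapDomain ι hι.injOn = 0 := by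
    ext i
    rw [Finsupp.comapDomain_apply, Finsupp.single_eq_of_ne, Finsupp.zero_apply]
    rintro h
    exact hs ⟨i, h⟩
  rw [wt, this, Finsupp.sum_zero_index]

theorem wt_eq_sum_range {ι : ℕ+ → σ} (hι : Function.Injective ι) {d : σ →₀ ℕ} {k : ℕ}
    (hk : wt hι d ≤ k) :
    wt hι d = ∑ i ∈ Finset.range k, (i + 1) * d (ι i.succPNat) := by
  have hle : ∀ i ∈ (d.comapDomain ι hι.injOn).support, (i : ℕ) ≤ k := by
    intro i hi
    refine le_trans ?_ hk
    have h1 : (i : ℕ) * d (ι i) ≤ wt hι d :=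
      Finset.single_le_sum (f := fun i : ℕ+ => (i : ℕ) * (d.comapDomain ι hι.injOn) i)
        (fun _ _ => Nat.zero_le _) hi
    refine le_trans (Nat.le_mul_of_pos_right _ ?_) h1
    exact Nat.pos_of_ne_zero (by simpa using hi)
  have : ∑ i ∈ Finset.range k, (i + 1) * d (ι i.succPNat) =
      ∑ i ∈ (Finset.range k).image Nat.succPNat, (i : ℕ) * d (ι i) := by
    rw [Finset.sum_image fun a _ b _ h => Nat.succPNat_injective h]
    rfl
  rw [this]
  refine Finset.sum_subset (fun i hi => ?_) fun i _ hi => ?_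
  · refine Finset.mem_image.2 ⟨i.natPred, ?_, PNat.succPNat_natPred i⟩
    have := hle i hi
    have := i.pos
    simp only [Finset.mem_range, PNat.natPred]
    omega
  · have : d (ι i) = 0 := by simpa using hi
    simp only [Finsupp.comapDomain_apply, this, mul_zero]

theorem coeff_X_mul_eq [DecidableEq σ] (s : σ) (φ : MvPowerSeries σ ℝ) (d : σ →₀ ℕ) :
    MvPowerSeries.coeff d (MvPowerSeries.X s * φ) =
      if d s = 0 then 0 else MvPowerSeries.coeff (d - Finsupp.single s 1) φ := by
  rw [MvPowerSeries.X, MvPowerSeries.coeff_monomial_mul, one_mul]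
  have : Finsupp.single s 1 ≤ d ↔ d s ≠ 0 := by
    rw [Finsupp.single_le_iff, Nat.one_le_iff_ne_zero]
  by_cases h : d s = 0
  · rw [if_neg (by rw [this]; exact fun h' => h' h), if_pos h]
  · rw [if_pos (this.2 h), if_neg h]

/-- The weighted homogeneous parts of a series of exponential type are, up to the part of weight
zero, the elementary Schur polynomials. -/
theorem weightedPart_eq_schur_mul {ι : ℕ+ → σ} (hι : Function.Injective ι) (c : ℕ+ → ℝ)
    (g : (σ →₀ ℕ) → ℝ)
    (hg : ∀ i d, g (d + Finsupp.single (ι i) 1) * ((d (ι i) : ℝ) + 1) = c i * g d)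
    (Q : ℕ → MvPowerSeries σ ℝ)
    (hQ : ∀ k d, MvPowerSeries.coeff d (Q k) = if wt hι d = k then g d else 0) (k : ℕ) :
    Q k = schur (fun i => c i • MvPowerSeries.X (ι i) : ℕ+ → MvPowerSeries σ ℝ) k * Q 0 := by
  classical
  set x : ℕ+ → MvPowerSeries σ ℝ := fun i => c i • MvPowerSeries.X (ι i) with hx
  have hrec : ∀ k : ℕ, ((k : MvPowerSeries σ ℝ) + 1) * Q (k + 1) =
      ∑ i ∈ Finset.range (k + 1),
        ((i : MvPowerSeries σ ℝ) + 1) * x i.succPNat * Q (k - i) := by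
    intro k
    ext d
    have hcast : ∀ (n : ℕ) (φ : MvPowerSeries σ ℝ), MvPowerSeries.coeff d
        (((n : MvPowerSeries σ ℝ) + 1) * φ) = ((n : ℝ) + 1) * MvPowerSeries.coeff d φ := by
      intro n φ
      have : ((n : MvPowerSeries σ ℝ) + 1) = MvPowerSeries.C ((n : ℝ) + 1) := by simp
      rw [this, MvPowerSeries.coeff_C_mul]
    have hterm : ∀ i ∈ Finset.range (k + 1), MvPowerSeries.coeff d
        (((i : MvPowerSeries σ ℝ) + 1) * x i.succPNat * Q (k - i)) =
          if wt hι d = k + 1 then (((i + 1) * d (ι i.succPNat) : ℕ) : ℝ) * g d else 0 := by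
      intro i hi
      rw [mul_assoc, hcast, hx]
      simp only
      rw [smul_mul_assoc, map_smul, smul_eq_mul, coeff_X_mul_eq]
      by_cases hd : d (ι i.succPNat) = 0
      · simp [hd]
      · obtain ⟨d', rfl⟩ : ∃ d', d = d' + Finsupp.single (ι i.succPNat) 1 :=
          ⟨d - Finsupp.single (ι i.succPNat) 1, (tsub_add_cancel_of_le (by
            rw [Finsupp.single_le_iff]; omega)).symm⟩
        rw [if_neg hd, add_tsub_cancel_right, hQ, wt_add, wt_single]
        have hi' := Finset.mem_range.1 hi
        have : wt hι d' = k - i ↔ wt hι d' + (i.succPNat : ℕ) * 1 = k + 1 := by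
          rw [Nat.succPNat_coe]; omega
        simp only [this]
        split_ifs
        · have := hg i.succPNat d'
          simp only [Finsupp.add_apply, Finsupp.single_eq_same]
          push_cast
          rw [← this]
          ring
        · simp
    rw [hcast, hQ, map_sum, Finset.sum_congr rfl hterm]
    by_cases h : wt hι d = k + 1
    · simp only [if_pos h]
      rw [← Finset.sum_mul, ← Nat.cast_sum, ← wt_eq_sum_range hι h.le, h]
      push_cast
      ring
    · simp [h]
  induction k using Nat.strong_induction_on with
  | _ k ih =>
    cases k with
    | zero => rw [schur_zero, one_mul]
    | succ k =>
      have hk : (((k : ℝ) + 1) : ℝ) ≠ 0 := by positivity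
      have hc : ((k : MvPowerSeries σ ℝ) + 1) = MvPowerSeries.C ((k : ℝ) + 1) := by simp
      have h : ((k : MvPowerSeries σ ℝ) + 1) * Q (k + 1) =
          ((k : MvPowerSeries σ ℝ) + 1) * (schur x (k + 1) * Q 0) := by
        rw [hrec, ← mul_assoc, schur_succ, Finset.sum_mul]
        refine Finset.sum_congr rfl fun i _ => ?_
        rw [ih (k - i) (by omega), mul_assoc _ (schur x (k - i))]
      rw [hc] at h
      calc Q (k + 1) = MvPowerSeries.C (((k : ℝ) + 1)⁻¹) *
            (MvPowerSeries.C ((k : ℝ) + 1) * Q (k + 1)) := by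
              rw [← mul_assoc, ← map_mul, inv_mul_cancel₀ hk, map_one, one_mul]
        _ = _ := by
              rw [h, ← mul_assoc, ← map_mul, inv_mul_cancel₀ hk, map_one, one_mul]

theorem linExp_add_single (c : σ → ℝ) (s : σ) (d : σ →₀ ℕ) :
    linExp c (d + Finsupp.single s 1) * ((d s : ℝ) + 1) = c s * linExp c d := by
  classical
  have key : ∀ m : σ →₀ ℕ, linExp c m = (c s ^ m s / ((m s).factorial : ℝ)) *
      (m.erase s).prod fun i e => c i ^ e / (e.factorial : ℝ) := fun m =>
    (Finsupp.mul_prod_erase' m s _ (by simp)).symm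
  rw [key, key d, Finsupp.erase_add, Finsupp.erase_single, add_zero]
  simp only [Finsupp.add_apply, Finsupp.single_eq_same, Nat.factorial_succ, pow_succ]
  push_cast
  have h1 : (d s : ℝ) + 1 ≠ 0 := by positivity
  have h2 : ((d s).factorial : ℝ) ≠ 0 := by positivity
  field_simp

theorem linExp_zero (c : σ → ℝ) : linExp c 0 = 1 := by
  simp [linExp]

/-- Coefficients of the elementary Schur polynomials: `p_k = ∑_{wt m = k} x^m / m!`. -/
theorem coeff_schur_smul_X (c : ℕ+ → ℝ) (k : ℕ) (d : ℕ+ →₀ ℕ) :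
    MvPowerSeries.coeff d (schur (fun i => c i • MvPowerSeries.X i : ℕ+ → MvPowerSeries ℕ+ ℝ) k) =
      if wt (ι := id) Function.injective_id d = k then linExp c d else 0 := by
  classical
  let Q : ℕ → MvPowerSeries ℕ+ ℝ := fun k d =>
    if wt (ι := id) Function.injective_id d = k then linExp c d else 0
  have h0 : Q 0 = 1 := by
    ext d
    change (if wt (ι := id) Function.injective_id d = 0 then linExp c d else 0) = _
    rw [MvPowerSeries.coeff_one]
    by_cases hd : d = 0
    · subst hd; simp [wt_zero, linExp_zero]
    · rw [if_neg hd, if_neg]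
      intro h
      apply hd
      simp only [wt, Finsupp.sum, Finset.sum_eq_zero_iff] at h
      ext i
      by_contra hi
      have := h i (by simpa using hi)
      simp only [mul_eq_zero, Finsupp.comapDomain_apply] at this
      rcases this with h | h
      · exact i.ne_zero h
      · exact hi h
  have := weightedPart_eq_schur_mul (ι := id) Function.injective_id c (linExp c)
    (fun i d => linExp_add_single c i d) Q (fun k d => rfl) k
  rw [h0, mul_one] at this
  rw [show (fun i => c i • MvPowerSeries.X i : ℕ+ → MvPowerSeries ℕ+ ℝ) =
    fun i => c i • MvPowerSeries.X (id i) from rfl, ← this]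
  rfl

/-- The formal series `∑_{r, q} M_{k + r, l + q} p_r(x) p_q(y)`: the bilinear pairing with moment
matrix `M` of `x^k e^{∑ x_i z^i}` and `y^l e^{∑ y_i z^i}`. -/
def momentPairing (M : ℕ → ℕ → ℝ) (x y : ℕ+ → MvPowerSeries σ ℝ) (k l : ℕ) :
    MvPowerSeries σ ℝ :=
  fsum fun p : ℕ × ℕ => M (k + p.1) (l + p.2) • (schur x p.1 * schur y p.2)

/-- The elementary Schur polynomials of `x` form a locally finite family. -/
def Tame (x : ℕ+ → MvPowerSeries σ ℝ) : Prop := LocallyFinite (schur x)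

theorem tame_of_hasSubst {x : ℕ+ → MvPowerSeries σ ℝ} (hx : MvPowerSeries.HasSubst x) :
    Tame x := by
  have h : LocallyFinite (schur (fun i : ℕ+ => (1 : ℝ) • MvPowerSeries.X i :
      ℕ+ → MvPowerSeries ℕ+ ℝ)) := by
    intro m
    refine (Set.finite_singleton (wt (ι := id) Function.injective_id m)).subset fun k hk => ?_
    simp only [Function.mem_support, coeff_schur_smul_X (fun _ => 1)] at hk
    by_contra h
    exact hk (if_neg fun h' => h h'.symm)
  have h2 := (coeffFinite_subst hx).locallyFinite h
  intro m
  refine (h2 m).subset fun k hk => ?_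
  simp only [Function.mem_support] at hk ⊢
  rw [← MvPowerSeries.coe_substAlgHom hx]
  have := schur_map ((MvPowerSeries.substAlgHom hx).restrictScalars ℝ)
    (fun i : ℕ+ => (1 : ℝ) • MvPowerSeries.X i : ℕ+ → MvPowerSeries ℕ+ ℝ) k
  simp only [AlgHom.restrictScalars_apply, one_smul, MvPowerSeries.substAlgHom_X] at this
  simp only [one_smul]
  rw [this]
  exact hk

theorem Tame.add {x y : ℕ+ → MvPowerSeries σ ℝ} (hx : Tame x) (hy : Tame y) : Tame (x + y) := by
  intro m
  have h := (LocallyFinite.mul hx hy m).image fun p => p.1 + p.2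
  refine h.subset fun k hk => ?_
  simp only [Function.mem_support, schur_add, map_sum] at hk
  obtain ⟨p, hp, h⟩ := Finset.exists_ne_zero_of_sum_ne_zero hk
  exact ⟨p, h, Finset.HasAntidiagonal.mem_antidiagonal.1 hp⟩

theorem locallyFinite_momentPairing (M : ℕ → ℕ → ℝ) {x y : ℕ+ → MvPowerSeries σ ℝ}
    (hx : Tame x) (hy : Tame y) (k l : ℕ) : LocallyFinite fun p : ℕ × ℕ =>
      M (k + p.1) (l + p.2) • (schur x p.1 * schur y p.2) :=
  (LocallyFinite.mul hx hy).smul fun p => M (k + p.1) (l + p.2)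

theorem momentPairing_swap (M : ℕ → ℕ → ℝ) (x y : ℕ+ → MvPowerSeries σ ℝ) (k l : ℕ) :
    momentPairing M x y k l = momentPairing (fun i j => M j i) y x l k := by
  rw [momentPairing, momentPairing, ← fsum_comp_equiv (Equiv.prodComm ℕ ℕ)]
  congr 1
  funext p
  simp only [Equiv.prodComm_apply, Prod.fst_swap, Prod.snd_swap]
  rw [mul_comm]

/-- Taylor's formula: a change of the times `x` by `b` acts on the moments through the elementary
Schur polynomials of `b`. -/
theorem momentPairing_add_left (M : ℕ → ℕ → ℝ) {x b y : ℕ+ → MvPowerSeries σ ℝ}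
    (hx : Tame x) (hb : Tame b) (hy : Tame y) (k l : ℕ) :
    momentPairing M (x + b) y k l =
      fsum fun r => schur b r * momentPairing M x y (k + r) l := by
  have hT : LocallyFinite fun p : (ℕ × ℕ) × ℕ =>
      M (k + (p.1.1 + p.1.2)) (l + p.2) • (schur b p.1.1 * schur x p.1.2 * schur y p.2) :=
    ((LocallyFinite.mul hb hx).mul hy).smul fun p => M (k + (p.1.1 + p.1.2)) (l + p.2)
  have h1 : (fsum fun r => schur b r * momentPairing M x y (k + r) l) =
      fsum fun p : (ℕ × ℕ) × ℕ =>
        M (k + (p.1.1 + p.1.2)) (l + p.2) • (schur b p.1.1 * schur x p.1.2 * schur y p.2) := by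
    rw [← fsum_comp_equiv (Equiv.prodAssoc ℕ ℕ ℕ).symm, fsum_prod]
    · congr 1
      funext r
      rw [momentPairing, fsum_mul_left (locallyFinite_momentPairing M hx hy _ _)]
      congr 1
      funext p
      simp only [Equiv.prodAssoc_symm_apply]
      rw [mul_smul_comm, mul_assoc, add_assoc]
    · exact hT.comp (Equiv.prodAssoc ℕ ℕ ℕ).symm.injective
  rw [h1]
  ext m
  have hfin : (Function.support fun p : (ℕ × ℕ) × ℕ => MvPowerSeries.coeff m
      (M (k + (p.1.1 + p.1.2)) (l + p.2) •
        (schur b p.1.1 * schur x p.1.2 * schur y p.2))).Finite := hT m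
  rw [momentPairing, coeff_fsum, coeff_fsum]
  -- group the pairs of indices by their sum
  set g : (ℕ × ℕ) × ℕ → ℝ := fun p => MvPowerSeries.coeff m
      (M (k + (p.1.1 + p.1.2)) (l + p.2) • (schur b p.1.1 * schur x p.1.2 * schur y p.2)) with hg
  have hsum : Summable g := summable_of_hasFiniteSupport hfin
  let e : (Σ p : ℕ × ℕ, Finset.HasAntidiagonal.antidiagonal p.1) ≃ (ℕ × ℕ) × ℕ :=
    { toFun := fun s => (s.2.1, s.1.2)
      invFun := fun p => ⟨(p.1.1 + p.1.2, p.2), ⟨p.1,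
        Finset.HasAntidiagonal.mem_antidiagonal.2 rfl⟩⟩
      left_inv := by
        rintro ⟨⟨r, q⟩, ⟨p, hp⟩⟩
        obtain rfl := Finset.HasAntidiagonal.mem_antidiagonal.1 hp
        rfl
      right_inv := fun p => rfl }
  have hsum' : Summable (g ∘ e) := (e.summable_iff).2 hsum
  rw [← tsum_eq_finsum (L := SummationFilter.unconditional _) hfin, ← e.tsum_eq g, ← tsum_eq_finsum
    (L := SummationFilter.unconditional _) (locallyFinite_momentPairing M (hx.add hb) hy k l m)]
  change _ = ∑' s, (g ∘ e) s
  rw [hsum'.tsum_sigma' fun p => Summable.of_finite]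
  refine tsum_congr fun p => ?_
  rw [tsum_fintype, add_comm x b]
  beta_reduce
  rw [schur_add, Finset.sum_mul, Finset.smul_sum, map_sum,
    ← Finset.sum_coe_sort]
  refine Finset.sum_congr rfl fun s _ => ?_
  have := Finset.HasAntidiagonal.mem_antidiagonal.1 s.2
  simp only [Function.comp, hg, e, Equiv.coe_fn_mk, this]

theorem momentPairing_add_right (M : ℕ → ℕ → ℝ) {x y b : ℕ+ → MvPowerSeries σ ℝ}
    (hx : Tame x) (hy : Tame y) (hb : Tame b) (k l : ℕ) :
    momentPairing M x (y + b) k l =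
      fsum fun r => schur b r * momentPairing M x y k (l + r) := by
  rw [momentPairing_swap, momentPairing_add_left _ hy hb hx]
  congr 1
  funext r
  rw [momentPairing_swap]

theorem momentPairing_subst (M : ℕ → ℕ → ℝ) {x y : ℕ+ → MvPowerSeries σ ℝ}
    (hx : Tame x) (hy : Tame y) {a : σ → MvPowerSeries τ ℝ} (ha : MvPowerSeries.HasSubst a)
    (k l : ℕ) : (momentPairing M x y k l).subst a =
      momentPairing M (fun i => (x i).subst a) (fun i => (y i).subst a) k l := by
  rw [momentPairing, (coeffFinite_subst ha).map_fsum (locallyFinite_momentPairing M hx hy k l)]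
  unfold momentPairing
  congr 1
  funext p
  rw [← MvPowerSeries.coe_substAlgHom ha, map_smul, map_mul]
  congr 2
  · exact schur_map ((MvPowerSeries.substAlgHom ha).restrictScalars ℝ) x p.1
  · exact schur_map ((MvPowerSeries.substAlgHom ha).restrictScalars ℝ) y p.2

/-- Exponents of weight `w₁` in `t` and `w₂` in `s` pick out the number `M_{k+w₁, l+w₂}`; the signs
come from `e^{-∑ s_i y^i}`. -/
theorem coeff_momentPairing (M : ℕ → ℕ → ℝ) (k l : ℕ) (d : ℕ+ ⊕ ℕ+ →₀ ℕ) :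
    MvPowerSeries.coeff d (momentPairing M (fun i => MvPowerSeries.X (Sum.inl i))
      (fun i => -MvPowerSeries.X (Sum.inr i)) k l) =
    linExp (Sum.elim (fun _ => 1) (fun _ => -1)) d *
      M (k + wt (ι := Sum.inl) Sum.inl_injective d)
        (l + wt (ι := Sum.inr) Sum.inr_injective d) := by
  classical
  set c : ℕ+ ⊕ ℕ+ → ℝ := Sum.elim (fun _ => 1) (fun _ => -1) with hc
  let Q : ℕ → ℕ → MvPowerSeries (ℕ+ ⊕ ℕ+) ℝ := fun r q d =>
    if wt (ι := Sum.inl) Sum.inl_injective d = r then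
      (if wt (ι := Sum.inr) Sum.inr_injective d = q then linExp c d else 0) else 0
  have hQ0 : Q 0 0 = 1 := by
    ext d
    change (if _ then (if _ then _ else _) else _) = _
    rw [MvPowerSeries.coeff_one]
    by_cases hd : d = 0
    · subst hd; simp [wt_zero, linExp_zero]
    · rw [if_neg hd]
      split_ifs with h1 h2
      · exfalso
        apply hd
        simp only [wt, Finsupp.sum, Finset.sum_eq_zero_iff] at h1 h2
        ext i
        by_contra hi
        cases i with
        | inl i =>
          have := h1 i (by simpa using hi)
          simp only [mul_eq_zero, Finsupp.comapDomain_apply] at this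
          exact this.elim i.ne_zero hi
        | inr i =>
          have := h2 i (by simpa using hi)
          simp only [mul_eq_zero, Finsupp.comapDomain_apply] at this
          exact this.elim i.ne_zero hi
      · rfl
      · rfl
  have hQ1 : ∀ q, Q 0 q = schur (fun i => -MvPowerSeries.X (Sum.inr i)) q := by
    intro q
    have := weightedPart_eq_schur_mul (ι := Sum.inr) Sum.inr_injective (fun _ => -1)
      (fun d : ℕ+ ⊕ ℕ+ →₀ ℕ =>
        if wt (ι := Sum.inl) Sum.inl_injective d = 0 then linExp c d else 0)
      (fun i d => by
        rw [wt_add, wt_single_of_notMem _ (by simp), add_zero]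
        split_ifs
        · exact linExp_add_single c (Sum.inr i) d
        · simp) (fun q => Q 0 q) (fun k d => by
        change (if _ then (if _ then _ else _) else _) = _
        split_ifs <;> rfl) q
    simp only [hQ0, mul_one, neg_smul, one_smul] at this
    exact this
  have hQ2 : ∀ r q, Q r q = schur (fun i => MvPowerSeries.X (Sum.inl i)) r *
      schur (fun i => -MvPowerSeries.X (Sum.inr i)) q := by
    intro r q
    have := weightedPart_eq_schur_mul (ι := Sum.inl) Sum.inl_injective (fun _ => 1)
      (fun d : ℕ+ ⊕ ℕ+ →₀ ℕ =>
        if wt (ι := Sum.inr) Sum.inr_injective d = q then linExp c d else 0)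
      (fun i d => by
        rw [wt_add, wt_single_of_notMem _ (by simp), add_zero]
        split_ifs
        · exact linExp_add_single c (Sum.inl i) d
        · simp) (fun r => Q r q) (fun k d => rfl) r
    simp only [hQ1, one_smul] at this
    exact this
  rw [momentPairing, coeff_fsum, finsum_eq_single _
    (wt (ι := Sum.inl) Sum.inl_injective d, wt (ι := Sum.inr) Sum.inr_injective d)]
  · rw [map_smul, ← hQ2, smul_eq_mul, mul_comm]
    change (if _ then (if _ then _ else _) else _) * _ = _
    rw [if_pos rfl, if_pos rfl]
  · rintro ⟨r, q⟩ hne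
    rw [map_smul, ← hQ2, smul_eq_mul]
    change _ * (if _ then (if _ then _ else _) else _) = _
    split_ifs with h1 h2
    · exact absurd (by rw [h1, h2]) hne
    · rw [mul_zero]
    · rw [mul_zero]

end Moments

/-! ### Bordered determinants -/

section Determinants

variable {A : Type*} [CommRing A]

/-- Adding multiples of the next row, the last row first, does not change the determinant. -/
theorem det_eq_of_row_eq_add_mul_succ {n : ℕ} {B C : Matrix (Fin (n + 1)) (Fin (n + 1)) A} (w : A)
    (hlast : ∀ j, B (Fin.last n) j = C (Fin.last n) j)
    (hsucc : ∀ (i : Fin n) (j), B i.castSucc j = C i.castSucc j + w * B i.succ j) :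
    B.det = C.det := by
  rw [← Matrix.det_submatrix_equiv_self Fin.revPerm B,
    ← Matrix.det_submatrix_equiv_self Fin.revPerm C]
  refine Matrix.det_eq_of_forall_row_eq_smul_add_pred (fun _ => w) (fun j => ?_) fun i j => ?_
  · simpa using hlast _
  · simpa [Fin.rev_succ, Fin.rev_castSucc] using hsucc i.rev j.rev

/-- The cofactors of a last row added to the first `m` rows of the matrix `N`. -/
def cofactorLast (N : ℕ → ℕ → A) (m : ℕ) (j : Fin (m + 1)) : A :=
  (-1) ^ (m + j : ℕ) * (Matrix.of fun a b : Fin m => N a (j.succAbove b)).det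

theorem sum_cofactorLast_mul (N : ℕ → ℕ → A) (m : ℕ) (r : Fin (m + 1) → A) :
    ∑ j, cofactorLast N m j * r j =
      (Matrix.of (Fin.snoc (fun a : Fin m => fun b : Fin (m + 1) => N a b) r :
        Fin (m + 1) → Fin (m + 1) → A)).det := by
  rw [Matrix.det_succ_row _ (Fin.last m)]
  refine Finset.sum_congr rfl fun j _ => ?_
  rw [cofactorLast, mul_right_comm]
  congr 2
  · simp
  · rw [Fin.succAbove_last]
    ext a b
    simp only [Matrix.of_apply, Matrix.submatrix_apply]
    rw [Fin.snoc_castSucc (α := fun _ => Fin (m + 1) → A)]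

theorem sum_cofactorLast_mul_row (N : ℕ → ℕ → A) {m i : ℕ} (hi : i < m) :
    ∑ j, cofactorLast N m j * N i j = 0 := by
  rw [sum_cofactorLast_mul N m fun j => N i j]
  refine Matrix.det_zero_of_row_eq (i := (⟨i, hi⟩ : Fin m).castSucc) (j := Fin.last m)
    (Fin.castSucc_lt_last _).ne ?_
  funext b
  simp only [Matrix.of_apply]
  rw [Fin.snoc_castSucc (α := fun _ => Fin (m + 1) → A), Fin.snoc_last]

/-- Expansion of `τ_{m+1}(t + [w], s)`: if `R` are the shifted moments, then every row but the last
can be reduced to a row of the unshifted moments `N`. -/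
theorem det_eq_sum_cofactorLast_mul (N R : ℕ → ℕ → A) (w : A)
    (hR : ∀ i j, R i j = N i j + w * R (i + 1) j) (m : ℕ) :
    (Matrix.of fun i j : Fin (m + 1) => R i j).det = ∑ j, cofactorLast N m j * R m j := by
  rw [sum_cofactorLast_mul N m fun j => R m j]
  refine det_eq_of_row_eq_add_mul_succ w (fun j => ?_) fun i j => ?_
  · simp
  · simpa using hR i j

/-- Expansion of `τ_m(t, s + [w])`: a polynomial in `w` whose coefficients are the cofactors of a
last row added to `m` rows and `m + 1` columns of moments. -/
theorem det_sub_mul_eq_sum_cofactorLast (N : ℕ → ℕ → A) (w : A) (m : ℕ) :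
    (Matrix.of fun i j : Fin m => N i j - w * N i (j + 1)).det =
      ∑ j : Fin (m + 1), w ^ (m - j : ℕ) * cofactorLast N m j := by
  have h1 := sum_cofactorLast_mul N m fun j => w ^ (m - j : ℕ)
  simp only [mul_comm (w ^ _)]
  rw [h1]
  -- subtract `w` times the next column from every column but the last
  set B := (Matrix.of (Fin.snoc (fun a : Fin m => fun b : Fin (m + 1) => N a b)
    (fun j : Fin (m + 1) => w ^ (m - j : ℕ)) : Fin (m + 1) → Fin (m + 1) → A)).transpose with hB
  have hB1 : ∀ (i : Fin (m + 1)) (j : Fin m), B i j.castSucc = N j i := fun i j => by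
    rw [hB, Matrix.transpose_apply, Matrix.of_apply,
      Fin.snoc_castSucc (α := fun _ => Fin (m + 1) → A)]
  have hB2 : ∀ i : Fin (m + 1), B i (Fin.last m) = w ^ (m - i : ℕ) := fun i => by
    rw [hB, Matrix.transpose_apply, Matrix.of_apply, Fin.snoc_last]
  let C : Matrix (Fin (m + 1)) (Fin (m + 1)) A :=
    Matrix.of (Fin.snoc (fun a : Fin m => fun b : Fin (m + 1) =>
      B a.castSucc b - w * B a.succ b) (B (Fin.last m)) : Fin (m + 1) → Fin (m + 1) → A)
  have hC1 : ∀ (i : Fin m) (j), C i.castSucc j = B i.castSucc j - w * B i.succ j := fun i j => by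
    simp only [C, Matrix.of_apply]
    rw [Fin.snoc_castSucc (α := fun _ => Fin (m + 1) → A)]
  have hC2 : ∀ j, C (Fin.last m) j = B (Fin.last m) j := fun j => by
    simp only [C, Matrix.of_apply]
    rw [Fin.snoc_last]
  refine Eq.trans ?_ (show B.det = _ by rw [hB, Matrix.det_transpose])
  rw [det_eq_of_row_eq_add_mul_succ (B := B) (C := C) w (fun j => (hC2 j).symm)
    (fun i j => by rw [hC1]; ring), Matrix.det_succ_column C (Fin.last m),
    Fin.sum_univ_castSucc, Finset.sum_eq_zero, zero_add, hC2, hB2]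
  · simp only [Fin.val_last, ← two_mul, pow_mul, neg_one_sq, one_pow, one_mul, Nat.sub_self,
      pow_zero, Fin.succAbove_last]
    rw [← Matrix.det_transpose]
    congr 1
    ext i j
    simp [hC1, hB1]
  · intro i _
    rw [hC1, hB2, hB2, Fin.val_castSucc, Fin.val_succ,
      show m - (i : ℕ) = m - (i + 1) + 1 from by omega, pow_succ']
    ring

end Determinants

/-! ### The 2-Toda bilinear identities -/

section Toda

/-- The power series that do not contain the local parameter `w`. -/
def freeOfW : Subalgebra ℝ (MvPowerSeries BVar ℝ) where
  carrier := {φ | ∀ m, m BVar.w ≠ 0 → MvPowerSeries.coeff m φ = 0}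
  mul_mem' := by
    classical
    intro φ ψ hφ hψ m hm
    rw [MvPowerSeries.coeff_mul]
    refine Finset.sum_eq_zero fun p hp => ?_
    have h := Finset.HasAntidiagonal.mem_antidiagonal.1 hp
    by_cases h1 : p.1 BVar.w = 0
    · rw [hψ p.2, mul_zero]
      intro h2
      rw [← h, Finsupp.add_apply, h1, h2] at hm
      exact hm rfl
    · rw [hφ p.1 h1, zero_mul]
  add_mem' := by
    intro φ ψ hφ hψ m hm
    rw [map_add, hφ m hm, hψ m hm, add_zero]
  algebraMap_mem' := by
    classical
    intro r m hm
    rw [MvPowerSeries.algebraMap_apply, MvPowerSeries.coeff_C, if_neg]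
    rintro rfl
    exact hm rfl

theorem X_mem_freeOfW {v : BVar} (hv : v ≠ BVar.w) : MvPowerSeries.X v ∈ freeOfW := by
  classical
  intro m hm
  rw [MvPowerSeries.coeff_X, if_neg]
  rintro rfl
  exact hm (Finsupp.single_eq_of_ne hv.symm)

theorem schur_mem_freeOfW {x : ℕ+ → MvPowerSeries BVar ℝ} (hx : ∀ i, x i ∈ freeOfW) (k : ℕ) :
    schur x k ∈ freeOfW := by
  have := schur_map freeOfW.val (fun i => (⟨x i, hx i⟩ : freeOfW)) k
  simp only [Subalgebra.coe_val] at this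
  rw [← this]
  exact Subtype.property _

theorem fsum_mem_freeOfW {β : Type*} {F : β → MvPowerSeries BVar ℝ}
    (hF : ∀ q, F q ∈ freeOfW) : fsum F ∈ freeOfW := fun m hm => by
  rw [coeff_fsum]
  exact finsum_eq_zero_of_forall_eq_zero fun q => hF q m hm

theorem det_mem_freeOfW {n : ℕ} {N : Matrix (Fin n) (Fin n) (MvPowerSeries BVar ℝ)}
    (hN : ∀ i j, N i j ∈ freeOfW) : N.det ∈ freeOfW := by
  rw [Matrix.det_apply]
  refine Subalgebra.sum_mem _ fun σ _ => ?_
  rw [Units.smul_def, zsmul_eq_mul]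
  exact Subalgebra.mul_mem _ (intCast_mem _ _) (Subalgebra.prod_mem _ fun i _ => hN _ _)

theorem momentPairing_mem_freeOfW (M : ℕ → ℕ → ℝ) {x y : ℕ+ → MvPowerSeries BVar ℝ}
    (hx : ∀ i, x i ∈ freeOfW) (hy : ∀ i, y i ∈ freeOfW) (k l : ℕ) :
    momentPairing M x y k l ∈ freeOfW :=
  fsum_mem_freeOfW fun _ => Subalgebra.smul_mem _
    (Subalgebra.mul_mem _ (schur_mem_freeOfW hx _) (schur_mem_freeOfW hy _)) _

theorem coeffFinite_coeffW (k : ℕ) : CoeffFinite (coeffW k) := fun e => by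
  classical
  by_cases he : e BVar.w = 0
  · refine ⟨{e + Finsupp.single BVar.w k}, fun _ => 1, fun φ => ?_⟩
    rw [Finset.sum_singleton, one_mul]
    exact if_pos he
  · refine ⟨∅, 0, fun φ => ?_⟩
    rw [Finset.sum_empty]
    exact if_neg he

theorem coeffW_pow_mul {φ : MvPowerSeries BVar ℝ} (hφ : φ ∈ freeOfW) (r k : ℕ) :
    coeffW k (MvPowerSeries.X BVar.w ^ r * φ) = if r = k then φ else 0 := by
  classical
  ext m
  change (if m BVar.w = 0 then
    MvPowerSeries.coeff (m + Finsupp.single BVar.w k) (MvPowerSeries.X BVar.w ^ r * φ) else 0) = _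
  rw [MvPowerSeries.X_pow_eq, MvPowerSeries.coeff_monomial_mul, one_mul]
  by_cases hm : m BVar.w = 0
  · rw [if_pos hm]
    by_cases hrk : r = k
    · subst hrk
      rw [if_pos le_add_self, if_pos rfl, add_tsub_cancel_right]
    · rw [if_neg hrk, map_zero]
      split_ifs with h
      · apply hφ
        rw [Finsupp.single_le_iff] at h
        simp only [Finsupp.add_apply, Finsupp.single_eq_same, hm, zero_add] at h
        simp only [Finsupp.tsub_apply, Finsupp.add_apply, Finsupp.single_eq_same, hm, zero_add]
        omega
      · rfl
  · rw [if_neg hm]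
    split_ifs
    · exact (hφ m hm).symm
    · rw [map_zero]

theorem locallyFinite_pow_mul (q : ℕ → MvPowerSeries BVar ℝ) :
    LocallyFinite fun k => MvPowerSeries.X BVar.w ^ k * q k := fun m => by
  classical
  refine (Set.finite_Iic (m BVar.w)).subset fun k hk => ?_
  by_contra h
  refine hk ?_
  simp only
  rw [MvPowerSeries.X_pow_eq, MvPowerSeries.coeff_monomial_mul, if_neg]
  rw [Finsupp.single_le_iff]
  exact h

theorem LocallyFinite.mul_apply {σ β : Type*} {F : β → MvPowerSeries σ ℝ} (hF : LocallyFinite F)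
    (G : β → MvPowerSeries σ ℝ) : LocallyFinite fun q => F q * G q := fun m => by
  classical
  refine ((Finset.HasAntidiagonal.antidiagonal m).finite_toSet.biUnion
    fun p _ => hF p.1).subset fun q hq => ?_
  simp only [Function.mem_support, MvPowerSeries.coeff_mul] at hq
  obtain ⟨p, hp, h⟩ := Finset.exists_ne_zero_of_sum_ne_zero hq
  exact Set.mem_biUnion hp (left_ne_zero_of_mul h)

/-- The residue of `(∑_i P_i z^i) (∑_e q_e z^{-e-1}) (∑_c B_c z^c)`, with `w = z⁻¹`. -/
theorem resPair_eq_sum {n m : ℕ} {P : Fin (n + 1) → MvPowerSeries BVar ℝ}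
    {q : ℕ → MvPowerSeries BVar ℝ} (hP : ∀ i, P i ∈ freeOfW) (hq : ∀ e, q e ∈ freeOfW)
    (hq0 : ∀ e < m, q e = 0) {B : ℕ → MvPowerSeries BVar ℝ} (hB : LocallyFinite B) :
    resPair ((m : ℤ) - n)
      (fun a => coeffW a ((∑ i : Fin (n + 1), MvPowerSeries.X BVar.w ^ (n - i : ℕ) * P i) *
        fsum fun k => MvPowerSeries.X BVar.w ^ k * q (m + k))) B =
      ∑ i, P i * fsum fun c => B c * q (c + i) := by
  have hA : ∀ a, coeffW a ((∑ i : Fin (n + 1), MvPowerSeries.X BVar.w ^ (n - i : ℕ) * P i) *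
      fsum fun k => MvPowerSeries.X BVar.w ^ k * q (m + k)) =
      ∑ i : Fin (n + 1), if n ≤ a + i then P i * q (m + a + i - n) else 0 := by
    intro a
    rw [Finset.sum_mul, (coeffFinite_coeffW a).map_sum]
    refine Finset.sum_congr rfl fun i _ => ?_
    rw [fsum_mul_left (locallyFinite_pow_mul fun k => q (m + k)),
      (coeffFinite_coeffW a).map_fsum ((locallyFinite_pow_mul fun k => q (m + k)).mul_left _)]
    have hterm : ∀ k, coeffW a (MvPowerSeries.X BVar.w ^ (n - i : ℕ) * P i *
        (MvPowerSeries.X BVar.w ^ k * q (m + k))) =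
        if n - (i : ℕ) + k = a then P i * q (m + k) else 0 := by
      intro k
      rw [mul_mul_mul_comm, ← pow_add, coeffW_pow_mul (Subalgebra.mul_mem _ (hP i) (hq _))]
    simp only [hterm]
    have hi := i.is_le
    split_ifs with h
    · rw [fsum_eq_single (a + i - n), if_pos (by omega)]
      · congr 2
        omega
      · intro k hk
        rw [if_neg (by omega)]
    · rw [fsum_eq_sum ∅, Finset.sum_empty]
      intro k _
      rw [if_neg (by omega)]
  have hLF : ∀ i : Fin (n + 1), LocallyFinite fun c => B c * q (c + i) :=
    fun i => hB.mul_apply _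
  have hterm : ∀ p : ℕ × ℕ, (if (p.2 : ℤ) - (p.1 : ℤ) = (m : ℤ) - n then
      coeffW p.1 ((∑ i : Fin (n + 1), MvPowerSeries.X BVar.w ^ (n - i : ℕ) * P i) *
        fsum fun k => MvPowerSeries.X BVar.w ^ k * q (m + k)) * B p.2 else 0) =
      ∑ i, P i * if p.2 + n = m + p.1 then B p.2 * q (p.2 + i) else 0 := by
    rintro ⟨a, c⟩
    by_cases h : c + n = m + a
    · rw [if_pos (by push_cast; omega)]
      simp only [if_pos h]
      rw [hA, Finset.sum_mul]
      refine Finset.sum_congr rfl fun i _ => ?_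
      split_ifs with h'
      · rw [show m + a + (i : ℕ) - n = c + i from by omega]
        ring
      · rw [hq0 _ (by omega)]
        ring
    · rw [if_neg (by push_cast; omega)]
      simp only [if_neg h, mul_zero, Finset.sum_const_zero]
  have hLF' : ∀ i : Fin (n + 1), LocallyFinite fun p : ℕ × ℕ =>
      if p.2 + n = m + p.1 then B p.2 * q (p.2 + i) else 0 := by
    intro i d
    have hinj : Set.InjOn (fun p : ℕ × ℕ => p.2) {p | p.2 + n = m + p.1} := by
      rintro ⟨a, c⟩ h ⟨a', c'⟩ h' hcc
      have h : c + n = m + a := h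
      have h' : c' + n = m + a' := h'
      have hcc : c = c' := hcc
      exact Prod.ext (by simp only; omega) hcc
    refine Set.Finite.of_finite_image (f := fun p : ℕ × ℕ => p.2)
      ((hLF i d).subset ?_) (hinj.mono ?_)
    · rintro _ ⟨p, hp, rfl⟩
      simp only [Function.mem_support] at hp ⊢
      split_ifs at hp
      · exact hp
      · exact absurd (map_zero _) hp
    · intro p hp
      simp only [Function.mem_support] at hp
      by_contra h
      have h : ¬ p.2 + n = m + p.1 := h
      exact hp (by rw [if_neg h, map_zero])
  simp only [resPair, hterm]
  rw [fsum_finsetSum _ fun i _ => (hLF' i).mul_left (P i)]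
  refine Finset.sum_congr rfl fun i _ => ?_
  rw [← fsum_mul_left (hLF' i)]
  congr 1
  rw [← fsum_comp_equiv (Equiv.prodComm ℕ ℕ), fsum_prod ((hLF' i).comp (Equiv.injective _))]
  congr 1
  funext c
  by_cases h : m ≤ c + n
  · rw [fsum_eq_single (c + n - m)]
    · exact if_pos (show c + n = m + (c + n - m) by omega)
    · intro a ha
      exact if_neg (show ¬ c + n = m + a by omega)
  · rw [fsum_eq_sum ∅, Finset.sum_empty, hq0 _ (by have := i.is_le; omega), mul_zero]
    intro a _
    exact if_neg (show ¬ c + n = m + a by omega)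

section Substitution

variable {σ τ κ : Type*}

theorem hasSubst_sumElim {x : κ → MvPowerSeries τ ℝ} {y : σ → MvPowerSeries τ ℝ}
    (hx : MvPowerSeries.HasSubst x) (hy : MvPowerSeries.HasSubst y) :
    MvPowerSeries.HasSubst (Sum.elim x y) where
  const_coeff s := by
    cases s with
    | inl i => exact hx.const_coeff i
    | inr i => exact hy.const_coeff i
  coeff_zero d := by
    refine (((hx.coeff_zero d).image Sum.inl).union ((hy.coeff_zero d).image Sum.inr)).subset ?_
    rintro (i | i) hi
    · exact Or.inl ⟨i, hi, rfl⟩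
    · exact Or.inr ⟨i, hi, rfl⟩

theorem hasSubst_X_comp {ι : σ → τ} (hι : Function.Injective ι) :
    MvPowerSeries.HasSubst fun i => (MvPowerSeries.X (ι i) : MvPowerSeries τ ℝ) := by
  classical
  refine ⟨fun i => by simp, fun d => ?_⟩
  refine (d.support.finite_toSet.preimage hι.injOn).subset fun i hi => ?_
  have hi : MvPowerSeries.coeff d (MvPowerSeries.X (ι i) : MvPowerSeries τ ℝ) ≠ 0 := hi
  rw [MvPowerSeries.coeff_X] at hi
  have h : d = Finsupp.single (ι i) 1 := by
    by_contra h
    exact hi (if_neg h)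
  simp [h]

theorem hasSubst_miwa_X (v : τ) :
    MvPowerSeries.HasSubst (miwa (MvPowerSeries.X v : MvPowerSeries τ ℝ)) := by
  classical
  refine ⟨fun i => ?_, fun d => ?_⟩
  · rw [miwa, ← MvPowerSeries.coeff_zero_eq_constantCoeff_apply, map_smul,
      MvPowerSeries.coeff_zero_eq_constantCoeff_apply, map_pow, MvPowerSeries.constantCoeff_X,
      zero_pow i.ne_zero, smul_zero]
    exact IsNilpotent.zero
  · refine ((Set.finite_singleton (d v)).preimage PNat.coe_injective.injOn).subset fun i hi => ?_
    have hi : MvPowerSeries.coeff d (miwa (MvPowerSeries.X v : MvPowerSeries τ ℝ) i) ≠ 0 := hi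
    rw [miwa, map_smul, MvPowerSeries.coeff_X_pow] at hi
    have h : d = Finsupp.single v (i : ℕ) := by
      by_contra h
      exact hi (by rw [if_neg h, smul_zero])
    simp [h]

theorem hasSubst_neg {x : σ → MvPowerSeries τ ℝ} (hx : MvPowerSeries.HasSubst x) :
    MvPowerSeries.HasSubst (-x) := by
  have := hx.mul_left (fun _ => -1)
  convert this using 1
  funext i
  simp

theorem hasSubst_sub {x y : σ → MvPowerSeries τ ℝ} (hx : MvPowerSeries.HasSubst x)
    (hy : MvPowerSeries.HasSubst y) : MvPowerSeries.HasSubst (x - y) := by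
  rw [sub_eq_add_neg]
  exact hx.add (hasSubst_neg hy)

theorem subst_neg {a : σ → MvPowerSeries τ ℝ} (ha : MvPowerSeries.HasSubst a)
    (φ : MvPowerSeries σ ℝ) : (-φ).subst a = -φ.subst a := by
  rw [← MvPowerSeries.coe_substAlgHom ha, map_neg]

theorem tame_X_comp {ι : ℕ+ → τ} (hι : Function.Injective ι) :
    Tame fun i => (MvPowerSeries.X (ι i) : MvPowerSeries τ ℝ) :=
  tame_of_hasSubst (hasSubst_X_comp hι)

theorem tame_neg_X_comp {ι : ℕ+ → τ} (hι : Function.Injective ι) :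
    Tame fun i => -(MvPowerSeries.X (ι i) : MvPowerSeries τ ℝ) :=
  tame_of_hasSubst (hasSubst_neg (hasSubst_X_comp hι))

/-- The moments `μ_{kl}(t, s)` attached to the numbers `M_{kl} = μ_{kl}(T, S)`. -/
def formalMoment (M : ℕ → ℕ → ℝ) (k l : ℕ) : MvPowerSeries (ℕ+ ⊕ ℕ+) ℝ :=
  momentPairing M (fun i => MvPowerSeries.X (Sum.inl i)) (fun i => -MvPowerSeries.X (Sum.inr i)) k l

theorem formalMoment_subst (M : ℕ → ℕ → ℝ) {x y : ℕ+ → MvPowerSeries τ ℝ}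
    (hx : MvPowerSeries.HasSubst x) (hy : MvPowerSeries.HasSubst y) (k l : ℕ) :
    (formalMoment M k l).subst (Sum.elim x y) = momentPairing M x (-y) k l := by
  have h := hasSubst_sumElim hx hy
  rw [formalMoment, momentPairing_subst M (tame_X_comp Sum.inl_injective)
    (tame_neg_X_comp Sum.inr_injective) h]
  congr 1
  · funext i
    rw [MvPowerSeries.subst_X h, Sum.elim_inl]
  · funext i
    rw [subst_neg h, MvPowerSeries.subst_X h, Sum.elim_inr, Pi.neg_apply]

theorem det_subst {a : σ → MvPowerSeries τ ℝ} (ha : MvPowerSeries.HasSubst a) {n : ℕ}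
    (N : Matrix (Fin n) (Fin n) (MvPowerSeries σ ℝ)) :
    N.det.subst a = (Matrix.of fun i j => (N i j).subst a).det := by
  rw [← MvPowerSeries.coe_substAlgHom ha, AlgHom.map_det]
  rfl

/-- The shift `x ↦ x - [v]` multiplies the integrand by `1 - v x`. -/
theorem momentPairing_sub_miwa_left (M : ℕ → ℕ → ℝ) {x y : ℕ+ → MvPowerSeries τ ℝ}
    (hx : Tame x) (hy : Tame y) (v : τ) (k l : ℕ) :
    momentPairing M (x - miwa (MvPowerSeries.X v)) y k l =
      momentPairing M x y k l - MvPowerSeries.X v * momentPairing M x y (k + 1) l := by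
  rw [sub_eq_add_neg,
    momentPairing_add_left M hx (tame_of_hasSubst (hasSubst_neg (hasSubst_miwa_X v))) hy]
  have hs : ∀ k, schur (-miwa (MvPowerSeries.X v : MvPowerSeries τ ℝ)) k =
      if k = 0 then 1 else if k = 1 then -MvPowerSeries.X v else 0 :=
    schur_neg_inv_nat_mul_pow (MvPowerSeries.X v)
  rw [fsum_eq_sum {0, 1}]
  · simp [hs, sub_eq_add_neg]
  · intro r hr
    rw [hs, if_neg (by rintro rfl; simp at hr), if_neg (by rintro rfl; simp at hr), zero_mul]

theorem momentPairing_sub_miwa_right (M : ℕ → ℕ → ℝ) {x y : ℕ+ → MvPowerSeries τ ℝ}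
    (hx : Tame x) (hy : Tame y) (v : τ) (k l : ℕ) :
    momentPairing M x (y - miwa (MvPowerSeries.X v)) k l =
      momentPairing M x y k l - MvPowerSeries.X v * momentPairing M x y k (l + 1) := by
  rw [momentPairing_swap, momentPairing_sub_miwa_left _ hy hx, momentPairing_swap M x y,
    momentPairing_swap M x y]

/-- The shift `x ↦ x + [v]` multiplies the integrand by `1 / (1 - v x)`. -/
theorem momentPairing_add_miwa_left (M : ℕ → ℕ → ℝ) {x y : ℕ+ → MvPowerSeries τ ℝ}
    (hx : Tame x) (hy : Tame y) (v : τ) (k l : ℕ) :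
    momentPairing M (x + miwa (MvPowerSeries.X v)) y k l =
      fsum fun r => MvPowerSeries.X v ^ r * momentPairing M x y (k + r) l := by
  rw [momentPairing_add_left M hx (tame_of_hasSubst (hasSubst_miwa_X v)) hy]
  congr 1
  funext r
  congr 1
  exact schur_inv_nat_mul_pow (MvPowerSeries.X v) r

theorem momentPairing_add_miwa_right (M : ℕ → ℕ → ℝ) {x y : ℕ+ → MvPowerSeries τ ℝ}
    (hx : Tame x) (hy : Tame y) (v : τ) (k l : ℕ) :
    momentPairing M x (y + miwa (MvPowerSeries.X v)) k l =
      fsum fun r => MvPowerSeries.X v ^ r * momentPairing M x y k (l + r) := by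
  rw [momentPairing_swap, momentPairing_add_miwa_left _ hy hx]
  congr 1
  funext r
  rw [momentPairing_swap M x y]

end Substitution

theorem fsum_pow_mul_succ (q : ℕ → MvPowerSeries BVar ℝ) :
    (fsum fun r => MvPowerSeries.X BVar.w ^ r * q r) =
      q 0 + MvPowerSeries.X BVar.w * fsum fun r => MvPowerSeries.X BVar.w ^ r * q (r + 1) := by
  rw [fsum_mul_left (locallyFinite_pow_mul fun r => q (r + 1))]
  ext m
  rw [coeff_fsum, map_add, coeff_fsum]
  have h := locallyFinite_pow_mul q m
  have h' : (Function.support fun r => MvPowerSeries.coeff m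
      (MvPowerSeries.X BVar.w ^ (r + 1) * q (r + 1))).Finite :=
    (locallyFinite_pow_mul q).comp (add_left_injective 1) m
  rw [← tsum_eq_finsum (L := SummationFilter.unconditional _) h,
    (summable_of_hasFiniteSupport h).tsum_eq_zero_add]
  beta_reduce
  rw [pow_zero, one_mul]
  congr 1
  rw [tsum_eq_finsum (L := SummationFilter.unconditional _) h']
  refine finsum_congr fun r => ?_
  rw [pow_succ', mul_assoc]

/-- Both sides of the bilinear identity equal `∑_{i, j} P_i Q_j μ_{ij}(t, s')`, where
`P_i`, `Q_j` are the coefficients of the (unnormalized) biorthogonal polynomials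
`z^n τ_n(t - [z⁻¹], s)` and `z^m τ_m(t', s' + [z⁻¹])`. -/
theorem isTwoTodaTauVector_det (M : ℕ → ℕ → ℝ) :
    IsTwoTodaTauVector fun n =>
      (Matrix.of fun i j : Fin n => formalMoment M i j).det := by
  have ht := hasSubst_X_comp (ι := BVar.t) fun _ _ h => BVar.t.inj h
  have hs := hasSubst_X_comp (ι := BVar.s) fun _ _ h => BVar.s.inj h
  have ht' := hasSubst_X_comp (ι := BVar.t') fun _ _ h => BVar.t'.inj h
  have hs' := hasSubst_X_comp (ι := BVar.s') fun _ _ h => BVar.s'.inj h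
  have hW := hasSubst_miwa_X (τ := BVar) BVar.w
  refine ⟨by simp, fun n m => ?_⟩
  have heval : ∀ (n : ℕ) {x y : ℕ+ → MvPowerSeries BVar ℝ}, MvPowerSeries.HasSubst x →
      MvPowerSeries.HasSubst y →
      evalTimes (Matrix.of fun i j : Fin n => formalMoment M i j).det x y =
        (Matrix.of fun i j : Fin n => momentPairing M x (-y) i j).det := by
    intro n x y hx hy
    rw [evalTimes, det_subst (hasSubst_sumElim hx hy)]
    simp only [Matrix.of_apply, formalMoment_subst M hx hy]
  set t : ℕ+ → MvPowerSeries BVar ℝ := fun i => MvPowerSeries.X (BVar.t i) with htdef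
  set s : ℕ+ → MvPowerSeries BVar ℝ := fun i => MvPowerSeries.X (BVar.s i) with hsdef
  set t' : ℕ+ → MvPowerSeries BVar ℝ := fun i => MvPowerSeries.X (BVar.t' i) with htdef'
  set s' : ℕ+ → MvPowerSeries BVar ℝ := fun i => MvPowerSeries.X (BVar.s' i) with hsdef'
  set W : ℕ+ → MvPowerSeries BVar ℝ := miwa (MvPowerSeries.X BVar.w) with hWdef
  set w : MvPowerSeries BVar ℝ := MvPowerSeries.X BVar.w with hw
  have ft : ∀ i, t i ∈ freeOfW := fun i => X_mem_freeOfW (by simp)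
  have fs : ∀ i, (-s) i ∈ freeOfW := fun i => Subalgebra.neg_mem _ (X_mem_freeOfW (by simp))
  have ft' : ∀ i, t' i ∈ freeOfW := fun i => X_mem_freeOfW (by simp)
  have fs' : ∀ i, (-s') i ∈ freeOfW := fun i => Subalgebra.neg_mem _ (X_mem_freeOfW (by simp))
  have Tt := tame_of_hasSubst ht
  have Ts := tame_of_hasSubst (hasSubst_neg hs)
  have Tt' := tame_of_hasSubst ht'
  have Ts' := tame_of_hasSubst (hasSubst_neg hs')
  set μ : ℕ → ℕ → MvPowerSeries BVar ℝ := momentPairing M t (-s) with hμ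
  set μ' : ℕ → ℕ → MvPowerSeries BVar ℝ := momentPairing M t' (-s') with hμ'
  have sl : ∀ k l, momentPairing M (t - W) (-s) k l = μ k l - w * μ (k + 1) l :=
    momentPairing_sub_miwa_left M Tt Ts BVar.w
  have sr : ∀ k l, momentPairing M t' (-s' - W) k l = μ' k l - w * μ' k (l + 1) :=
    momentPairing_sub_miwa_right M Tt' Ts' BVar.w
  have al : ∀ k l, momentPairing M (t' + W) (-s') k l = fsum fun r => w ^ r * μ' (k + r) l :=
    momentPairing_add_miwa_left M Tt' Ts' BVar.w
  have ar : ∀ k l, momentPairing M t (-s + W) k l = fsum fun r => w ^ r * μ k (l + r) :=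
    momentPairing_add_miwa_right M Tt Ts BVar.w
  have hLF : ∀ q : ℕ → MvPowerSeries BVar ℝ, LocallyFinite fun k => w ^ k * q k :=
    locallyFinite_pow_mul
  have hpeel : ∀ q : ℕ → MvPowerSeries BVar ℝ,
      (fsum fun r => w ^ r * q r) = q 0 + w * fsum fun r => w ^ r * q (r + 1) := fsum_pow_mul_succ
  have fμ : ∀ i j, μ i j ∈ freeOfW := momentPairing_mem_freeOfW M ft fs
  have fμ' : ∀ i j, μ' i j ∈ freeOfW := momentPairing_mem_freeOfW M ft' fs'
  set P : Fin (n + 1) → MvPowerSeries BVar ℝ := cofactorLast (fun i j => μ j i) n with hP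
  set Q : Fin (m + 1) → MvPowerSeries BVar ℝ := cofactorLast μ' m with hQ
  have fP : ∀ i, P i ∈ freeOfW := fun i => Subalgebra.mul_mem _
    (Subalgebra.pow_mem _ (Subalgebra.neg_mem _ (Subalgebra.one_mem _)) _)
    (det_mem_freeOfW fun _ _ => fμ _ _)
  have fQ : ∀ i, Q i ∈ freeOfW := fun i => Subalgebra.mul_mem _
    (Subalgebra.pow_mem _ (Subalgebra.neg_mem _ (Subalgebra.one_mem _)) _)
    (det_mem_freeOfW fun _ _ => fμ' _ _)
  have e1 : evalTimes (Matrix.of fun i j : Fin n => formalMoment M i j).det (t - W) s =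
      ∑ i : Fin (n + 1), w ^ (n - i : ℕ) * P i := by
    rw [heval n (hasSubst_sub ht hW) hs, hP, ← det_sub_mul_eq_sum_cofactorLast,
      ← Matrix.det_transpose]
    simp only [sl]
    rfl
  have e2 : evalTimes (Matrix.of fun i j : Fin (m + 1) => formalMoment M i j).det (t' + W) s' =
      fsum fun k => w ^ k * ∑ j, Q j * μ' (m + k) j := by
    rw [heval (m + 1) (ht'.add hW) hs', det_eq_sum_cofactorLast_mul μ'
      (momentPairing M (t' + W) (-s')) w]
    · simp only [al, Finset.mul_sum]
      rw [fsum_finsetSum]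
      · refine Finset.sum_congr rfl fun j _ => ?_
        rw [fsum_mul_left (hLF fun r => μ' (m + r) j)]
        congr 1
        funext r
        rw [hQ, mul_left_comm]
      · intro j _
        exact hLF fun r => Q j * μ' (m + r) j
    · intro i j
      rw [al, al, hpeel fun r => μ' (i + r) j]
      simp only [add_zero, add_assoc, add_comm 1]
  have e3 : evalTimes (Matrix.of fun i j : Fin (n + 1) => formalMoment M i j).det t (s - W) =
      fsum fun k => w ^ k * ∑ i, P i * μ i (n + k) := by
    rw [heval (n + 1) ht (hasSubst_sub hs hW), ← Matrix.det_transpose]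
    change (Matrix.of fun i j : Fin (n + 1) => momentPairing M t (-(s - W)) j i).det = _
    rw [neg_sub, sub_eq_add_neg, add_comm W, det_eq_sum_cofactorLast_mul (fun i j => μ j i)
      (fun i j => momentPairing M t (-s + W) j i) w]
    · simp only [ar, Finset.mul_sum]
      rw [fsum_finsetSum]
      · refine Finset.sum_congr rfl fun j _ => ?_
        rw [fsum_mul_left (hLF fun r => μ j (n + r))]
        congr 1
        funext r
        rw [hP, mul_left_comm]
      · intro j _
        exact hLF fun r => P j * μ j (n + r)
    · intro i j
      simp only [ar]
      rw [hpeel fun r => μ j (i + r)]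
      simp only [add_zero, add_assoc, add_comm 1]
  have e4 : evalTimes (Matrix.of fun i j : Fin m => formalMoment M i j).det t' (s' + W) =
      ∑ j : Fin (m + 1), w ^ (m - j : ℕ) * Q j := by
    rw [heval m ht' (hs'.add hW), hQ, ← det_sub_mul_eq_sum_cofactorLast, neg_add, ← sub_eq_add_neg]
    simp only [sr]
  -- the moments at `(t, s')`, expanded around `(t', s')` and around `(t, s)`
  have hTts := tame_of_hasSubst (hasSubst_sub ht ht')
  have hTss := tame_of_hasSubst (hasSubst_sub hs hs')
  have m1 : ∀ i j, momentPairing M t (-s') i j = fsum fun c => schur (t - t') c * μ' (c + i) j := by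
    intro i j
    have := momentPairing_add_left M Tt' hTts Ts' i j
    rw [add_sub_cancel] at this
    rw [this]
    simp only [add_comm i, hμ']
  have m2 : ∀ i j, momentPairing M t (-s') i j = fsum fun c => schur (s - s') c * μ i (c + j) := by
    intro i j
    have := momentPairing_add_right M Tt Ts hTss i j
    rw [neg_add_eq_sub, sub_sub_cancel_left] at this
    rw [this]
    simp only [add_comm j, hμ]
  have r1 := resPair_eq_sum (n := n) (m := m) (P := P) (q := fun e => ∑ j, Q j * μ' e j)
    (B := schur (t - t')) fP (fun e => Subalgebra.sum_mem _ fun j _ =>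
      Subalgebra.mul_mem _ (fQ _) (fμ' _ _)) (fun e he => sum_cofactorLast_mul_row μ' he) hTts
  have r2 := resPair_eq_sum (n := m) (m := n) (P := Q) (q := fun e => ∑ i, P i * μ i e)
    (B := schur (s - s')) fQ (fun e => Subalgebra.sum_mem _ fun j _ =>
      Subalgebra.mul_mem _ (fP _) (fμ _ _))
      (fun e he => sum_cofactorLast_mul_row (fun i j => μ j i) he) hTss
  simp only [e1, e2, e3, e4]
  refine r1.trans (Eq.trans ?_ (r2.symm.trans ?_))
  · have h1 : ∀ i : Fin (n + 1), (fsum fun c => schur (t - t') c * ∑ j, Q j * μ' (c + i) j) =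
        ∑ j, Q j * momentPairing M t (-s') i j := by
      intro i
      simp only [Finset.mul_sum, mul_left_comm _ (Q _)]
      rw [fsum_finsetSum]
      · refine Finset.sum_congr rfl fun j _ => ?_
        rw [m1, fsum_mul_left (LocallyFinite.mul_apply hTts _)]
      · exact fun j _ => (LocallyFinite.mul_apply hTts _).mul_left _
    have h2 : ∀ j : Fin (m + 1), (fsum fun c => schur (s - s') c * ∑ i, P i * μ i (c + j)) =
        ∑ i, P i * momentPairing M t (-s') i j := by
      intro j
      simp only [Finset.mul_sum, mul_left_comm _ (P _)]
      rw [fsum_finsetSum]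
      · refine Finset.sum_congr rfl fun i _ => ?_
        rw [m2, fsum_mul_left (LocallyFinite.mul_apply hTss _)]
      · exact fun j _ => (LocallyFinite.mul_apply hTss _).mul_left _
    simp only [h1, h2]
    simp only [Finset.mul_sum]
    rw [Finset.sum_comm]
    exact Finset.sum_congr rfl fun j _ => Finset.sum_congr rfl fun i _ => mul_left_comm _ _ _
  · congr 1
    funext a
    rw [mul_comm]

end Toda

/-! ### Pfaffians -/

section Pfaffian

set_option linter.unusedSectionVars false

open Equiv

variable {R : Type*} [CommRing R] [Algebra ℝ R]

/-- The two members `2 i`, `2 i + 1` of the pairs as an enumeration of `Fin (2 n)`. -/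
def pairEquiv (n : ℕ) : Fin n × Fin 2 ≃ Fin (2 * n) :=
  finProdFinEquiv.trans (finCongr (mul_comm n 2))

theorem pairEquiv_zero {n : ℕ} (i : Fin n) : pairEquiv n (i, 0) = ⟨2 * i, by omega⟩ := by
  ext; simp [pairEquiv, finProdFinEquiv]

theorem pairEquiv_one {n : ℕ} (i : Fin n) : pairEquiv n (i, 1) = ⟨2 * i + 1, by omega⟩ := by
  ext; simp [pairEquiv, finProdFinEquiv, add_comm]

/-- The term of the permutation `σ` in the Pfaffian. -/
def pfTerm {n : ℕ} (A : Matrix (Fin (2 * n)) (Fin (2 * n)) R) (σ : Perm (Fin (2 * n))) : R :=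
  ((Perm.sign σ : ℤ) : R) * ∏ i : Fin n, A (σ (pairEquiv n (i, 0))) (σ (pairEquiv n (i, 1)))

theorem pfaffian_eq_sum_pfTerm {n : ℕ} (A : Matrix (Fin (2 * n)) (Fin (2 * n)) R) :
    pfaffian A = (1 / (2 ^ n * (n.factorial : ℝ))) • ∑ σ, pfTerm A σ := by
  simp only [pfaffian, pfTerm, pairEquiv_zero, pairEquiv_one]

theorem pfTerm_mul_swap {n : ℕ} {A : Matrix (Fin (2 * n)) (Fin (2 * n)) R}
    (hA : ∀ i j, A i j = -A j i) (σ : Perm (Fin (2 * n))) (i : Fin n) :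
    pfTerm A (σ * swap (pairEquiv n (i, 0)) (pairEquiv n (i, 1))) = pfTerm A σ := by
  have hne : pairEquiv n (i, 0) ≠ pairEquiv n (i, 1) := by simp
  have hprod : ∏ j : Fin n, A ((σ * swap (pairEquiv n (i, 0)) (pairEquiv n (i, 1)))
        (pairEquiv n (j, 0)))
      ((σ * swap (pairEquiv n (i, 0)) (pairEquiv n (i, 1))) (pairEquiv n (j, 1))) =
      -∏ j : Fin n, A (σ (pairEquiv n (j, 0))) (σ (pairEquiv n (j, 1))) := by
    rw [← Finset.mul_prod_erase _ _ (Finset.mem_univ i),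
      ← Finset.mul_prod_erase _ (fun j => A (σ (pairEquiv n (j, 0))) (σ (pairEquiv n (j, 1))))
        (Finset.mem_univ i), ← neg_mul]
    congr 1
    · rw [Perm.mul_apply, Perm.mul_apply, swap_apply_left, swap_apply_right]
      exact hA _ _
    · refine Finset.prod_congr rfl fun j hj => ?_
      have hji : j ≠ i := Finset.ne_of_mem_erase hj
      rw [Perm.mul_apply, Perm.mul_apply, swap_apply_of_ne_of_ne, swap_apply_of_ne_of_ne] <;>
        simp [hji]
  rw [pfTerm, hprod, pfTerm, Perm.sign_mul, Perm.sign_swap hne]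
  simp

theorem pfTerm_mul_pairPerm {n : ℕ} (A : Matrix (Fin (2 * n)) (Fin (2 * n)) R)
    (σ : Perm (Fin (2 * n))) (ρ : Perm (Fin n)) :
    pfTerm A (σ * (pairEquiv n).permCongr (prodCongrLeft fun _ => ρ)) = pfTerm A σ := by
  have hsign : Perm.sign ((pairEquiv n).permCongr (prodCongrLeft fun _ : Fin 2 => ρ)) = 1 := by
    rw [Perm.sign_permCongr, Perm.sign_prodCongrLeft]
    simp [Int.units_sq]
  rw [pfTerm, Perm.sign_mul, hsign, mul_one, pfTerm]
  congr 1
  refine Equiv.prod_comp ρ (fun j => A (σ (pairEquiv n (j, 0))) (σ (pairEquiv n (j, 1)))) ▸ ?_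
  refine Finset.prod_congr rfl fun j _ => ?_
  simp [Equiv.permCongr_apply]

/-- The symmetries of the matching act transitively on the indices; this reduces the sum over all
permutations to those that fix `0`. -/
theorem exists_pfTerm_mul_eq {n : ℕ} {A : Matrix (Fin (2 * (n + 1))) (Fin (2 * (n + 1))) R}
    (hA : ∀ i j, A i j = -A j i) (p : Fin (2 * (n + 1))) :
    ∃ π : Perm (Fin (2 * (n + 1))), π 0 = p ∧ ∀ σ, pfTerm A (σ * π) = pfTerm A σ := by
  obtain ⟨⟨i, b⟩, rfl⟩ := (pairEquiv (n + 1)).surjective p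
  have h0 : (0 : Fin (2 * (n + 1))) = pairEquiv (n + 1) (0, 0) := by
    rw [pairEquiv_zero]; rfl
  have hπ : ((pairEquiv (n + 1)).permCongr (prodCongrLeft fun _ => swap 0 i)) 0 =
      pairEquiv (n + 1) (i, 0) := by
    rw [h0]
    simp [Equiv.permCongr_apply]
  fin_cases b
  · exact ⟨_, hπ, fun σ => pfTerm_mul_pairPerm A σ _⟩
  · refine ⟨swap (pairEquiv _ (i, 0)) (pairEquiv _ (i, 1)) *
      (pairEquiv (n + 1)).permCongr (prodCongrLeft fun _ => swap 0 i), ?_, fun σ => ?_⟩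
    · rw [Perm.mul_apply, hπ, swap_apply_left]
      rfl
    · rw [← mul_assoc, pfTerm_mul_pairPerm, pfTerm_mul_swap hA]

theorem sum_perm_fix_zero {m : ℕ} {S : Type*} [AddCommMonoid S] (F : Perm (Fin (m + 1)) → S) :
    ∑ σ with σ 0 = 0, F σ = ∑ e : Perm (Fin m), F (Perm.decomposeFin.symm (0, e)) := by
  symm
  refine Finset.sum_bij (fun e _ => Perm.decomposeFin.symm (0, e)) ?_ ?_ ?_ fun _ _ => rfl
  · intro e _
    simp
  · intro e _ e' _ h
    simpa using Perm.decomposeFin.symm.injective h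
  · intro σ hσ
    refine ⟨(Perm.decomposeFin σ).2, Finset.mem_univ _, ?_⟩
    have hσ : σ 0 = 0 := by simpa using hσ
    have h := Perm.decomposeFin_symm_apply_zero (Perm.decomposeFin σ).1 (Perm.decomposeFin σ).2
    rw [Prod.mk.eta, symm_apply_apply, hσ] at h
    rw [h, Prod.mk.eta, symm_apply_apply]

theorem sum_perm_eq_sum_image {m : ℕ} {S : Type*} [AddCommMonoid S] (F : Perm (Fin (m + 1)) → S) :
    ∑ σ, F σ = ∑ j : Fin (m + 1), ∑ e : Perm (Fin m),
      F (j.cycleRange.symm * Perm.decomposeFin.symm (0, e)) := by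
  rw [← Finset.sum_fiberwise_of_maps_to (g := fun σ : Perm (Fin (m + 1)) => σ 0)
    (t := Finset.univ) fun _ _ => Finset.mem_univ _]
  refine Finset.sum_congr rfl fun j _ => ?_
  rw [← sum_perm_fix_zero fun σ => F (j.cycleRange.symm * σ)]
  symm
  refine Finset.sum_equiv (Equiv.mulLeft j.cycleRange.symm) (fun σ => ?_) fun σ _ => rfl
  simp only [Finset.mem_filter, Finset.mem_univ, true_and, coe_mulLeft, Perm.mul_apply]
  rw [symm_apply_eq, Fin.cycleRange_self]

/-- Expansion of the Pfaffian along the first row. -/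
theorem pfaffian_succ {n : ℕ} {A : Matrix (Fin (2 * (n + 1))) (Fin (2 * (n + 1))) R}
    (hA : ∀ i j, A i j = -A j i) :
    pfaffian A = ∑ j : Fin (2 * n + 1), (-1) ^ (j : ℕ) * A 0 j.succ *
      pfaffian (Matrix.of fun a b : Fin (2 * n) => A (j.succAbove a).succ (j.succAbove b).succ) := by
  have h1 : ∑ σ, pfTerm A σ = ((2 * (n + 1) : ℕ) : ℝ) •
      ∑ σ : Perm (Fin (2 * n + 1 + 1)) with σ 0 = 0, pfTerm (n := n + 1) A σ := by
    rw [← Equiv.sum_comp (Equiv.inv (Perm (Fin (2 * (n + 1))))),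
      ← Finset.sum_fiberwise_of_maps_to (g := fun σ : Perm (Fin (2 * (n + 1))) => σ 0)
      (t := Finset.univ) fun _ _ => Finset.mem_univ _]
    rw [Finset.sum_congr rfl (g := fun _ =>
      ∑ σ : Perm (Fin (2 * n + 1 + 1)) with σ 0 = 0, pfTerm (n := n + 1) A σ)]
    · rw [Finset.sum_const, Finset.card_univ, Fintype.card_fin, Nat.cast_smul_eq_nsmul]
    · intro p _
      obtain ⟨π, hπ0, hπ⟩ := exists_pfTerm_mul_eq hA p
      refine Finset.sum_equiv ((Equiv.inv _).trans (Equiv.mulRight π)) (fun σ => ?_) fun σ _ => ?_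
      · simp only [Finset.mem_filter, Finset.mem_univ, true_and, Equiv.trans_apply, Equiv.inv_apply,
          coe_mulRight]
        change σ 0 = p ↔ σ⁻¹ (π 0) = 0
        rw [hπ0, Perm.inv_eq_iff_eq, eq_comm]
      · exact (hπ _).symm
  have h2 : ∑ σ : Perm (Fin (2 * n + 1 + 1)) with σ 0 = 0, pfTerm (n := n + 1) A σ =
      ∑ j : Fin (2 * n + 1), (-1) ^ (j : ℕ) * A 0 j.succ * ∑ e, pfTerm
        (Matrix.of fun a b : Fin (2 * n) => A (j.succAbove a).succ (j.succAbove b).succ) e := by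
    rw [sum_perm_fix_zero, sum_perm_eq_sum_image]
    refine Finset.sum_congr rfl fun j _ => ?_
    rw [Finset.mul_sum]
    refine Finset.sum_congr rfl fun e _ => ?_
    set σ : Perm (Fin (2 * n + 1 + 1)) := Perm.decomposeFin.symm
      (0, j.cycleRange.symm * Perm.decomposeFin.symm (0, e)) with hσ
    have hσ0 : σ 0 = 0 := by rw [hσ, Perm.decomposeFin_symm_apply_zero]
    have hσ1 : σ 1 = j.succ := by
      rw [hσ, ← Fin.succ_zero_eq_one, Perm.decomposeFin_symm_apply_succ]
      simp
    have hσ2 : ∀ x : Fin (2 * n), σ x.succ.succ = (j.succAbove (e x)).succ := by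
      intro x
      rw [hσ, Perm.decomposeFin_symm_apply_succ]
      simp
    have hsign : Perm.sign σ = (-1) ^ (j : ℕ) * Perm.sign e := by
      rw [hσ, Perm.decomposeFin.symm_sign, if_pos rfl, one_mul, Perm.sign_mul,
        Perm.decomposeFin.symm_sign, if_pos rfl, one_mul, Perm.sign_symm, Fin.sign_cycleRange]
    have hp0 : pairEquiv (n + 1) (0, 0) = (0 : Fin (2 * n + 1 + 1)) := by
      rw [pairEquiv_zero]; rfl
    have hp1 : pairEquiv (n + 1) (0, 1) = (1 : Fin (2 * n + 1 + 1)) := by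
      rw [pairEquiv_one]; rfl
    have hps : ∀ (i : Fin n) (b : Fin 2), pairEquiv (n + 1) (i.succ, b) =
        ((pairEquiv n (i, b)).succ.succ : Fin (2 * n + 1 + 1)) := by
      intro i b
      ext
      simp [pairEquiv, finProdFinEquiv]
      ring
    have hprod : ∏ i : Fin (n + 1), A (σ (pairEquiv (n + 1) (i, 0)))
        (σ (pairEquiv (n + 1) (i, 1))) = A 0 j.succ * ∏ i : Fin n,
          A (j.succAbove (e (pairEquiv n (i, 0)))).succ
            (j.succAbove (e (pairEquiv n (i, 1)))).succ := by
      rw [Fin.prod_univ_succ, hp0, hp1, hσ0, hσ1]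
      congr 1
      refine Finset.prod_congr rfl fun i _ => ?_
      rw [hps, hps, hσ2, hσ2]
    rw [pfTerm, pfTerm]
    refine (congrArg₂ (· * ·) (congrArg (fun z : ℤˣ => ((z : ℤ) : R)) hsign) hprod).trans ?_
    simp only [Matrix.of_apply]
    push_cast
    ring
  rw [pfaffian_eq_sum_pfTerm, h1, h2]
  simp only [pfaffian_eq_sum_pfTerm]
  rw [smul_smul, Finset.smul_sum]
  refine Finset.sum_congr rfl fun j _ => ?_
  rw [mul_smul_comm]
  congr 1
  rw [Nat.factorial_succ, pow_succ]
  push_cast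
  have : (n.factorial : ℝ) ≠ 0 := by positivity
  have : (n : ℝ) + 1 ≠ 0 := by positivity
  field_simp

end Pfaffian

/-! ### Pfaffians of Gram matrices -/

section GramPfaffian

set_option linter.unusedSectionVars false

open Equiv Matrix

variable {R M : Type*} [CommRing R] [Algebra ℝ R] [AddCommGroup M] [Module R M]

/-- The Pfaffian of the Gram matrix of a family of vectors. -/
def gramPf (B : M →ₗ[R] M →ₗ[R] R) {n : ℕ} (v : Fin (2 * n) → M) : R :=
  pfaffian (Matrix.of fun i j => B (v i) (v j))

theorem prod_pair_update (B : M →ₗ[R] M →ₗ[R] R) {n : ℕ} (v : Fin (2 * n) → M) (i : Fin n)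
    (b : Fin 2) (z : M) :
    ∏ j : Fin n, B (Function.update v (pairEquiv n (i, b)) z (pairEquiv n (j, 0)))
        (Function.update v (pairEquiv n (i, b)) z (pairEquiv n (j, 1))) =
      (if b = 0 then B z (v (pairEquiv n (i, 1))) else B (v (pairEquiv n (i, 0))) z) *
        ∏ j ∈ Finset.univ.erase i, B (v (pairEquiv n (j, 0))) (v (pairEquiv n (j, 1))) := by
  rw [← Finset.mul_prod_erase _ _ (Finset.mem_univ i)]
  congr 1
  · fin_cases b <;> simp
  · refine Finset.prod_congr rfl fun j hj => ?_
    have hji : j ≠ i := Finset.ne_of_mem_erase hj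
    rw [Function.update_of_ne (by simp [hji]), Function.update_of_ne (by simp [hji])]

/-- The multilinear map `v ↦ ∏ B(v_{2i}, v_{2i+1})`. -/
def pairMultilinear (B : M →ₗ[R] M →ₗ[R] R) (n : ℕ) :
    MultilinearMap R (fun _ : Fin (2 * n) => M) R where
  toFun v := ∏ i : Fin n, B (v (pairEquiv n (i, 0))) (v (pairEquiv n (i, 1)))
  map_update_add' := by
    intro d v k x y
    obtain ⟨⟨i, b⟩, rfl⟩ := (pairEquiv n).surjective k
    have h := prod_pair_update B v i b
    rw [Subsingleton.elim d (instDecidableEqFin (2 * n)), h, h, h, ← add_mul]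
    split_ifs <;> simp
  map_update_smul' := by
    intro d v k c x
    obtain ⟨⟨i, b⟩, rfl⟩ := (pairEquiv n).surjective k
    have h := prod_pair_update B v i b
    rw [Subsingleton.elim d (instDecidableEqFin (2 * n)), h, h]
    split_ifs <;> simp [mul_assoc]

theorem gramPf_eq_alternatization (B : M →ₗ[R] M →ₗ[R] R) {n : ℕ} (v : Fin (2 * n) → M) :
    gramPf B v = ((1 / (2 ^ n * (n.factorial : ℝ))) •
      (MultilinearMap.alternatization (pairMultilinear B n))) v := by
  rw [gramPf, pfaffian_eq_sum_pfTerm, AlternatingMap.smul_apply,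
    MultilinearMap.alternatization_apply]
  congr 1
  refine Finset.sum_congr rfl fun σ _ => ?_
  rw [pfTerm, Units.smul_def, zsmul_eq_mul]
  rfl

/-- The Pfaffian of the Gram matrix as an alternating map. -/
def gramPfForm (B : M →ₗ[R] M →ₗ[R] R) (n : ℕ) : M [⋀^Fin (2 * n)]→ₗ[R] R :=
  (1 / (2 ^ n * (n.factorial : ℝ))) • (MultilinearMap.alternatization (pairMultilinear B n))

theorem gramPfForm_apply (B : M →ₗ[R] M →ₗ[R] R) {n : ℕ} (v : Fin (2 * n) → M) :
    gramPfForm B n v = gramPf B v := (gramPf_eq_alternatization B v).symm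

theorem gramPf_zero (B : M →ₗ[R] M →ₗ[R] R) (v : Fin (2 * 0) → M) : gramPf B v = 1 := by
  simp [gramPf, pfaffian]

/-- Expansion along the first vector. -/
theorem gramPf_vecCons {B : M →ₗ[R] M →ₗ[R] R} (hB : ∀ x y, B x y = -B y x) {n : ℕ} (a : M)
    (w : Fin (2 * n + 1) → M) :
    gramPf (n := n + 1) B (vecCons a w) =
      ∑ j : Fin (2 * n + 1), (-1) ^ (j : ℕ) * B a (w j) * gramPf B (w ∘ j.succAbove) := by
  rw [gramPf, pfaffian_succ fun i j => by simpa using hB _ _]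
  rfl

theorem vecCons_comp_succAbove_succ {n : ℕ} (a : M) (w : Fin (n + 1) → M) (j : Fin (n + 1)) :
    (vecCons a w) ∘ (j.succ).succAbove = vecCons a (w ∘ j.succAbove) := by
  funext i
  refine Fin.cases ?_ (fun i => ?_) i
  · simp
  · simp

theorem vecCons_comp_succAbove_zero {n : ℕ} (a : M) (w : Fin n → M) :
    (vecCons a w) ∘ (0 : Fin (n + 1)).succAbove = w := by
  funext i
  simp

theorem gramPf_vecCons_of_perp {B : M →ₗ[R] M →ₗ[R] R} (hB : ∀ x y, B x y = -B y x) {n : ℕ}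
    {q : M} (a : M) {v : Fin (2 * n) → M} (hq : ∀ i, B q (v i) = 0) :
    gramPf (n := n + 1) B (vecCons q (vecCons a v)) = B q a * gramPf B v := by
  rw [gramPf_vecCons hB, Fin.sum_univ_succ, Finset.sum_eq_zero fun j _ => by simp [hq]]
  rw [vecCons_comp_succAbove_zero]
  simp

theorem gramPf_vecCons₃_of_perp {B : M →ₗ[R] M →ₗ[R] R} (hB : ∀ x y, B x y = -B y x) {n : ℕ}
    {q : M} (a b c : M) {v : Fin (2 * n) → M} (hq : ∀ i, B q (v i) = 0) :
    gramPf (n := n + 2) B (vecCons q (vecCons c (vecCons b (vecCons a v)))) =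
      B q c * gramPf (n := n + 1) B (vecCons b (vecCons a v)) -
      B q b * gramPf (n := n + 1) B (vecCons c (vecCons a v)) +
      B q a * gramPf (n := n + 1) B (vecCons c (vecCons b v)) := by
  have h := gramPf_vecCons (n := n + 1) hB q (vecCons c (vecCons b (vecCons a v)))
  refine h.trans ?_
  erw [Fin.sum_univ_succ, Fin.sum_univ_succ, Fin.sum_univ_succ]
  rw [Finset.sum_eq_zero fun j _ => by simp [hq]]
  rw [vecCons_comp_succAbove_zero, vecCons_comp_succAbove_succ, vecCons_comp_succAbove_succ,
    vecCons_comp_succAbove_succ, vecCons_comp_succAbove_zero, vecCons_comp_succAbove_zero]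
  have h1 : 1 % (2 * (n + 1) + 1) = 1 := Nat.mod_eq_of_lt (by omega)
  have h2 : 2 % (2 * (n + 1) + 1) = 2 := Nat.mod_eq_of_lt (by omega)
  simp [h1, h2]
  ring

/-! ### Alternating maps and unipotent changes of basis -/

theorem map_vecCons_eq_zero_of_mem_span {n : ℕ} (f : M [⋀^Fin (n + 1)]→ₗ[R] R) {v : Fin n → M}
    {y : M} (hy : y ∈ Submodule.span R (Set.range v)) : f (vecCons y v) = 0 := by
  induction hy using Submodule.span_induction with
  | mem x hx =>
    obtain ⟨i, rfl⟩ := hx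
    exact f.map_eq_zero_of_eq _ (i := 0) (j := i.succ) (by simp) (Fin.succ_ne_zero i).symm
  | zero => exact f.map_coord_zero 0 (by simp)
  | add x y _ _ hx hy => rw [f.map_vecCons_add, hx, hy, add_zero]
  | smul c x _ hx => rw [f.map_vecCons_smul, hx, smul_zero]

theorem map_vecCons_add_of_mem_span {n : ℕ} (f : M [⋀^Fin (n + 1)]→ₗ[R] R) {v : Fin n → M}
    (a : M) {y : M} (hy : y ∈ Submodule.span R (Set.range v)) :
    f (vecCons (a + y) v) = f (vecCons a v) := by
  rw [f.map_vecCons_add, map_vecCons_eq_zero_of_mem_span f hy, add_zero]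

theorem span_range_le_vecCons {n : ℕ} (a : M) (v : Fin n → M) :
    Submodule.span R (Set.range v) ≤ Submodule.span R (Set.range (vecCons a v)) :=
  Submodule.span_mono (by rintro _ ⟨i, rfl⟩; exact ⟨i.succ, by simp⟩)

theorem map_vecCons₂_add_of_mem_span {n : ℕ} (f : M [⋀^Fin (n + 2)]→ₗ[R] R) {v : Fin n → M}
    (a b : M) {y z : M} (hy : y ∈ Submodule.span R (Set.range v))
    (hz : z ∈ Submodule.span R (Set.range v)) :
    f (vecCons (a + y) (vecCons (b + z) v)) = f (vecCons a (vecCons b v)) := by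
  rw [map_vecCons_add_of_mem_span f a (span_range_le_vecCons _ _ hy),
    ← AlternatingMap.curryLeft_apply_apply, map_vecCons_add_of_mem_span _ b hz]
  rfl

/-- Adding multiples of the vector in front to the next one does not change an alternating map. -/
theorem map_vecCons_vecCons_add_smul {n : ℕ} (f : M [⋀^Fin (n + 2)]→ₗ[R] R) {v : Fin n → M}
    (a b : M) (c : R) :
    f (vecCons a (vecCons (b + c • a) v)) = f (vecCons a (vecCons b v)) := by
  rw [← AlternatingMap.curryLeft_apply_apply, AlternatingMap.map_vecCons_add,
    AlternatingMap.map_vecCons_smul, AlternatingMap.curryLeft_apply_apply,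
    AlternatingMap.curryLeft_apply_apply]
  rw [f.map_eq_zero_of_eq (vecCons a (vecCons a v)) (i := 0) (j := 1) (by simp) (by simp)]
  simp

/-- The vectors `x_{N-1}, …, x_1, x_0`. -/
def desc (x : ℕ → M) (N : ℕ) (i : Fin N) : M := x (N - 1 - i)

theorem desc_succ (x : ℕ → M) (N : ℕ) : desc x (N + 1) = vecCons (x N) (desc x N) := by
  funext i
  refine Fin.cases ?_ (fun i => ?_) i
  · simp [desc]
  · simp only [desc, cons_val_succ, Fin.val_succ]
    congr 1
    omega

/-- The change of basis from `x_i` to `x_i - u x_{i+1}` is unipotent as long as the last vector is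
kept. -/
theorem map_vecCons_desc_sub_smul (x : ℕ → M) (u : R) (N : ℕ) :
    ∀ f : M [⋀^Fin (N + 1)]→ₗ[R] R,
      f (vecCons (x N) (desc (fun i => x i - u • x (i + 1)) N)) =
        f (vecCons (x N) (desc x N)) := by
  induction N with
  | zero => 
    intro f
    congr 2
    funext i
    exact i.elim0
  | succ N ih =>
    intro f
    rw [desc_succ, desc_succ, sub_eq_add_neg, ← neg_smul, map_vecCons_vecCons_add_smul,
      ← AlternatingMap.curryLeft_apply_apply, ih]
    rfl

/-! ### The Plücker relation -/

/-- If the Pfaffian of `v` is invertible, then every vector is the sum of one in the span of `v`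
and one orthogonal to it; the coefficients are Pfaffians with one vector of `v` exchanged. -/
theorem exists_perp_of_isUnit_gramPf {B : M →ₗ[R] M →ₗ[R] R} (hB : ∀ x y, B x y = -B y x) {n : ℕ}
    {v : Fin (2 * n) → M} (hv : IsUnit (gramPf B v)) (a : M) :
    ∃ z ∈ Submodule.span R (Set.range v), ∀ i, B (a + z) (v i) = 0 := by
  obtain ⟨c, hc⟩ := hv.exists_left_inv
  let w : Fin (2 * n + 1) → M := vecCons a v
  let s : M := ∑ j : Fin (2 * n), ((-1) ^ (j.succ : ℕ) * gramPf B (w ∘ (j.succ).succAbove)) • v j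
  have hs : s ∈ Submodule.span R (Set.range v) :=
    Submodule.sum_mem _ fun j _ =>
      Submodule.smul_mem _ _ (Submodule.subset_span (Set.mem_range_self j))
  refine ⟨c • s, Submodule.smul_mem _ _ hs, fun i => ?_⟩
  have h : gramPf (n := n + 1) B (vecCons (v i) w) = 0 := by
    rw [← gramPfForm_apply]
    refine (gramPfForm B (n + 1)).map_eq_zero_of_eq _ (i := (0 : Fin (2 * n + 1 + 1)))
      (j := i.succ.succ) ?_ (Fin.succ_ne_zero _).symm
    simp [w]
  rw [gramPf_vecCons hB, Fin.sum_univ_succ] at h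
  have h0 : gramPf B (w ∘ (0 : Fin (2 * n + 1)).succAbove) = gramPf B v := by
    rw [vecCons_comp_succAbove_zero]
  have h1 : B (v i) s = ∑ j : Fin (2 * n),
      (-1) ^ (j.succ : ℕ) * B (v i) (w j.succ) * gramPf B (w ∘ (j.succ).succAbove) := by
    rw [map_sum]
    refine Finset.sum_congr rfl fun j _ => ?_
    simp only [map_smul, smul_eq_mul, w, cons_val_succ]
    ring
  rw [h0, ← h1] at h
  rw [hB, map_add, map_smul, smul_eq_mul]
  have h2 : B (v i) a * gramPf B v + B (v i) s = 0 := by simpa [w] using h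
  linear_combination (-c) * h2 + B (v i) a * hc

/-- The three-term Plücker relation: after correction by vectors in the span of `v`, all of `a`,
`b`, `c`, `d` are orthogonal to `v`, and both sides reduce to the Pfaffian of size four. -/
theorem gramPf_pluecker {B : M →ₗ[R] M →ₗ[R] R} (hB : ∀ x y, B x y = -B y x) {n : ℕ}
    {v : Fin (2 * n) → M} (hv : IsUnit (gramPf B v)) (a b c d : M) :
    gramPf B v * gramPf (n := n + 2) B (vecCons a (vecCons b (vecCons c (vecCons d v)))) =
      gramPf (n := n + 1) B (vecCons a (vecCons b v)) *
        gramPf (n := n + 1) B (vecCons c (vecCons d v)) -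
      gramPf (n := n + 1) B (vecCons a (vecCons c v)) *
        gramPf (n := n + 1) B (vecCons b (vecCons d v)) +
      gramPf (n := n + 1) B (vecCons a (vecCons d v)) *
        gramPf (n := n + 1) B (vecCons b (vecCons c v)) := by
  obtain ⟨z, hz, ha⟩ := exists_perp_of_isUnit_gramPf hB hv a
  obtain ⟨z', hz', hb⟩ := exists_perp_of_isUnit_gramPf hB hv b
  obtain ⟨z'', hz'', hc⟩ := exists_perp_of_isUnit_gramPf hB hv c
  obtain ⟨z''', hz''', hd⟩ := exists_perp_of_isUnit_gramPf hB hv d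
  have h2 : ∀ a b y z : M, y ∈ Submodule.span R (Set.range v) →
      z ∈ Submodule.span R (Set.range v) →
      gramPf (n := n + 1) B (vecCons a (vecCons b v)) =
        gramPf (n := n + 1) B (vecCons (a + y) (vecCons (b + z) v)) := fun a b y z hy hz => by
    rw [← gramPfForm_apply, ← gramPfForm_apply]
    exact (map_vecCons₂_add_of_mem_span (gramPfForm B (n + 1)) a b hy hz).symm
  have h4 : gramPf (n := n + 2) B (vecCons a (vecCons b (vecCons c (vecCons d v)))) =
      gramPf (n := n + 2) B
        (vecCons (a + z) (vecCons (b + z') (vecCons (c + z'') (vecCons (d + z''') v)))) := by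
    rw [← gramPfForm_apply, ← gramPfForm_apply]
    have hle := (span_range_le_vecCons (R := R) (d + z''') v).trans
      (span_range_le_vecCons (c + z'') _)
    have e1 := map_vecCons₂_add_of_mem_span (n := 2 * n + 2) (gramPfForm B (n + 2)) a b
      (hle hz) (hle hz')
    refine Eq.trans ?_ e1.symm
    have e2 := map_vecCons₂_add_of_mem_span (n := 2 * n)
      (((gramPfForm B (n + 2)).curryLeft (n := 2 * n + 3) a).curryLeft b) c d hz'' hz'''
    exact e2.symm
  rw [h4, h2 a b _ _ hz hz', h2 c d _ _ hz'' hz''', h2 a c _ _ hz hz'', h2 b d _ _ hz' hz''',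
    h2 a d _ _ hz hz''', h2 b c _ _ hz' hz'', gramPf_vecCons₃_of_perp hB _ _ _ ha,
    gramPf_vecCons_of_perp hB _ ha, gramPf_vecCons_of_perp hB _ ha, gramPf_vecCons_of_perp hB _ ha,
    gramPf_vecCons_of_perp hB _ hb, gramPf_vecCons_of_perp hB _ hb, gramPf_vecCons_of_perp hB _ hc]
  ring

/-! ### The square of a Pfaffian -/

/-- The determinant of `B(v_i, w_j)`, as an alternating map of `v`. -/
def pairingDet (B : M →ₗ[R] M →ₗ[R] R) {n : ℕ} (w : Fin n → M) : M [⋀^Fin n]→ₗ[R] R :=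
  (Matrix.detRowAlternating (n := Fin n) (R := R)).compLinearMap
    (LinearMap.pi fun j => B.flip (w j))

theorem pairingDet_apply (B : M →ₗ[R] M →ₗ[R] R) {n : ℕ} (v w : Fin n → M) :
    pairingDet B w v = (Matrix.of fun i j => B (v i) (w j)).det := rfl

/-- For a skew form the two families may be exchanged, as their number is even. -/
theorem pairingDet_comm {B : M →ₗ[R] M →ₗ[R] R} (hB : ∀ x y, B x y = -B y x) {n : ℕ}
    (v w : Fin (2 * n) → M) : pairingDet B w v = pairingDet B v w := by
  rw [pairingDet_apply, pairingDet_apply, ← Matrix.det_transpose]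
  have : (Matrix.of fun i j => B (v i) (w j))ᵀ = -(Matrix.of fun i j => B (w i) (v j)) := by
    ext i j
    simpa using hB _ _
  rw [this, Matrix.det_neg]
  simp

/-- The Gram matrix is block diagonal, with the block `((0, c), (-c, 0))`, `c = B(a, b)`. -/
theorem det_gram_vecCons₂_of_perp {B : M →ₗ[R] M →ₗ[R] R} (hB : ∀ x y, B x y = -B y x) {n : ℕ}
    {a b : M} {v : Fin n → M} (ha : ∀ i, B a (v i) = 0) (hb : ∀ i, B b (v i) = 0) :
    (Matrix.of fun i j => B (vecCons a (vecCons b v) i) (vecCons a (vecCons b v) j)).det =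
      B a b ^ 2 * (Matrix.of fun i j => B (v i) (v j)).det := by
  have h0 : ∀ x, B x x = 0 := fun x => by
    have h2 : (2 : ℝ) • B x x = 0 := by
      rw [two_smul]
      nth_rewrite 1 [hB x x]
      simp
    have h3 : ((1 / 2 : ℝ) * 2) • B x x = 0 := by rw [mul_smul, h2, smul_zero]
    simpa using h3
  rw [Matrix.det_succ_row_zero, Fin.sum_univ_succ, Fin.sum_univ_succ,
    Finset.sum_eq_zero fun j _ => by simp [ha]]
  have hsub : ((Matrix.of fun i j => B (vecCons a (vecCons b v) i)
      (vecCons a (vecCons b v) j)).submatrix Fin.succ (Fin.succAbove (Fin.succ 0))).submatrix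
        Fin.succ (Fin.succAbove 0) = Matrix.of fun i j => B (v i) (v j) := by
    ext i j
    simp [Fin.succAbove, Fin.lt_def]
  have hdet : ((Matrix.of fun i j => B (vecCons a (vecCons b v) i)
      (vecCons a (vecCons b v) j)).submatrix Fin.succ (Fin.succAbove (Fin.succ 0))).det =
      B b a * (Matrix.of fun i j => B (v i) (v j)).det := by
    rw [Matrix.det_succ_row_zero, Fin.sum_univ_succ, Finset.sum_eq_zero fun j _ => by
      simp [hb, Fin.succAbove, Fin.lt_def], hsub]
    simp
  rw [hdet, hB b a]
  simp [h0]
  ring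

/-- If all the Pfaffians of the initial segments are invertible, then the square of the Pfaffian
is the determinant. -/
theorem gramPf_desc_sq {B : M →ₗ[R] M →ₗ[R] R} (hB : ∀ x y, B x y = -B y x) (x : ℕ → M) (n : ℕ)
    (hx : ∀ m < n, IsUnit (gramPf B (desc x (2 * m)))) :
    gramPf B (desc x (2 * n)) ^ 2 =
      (Matrix.of fun i j => B (desc x (2 * n) i) (desc x (2 * n) j)).det := by
  induction n with
  | zero => simp [gramPf_zero]
  | succ n ih =>
    have ih := ih fun m hm => hx m (by omega)
    have hv := hx n (by omega)
    set v := desc x (2 * n) with hvdef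
    obtain ⟨z, hz, ha⟩ := exists_perp_of_isUnit_gramPf hB hv (x (2 * n + 1))
    obtain ⟨z', hz', hb⟩ := exists_perp_of_isUnit_gramPf hB hv (x (2 * n))
    have hd : desc x (2 * (n + 1)) = vecCons (x (2 * n + 1)) (vecCons (x (2 * n)) v) := by
      change desc x (2 * n + 1 + 1) = _
      rw [desc_succ, desc_succ]
    have h1 : gramPf B (desc x (2 * (n + 1))) = gramPf (n := n + 1) B
        (vecCons (x (2 * n + 1) + z) (vecCons (x (2 * n) + z') v)) := by
      rw [hd, ← gramPfForm_apply, ← gramPfForm_apply]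
      exact (map_vecCons₂_add_of_mem_span (gramPfForm B (n + 1)) _ _ hz hz').symm
    have h2 : ∀ w : Fin (2 * (n + 1)) → M, pairingDet B w (desc x (2 * (n + 1))) =
        pairingDet B w
          (vecCons (x (2 * n + 1) + z) (vecCons (x (2 * n) + z') v) : Fin (2 * n + 2) → M) := by
      intro w
      rw [hd]
      exact (map_vecCons₂_add_of_mem_span (pairingDet B w) _ _ hz hz').symm
    rw [h1, gramPf_vecCons_of_perp hB _ ha, mul_pow, ih, ← pairingDet_apply (n := 2 * (n + 1)), h2,
      pairingDet_comm hB, h2]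
    exact (det_gram_vecCons₂_of_perp hB ha hb).symm

/-! ### Derivations -/

theorem derivation_prod (δ : Derivation ℝ R R) {ι : Type*} [DecidableEq ι] (s : Finset ι)
    (f : ι → R) : δ (∏ i ∈ s, f i) = ∑ i ∈ s, δ (f i) * ∏ j ∈ s.erase i, f j := by
  induction s using Finset.induction_on with
  | empty => simp
  | insert a s ha ih =>
    rw [Finset.prod_insert ha, Derivation.leibniz, ih, Finset.sum_insert ha,
      Finset.erase_insert ha, smul_eq_mul, smul_eq_mul, Finset.mul_sum, add_comm, mul_comm]
    congr 1
    refine Finset.sum_congr rfl fun i hi => ?_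
    have hia : a ≠ i := fun h => ha (h ▸ hi)
    rw [Finset.erase_insert_of_ne hia, Finset.prod_insert fun h => ha (Finset.mem_of_mem_erase h)]
    ring

theorem pairMultilinear_update (B : M →ₗ[R] M →ₗ[R] R) {n : ℕ} (v : Fin (2 * n) → M) (i : Fin n)
    (b : Fin 2) (z : M) : pairMultilinear B n (Function.update v (pairEquiv n (i, b)) z) =
      (if b = 0 then B z (v (pairEquiv n (i, 1))) else B (v (pairEquiv n (i, 0))) z) *
        ∏ j ∈ Finset.univ.erase i, B (v (pairEquiv n (j, 0))) (v (pairEquiv n (j, 1))) :=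
  prod_pair_update B v i b z

/-- A derivation for which `v_k ↦ v'_k` is compatible with the form acts on the Pfaffian one
vector at a time. -/
theorem derivation_gramPf {B : M →ₗ[R] M →ₗ[R] R} (δ : Derivation ℝ R R) {n : ℕ}
    (v v' : Fin (2 * n) → M)
    (h : ∀ i j, δ (B (v i) (v j)) = B (v' i) (v j) + B (v i) (v' j)) :
    δ (gramPf B v) = ∑ k, gramPf B (Function.update v k (v' k)) := by
  have hsum : ∀ w : Fin (2 * n) → M, gramPf B w = (1 / (2 ^ n * (n.factorial : ℝ))) •
      ∑ σ : Perm (Fin (2 * n)), ((Perm.sign σ : ℤ) : R) * pairMultilinear B n (w ∘ σ) := fun w => by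
    rw [gramPf, pfaffian_eq_sum_pfTerm]
    rfl
  simp only [hsum]
  rw [δ.map_smul, ← Finset.smul_sum, map_sum, Finset.sum_comm]
  congr 1
  refine Finset.sum_congr rfl fun σ _ => ?_
  rw [Derivation.leibniz, Derivation.map_intCast, smul_zero, add_zero, smul_eq_mul,
    ← Finset.mul_sum]
  congr 1
  rw [← Equiv.sum_comp ((pairEquiv n).trans σ), Fintype.sum_prod_type]
  refine (derivation_prod δ Finset.univ fun i => B (v (σ (pairEquiv n (i, 0))))
    (v (σ (pairEquiv n (i, 1))))).trans (Finset.sum_congr rfl fun i _ => ?_)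
  have hup : ∀ b : Fin 2, Function.update v (σ (pairEquiv n (i, b))) (v' (σ (pairEquiv n (i, b)))) ∘
      σ = Function.update (v ∘ σ) (pairEquiv n (i, b)) (v' (σ (pairEquiv n (i, b)))) := fun b => by
    rw [Function.update_comp_equiv]
    simp
  simp only [Fin.sum_univ_two, Equiv.trans_apply, hup, pairMultilinear_update]
  simp [h, add_mul]

/-! ### Reversing the order -/

theorem sign_revPerm_two_mul (n : ℕ) : Perm.sign (Fin.revPerm : Perm (Fin (2 * n))) = (-1) ^ n := by
  rw [Perm.sign_eq_prod_prod_Iio]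
  have h : ∀ j : Fin (2 * n), ∏ i ∈ Finset.Iio j,
      (if (Fin.revPerm : Perm (Fin (2 * n))) i < Fin.revPerm j then (1 : ℤˣ) else -1) =
        (-1) ^ (j : ℕ) := by
    intro j
    rw [Finset.prod_congr rfl (g := fun _ => (-1 : ℤˣ)) fun i hi => by
      rw [if_neg]
      simpa using (Finset.mem_Iio.mp hi).le]
    simp
  rw [Finset.prod_congr rfl fun j _ => h j, Fin.prod_univ_eq_prod_range (fun j => (-1 : ℤˣ) ^ j)]
  induction n with
  | zero => rfl
  | succ n ih =>
    rw [mul_add, mul_one, Finset.prod_range_succ, Finset.prod_range_succ, ih fun j => ?_]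
    · rw [pow_succ (-1) (2 * n), pow_mul]
      simp [pow_succ]
    · rw [Finset.prod_congr rfl (g := fun _ => (-1 : ℤˣ)) fun i hi => by
        rw [if_neg]
        simpa using (Finset.mem_Iio.mp hi).le]
      simp

theorem gramPf_desc_eq (B : M →ₗ[R] M →ₗ[R] R) (x : ℕ → M) (n : ℕ) :
    gramPf B (desc x (2 * n)) = (-1) ^ n * gramPf B fun i : Fin (2 * n) => x i := by
  have h : desc x (2 * n) = (fun i : Fin (2 * n) => x i) ∘ Fin.revPerm := by
    funext i
    simp only [desc, Function.comp_apply, Fin.revPerm_apply, Fin.val_rev]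
    congr 1
    omega
  rw [h, ← gramPfForm_apply, ← gramPfForm_apply, AlternatingMap.map_perm, sign_revPerm_two_mul,
    Units.smul_def, zsmul_eq_mul]
  simp

end GramPfaffian

/-! ### The differential Fay identity -/

section AbstractFay

set_option linter.unusedSectionVars false

open Matrix

variable {R : Type*} [CommRing R] [Algebra ℝ R]

/-- `(-1)^n pf(N_{ij})_{0 ≤ i, j < 2n}`. -/
def pfSeq (N : ℕ → ℕ → R) (n : ℕ) : R :=
  (-1) ^ n * pfaffian (Matrix.of fun i j : Fin (2 * n) => N i j)

/-- The moments after the change of times `t ↦ t - [u]`. -/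
def shiftMoment (u : R) (N : ℕ → ℕ → R) (k l : ℕ) : R :=
  N k l - u * N (k + 1) l - u * N k (l + 1) + u ^ 2 * N (k + 1) (l + 1)

/-- The form with moments `N_{ij}` on the vectors `x_i`, extended to two more vectors `p_0`, `p_1`
with `B(x_i, p_b) = c_b(i)` and `B(p_0, p_1) = 0`. -/
def adjoinForm (N : ℕ → ℕ → R) (c : Fin 2 → ℕ → R) :
    (ℕ ⊕ Fin 2 →₀ R) →ₗ[R] (ℕ ⊕ Fin 2 →₀ R) →ₗ[R] R :=
  Finsupp.linearCombination R fun i => Finsupp.linearCombination R fun j =>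
    Sum.elim (fun i => Sum.elim (fun j => N i j) (fun b => c b i) j)
      (fun b => Sum.elim (fun j => -c b j) (fun _ => 0) j) i

/-- The vectors `x_i`. -/
def momentVec (i : ℕ) : ℕ ⊕ Fin 2 →₀ R := Finsupp.single (Sum.inl i) 1

/-- The vectors `p_b`. -/
def extraVec (b : Fin 2) : ℕ ⊕ Fin 2 →₀ R := Finsupp.single (Sum.inr b) 1

variable {N : ℕ → ℕ → R} {c : Fin 2 → ℕ → R}

theorem adjoinForm_momentVec (i j : ℕ) :
    adjoinForm N c (momentVec i) (momentVec j) = N i j := by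
  simp [adjoinForm, momentVec]

theorem adjoinForm_extraVec_momentVec (i : ℕ) (b : Fin 2) :
    adjoinForm N c (extraVec b) (momentVec i) = -c b i := by
  simp [adjoinForm, momentVec, extraVec]

theorem adjoinForm_extraVec (b b' : Fin 2) :
    adjoinForm N c (extraVec b) (extraVec b') = 0 := by
  simp [adjoinForm, extraVec]

theorem adjoinForm_skew (hN : ∀ i j, N i j = -N j i) (x y : ℕ ⊕ Fin 2 →₀ R) :
    adjoinForm N c x y = -adjoinForm N c y x := by
  have h : adjoinForm N c = -(adjoinForm N c).flip := by
    refine Finsupp.lhom_ext' fun i => LinearMap.ext_ring ?_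
    refine Finsupp.lhom_ext' fun j => LinearMap.ext_ring ?_
    rcases i with i | b <;> rcases j with j | b' <;>
      simp [adjoinForm]
    exact hN i j
  exact congrArg (fun f : (ℕ ⊕ Fin 2 →₀ R) →ₗ[R] (ℕ ⊕ Fin 2 →₀ R) →ₗ[R] R => f x y) h

theorem gramPf_desc_eq_pfSeq {M : Type*} [AddCommGroup M] [Module R M] {B : M →ₗ[R] M →ₗ[R] R}
    {e : ℕ → M} (h : ∀ i j, B (e i) (e j) = N i j) (n : ℕ) :
    gramPf B (desc e (2 * n)) = pfSeq N n := by
  rw [gramPf_desc_eq, pfSeq, gramPf]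
  simp only [h]

theorem form_sub_smul {M : Type*} [AddCommGroup M] [Module R M] {B : M →ₗ[R] M →ₗ[R] R}
    {e : ℕ → M} (h : ∀ i j, B (e i) (e j) = N i j) (u : R) (i j : ℕ) :
    B (e i - u • e (i + 1)) (e j - u • e (j + 1)) = shiftMoment u N i j := by
  simp only [map_sub, map_smul, LinearMap.sub_apply, LinearMap.smul_apply, h, smul_eq_mul,
    shiftMoment]
  ring

/-- For a vector `p` orthogonal to the differences `x_i - u x_{i+1}`, a unipotent change of basis
leaves a single term of the expansion along `p`. -/
theorem gramPf_vecCons_desc {M : Type*} [AddCommGroup M] [Module R M] {B : M →ₗ[R] M →ₗ[R] R}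
    (hB : ∀ x y, B x y = -B y x) (x : ℕ → M) (p : M) (u : R) (n : ℕ)
    (hp : ∀ i < 2 * n, B p (x i - u • x (i + 1)) = 0) :
    gramPf (n := n + 1) B (vecCons p (vecCons (x (2 * n)) (desc x (2 * n)))) =
      B p (x (2 * n)) * gramPf B (desc (fun i => x i - u • x (i + 1)) (2 * n)) := by
  have hp' : ∀ i, B p (desc (fun i => x i - u • x (i + 1)) (2 * n) i) = 0 := fun i =>
    hp _ (by omega)
  rw [← gramPf_vecCons_of_perp hB _ hp', ← gramPfForm_apply, ← gramPfForm_apply]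
  exact (map_vecCons_desc_sub_smul x u (2 * n) ((gramPfForm B (n + 1)).curryLeft p)).symm

/-- The case of two mutually orthogonal vectors `p`, `q`, of which `p` is orthogonal to the first
differences `e_i = x_i - u x_{i+1}` and `q` to the second differences `e_i - v e_{i+1}`. -/
theorem gramPf_vecCons₂_desc {M : Type*} [AddCommGroup M] [Module R M] {B : M →ₗ[R] M →ₗ[R] R}
    (hB : ∀ x y, B x y = -B y x) (x e : ℕ → M) (p q : M) (u v : R) (n : ℕ)
    (he : ∀ i, e i = x i - u • x (i + 1)) (hpq : B q p = 0)
    (hp : ∀ i ≤ 2 * n, B p (e i) = 0) (hq : ∀ i < 2 * n, B q (e i - v • e (i + 1)) = 0) :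
    gramPf (n := n + 2) B (vecCons q (vecCons p (vecCons (x (2 * n + 1))
        (vecCons (x (2 * n)) (desc x (2 * n)))))) =
      B q (e (2 * n)) * B p (x (2 * n + 1)) *
        gramPf B (desc (fun i => e i - v • e (i + 1)) (2 * n)) := by
  have he' : e = fun i => x i - u • x (i + 1) := funext he
  have h1 : gramPf (n := n + 2) B (vecCons q (vecCons p (vecCons (x (2 * n + 1))
        (vecCons (x (2 * n)) (desc x (2 * n)))))) =
      gramPf (n := n + 2) B (vecCons q (vecCons p (vecCons (x (2 * n + 1))
        (vecCons (e (2 * n)) (desc (fun i => e i - v • e (i + 1)) (2 * n)))))) := by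
    rw [← gramPfForm_apply, ← gramPfForm_apply]
    have e1 := map_vecCons_desc_sub_smul x u (2 * n + 1)
      (((gramPfForm B (n + 2)).curryLeft (n := 2 * n + 3) q).curryLeft p)
    rw [← he', desc_succ, desc_succ] at e1
    have e2 := map_vecCons_desc_sub_smul e v (2 * n)
      ((((gramPfForm B (n + 2)).curryLeft (n := 2 * n + 3) q).curryLeft p).curryLeft
        (x (2 * n + 1)))
    exact e1.symm.trans e2.symm
  have hpg : ∀ i, B p (desc (fun i => e i - v • e (i + 1)) (2 * n) i) = 0 := fun i => by
    rw [desc, map_sub, map_smul, hp _ (by omega), hp _ (by omega), smul_zero, sub_zero]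
  have hqg : ∀ i, B q (desc (fun i => e i - v • e (i + 1)) (2 * n) i) = 0 := fun i =>
    hq _ (by omega)
  rw [h1, gramPf_vecCons₃_of_perp hB _ _ _ hqg, hpq, gramPf_vecCons_of_perp hB _ hpg,
    gramPf_vecCons_of_perp hB _ hpg, hp _ le_rfl]
  ring

/-- The differential Fay identity in a ring with a derivation `δ` that shifts the moments: the
Plücker relation for the vectors `p_1`, `p_0`, `x_{2n+1}`, `x_{2n}`, where `B(p_b, x_i)` is
`-u^{2n+1-i}` for `b = 0` and `-v^{2n+1-i}` for `b = 1`. -/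
theorem fay_of_derivation (hN : ∀ i j, N i j = -N j i) (δ : Derivation ℝ R R)
    (hδ : ∀ i j, δ (N i j) = N (i + 1) j + N i (j + 1)) {u v : R} (hδu : δ u = 0) (hδv : δ v = 0)
    (hu : ∀ x y : R, u * x = u * y → x = y) (hv : ∀ x y : R, v * x = v * y → x = y) (n : ℕ)
    (hunit : IsUnit (pfSeq N n)) :
    u * v * (δ (pfSeq (shiftMoment u N) n) * pfSeq (shiftMoment v N) n -
        pfSeq (shiftMoment u N) n * δ (pfSeq (shiftMoment v N) n)) +
      (v - u) * (pfSeq (shiftMoment u N) n * pfSeq (shiftMoment v N) n -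
        pfSeq N n * pfSeq (shiftMoment v (shiftMoment u N)) n) =
      u * v * (u * v * (u - v) *
        (if n = 0 then 0 else pfSeq (shiftMoment v (shiftMoment u N)) (n - 1)) *
          pfSeq N (n + 1)) := by
  let w : Fin 2 → R := ![u, v]
  let B := adjoinForm N fun b i => w b ^ (2 * n + 1 - i)
  let x : ℕ → (ℕ ⊕ Fin 2 →₀ R) := momentVec
  let p : Fin 2 → (ℕ ⊕ Fin 2 →₀ R) := extraVec
  have hB : ∀ x y, B x y = -B y x := adjoinForm_skew hN
  have hxx : ∀ i j, B (x i) (x j) = N i j := adjoinForm_momentVec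
  have hpx : ∀ b i, B (p b) (x i) = -w b ^ (2 * n + 1 - i) := fun b i =>
    adjoinForm_extraVec_momentVec i b
  have hpp : ∀ b b', B (p b) (p b') = 0 := adjoinForm_extraVec
  have hperp : ∀ b, ∀ i ≤ 2 * n, B (p b) (x i - w b • x (i + 1)) = 0 := fun b i hi => by
    rw [map_sub, map_smul, hpx, hpx, smul_eq_mul,
      show 2 * n + 1 - i = (2 * n + 1 - (i + 1)) + 1 by omega, pow_succ]
    ring
  have hee : ∀ b i j, B (x i - w b • x (i + 1)) (x j - w b • x (j + 1)) =
      shiftMoment (w b) N i j := fun b => form_sub_smul hxx (w b)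
  -- the Pfaffians with one extra vector
  have hone : ∀ b, gramPf (n := n + 1) B (vecCons (p b) (vecCons (x (2 * n)) (desc x (2 * n)))) =
      -(w b * pfSeq (shiftMoment (w b) N) n) := fun b => by
    rw [gramPf_vecCons_desc hB x (p b) (w b) n fun i hi => hperp b i hi.le, hpx,
      gramPf_desc_eq_pfSeq (hee b), Nat.add_sub_cancel_left]
    ring
  have hδw : ∀ b, δ (w b) = 0 := fun b => by fin_cases b <;> simp [w, hδu, hδv]
  have hw : ∀ b, ∀ x y : R, w b * x = w b * y → x = y := fun b => by
    fin_cases b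
    · exact hu
    · exact hv
  -- applying `w δ` to the last identity exchanges `x_{2n}` for `x_{2n+1}`
  have htwo : ∀ b, gramPf (n := n + 1) B
      (vecCons (p b) (vecCons (x (2 * n + 1)) (desc x (2 * n)))) =
      -(w b * δ (pfSeq (shiftMoment (w b) N) n) + pfSeq (shiftMoment (w b) N) n) := by
    intro b
    apply hw b
    let v₀ : Fin (2 * (n + 1)) → (ℕ ⊕ Fin 2 →₀ R) := vecCons (p b) (desc x (2 * n + 1))
    let v₁ : Fin (2 * (n + 1)) → (ℕ ⊕ Fin 2 →₀ R) :=
      vecCons (-p b) (w b • desc (fun i => x (i + 1)) (2 * n + 1))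
    have hder : ∀ i j, (w b • δ) (B (v₀ i) (v₀ j)) = B (v₁ i) (v₀ j) + B (v₀ i) (v₁ j) := by
      have hδpow : ∀ k, δ (w b ^ k) = 0 := fun k => by
        rw [Derivation.leibniz_pow, hδw]; simp
      have hxp : ∀ i, i < 2 * n + 1 → B (p b) (x i) = w b • B (p b) (x (i + 1)) := fun i hi => by
        have := hperp b i (by omega)
        rwa [map_sub, map_smul, sub_eq_zero] at this
      refine fun i => Fin.cases (fun j => Fin.cases ?_ (fun j => ?_) j)
        (fun i j => Fin.cases ?_ (fun j => ?_) j) i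
      · simp [v₀, v₁, hpp]
      · simp only [v₀, v₁, cons_val_zero, cons_val_succ, desc, Pi.smul_apply, map_smul,
          Derivation.smul_apply, map_neg, LinearMap.neg_apply]
        rw [← hxp _ (by omega), hpx, map_neg, hδpow]
        simp
      · simp only [v₀, v₁, cons_val_zero, cons_val_succ, desc, Pi.smul_apply, map_smul,
          Derivation.smul_apply, map_neg, LinearMap.smul_apply]
        rw [hB _ (p b), hB _ (p b), smul_neg, ← hxp _ (by omega), hpx, neg_neg, hδpow]
        simp
      · simp only [v₀, v₁, cons_val_succ, desc, Pi.smul_apply, map_smul,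
          Derivation.smul_apply, LinearMap.smul_apply, hxx, hδ, smul_eq_mul]
        ring
    have h := derivation_gramPf (w b • δ) v₀ v₁ hder
    have hv₀ : v₀ = vecCons (p b) (vecCons (x (2 * n)) (desc x (2 * n))) := by
      simp only [v₀, desc_succ]
    have h0 : Function.update v₀ 0 (v₁ 0) = vecCons (-p b) (desc x (2 * n + 1)) := by
      funext i
      refine Fin.cases ?_ (fun i => ?_) i
      · simp [v₁]
      · simp [v₀]
    have h1 : Function.update v₀ (1 : Fin (2 * n + 1 + 1)) (v₁ (1 : Fin (2 * n + 1 + 1))) =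
        vecCons (p b) (vecCons (w b • x (2 * n + 1)) (desc x (2 * n))) := by
      rw [hv₀]
      funext i
      refine Fin.cases ?_ (fun i => Fin.cases ?_ (fun i => ?_) i) i
      · rw [Function.update_of_ne (by simp)]
        rfl
      · simp [v₁, desc_succ]
      · rw [Function.update_of_ne (by simp [Fin.ext_iff])]
        rfl
    have hrest : ∀ k : Fin (2 * n), gramPf (n := n + 1) B
        (Function.update v₀ k.succ.succ (v₁ k.succ.succ)) = 0 := by
      intro k
      have hk : v₁ k.succ.succ = w b • v₀ k.castSucc.succ := by
        simp only [v₁, v₀, cons_val_succ, desc, Pi.smul_apply]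
        congr 2
        simp
        omega
      have hne : k.succ.succ ≠ k.castSucc.succ := fun h => by simp [Fin.ext_iff] at h
      have hself := (gramPfForm B (n + 1)).map_update_self v₀ hne
      rw [hk, ← gramPfForm_apply, AlternatingMap.map_update_smul]
      exact (congrArg (w b • ·) hself).trans (smul_zero _)
    rw [show (∑ k, gramPf B (Function.update v₀ k (v₁ k))) =
      ∑ k : Fin (2 * n + 1 + 1), gramPf (n := n + 1) B (Function.update v₀ k (v₁ k)) from rfl,
      Fin.sum_univ_succ, Fin.sum_univ_succ, Finset.sum_eq_zero fun k _ => hrest k, add_zero] at h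
    have h0' : gramPf (n := n + 1) B (vecCons (-p b) (desc x (2 * n + 1))) =
        w b * pfSeq (shiftMoment (w b) N) n := by
      have := (gramPfForm B (n + 1)).map_vecCons_smul (n := 2 * n + 1)
        (desc x (2 * n + 1)) (-1 : R) (p b)
      rw [neg_one_smul, neg_one_smul] at this
      rw [← gramPfForm_apply]
      refine this.trans ?_
      rw [desc_succ, gramPfForm_apply, hone, neg_neg]
    have h1' : gramPf (n := n + 1) B
        (vecCons (p b) (vecCons (w b • x (2 * n + 1)) (desc x (2 * n)))) =
        w b * gramPf (n := n + 1) B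
          (vecCons (p b) (vecCons (x (2 * n + 1)) (desc x (2 * n)))) := by
      rw [← gramPfForm_apply, ← gramPfForm_apply]
      exact AlternatingMap.map_vecCons_smul ((gramPfForm B (n + 1)).curryLeft (n := 2 * n + 1)
        (p b)) (desc x (2 * n)) (w b) (x (2 * n + 1))
    rw [h0, h0', Fin.succ_zero_eq_one, h1, h1', hv₀, hone, Derivation.smul_apply, map_neg,
      Derivation.leibniz, hδw] at h
    simp only [smul_eq_mul, mul_zero, add_zero] at h
    linear_combination -h
  have hxn : gramPf (n := n + 1) B (vecCons (x (2 * n + 1)) (vecCons (x (2 * n))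
      (desc x (2 * n)))) = pfSeq N (n + 1) := by
    rw [← gramPf_desc_eq_pfSeq hxx (n + 1)]
    change _ = gramPf (n := n + 1) B (desc x (2 * n + 1 + 1))
    rw [desc_succ, desc_succ]
  let e : ℕ → (ℕ ⊕ Fin 2 →₀ R) := fun i => x i - u • x (i + 1)
  have hqe : ∀ i ≤ 2 * n, B (p 1) (e i) = -(v ^ (2 * n - i) * (v - u)) := fun i hi => by
    simp only [e]
    rw [map_sub, map_smul, hpx, hpx, smul_eq_mul,
      show 2 * n + 1 - i = (2 * n - i) + 1 by omega, show 2 * n + 1 - (i + 1) = 2 * n - i by omega]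
    simp only [w, Matrix.cons_val_one, Matrix.cons_val_fin_one]
    ring
  have hqg : ∀ i < 2 * n, B (p 1) (e i - v • e (i + 1)) = 0 := fun i hi => by
    rw [map_sub, map_smul, hqe i hi.le, hqe (i + 1) hi, smul_eq_mul,
      show 2 * n - i = (2 * n - (i + 1)) + 1 by omega]
    ring
  have hgg : ∀ i j, B (e i - v • e (i + 1)) (e j - v • e (j + 1)) =
      shiftMoment v (shiftMoment u N) i j := form_sub_smul (fun i j => hee 0 i j) v
  have hfour : ∀ m ≤ n, gramPf (n := m + 2) B (vecCons (p 1) (vecCons (p 0)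
      (vecCons (x (2 * m + 1)) (vecCons (x (2 * m)) (desc x (2 * m)))))) =
      v ^ (2 * n - 2 * m) * (v - u) * u ^ (2 * n - 2 * m) *
        pfSeq (shiftMoment v (shiftMoment u N)) m := fun m hm => by
    rw [gramPf_vecCons₂_desc hB x e (p 0) (p 1) u v m (fun _ => rfl) (hpp _ _)
      (fun i hi => hperp 0 i (by omega)) (fun i hi => hqg i (by omega)),
      gramPf_desc_eq_pfSeq hgg, hqe _ (by omega), hpx,
      show 2 * n + 1 - (2 * m + 1) = 2 * n - 2 * m by omega]
    simp only [w, Matrix.cons_val_zero]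
    ring
  have htop := hfour n le_rfl
  rw [Nat.sub_self, pow_zero, pow_zero, one_mul, mul_one] at htop
  have hlow : gramPf (n := n + 1) B (vecCons (p 1) (vecCons (p 0) (desc x (2 * n)))) =
      u ^ 2 * v ^ 2 * (v - u) *
        (if n = 0 then 0 else pfSeq (shiftMoment v (shiftMoment u N)) (n - 1)) := by
    cases n with
    | zero =>
      rw [gramPf_vecCons_of_perp hB _ fun i : Fin (2 * 0) => i.elim0, hpp]
      simp
    | succ m =>
      rw [if_neg (Nat.succ_ne_zero m), Nat.add_sub_cancel]
      have := hfour m (Nat.le_succ m)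
      rw [show 2 * (m + 1) - 2 * m = 2 by omega] at this
      have hd : desc x (2 * (m + 1)) =
          vecCons (x (2 * m + 1)) (vecCons (x (2 * m)) (desc x (2 * m))) := by
        change desc x (2 * m + 1 + 1) = _
        rw [desc_succ, desc_succ]
      rw [hd]
      refine this.trans ?_
      ring
  have hpl := gramPf_pluecker hB (v := desc x (2 * n))
    (by rwa [gramPf_desc_eq_pfSeq hxx]) (p 1) (p 0) (x (2 * n + 1)) (x (2 * n))
  rw [gramPf_desc_eq_pfSeq hxx, htop, hlow, hxn, hone, hone, htwo, htwo] at hpl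
  simp only [w, Matrix.cons_val_zero, Matrix.cons_val_one, Matrix.cons_val_fin_one] at hpl
  linear_combination (-1 : R) * hpl

end AbstractFay

section FormalFay

variable {σ τ : Type*}

theorem pfSeq_map {A B : Type*} [CommRing A] [Algebra ℝ A] [CommRing B] [Algebra ℝ B]
    (f : A →ₐ[ℝ] B) (N : ℕ → ℕ → A) (n : ℕ) :
    f (pfSeq N n) = pfSeq (fun i j => f (N i j)) n := by
  simp [pfSeq, pfaffian]

/-- The moments `μ_{kl}(t, -t)` attached to the numbers `M_{kl} = μ_{kl}(T, -T)`. -/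
def diagMoment (M : ℕ → ℕ → ℝ) (k l : ℕ) : MvPowerSeries ℕ+ ℝ :=
  momentPairing M MvPowerSeries.X MvPowerSeries.X k l

/-- The Pfaffian `τ`-function `τ̃_{2n}` attached to the numbers `M_{kl}`. -/
def pfSeries (M : ℕ → ℕ → ℝ) (n : ℕ) : MvPowerSeries ℕ+ ℝ := pfSeq (diagMoment M) n

theorem hasSubst_X : MvPowerSeries.HasSubst (MvPowerSeries.X : σ → MvPowerSeries σ ℝ) :=
  hasSubst_X_comp Function.injective_id

theorem diagMoment_subst (M : ℕ → ℕ → ℝ) {a : ℕ+ → MvPowerSeries τ ℝ}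
    (ha : MvPowerSeries.HasSubst a) (k l : ℕ) :
    (diagMoment M k l).subst a = momentPairing M a a k l := by
  rw [diagMoment, momentPairing_subst M (tame_of_hasSubst hasSubst_X)
    (tame_of_hasSubst hasSubst_X) ha]
  simp only [MvPowerSeries.subst_X ha]

theorem formalMoment_subst_diag (M : ℕ → ℕ → ℝ) (k l : ℕ) :
    restrictDiag (formalMoment M k l) = diagMoment M k l := by
  refine (formalMoment_subst M hasSubst_X (hasSubst_neg hasSubst_X) k l).trans ?_
  rw [neg_neg, diagMoment]

theorem pfSeries_subst (M : ℕ → ℕ → ℝ) {a : ℕ+ → MvPowerSeries τ ℝ}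
    (ha : MvPowerSeries.HasSubst a) (n : ℕ) :
    (pfSeries M n).subst a = pfSeq (momentPairing M a a) n := by
  rw [← MvPowerSeries.coe_substAlgHom ha, pfSeries, pfSeq_map]
  congr 1
  funext k l
  rw [MvPowerSeries.coe_substAlgHom ha, diagMoment_subst M ha]

theorem momentPairing_skew {M : ℕ → ℕ → ℝ} (hM : ∀ k l, M k l = -M l k)
    (x : ℕ+ → MvPowerSeries σ ℝ) (k l : ℕ) :
    momentPairing M x x k l = -momentPairing M x x l k := by
  rw [momentPairing_swap]
  ext m
  rw [momentPairing, momentPairing, map_neg, coeff_fsum, coeff_fsum, ← finsum_neg_distrib]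
  refine finsum_congr fun p => ?_
  rw [hM (k + p.2) (l + p.1), neg_smul, map_neg]

theorem momentPairing_sub_miwa (M : ℕ → ℕ → ℝ) {x : ℕ+ → MvPowerSeries τ ℝ}
    (hx : MvPowerSeries.HasSubst x) (v : τ) :
    momentPairing M (x - miwa (MvPowerSeries.X v)) (x - miwa (MvPowerSeries.X v)) =
      shiftMoment (MvPowerSeries.X v) (momentPairing M x x) := by
  have hx' := tame_of_hasSubst hx
  have hy := tame_of_hasSubst (hasSubst_sub hx (hasSubst_miwa_X v))
  funext k l
  rw [momentPairing_sub_miwa_left M hx' hy, momentPairing_sub_miwa_right M hx' hx',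
    momentPairing_sub_miwa_right M hx' hx', shiftMoment]
  ring

theorem pderiv_formalMoment_inl (M : ℕ → ℕ → ℝ) (i : ℕ+) (k l : ℕ) :
    MvPowerSeries.pderiv ℝ (Sum.inl i) (formalMoment M k l) = formalMoment M (k + i) l := by
  ext d
  rw [MvPowerSeries.coeff_pderiv, formalMoment, coeff_momentPairing, formalMoment,
    coeff_momentPairing, wt_add, wt_add, wt_single_of_notMem (ι := Sum.inr) _ (by simp),
    wt_single (ι := Sum.inl), mul_one, add_zero, mul_right_comm]
  have h := linExp_add_single (Sum.elim (fun _ => 1) (fun _ => -1) : ℕ+ ⊕ ℕ+ → ℝ) (Sum.inl i) d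
  rw [h, Sum.elim_inl, one_mul]
  congr 2
  ring

theorem pderiv_formalMoment_inr (M : ℕ → ℕ → ℝ) (i : ℕ+) (k l : ℕ) :
    MvPowerSeries.pderiv ℝ (Sum.inr i) (formalMoment M k l) = -formalMoment M k (l + i) := by
  ext d
  rw [MvPowerSeries.coeff_pderiv, formalMoment, coeff_momentPairing, map_neg, formalMoment,
    coeff_momentPairing, wt_add, wt_add, wt_single_of_notMem (ι := Sum.inl) _ (by simp),
    wt_single (ι := Sum.inr), mul_one, add_zero, mul_right_comm]
  have h := linExp_add_single (Sum.elim (fun _ => 1) (fun _ => -1) : ℕ+ ⊕ ℕ+ → ℝ) (Sum.inr i) d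
  rw [h, Sum.elim_inr, neg_one_mul, neg_mul]
  congr 3
  ring

/-- The chain rule for `φ(t, -t)`. -/
theorem pderiv_restrictDiag (φ : MvPowerSeries (ℕ+ ⊕ ℕ+) ℝ) (i : ℕ+) :
    MvPowerSeries.pderiv ℝ i (restrictDiag φ) =
      restrictDiag (MvPowerSeries.pderiv ℝ (Sum.inl i) φ) -
        restrictDiag (MvPowerSeries.pderiv ℝ (Sum.inr i) φ) := by
  have ha : MvPowerSeries.HasSubst (Sum.elim (fun i => MvPowerSeries.X i)
      (fun i => -MvPowerSeries.X i) : ℕ+ ⊕ ℕ+ → MvPowerSeries ℕ+ ℝ) :=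
    hasSubst_sumElim hasSubst_X (hasSubst_neg hasSubst_X)
  rw [restrictDiag, pderiv_subst ha, fsum_eq_sum {Sum.inl i, Sum.inr i}]
  · rw [Finset.sum_pair (by simp)]
    simp only [Sum.elim_inl, Sum.elim_inr, map_neg, MvPowerSeries.pderiv_X_self, restrictDiag]
    ring
  · intro q hq
    rcases q with j | j
    · have : j ≠ i := by rintro rfl; simp at hq
      rw [Sum.elim_inl, MvPowerSeries.pderiv_X_of_ne this, mul_zero]
    · have : j ≠ i := by rintro rfl; simp at hq
      rw [Sum.elim_inr, map_neg, MvPowerSeries.pderiv_X_of_ne this, neg_zero, mul_zero]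

theorem coeffFinite_restrictDiag : CoeffFinite restrictDiag :=
  coeffFinite_subst (hasSubst_sumElim hasSubst_X (hasSubst_neg hasSubst_X))

theorem pderiv_diagMoment (M : ℕ → ℕ → ℝ) (i : ℕ+) (k l : ℕ) :
    MvPowerSeries.pderiv ℝ i (diagMoment M k l) =
      diagMoment M (k + i) l + diagMoment M k (l + i) := by
  rw [← formalMoment_subst_diag, pderiv_restrictDiag, pderiv_formalMoment_inl,
    pderiv_formalMoment_inr, ← neg_one_smul ℝ (formalMoment M k (l + i)),
    coeffFinite_restrictDiag.map_smul, formalMoment_subst_diag, formalMoment_subst_diag]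
  simp

/-- Differentiation and renaming of variables. -/
theorem pderiv_subst_X_comp {ι : σ → τ} (hι : Function.Injective ι) (i : σ)
    (φ : MvPowerSeries σ ℝ) :
    MvPowerSeries.pderiv ℝ (ι i) (φ.subst fun i => (MvPowerSeries.X (ι i) : MvPowerSeries τ ℝ)) =
      (MvPowerSeries.pderiv ℝ i φ).subst fun i => (MvPowerSeries.X (ι i) : MvPowerSeries τ ℝ) := by
  rw [pderiv_subst (hasSubst_X_comp hι), fsum_eq_single i]
  · rw [MvPowerSeries.pderiv_X_self, mul_one]
  · intro j hj
    rw [MvPowerSeries.pderiv_X_of_ne (hι.ne hj), mul_zero]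

theorem FayVar.t_injective : Function.Injective FayVar.t := fun _ _ h => FayVar.t.inj h

theorem mvX_mul_cancel (s : σ) {x y : MvPowerSeries σ ℝ}
    (h : MvPowerSeries.X s * x = MvPowerSeries.X s * y) : x = y :=
  mul_left_cancel₀ (fun h0 => by
    have := congrArg (MvPowerSeries.coeff (Finsupp.single s 1)) h0
    classical
    rw [MvPowerSeries.coeff_X, if_pos rfl, map_zero] at this
    exact one_ne_zero this) h

/-- The constant term is needed to invert the Pfaffian in the Plücker relation. -/
theorem fayIdentity_pfSeries {M : ℕ → ℕ → ℝ} (hM : ∀ k l, M k l = -M l k) (n : ℕ)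
    (hn : MvPowerSeries.constantCoeff (pfSeries M n) ≠ 0) :
    FayIdentity (if n = 0 then 0 else pfSeries M (n - 1)) (pfSeries M n) (pfSeries M (n + 1)) := by
  let t : ℕ+ → MvPowerSeries FayVar ℝ := fun i => MvPowerSeries.X (FayVar.t i)
  let u : MvPowerSeries FayVar ℝ := MvPowerSeries.X FayVar.u
  let v : MvPowerSeries FayVar ℝ := MvPowerSeries.X FayVar.v
  have ht : MvPowerSeries.HasSubst t := hasSubst_X_comp FayVar.t_injective
  have htu : MvPowerSeries.HasSubst (t - miwa u) := hasSubst_sub ht (hasSubst_miwa_X _)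
  have htv : MvPowerSeries.HasSubst (t - miwa v) := hasSubst_sub ht (hasSubst_miwa_X _)
  have htuv : MvPowerSeries.HasSubst (t - miwa u - miwa v) := hasSubst_sub htu (hasSubst_miwa_X _)
  have hm : (if n = 0 then 0 else pfSeries M (n - 1)).subst (t - miwa u - miwa v) =
      if n = 0 then 0 else (pfSeries M (n - 1)).subst (t - miwa u - miwa v) := by
    split_ifs
    · rw [← MvPowerSeries.coe_substAlgHom htuv, map_zero]
    · rfl
  have hunit : IsUnit (pfSeq (momentPairing M t t) n) := by
    rw [← pfSeries_subst M ht, ← MvPowerSeries.coe_substAlgHom ht]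
    exact (MvPowerSeries.isUnit_iff_constantCoeff.mpr (IsUnit.mk0 _ hn)).map _
  have hδ : ∀ i j, MvPowerSeries.pderiv ℝ (FayVar.t 1) (momentPairing M t t i j) =
      momentPairing M t t (i + 1) j + momentPairing M t t i (j + 1) := fun i j => by
    rw [← diagMoment_subst M ht, pderiv_subst_X_comp FayVar.t_injective, pderiv_diagMoment,
      ← MvPowerSeries.coe_substAlgHom ht, map_add, MvPowerSeries.coe_substAlgHom ht,
      diagMoment_subst M ht, diagMoment_subst M ht]
    rfl
  have key := fay_of_derivation (momentPairing_skew hM t) (MvPowerSeries.pderiv ℝ (FayVar.t 1)) hδ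
    (u := u) (v := v) (MvPowerSeries.pderiv_X_of_ne (by simp))
    (MvPowerSeries.pderiv_X_of_ne (by simp)) (fun _ _ => mvX_mul_cancel _)
    (fun _ _ => mvX_mul_cancel _) n hunit
  rw [← momentPairing_sub_miwa M ht, ← momentPairing_sub_miwa M ht,
    ← momentPairing_sub_miwa M htu, ← pfSeries_subst M ht, ← pfSeries_subst M ht,
    ← pfSeries_subst M htu, ← pfSeries_subst M htv, ← pfSeries_subst M htuv,
    ← pfSeries_subst M htuv, ← hm] at key
  exact key

end FormalFay

/-! ### The Hirota equations -/

section Hirota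

/-- The coefficient of `u^k v^0`, a power series in the times. -/
def coeffU (k : ℕ) (φ : MvPowerSeries FayVar ℝ) : MvPowerSeries ℕ+ ℝ :=
  fun d => MvPowerSeries.coeff (d.mapDomain FayVar.t + Finsupp.single FayVar.u k) φ

theorem coeff_coeffU (k : ℕ) (φ : MvPowerSeries FayVar ℝ) (d : ℕ+ →₀ ℕ) :
    MvPowerSeries.coeff d (coeffU k φ) =
      MvPowerSeries.coeff (d.mapDomain FayVar.t + Finsupp.single FayVar.u k) φ := rfl

theorem coeffFinite_coeffU (k : ℕ) : CoeffFinite (coeffU k) := fun d =>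
  ⟨{d.mapDomain FayVar.t + Finsupp.single FayVar.u k}, fun _ => 1, fun φ => by
    simp [coeff_coeffU]⟩

theorem mapDomain_t_apply_u (d : ℕ+ →₀ ℕ) : d.mapDomain FayVar.t FayVar.u = 0 :=
  Finsupp.mapDomain_of_notMem_range _ _ (by simp)

theorem coeffU_pow_mul (k r : ℕ) (φ : MvPowerSeries FayVar ℝ) :
    coeffU (k + r) (MvPowerSeries.X FayVar.u ^ r * φ) = coeffU k φ := by
  ext d
  rw [coeff_coeffU, coeff_coeffU, MvPowerSeries.X_pow_eq, Finsupp.single_add, ← add_assoc,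
    add_comm _ (Finsupp.single FayVar.u r), MvPowerSeries.coeff_add_monomial_mul, one_mul]

theorem monomial_subst_X_comp {σ τ : Type*} {ι : σ → τ} (hι : Function.Injective ι)
    (d : σ →₀ ℕ) :
    (MvPowerSeries.monomial d (1 : ℝ)).subst (fun i => (MvPowerSeries.X (ι i) :
      MvPowerSeries τ ℝ)) = MvPowerSeries.monomial (d.mapDomain ι) 1 := by
  rw [MvPowerSeries.subst_monomial (hasSubst_X_comp hι), map_one, one_mul,
    MvPowerSeries.monomial_one_eq, Finsupp.prod_mapDomain_index_inj hι]

theorem coeffU_pow_mul_subst (k r : ℕ) (ψ : MvPowerSeries ℕ+ ℝ) :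
    coeffU k (MvPowerSeries.X FayVar.u ^ r * ψ.subst fun i => (MvPowerSeries.X (FayVar.t i) :
      MvPowerSeries FayVar ℝ)) = if k = r then ψ else 0 := by
  classical
  have hinj : Function.Injective (Finsupp.mapDomain FayVar.t : (ℕ+ →₀ ℕ) → _) :=
    Finsupp.mapDomain_injective FayVar.t_injective
  have h1 : CoeffFinite fun ψ : MvPowerSeries ℕ+ ℝ => coeffU k (MvPowerSeries.X FayVar.u ^ r *
      ψ.subst fun i => (MvPowerSeries.X (FayVar.t i) : MvPowerSeries FayVar ℝ)) :=
    (coeffFinite_coeffU k).comp ((coeffFinite_mul_left _).comp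
      (coeffFinite_subst (hasSubst_X_comp FayVar.t_injective)))
  have h2 : CoeffFinite fun ψ : MvPowerSeries ℕ+ ℝ => if k = r then ψ else 0 := by
    split_ifs
    · exact coeffFinite_id
    · exact coeffFinite_zero
  refine congrFun (h1.ext h2 fun e => ?_) ψ
  rw [monomial_subst_X_comp FayVar.t_injective, MvPowerSeries.X_pow_eq,
    MvPowerSeries.monomial_mul_monomial, one_mul]
  ext d
  rw [coeff_coeffU, MvPowerSeries.coeff_monomial]
  have hiff : d.mapDomain FayVar.t + Finsupp.single FayVar.u k =
      Finsupp.single FayVar.u r + e.mapDomain FayVar.t ↔ k = r ∧ d = e := by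
    constructor
    · intro h
      have hkr : k = r := by
        have := DFunLike.congr_fun h FayVar.u
        simpa [mapDomain_t_apply_u] using this
      subst hkr
      rw [add_comm] at h
      exact ⟨rfl, hinj (add_left_cancel h)⟩
    · rintro ⟨rfl, rfl⟩
      exact add_comm _ _
  by_cases hkr : k = r
  · rw [if_pos hkr, MvPowerSeries.coeff_monomial]
    exact if_congr (hiff.trans (and_iff_right hkr)) rfl rfl
  · rw [if_neg hkr, if_neg fun h => hkr (hiff.1 h).1, map_zero]

theorem coeffU_mul_subst (k : ℕ) (ψ : MvPowerSeries ℕ+ ℝ) :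
    coeffU k (ψ.subst fun i => (MvPowerSeries.X (FayVar.t i) : MvPowerSeries FayVar ℝ)) =
      if k = 0 then ψ else 0 := by
  have := coeffU_pow_mul_subst k 0 ψ
  rwa [pow_zero, one_mul] at this

theorem monomial_sumElim_subst {σ τ κ : Type*} {x : κ → MvPowerSeries τ ℝ}
    {y : σ → MvPowerSeries τ ℝ} (hx : MvPowerSeries.HasSubst x) (hy : MvPowerSeries.HasSubst y)
    (d : κ →₀ ℕ) (m : σ →₀ ℕ) :
    (MvPowerSeries.monomial (d.sumElim m) (1 : ℝ)).subst (Sum.elim x y) =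
      (d.prod fun i e => x i ^ e) * m.prod fun i e => y i ^ e := by
  rw [MvPowerSeries.subst_monomial (hasSubst_sumElim hx hy), map_one, one_mul,
    Finsupp.prod_sumElim]
  rfl

theorem exists_sumElim_eq {κ σ : Type*} (e : κ ⊕ σ →₀ ℕ) : ∃ d m, Finsupp.sumElim d m = e :=
  ⟨_, _, Finsupp.comapDomain_sumElim_comapDomain ..⟩

/-- Setting the second set of variables to zero. -/
theorem coeff_evalTimes_X_zero (φ : MvPowerSeries (ℕ+ ⊕ ℕ+) ℝ) (d : ℕ+ →₀ ℕ) :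
    MvPowerSeries.coeff d (evalTimes φ (fun i => MvPowerSeries.X i) fun _ => 0) =
      MvPowerSeries.coeff (d.sumElim 0) φ := by
  classical
  have hz : MvPowerSeries.HasSubst (fun _ => 0 : ℕ+ → MvPowerSeries ℕ+ ℝ) :=
    MvPowerSeries.HasSubst.zero
  let Ψ : MvPowerSeries (ℕ+ ⊕ ℕ+) ℝ → MvPowerSeries ℕ+ ℝ := fun φ d =>
    MvPowerSeries.coeff (d.sumElim 0) φ
  have h1 : CoeffFinite Ψ := fun d => ⟨{d.sumElim 0}, fun _ => 1, fun φ => by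
    simp only [Finset.sum_singleton, one_mul]; rfl⟩
  have h2 : CoeffFinite fun φ => evalTimes φ (fun i => MvPowerSeries.X i)
      (fun _ => 0 : ℕ+ → MvPowerSeries ℕ+ ℝ) :=
    coeffFinite_subst (hasSubst_sumElim hasSubst_X hz)
  have h3 := congrFun (h2.ext h1 fun e => ?_) φ
  · exact congrArg (MvPowerSeries.coeff d) h3
  obtain ⟨d, m, rfl⟩ := exists_sumElim_eq e
  rw [evalTimes, monomial_sumElim_subst hasSubst_X hz]
  ext d'
  change _ = MvPowerSeries.coeff (d'.sumElim 0) (MvPowerSeries.monomial (d.sumElim m) (1 : ℝ))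
  rw [MvPowerSeries.coeff_monomial]
  by_cases hm : m = 0
  · subst hm
    rw [Finsupp.prod_zero_index, mul_one, ← MvPowerSeries.monomial_one_eq,
      MvPowerSeries.coeff_monomial]
    refine if_congr ⟨fun h => by rw [h], fun h => ?_⟩ rfl rfl
    ext i
    exact DFunLike.congr_fun h (Sum.inl i)
  · obtain ⟨i, hi⟩ := Finsupp.support_nonempty_iff.2 hm
    have h0 : (m.prod fun _ e => (0 : MvPowerSeries ℕ+ ℝ) ^ e) = 0 :=
      Finset.prod_eq_zero hi (zero_pow (Finsupp.mem_support_iff.1 hi))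
    rw [h0, mul_zero, map_zero, if_neg]
    intro h
    exact hm (by ext i; exact (DFunLike.congr_fun h (Sum.inr i)).symm)

theorem coeff_schurTilde (k : ℕ) (m : ℕ+ →₀ ℕ) :
    MvPolynomial.coeff m (schurTilde k) = if wt (ι := id) Function.injective_id m = k then
      linExp (fun i : ℕ+ => 1 / (i : ℝ)) m else 0 := by
  rw [← coeff_schur_smul_X, ← MvPolynomial.coeff_coe]
  congr 1
  have h := schur_map (MvPolynomial.coeToMvPowerSeries.algHom (σ := ℕ+) (R := ℝ) ℝ)
    (fun i : ℕ+ => MvPolynomial.C (1 / (i : ℝ)) * MvPolynomial.X i) k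
  rw [MvPolynomial.coeToMvPowerSeries.algHom_apply] at h
  simp only [Algebra.algebraMap_self, MvPowerSeries.map_id, RingHom.id_apply,
    MvPolynomial.coeToMvPowerSeries.algHom_apply, MvPolynomial.coe_mul, MvPolynomial.coe_C,
    MvPolynomial.coe_X, ← MvPowerSeries.smul_eq_C_mul] at h
  exact h

/-- The coefficients of `P(∂_y) Φ` at `y = 0`. -/
theorem coeff_evalTimes_diffOp (P : MvPolynomial ℕ+ ℝ) (Φ : MvPowerSeries (ℕ+ ⊕ ℕ+) ℝ)
    (d : ℕ+ →₀ ℕ) :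
    MvPowerSeries.coeff d (evalTimes (diffOp Sum.inr P Φ) (fun i => MvPowerSeries.X i)
      fun _ => 0) = ∑ m ∈ P.support, MvPolynomial.coeff m P *
        ((m.prod fun _ e => (e.factorial : ℝ)) * MvPowerSeries.coeff (d.sumElim m) Φ) := by
  rw [coeff_evalTimes_X_zero, diffOp, map_sum]
  refine Finset.sum_congr rfl fun m _ => ?_
  rw [map_smul, smul_eq_mul]
  congr 1
  change ((m.mapDomain Sum.inr).prod fun i e =>
      ((((d.sumElim 0 : ℕ+ ⊕ ℕ+ →₀ ℕ) i + e).descFactorial e : ℕ) : ℝ)) *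
    MvPowerSeries.coeff (d.sumElim 0 + m.mapDomain Sum.inr) Φ = _
  rw [Finsupp.prod_mapDomain_index_inj Sum.inr_injective]
  congr 2
  · funext i e
    simp [Finsupp.sumElim_inr, Nat.descFactorial_self]
  · rw [Finsupp.sumElim_eq_add, Finsupp.sumElim_eq_add, Finsupp.mapDomain_zero, add_zero]

theorem hirota_sub (P Q : MvPolynomial ℕ+ ℝ) (f g : MvPowerSeries ℕ+ ℝ) :
    hirota (P - Q) f g = hirota P f g - hirota Q f g := by
  classical
  ext d
  have hsum : ∀ (P : MvPolynomial ℕ+ ℝ) (s : Finset (ℕ+ →₀ ℕ)) (c : (ℕ+ →₀ ℕ) → ℝ),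
      P.support ⊆ s → ∑ m ∈ P.support, MvPolynomial.coeff m P * c m =
        ∑ m ∈ s, MvPolynomial.coeff m P * c m := fun P s c hs =>
    Finset.sum_subset hs fun m _ hm => by rw [MvPolynomial.notMem_support_iff.1 hm, zero_mul]
  simp only [hirota]
  rw [map_sub, coeff_evalTimes_diffOp, coeff_evalTimes_diffOp, coeff_evalTimes_diffOp,
    hsum (P - Q) _ _ (MvPolynomial.support_sub ℕ+ P Q),
    hsum P (P.support ∪ Q.support) _ Finset.subset_union_left,
    hsum Q (P.support ∪ Q.support) _ Finset.subset_union_right, ← Finset.sum_sub_distrib]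
  refine Finset.sum_congr rfl fun m _ => ?_
  rw [MvPolynomial.coeff_sub, sub_mul]

/-- The Hirota operation of `p_k(∂̃)` is the coefficient of `u^k` in `Φ(t, y)` at `y = [u]`. -/
theorem coeffU_subst_miwa (k : ℕ) (Φ : MvPowerSeries (ℕ+ ⊕ ℕ+) ℝ) :
    coeffU k (Φ.subst (Sum.elim (fun i => MvPowerSeries.X (FayVar.t i))
      (miwa (MvPowerSeries.X FayVar.u)))) =
    evalTimes (diffOp Sum.inr (schurTilde k) Φ) (fun i => MvPowerSeries.X i) fun _ => 0 := by
  classical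
  let c : (ℕ+ →₀ ℕ) → ℝ := fun m => m.prod fun i e => (1 / (i : ℝ)) ^ e
  have ht := hasSubst_X_comp FayVar.t_injective
  have hu := hasSubst_miwa_X FayVar.u
  have h1 : CoeffFinite fun Φ : MvPowerSeries (ℕ+ ⊕ ℕ+) ℝ =>
      coeffU k (Φ.subst (Sum.elim (fun i => MvPowerSeries.X (FayVar.t i))
        (miwa (MvPowerSeries.X FayVar.u)))) :=
    (coeffFinite_coeffU k).comp (coeffFinite_subst (hasSubst_sumElim ht hu))
  have h2 : CoeffFinite fun Φ : MvPowerSeries (ℕ+ ⊕ ℕ+) ℝ =>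
      evalTimes (diffOp Sum.inr (schurTilde k) Φ) (fun i => MvPowerSeries.X i)
        (fun _ => 0 : ℕ+ → MvPowerSeries ℕ+ ℝ) := fun d => by
    refine ⟨(schurTilde k).support.image fun m => d.sumElim m, fun e =>
      MvPolynomial.coeff (e.comapDomain Sum.inr Sum.inr_injective.injOn) (schurTilde k) *
      ((e.comapDomain Sum.inr Sum.inr_injective.injOn).prod fun _ e => (e.factorial : ℝ)),
      fun Φ => ?_⟩
    rw [coeff_evalTimes_diffOp, Finset.sum_image]
    · refine Finset.sum_congr rfl fun m _ => ?_
      beta_reduce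
      rw [Finsupp.comapDomain_inr_sumElim, mul_assoc]
    · intro m _ m' _ h
      ext i
      exact DFunLike.congr_fun h (Sum.inr i)
  refine congrFun (h1.ext h2 fun e => ?_) Φ
  obtain ⟨d, m, rfl⟩ := exists_sumElim_eq e
  have hm : (m.prod fun i e => miwa (MvPowerSeries.X FayVar.u : MvPowerSeries FayVar ℝ) i ^ e) =
      c m • MvPowerSeries.X FayVar.u ^ wt (ι := id) Function.injective_id m := by
    have hwt : wt (ι := id) Function.injective_id m = m.sum fun i e => (i : ℕ) * e := by
      rw [wt]
      congr 1
      ext i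
      simp
    rw [hwt, Finsupp.sum, ← Finset.prod_pow_eq_pow_sum, MvPowerSeries.smul_eq_C_mul]
    simp only [c, Finsupp.prod, map_prod, ← Finset.prod_mul_distrib]
    refine Finset.prod_congr rfl fun i _ => ?_
    rw [miwa, smul_pow, ← pow_mul, MvPowerSeries.smul_eq_C_mul]
  rw [monomial_sumElim_subst ht hu, hm, mul_smul_comm, mul_comm, (coeffFinite_coeffU k).map_smul,
    ← Finsupp.prod_mapDomain_index_inj (h := fun i e => (MvPowerSeries.X i : MvPowerSeries FayVar ℝ)
      ^ e) FayVar.t_injective, ← MvPowerSeries.monomial_one_eq,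
    ← monomial_subst_X_comp FayVar.t_injective, coeffU_pow_mul_subst]
  ext d'
  rw [coeff_evalTimes_diffOp, Finset.sum_eq_single m]
  · rw [coeff_schurTilde, MvPowerSeries.coeff_monomial, map_smul, smul_eq_mul]
    have hiff : d'.sumElim m = d.sumElim m ↔ d' = d :=
      ⟨fun h => by ext i; exact DFunLike.congr_fun h (Sum.inl i), fun h => by rw [h]⟩
    have hc : linExp (fun i : ℕ+ => 1 / (i : ℝ)) m * (m.prod fun _ e => (e.factorial : ℝ)) =
        c m := by
      simp only [linExp, c, Finsupp.prod, ← Finset.prod_mul_distrib]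
      refine Finset.prod_congr rfl fun i _ => ?_
      rw [div_mul_cancel₀ _ (by positivity)]
    simp only [hiff]
    by_cases hk : k = wt (ι := id) Function.injective_id m
    · rw [if_pos hk, if_pos hk.symm, ← mul_assoc, hc, MvPowerSeries.coeff_monomial]
    · rw [if_neg hk, if_neg (Ne.symm hk), zero_mul, map_zero, mul_zero]
  · intro m' _ hm'
    rw [MvPowerSeries.coeff_monomial, if_neg, mul_zero, mul_zero]
    intro h
    exact hm' (by ext i; exact DFunLike.congr_fun h (Sum.inr i))
  · intro hm
    rw [MvPolynomial.notMem_support_iff.1 hm, zero_mul]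

theorem hirota_schurTilde (k : ℕ) (f g : MvPowerSeries ℕ+ ℝ) :
    hirota (schurTilde k) f g = coeffU k
      (f.subst ((fun i => MvPowerSeries.X (FayVar.t i)) + miwa (MvPowerSeries.X FayVar.u)) *
        g.subst ((fun i => MvPowerSeries.X (FayVar.t i)) - miwa (MvPowerSeries.X FayVar.u))) := by
  have ht := hasSubst_X_comp (τ := ℕ+ ⊕ ℕ+) (Sum.inl_injective (α := ℕ+) (β := ℕ+))
  have hy := hasSubst_X_comp (τ := ℕ+ ⊕ ℕ+) (Sum.inr_injective (α := ℕ+) (β := ℕ+))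
  have he := hasSubst_sumElim (hasSubst_X_comp FayVar.t_injective) (hasSubst_miwa_X FayVar.u)
  have hadd := MvPowerSeries.subst_comp_subst_apply (ht.add hy) he f
  have hsub := MvPowerSeries.subst_comp_subst_apply (hasSubst_sub ht hy) he g
  rw [hirota, ← coeffU_subst_miwa]
  refine congrArg (coeffU k) ?_
  rw [MvPowerSeries.subst_mul he]
  refine (congrArg₂ (· * ·) hadd hsub).trans ?_
  congr 2
  · funext i
    simp only [Pi.add_apply, MvPowerSeries.subst_add he, MvPowerSeries.subst_X he, Sum.elim_inl,
      Sum.elim_inr]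
  · funext i
    simp only [Pi.sub_apply, sub_eq_add_neg, MvPowerSeries.subst_add he, subst_neg he,
      MvPowerSeries.subst_X he, Sum.elim_inl, Sum.elim_inr]

end Hirota

section HirotaOfFay

variable {σ τ : Type*}

theorem pderiv_subst_eq_zero {a : σ → MvPowerSeries τ ℝ} (ha : MvPowerSeries.HasSubst a) {j : τ}
    (h : ∀ i, MvPowerSeries.pderiv ℝ j (a i) = 0) (φ : MvPowerSeries σ ℝ) :
    MvPowerSeries.pderiv ℝ j (φ.subst a) = 0 := by
  rw [pderiv_subst ha, fsum_eq_sum ∅ fun i _ => by rw [h, mul_zero], Finset.sum_empty]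

theorem pderiv_subst_eq {a : σ → MvPowerSeries τ ℝ} (ha : MvPowerSeries.HasSubst a) {j : τ} (i : σ)
    (h1 : MvPowerSeries.pderiv ℝ j (a i) = 1)
    (h : ∀ i', i' ≠ i → MvPowerSeries.pderiv ℝ j (a i') = 0) (φ : MvPowerSeries σ ℝ) :
    MvPowerSeries.pderiv ℝ j (φ.subst a) = (MvPowerSeries.pderiv ℝ i φ).subst a := by
  rw [pderiv_subst ha, fsum_eq_single i fun i' hi' => by rw [h i' hi', mul_zero], h1, mul_one]

theorem pderiv_miwa_self (v : σ) (i : ℕ+) :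
    MvPowerSeries.pderiv ℝ v (miwa (MvPowerSeries.X v) i) =
      (MvPowerSeries.X v : MvPowerSeries σ ℝ) ^ ((i : ℕ) - 1) := by
  have hi : (i : ℝ) ≠ 0 := by positivity
  rw [miwa, Derivation.map_smul, MvPowerSeries.pderiv_pow, MvPowerSeries.pderiv_X_self, mul_one,
    ← nsmul_eq_mul, ← Nat.cast_smul_eq_nsmul ℝ, smul_smul, one_div, inv_mul_cancel₀ hi, one_smul]

theorem pderiv_miwa_of_ne {u v : σ} (h : u ≠ v) (i : ℕ+) :
    MvPowerSeries.pderiv ℝ v (miwa (MvPowerSeries.X u : MvPowerSeries σ ℝ) i) = 0 := by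
  rw [miwa, Derivation.map_smul, MvPowerSeries.pderiv_pow, MvPowerSeries.pderiv_X_of_ne h, mul_zero,
    smul_zero]

theorem iterDeriv_single_add_single {a b : σ} (hab : a ≠ b) (φ : MvPowerSeries σ ℝ) :
    iterDeriv (Finsupp.single a 1 + Finsupp.single b 1) φ =
      MvPowerSeries.pderiv ℝ a (MvPowerSeries.pderiv ℝ b φ) := by
  classical
  ext d
  rw [MvPowerSeries.coeff_pderiv, MvPowerSeries.coeff_pderiv]
  change ((Finsupp.single a 1 + Finsupp.single b 1).prod fun i e =>
    (((d i + e).descFactorial e : ℕ) : ℝ)) * MvPowerSeries.coeff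
      (d + (Finsupp.single a 1 + Finsupp.single b 1)) φ = _
  rw [Finsupp.prod_add_index_of_disjoint, Finsupp.prod_single_index (by simp),
    Finsupp.prod_single_index (by simp)]
  · rw [Finsupp.add_apply, Finsupp.single_eq_of_ne hab.symm, ← add_assoc]
    simp only [Nat.descFactorial_one]
    push_cast
    ring
  · rw [Finsupp.support_single _ one_ne_zero, Finsupp.support_single _ one_ne_zero]
    simpa using hab

/-- `∂_1 ∂_j f ∘ g` for `j > 1`. -/
theorem hirota_X_mul_X (r : ℝ) {j : ℕ+} (hj : j ≠ 1) (f : MvPowerSeries ℕ+ ℝ) :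
    hirota (MvPolynomial.C r * MvPolynomial.X 1 * MvPolynomial.X j) f f =
      (2 * r) • (f * MvPowerSeries.pderiv ℝ j (MvPowerSeries.pderiv ℝ 1 f) -
        MvPowerSeries.pderiv ℝ 1 f * MvPowerSeries.pderiv ℝ j f) := by
  classical
  rcases eq_or_ne r 0 with rfl | hr
  · simp only [map_zero, zero_mul, mul_zero, zero_smul, hirota, diffOp, MvPolynomial.support_zero,
      Finset.sum_empty, evalTimes]
    rw [← MvPowerSeries.coe_substAlgHom
      (hasSubst_sumElim hasSubst_X MvPowerSeries.HasSubst.zero), map_zero]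
  let t : ℕ+ → MvPowerSeries (ℕ+ ⊕ ℕ+) ℝ := fun i => MvPowerSeries.X (Sum.inl i)
  let y : ℕ+ → MvPowerSeries (ℕ+ ⊕ ℕ+) ℝ := fun i => MvPowerSeries.X (Sum.inr i)
  have hty : MvPowerSeries.HasSubst (t + y) :=
    (hasSubst_X_comp Sum.inl_injective).add (hasSubst_X_comp Sum.inr_injective)
  have hty' : MvPowerSeries.HasSubst (t - y) :=
    hasSubst_sub (hasSubst_X_comp Sum.inl_injective) (hasSubst_X_comp Sum.inr_injective)
  have he : MvPowerSeries.HasSubst (Sum.elim (fun i => MvPowerSeries.X i) (fun _ => 0) :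
      ℕ+ ⊕ ℕ+ → MvPowerSeries ℕ+ ℝ) := hasSubst_sumElim hasSubst_X MvPowerSeries.HasSubst.zero
  have hmono : (MvPolynomial.C r * MvPolynomial.X 1 * MvPolynomial.X j : MvPolynomial ℕ+ ℝ) =
      MvPolynomial.monomial (Finsupp.single 1 1 + Finsupp.single j 1) r := by
    rw [MvPolynomial.X, MvPolynomial.X, MvPolynomial.C_mul_monomial, MvPolynomial.monomial_mul]
    simp
  have hdiff : ∀ Φ : MvPowerSeries (ℕ+ ⊕ ℕ+) ℝ,
      diffOp Sum.inr (MvPolynomial.C r * MvPolynomial.X 1 * MvPolynomial.X j) Φ =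
        r • MvPowerSeries.pderiv ℝ (Sum.inr 1) (MvPowerSeries.pderiv ℝ (Sum.inr j) Φ) := fun Φ => by
    rw [hmono, diffOp, MvPolynomial.support_monomial, if_neg hr, Finset.sum_singleton,
      MvPolynomial.coeff_monomial, if_pos rfl, Finsupp.mapDomain_add, Finsupp.mapDomain_single,
      Finsupp.mapDomain_single, iterDeriv_single_add_single (by simpa using hj.symm)]
  have hplus : ∀ (i : ℕ+) (φ : MvPowerSeries ℕ+ ℝ),
      MvPowerSeries.pderiv ℝ (Sum.inr i) (φ.subst (t + y)) =
        (MvPowerSeries.pderiv ℝ i φ).subst (t + y) := fun i φ => by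
    refine pderiv_subst_eq hty i ?_ (fun i' hi' => ?_) φ
    · simp [t, y, MvPowerSeries.pderiv_X_of_ne, MvPowerSeries.pderiv_X_self]
    · simp [t, y, MvPowerSeries.pderiv_X_of_ne, hi']
  have hminus : ∀ (i : ℕ+) (φ : MvPowerSeries ℕ+ ℝ),
      MvPowerSeries.pderiv ℝ (Sum.inr i) (φ.subst (t - y)) =
        -(MvPowerSeries.pderiv ℝ i φ).subst (t - y) := fun i φ => by
    rw [pderiv_subst hty', fsum_eq_single i fun i' hi' => by
      simp [t, y, MvPowerSeries.pderiv_X_of_ne, hi']]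
    simp [t, y, MvPowerSeries.pderiv_X_of_ne, MvPowerSeries.pderiv_X_self]
  have hevp : ∀ φ : MvPowerSeries ℕ+ ℝ, (φ.subst (t + y)).subst (Sum.elim
      (fun i => MvPowerSeries.X i) (fun _ => 0) : ℕ+ ⊕ ℕ+ → MvPowerSeries ℕ+ ℝ) = φ := fun φ => by
    rw [MvPowerSeries.subst_comp_subst_apply hty he]
    conv_rhs => rw [← id_eq φ, ← MvPowerSeries.subst_self]
    congr 1
    funext i
    simp [t, y, MvPowerSeries.subst_add he, MvPowerSeries.subst_X he]
  have hevm : ∀ φ : MvPowerSeries ℕ+ ℝ, (φ.subst (t - y)).subst (Sum.elim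
      (fun i => MvPowerSeries.X i) (fun _ => 0) : ℕ+ ⊕ ℕ+ → MvPowerSeries ℕ+ ℝ) = φ := fun φ => by
    rw [MvPowerSeries.subst_comp_subst_apply hty' he]
    conv_rhs => rw [← id_eq φ, ← MvPowerSeries.subst_self]
    congr 1
    funext i
    simp [t, y, sub_eq_add_neg, MvPowerSeries.subst_add he, subst_neg he, MvPowerSeries.subst_X he]
  have hcomm : MvPowerSeries.pderiv ℝ j (MvPowerSeries.pderiv ℝ 1 f) =
      MvPowerSeries.pderiv ℝ 1 (MvPowerSeries.pderiv ℝ j f) := by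
    rw [← iterDeriv_single_add_single hj, ← iterDeriv_single_add_single hj.symm, add_comm]
  change evalTimes (diffOp Sum.inr _ (f.subst (t + y) * f.subst (t - y))) _ _ = _
  rw [hdiff, evalTimes, Derivation.leibniz, map_add]
  simp only [smul_eq_mul, Derivation.leibniz, hplus, hminus, map_neg]
  simp only [← MvPowerSeries.coe_substAlgHom he, map_smul, map_add, map_mul, map_neg]
  simp only [MvPowerSeries.coe_substAlgHom he, hevp, hevm]
  rw [hcomm, mul_smul, smul_comm (2 : ℝ) r]
  congr 1
  rw [two_smul]
  ring

/-- The evaluation `t ↦ t + [u]`, `v ↦ u`. -/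
def shiftEval : FayVar → MvPowerSeries FayVar ℝ
  | FayVar.t i => MvPowerSeries.X (FayVar.t i) + miwa (MvPowerSeries.X FayVar.u) i
  | FayVar.u => MvPowerSeries.X FayVar.u
  | FayVar.v => MvPowerSeries.X FayVar.u

theorem hasSubst_shiftEval : MvPowerSeries.HasSubst shiftEval := by
  have h := (hasSubst_X_comp FayVar.t_injective).add (hasSubst_miwa_X FayVar.u)
  constructor
  · intro s
    cases s with
    | t i => exact h.const_coeff i
    | u => simp [shiftEval]
    | v => simp [shiftEval]
  · intro d
    refine (((h.coeff_zero d).image FayVar.t).union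
      (Set.toFinite {FayVar.u, FayVar.v})).subset ?_
    rintro (i | _ | _) hi
    · exact Or.inl ⟨i, hi, rfl⟩
    · exact Or.inr (by simp)
    · exact Or.inr (by simp)

set_option maxHeartbeats 1000000 in
/-- The derivative of the differential Fay identity in `v` at `v = u`, after the shift
`t ↦ t + [u]`. -/
theorem bilinear_of_fayIdentity {f fm fp : MvPowerSeries ℕ+ ℝ} (h : FayIdentity fm f fp) :
    let t : ℕ+ → MvPowerSeries FayVar ℝ := fun i => MvPowerSeries.X (FayVar.t i)
    let u : MvPowerSeries FayVar ℝ := MvPowerSeries.X FayVar.u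
    let S : MvPowerSeries ℕ+ ℝ → MvPowerSeries FayVar ℝ := fun φ =>
      fsum fun i : ℕ+ => u ^ ((i : ℕ) - 1) * (MvPowerSeries.pderiv ℝ i φ).subst t
    f.subst (t + miwa u) * f.subst (t - miwa u) =
      f.subst t * f.subst t -
      u ^ 2 * ((MvPowerSeries.pderiv ℝ 1 f).subst t * S f -
        f.subst t * S (MvPowerSeries.pderiv ℝ 1 f)) +
      u ^ 4 * (fp.subst (t + miwa u) * fm.subst (t - miwa u)) := by
  intro t u S
  let v : MvPowerSeries FayVar ℝ := MvPowerSeries.X FayVar.v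
  have ht : MvPowerSeries.HasSubst t := hasSubst_X_comp FayVar.t_injective
  have htu : MvPowerSeries.HasSubst (t - miwa u) := hasSubst_sub ht (hasSubst_miwa_X _)
  have htv : MvPowerSeries.HasSubst (t - miwa v) := hasSubst_sub ht (hasSubst_miwa_X _)
  have htuv : MvPowerSeries.HasSubst (t - miwa u - miwa v) := hasSubst_sub htu (hasSubst_miwa_X _)
  have hD : ∀ (w : MvPowerSeries FayVar ℝ), MvPowerSeries.HasSubst (t - miwa w) →
      (∀ i, MvPowerSeries.pderiv ℝ (FayVar.t 1) (miwa w i) = 0) → ∀ φ : MvPowerSeries ℕ+ ℝ,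
      MvPowerSeries.pderiv ℝ (FayVar.t 1) (φ.subst (t - miwa w)) =
        (MvPowerSeries.pderiv ℝ 1 φ).subst (t - miwa w) := fun w hw hw0 φ => by
    refine pderiv_subst_eq hw 1 ?_ (fun i hi => ?_) φ
    · rw [Pi.sub_apply, map_sub, hw0, sub_zero, MvPowerSeries.pderiv_X_self]
    · rw [Pi.sub_apply, map_sub, hw0, sub_zero, MvPowerSeries.pderiv_X_of_ne (by simpa using hi)]
  have hpt : ∀ i, MvPowerSeries.pderiv ℝ FayVar.v (t i) = 0 := fun i =>
    MvPowerSeries.pderiv_X_of_ne (by simp)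
  have hpu : ∀ i, MvPowerSeries.pderiv ℝ FayVar.v (miwa u i) = 0 :=
    pderiv_miwa_of_ne (by simp)
  have hv0 : ∀ φ : MvPowerSeries ℕ+ ℝ, MvPowerSeries.pderiv ℝ FayVar.v (φ.subst t) = 0 :=
    pderiv_subst_eq_zero ht hpt
  have hv1 : ∀ φ : MvPowerSeries ℕ+ ℝ,
      MvPowerSeries.pderiv ℝ FayVar.v (φ.subst (t - miwa u)) = 0 :=
    pderiv_subst_eq_zero htu fun i => by rw [Pi.sub_apply, map_sub, hpt, hpu, sub_zero]
  -- the evaluation `t ↦ t + [u]`, `v ↦ u`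
  have hs := hasSubst_shiftEval
  let ψ := MvPowerSeries.substAlgHom (R := ℝ) hs
  have hψ : ∀ φ : MvPowerSeries FayVar ℝ, ψ φ = φ.subst shiftEval := fun φ => by
    rw [MvPowerSeries.coe_substAlgHom]
  have hψu : ψ u = u := by rw [hψ, MvPowerSeries.subst_X hs]; rfl
  have hψv : ψ v = u := by rw [hψ, MvPowerSeries.subst_X hs]; rfl
  have hψt : ∀ i, ψ (t i) = t i + miwa u i := fun i => by
    rw [hψ, MvPowerSeries.subst_X hs]; rfl
  have hψmu : ∀ i, ψ (miwa u i) = miwa u i := fun i => by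
    rw [miwa, map_smul, map_pow, hψu]
  have hψmv : ∀ i, ψ (miwa v i) = miwa u i := fun i => by
    rw [miwa, map_smul, map_pow, hψv, miwa]
  have hψs : ∀ {a b : ℕ+ → MvPowerSeries FayVar ℝ}, MvPowerSeries.HasSubst a →
      (∀ i, ψ (a i) = b i) → ∀ φ : MvPowerSeries ℕ+ ℝ, ψ (φ.subst a) = φ.subst b :=
    fun {a b} ha hab φ => by
      rw [hψ, MvPowerSeries.subst_comp_subst_apply ha hs]
      congr 1
      funext i
      rw [← hψ, hab]
  have h0 : ∀ φ : MvPowerSeries ℕ+ ℝ, ψ (φ.subst t) = φ.subst (t + miwa u) := hψs ht hψt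
  have h1 : ∀ φ : MvPowerSeries ℕ+ ℝ, ψ (φ.subst (t - miwa u)) = φ.subst t :=
    hψs htu fun i => by rw [Pi.sub_apply, map_sub, hψt, hψmu, add_sub_cancel_right]
  have h2 : ∀ φ : MvPowerSeries ℕ+ ℝ, ψ (φ.subst (t - miwa v)) = φ.subst t :=
    hψs htv fun i => by rw [Pi.sub_apply, map_sub, hψt, hψmv, add_sub_cancel_right]
  have h3 : ∀ φ : MvPowerSeries ℕ+ ℝ, ψ (φ.subst (t - miwa u - miwa v)) = φ.subst (t - miwa u) :=
    hψs htuv fun i => by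
      rw [Pi.sub_apply, Pi.sub_apply, map_sub, map_sub, hψt, hψmu, hψmv, add_sub_cancel_right]
  have h4 : ∀ φ : MvPowerSeries ℕ+ ℝ,
      ψ (MvPowerSeries.pderiv ℝ FayVar.v (φ.subst (t - miwa v))) = -S φ := fun φ => by
    have hLF : LocallyFinite fun i => (MvPowerSeries.pderiv ℝ i φ).subst (t - miwa v) *
        MvPowerSeries.pderiv ℝ FayVar.v ((t - miwa v) i) := by
      have h := ((coeffFinite_pderiv FayVar.v).locallyFinite
        (locallyFinite_of_hasSubst htv)).mul_apply fun i =>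
          (MvPowerSeries.pderiv ℝ i φ).subst (t - miwa v)
      simpa only [mul_comm] using h
    rw [pderiv_subst htv, hψ, (coeffFinite_subst hs).map_fsum hLF]
    ext m
    rw [coeff_fsum, map_neg, coeff_fsum, ← finsum_neg_distrib]
    refine finsum_congr fun i => ?_
    rw [← hψ, map_mul, h2, Pi.sub_apply, map_sub, hpt, zero_sub, pderiv_miwa_self, map_neg,
      map_pow, hψv, mul_neg, map_neg, mul_comm]
  have key := congrArg (fun φ => ψ (MvPowerSeries.pderiv ℝ FayVar.v φ)) h
  beta_reduce at key
  rw [show MvPowerSeries.pderiv ℝ (FayVar.t 1) (f.subst (t - miwa u)) =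
      (MvPowerSeries.pderiv ℝ 1 f).subst (t - miwa u) from
      hD u htu (pderiv_miwa_of_ne (by simp)) f,
    show MvPowerSeries.pderiv ℝ (FayVar.t 1) (f.subst (t - miwa v)) =
      (MvPowerSeries.pderiv ℝ 1 f).subst (t - miwa v) from
      hD v htv (pderiv_miwa_of_ne (by simp)) f] at key
  have hpv : MvPowerSeries.pderiv ℝ FayVar.v v = 1 := MvPowerSeries.pderiv_X_self ..
  have hpu' : MvPowerSeries.pderiv ℝ FayVar.v u = 0 := MvPowerSeries.pderiv_X_of_ne (by simp)
  change ψ (MvPowerSeries.pderiv ℝ FayVar.v (u * v * ((MvPowerSeries.pderiv ℝ 1 f).subst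
      (t - miwa u) * f.subst (t - miwa v) - f.subst (t - miwa u) *
        (MvPowerSeries.pderiv ℝ 1 f).subst (t - miwa v)) + (v - u) *
      (f.subst (t - miwa u) * f.subst (t - miwa v) - f.subst t *
        f.subst (t - miwa u - miwa v)))) = ψ (MvPowerSeries.pderiv ℝ FayVar.v
      (u * v * (u * v * (u - v) * fm.subst (t - miwa u - miwa v) * fp.subst t))) at key
  simp only [Derivation.leibniz, map_add, map_sub, map_mul, smul_eq_mul, hv0, hv1, hpv, hpu', h0,
    h1, h2, h3, h4, hψu, hψv, map_zero, map_one] at key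
  linear_combination -key

/-- The coefficients of `u^{k+4}` in `bilinear_of_fayIdentity` are the Hirota equations. -/
theorem hirotaEquations_of_fayIdentity {f fm fp : MvPowerSeries ℕ+ ℝ} (h : FayIdentity fm f fp) :
    HirotaEquations fm f fp := by
  intro k
  have ht : MvPowerSeries.HasSubst fun i => (MvPowerSeries.X (FayVar.t i) :
    MvPowerSeries FayVar ℝ) := hasSubst_X_comp FayVar.t_injective
  have hS : ∀ φ ψ : MvPowerSeries ℕ+ ℝ, coeffU (k + 2)
      (φ.subst (fun i => (MvPowerSeries.X (FayVar.t i) : MvPowerSeries FayVar ℝ)) *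
        fsum fun i : ℕ+ => MvPowerSeries.X FayVar.u ^ ((i : ℕ) - 1) *
          (MvPowerSeries.pderiv ℝ i ψ).subst
            fun i => (MvPowerSeries.X (FayVar.t i) : MvPowerSeries FayVar ℝ)) =
      φ * MvPowerSeries.pderiv ℝ ⟨k + 3, by omega⟩ ψ := by
    intro φ ψ
    have hLF : LocallyFinite fun i : ℕ+ => MvPowerSeries.X FayVar.u ^ ((i : ℕ) - 1) *
        (MvPowerSeries.pderiv ℝ i ψ).subst
          fun i => (MvPowerSeries.X (FayVar.t i) : MvPowerSeries FayVar ℝ) := by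
      intro m
      have hfin : {i : ℕ+ | (i : ℕ) - 1 ≤ m FayVar.u}.Finite :=
        ((Set.finite_le_nat (m FayVar.u + 1)).preimage PNat.coe_injective.injOn).subset
          fun i (hi : (i : ℕ) - 1 ≤ m FayVar.u) => show (i : ℕ) ≤ m FayVar.u + 1 by omega
      refine hfin.subset fun i hi => ?_
      classical
      have hi : MvPowerSeries.coeff m (MvPowerSeries.X FayVar.u ^ ((i : ℕ) - 1) *
        (MvPowerSeries.pderiv ℝ i ψ).subst
          fun i => (MvPowerSeries.X (FayVar.t i) : MvPowerSeries FayVar ℝ)) ≠ 0 := hi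
      rw [MvPowerSeries.X_pow_eq, MvPowerSeries.coeff_monomial_mul] at hi
      have := Finsupp.single_le_iff.1 (of_not_not fun h => hi (if_neg h))
      exact this
    rw [fsum_mul_left hLF, (coeffFinite_coeffU _).map_fsum (hLF.mul_left _),
      fsum_eq_single ⟨k + 3, by omega⟩]
    · rw [mul_left_comm, ← MvPowerSeries.subst_mul ht, coeffU_pow_mul_subst]
      exact if_pos (show k + 2 = k + 3 - 1 by omega)
    · intro i hi
      rw [mul_left_comm, ← MvPowerSeries.subst_mul ht, coeffU_pow_mul_subst, if_neg]
      intro hk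
      exact hi (PNat.eq (show (i : ℕ) = k + 3 by have := i.pos; omega))
  have key := congrArg (coeffU (k + 4)) (bilinear_of_fayIdentity h)
  rw [← hirota_schurTilde, (coeffFinite_coeffU _).map_add, coeffU_pow_mul, ← hirota_schurTilde,
    sub_eq_add_neg, (coeffFinite_coeffU _).map_add, ← MvPowerSeries.subst_mul ht,
    coeffU_mul_subst, if_neg (by omega), ← neg_one_smul ℝ (_ ^ 2 * _),
    (coeffFinite_coeffU _).map_smul, coeffU_pow_mul (k + 2) 2, sub_eq_add_neg,
    (coeffFinite_coeffU _).map_add, ← neg_one_smul ℝ (_ * fsum _),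
    (coeffFinite_coeffU _).map_smul, hS, hS] at key
  have hne : (⟨k + 3, by omega⟩ : ℕ+) ≠ 1 := fun h => by
    have : k + 3 = 1 := congrArg PNat.val h
    omega
  refine (hirota_sub _ _ _ _).trans
    ((congrArg₂ (· - ·) key (hirota_X_mul_X (1 / 2) hne f)).trans ?_)
  rw [show (2 : ℝ) * (1 / 2) = 1 by norm_num, one_smul]
  simp only [neg_smul, one_smul]
  ring

end HirotaOfFay

/-! ### Formal integrals -/

section FormalIntegral

variable {α β σ : Type*} [MeasureSpace α] [MeasureSpace β]

theorem coeff_formalIntegral (F : α → MvPowerSeries σ ℝ) (m : σ →₀ ℕ) :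
    MvPowerSeries.coeff m (formalIntegral F) = ∫ x, MvPowerSeries.coeff m (F x) := rfl

theorem FormallyIntegrable.smul {F : α → MvPowerSeries σ ℝ} (hF : FormallyIntegrable F) (c : ℝ) :
    FormallyIntegrable fun x => c • F x := fun m => by
  simpa using (hF m).const_mul c

theorem formalIntegral_smul (c : ℝ) (F : α → MvPowerSeries σ ℝ) :
    (formalIntegral fun x => c • F x) = c • formalIntegral F := by
  ext m
  simp only [coeff_formalIntegral, map_smul, smul_eq_mul, integral_const_mul]

theorem FormallyIntegrable.finsetSum {ι : Type*} {s : Finset ι} {F : ι → α → MvPowerSeries σ ℝ}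
    (hF : ∀ i ∈ s, FormallyIntegrable (F i)) : FormallyIntegrable fun x => ∑ i ∈ s, F i x :=
  fun m => by
    simp only [map_sum]
    exact integrable_finsetSum s fun i hi => hF i hi m

theorem formalIntegral_finsetSum {ι : Type*} {s : Finset ι} {F : ι → α → MvPowerSeries σ ℝ}
    (hF : ∀ i ∈ s, FormallyIntegrable (F i)) :
    (formalIntegral fun x => ∑ i ∈ s, F i x) = ∑ i ∈ s, formalIntegral (F i) := by
  ext m
  rw [coeff_formalIntegral, map_sum]
  simp only [map_sum, coeff_formalIntegral]
  exact integral_finsetSum s fun i hi => hF i hi m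

theorem FormallyIntegrable.comp_equiv {F : β → MvPowerSeries σ ℝ} (hF : FormallyIntegrable F)
    {e : α ≃ᵐ β} (he : MeasurePreserving e) : FormallyIntegrable fun x => F (e x) := fun m =>
  (he.integrable_comp_emb e.measurableEmbedding).2 (hF m)

theorem formalIntegral_comp_equiv (F : β → MvPowerSeries σ ℝ) {e : α ≃ᵐ β}
    (he : MeasurePreserving e) : (formalIntegral fun x => F (e x)) = formalIntegral F := by
  ext m
  exact he.integral_comp' (fun y => MvPowerSeries.coeff m (F y))

/-- Fubini's theorem for products of functions of separate variables. -/
theorem formallyIntegrable_prod [SigmaFinite (volume : Measure α)] {ι : Type*} [Fintype ι]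
    {F : ι → α → MvPowerSeries σ ℝ} (hF : ∀ i, FormallyIntegrable (F i)) :
    FormallyIntegrable fun x : ι → α => ∏ i, F i (x i) := fun m => by
  classical
  simp only [MvPowerSeries.coeff_prod]
  refine integrable_finsetSum _ fun l _ => ?_
  exact Integrable.fintype_prod fun i => hF i (l i)

theorem formalIntegral_prod [SigmaFinite (volume : Measure α)] {ι : Type*} [Fintype ι]
    {F : ι → α → MvPowerSeries σ ℝ} (hF : ∀ i, FormallyIntegrable (F i)) :
    (formalIntegral fun x : ι → α => ∏ i, F i (x i)) = ∏ i, formalIntegral (F i) := by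
  classical
  ext m
  rw [coeff_formalIntegral, MvPowerSeries.coeff_prod]
  simp only [MvPowerSeries.coeff_prod]
  rw [integral_finsetSum _ fun l _ => Integrable.fintype_prod fun i => hF i (l i)]
  refine Finset.sum_congr rfl fun l _ => ?_
  rw [integral_fintype_prod_volume_eq_prod fun i x => MvPowerSeries.coeff (l i) (F i x)]
  rfl

theorem formallyIntegrable_prod_pair {n : ℕ} {F : Fin n → ℝ × ℝ → MvPowerSeries σ ℝ}
    (hF : ∀ i, FormallyIntegrable (F i)) :
    FormallyIntegrable fun p : (Fin n → ℝ) × (Fin n → ℝ) => ∏ k, F k (p.1 k, p.2 k) :=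
  (formallyIntegrable_prod hF).comp_equiv
    (e := (MeasurableEquiv.arrowProdEquivProdArrow ℝ ℝ (Fin n)).symm)
    (volume_measurePreserving_arrowProdEquivProdArrow ℝ ℝ (Fin n)).symm

theorem formalIntegral_prod_pair {n : ℕ} {F : Fin n → ℝ × ℝ → MvPowerSeries σ ℝ}
    (hF : ∀ i, FormallyIntegrable (F i)) :
    (formalIntegral fun p : (Fin n → ℝ) × (Fin n → ℝ) => ∏ k, F k (p.1 k, p.2 k)) =
      ∏ k, formalIntegral (F k) :=
  (formalIntegral_comp_equiv (fun q : Fin n → ℝ × ℝ => ∏ k, F k (q k))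
    (e := (MeasurableEquiv.arrowProdEquivProdArrow ℝ ℝ (Fin n)).symm)
    (volume_measurePreserving_arrowProdEquivProdArrow ℝ ℝ (Fin n)).symm).trans
      (formalIntegral_prod hF)

/-- The pairs of coordinates of a point, for a pairing of the indices. -/
def pairCoords {n : ℕ} {κ : Type*} [Fintype κ] (e : Fin n ⊕ Fin n ≃ κ) :
    (κ → ℝ) ≃ᵐ (Fin n → ℝ × ℝ) :=
  ((MeasurableEquiv.piCongrLeft (fun _ => ℝ) e).symm.trans
    (MeasurableEquiv.sumPiEquivProdPi fun _ : Fin n ⊕ Fin n => ℝ)).trans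
      (MeasurableEquiv.arrowProdEquivProdArrow ℝ ℝ (Fin n)).symm

theorem measurePreserving_pairCoords {n : ℕ} {κ : Type*} [Fintype κ] (e : Fin n ⊕ Fin n ≃ κ) :
    MeasurePreserving (pairCoords e) :=
  ((volume_measurePreserving_arrowProdEquivProdArrow ℝ ℝ (Fin n)).symm).comp
    ((volume_measurePreserving_sumPiEquivProdPi fun _ : Fin n ⊕ Fin n => ℝ).comp
      (volume_measurePreserving_piCongrLeft (fun _ => ℝ) e).symm)

theorem formallyIntegrable_prod_pairCoords {n : ℕ} {κ : Type*} [Fintype κ]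
    (e : Fin n ⊕ Fin n ≃ κ) {F : Fin n → ℝ × ℝ → MvPowerSeries σ ℝ}
    (hF : ∀ i, FormallyIntegrable (F i)) :
    FormallyIntegrable fun x : κ → ℝ => ∏ i, F i (x (e (Sum.inl i)), x (e (Sum.inr i))) :=
  (formallyIntegrable_prod hF).comp_equiv (measurePreserving_pairCoords e)

theorem formalIntegral_prod_pairCoords {n : ℕ} {κ : Type*} [Fintype κ]
    (e : Fin n ⊕ Fin n ≃ κ) {F : Fin n → ℝ × ℝ → MvPowerSeries σ ℝ}
    (hF : ∀ i, FormallyIntegrable (F i)) :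
    (formalIntegral fun x : κ → ℝ => ∏ i, F i (x (e (Sum.inl i)), x (e (Sum.inr i)))) =
      ∏ i, formalIntegral (F i) :=
  (formalIntegral_comp_equiv (fun q : Fin n → ℝ × ℝ => ∏ k, F k (q k))
    (measurePreserving_pairCoords e)).trans (formalIntegral_prod hF)

end FormalIntegral

/-! ### The moments of a weight -/

section RealMoments

/-- All moments of a function are finite. -/
def FiniteMoments (w : ℝ → ℝ) : Prop := ∀ p : ℕ, Integrable fun x => x ^ p * w x

/-- `∬ x^k y^l w₁(x) w₂(y) ε(x - y) dx dy`. -/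
def realMoment (w₁ w₂ : ℝ → ℝ) (k l : ℕ) : ℝ :=
  ∫ p : ℝ × ℝ, p.1 ^ k * p.2 ^ l * (w₁ p.1 * w₂ p.2 * Real.sign (p.1 - p.2))

theorem measurable_real_sign : Measurable Real.sign := by
  unfold Real.sign
  exact Measurable.ite measurableSet_Iio measurable_const
    (Measurable.ite measurableSet_Ioi measurable_const measurable_const)

theorem abs_real_sign_le (x : ℝ) : |Real.sign x| ≤ 1 := by
  rcases Real.sign_apply_eq x with h | h | h <;> simp [h]

theorem integrable_mul_mul_sign {f g : ℝ → ℝ} (hf : Integrable f) (hg : Integrable g) :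
    Integrable fun p : ℝ × ℝ => f p.1 * g p.2 * Real.sign (p.1 - p.2) := by
  refine (hf.mul_prod hg).mul_bdd (c := 1) ?_ ?_
  · exact (measurable_real_sign.comp (measurable_fst.sub measurable_snd)).aestronglyMeasurable
  · exact Eventually.of_forall fun p => abs_real_sign_le _

theorem integrable_realMoment {w₁ w₂ : ℝ → ℝ} (h₁ : FiniteMoments w₁) (h₂ : FiniteMoments w₂)
    (k l : ℕ) : Integrable fun p : ℝ × ℝ =>
      p.1 ^ k * p.2 ^ l * (w₁ p.1 * w₂ p.2 * Real.sign (p.1 - p.2)) := by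
  refine (integrable_mul_mul_sign (h₁ k) (h₂ l)).congr (Eventually.of_forall fun p => ?_)
  ring

theorem realMoment_swap (w₁ w₂ : ℝ → ℝ) (k l : ℕ) :
    realMoment w₁ w₂ k l = -realMoment w₂ w₁ l k := by
  have h := integral_prod_swap (μ := (volume : Measure ℝ)) (ν := (volume : Measure ℝ))
    fun p : ℝ × ℝ => p.1 ^ k * p.2 ^ l * (w₁ p.1 * w₂ p.2 * Real.sign (p.1 - p.2))
  rw [realMoment, realMoment, ← integral_neg]
  refine h.symm.trans ?_
  congr 1
  funext p
  simp only [Prod.fst_swap, Prod.snd_swap]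
  rw [← neg_sub p.1 p.2, Real.sign_neg]
  ring

theorem realMoment_skew (w : ℝ → ℝ) (k l : ℕ) : realMoment w w k l = -realMoment w w l k :=
  realMoment_swap w w k l

/-- The coefficients of `e^{∑ (x^i X_i - y^i Y_i)}`. -/
theorem linExp_sumElim_pow (x y : ℝ) (d : ℕ+ ⊕ ℕ+ →₀ ℕ) :
    linExp (Sum.elim (fun i : ℕ+ => x ^ (i : ℕ)) (fun i : ℕ+ => -y ^ (i : ℕ))) d =
      linExp (Sum.elim (fun _ => 1) (fun _ => -1)) d *
        (x ^ wt (ι := Sum.inl) Sum.inl_injective d * y ^ wt (ι := Sum.inr) Sum.inr_injective d) := by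
  have hpow : ∀ (z : ℝ) (m : ℕ+ →₀ ℕ), (m.prod fun i e => (z ^ (i : ℕ)) ^ e) =
      z ^ m.sum fun i e => (i : ℕ) * e := fun z m => by
    rw [Finsupp.sum, ← Finset.prod_pow_eq_pow_sum]
    exact Finset.prod_congr rfl fun i _ => (pow_mul _ _ _).symm
  obtain ⟨a, b, rfl⟩ := exists_sumElim_eq d
  rw [wt, wt, Finsupp.comapDomain_inl_sumElim, Finsupp.comapDomain_inr_sumElim, ← hpow, ← hpow]
  simp only [linExp, Finsupp.prod_sumElim]
  simp only [Finsupp.prod, Function.comp_def, Sum.elim_inl, Sum.elim_inr]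
  rw [mul_mul_mul_comm, ← Finset.prod_mul_distrib, ← Finset.prod_mul_distrib]
  congr 1 <;> refine Finset.prod_congr rfl fun i _ => ?_
  · rw [one_pow]; ring
  · rw [neg_pow (y ^ (i : ℕ))]; ring

variable {U : Set ℝ} {V : ℝ → ℝ} {T S : ℕ+ →₀ ℝ}

theorem coeff_momentIntegrand (k l : ℕ) (p : ℝ × ℝ) (d : ℕ+ ⊕ ℕ+ →₀ ℕ) :
    MvPowerSeries.coeff d (momentIntegrand U V T S k l p) =
      linExp (Sum.elim (fun _ => 1) (fun _ => -1)) d *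
        (p.1 ^ (k + wt (ι := Sum.inl) Sum.inl_injective d) *
          p.2 ^ (l + wt (ι := Sum.inr) Sum.inr_injective d) *
          (weight U V T p.1 * weight U V (-S) p.2 * Real.sign (p.1 - p.2))) := by
  rw [momentIntegrand, skewWeight, map_smul, map_smul, smul_eq_mul, smul_eq_mul]
  change _ * (_ * linExp _ d) = _
  rw [linExp_sumElim_pow]
  ring

theorem formallyIntegrable_momentIntegrand (hT : HasMoments U V T) (hS : HasMoments U V (-S))
    (k l : ℕ) : FormallyIntegrable (momentIntegrand U V T S k l) := fun d => by
  simp only [coeff_momentIntegrand]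
  exact (integrable_realMoment hT hS _ _).const_mul _

theorem moment_eq_formalMoment (k l : ℕ) :
    moment U V T S k l = formalMoment (realMoment (weight U V T) (weight U V (-S))) k l := by
  ext d
  rw [moment, coeff_formalIntegral, formalMoment, coeff_momentPairing]
  simp only [coeff_momentIntegrand]
  rw [integral_const_mul]
  rfl

theorem tau_eq_det (n : ℕ) : tau U V T S n = (Matrix.of fun i j : Fin n =>
    formalMoment (realMoment (weight U V T) (weight U V (-S))) i j).det := by
  simp only [tau, momentMatrix, moment_eq_formalMoment]

theorem isTwoTodaTauVector_tau : IsTwoTodaTauVector (tau U V T S) := by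
  have h : tau U V T S = _ := funext tau_eq_det
  rw [h]
  exact isTwoTodaTauVector_det _

/-! ### The Andréief identity -/

/-- Every `π` contributes the same determinant, so that the sum over both permutations is `n!` times
it. -/
theorem sum_sum_sign_smul_prod {A : Type*} [CommRing A] [Algebra ℝ A] {n : ℕ}
    (N : Matrix (Fin n) (Fin n) A) :
    ∑ π : Equiv.Perm (Fin n), ∑ ρ : Equiv.Perm (Fin n),
      (((Equiv.Perm.sign π : ℤ) : ℝ) * ((Equiv.Perm.sign ρ : ℤ) : ℝ)) • ∏ k, N (π k) (ρ k) =
      (n.factorial : ℝ) • N.det := by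
  have hπ : ∀ π : Equiv.Perm (Fin n), ∑ ρ : Equiv.Perm (Fin n),
      (((Equiv.Perm.sign π : ℤ) : ℝ) * ((Equiv.Perm.sign ρ : ℤ) : ℝ)) • ∏ k, N (π k) (ρ k) =
      N.det := by
    intro π
    -- the double sum over permutations is the sum over `π ρ⁻¹`
    rw [Matrix.det_apply, ← Equiv.sum_comp (Equiv.mulLeft π)
      (fun σ => Equiv.Perm.sign σ • ∏ i, N (σ i) i),
      ← Equiv.sum_comp (Equiv.inv (Equiv.Perm (Fin n)))]
    refine Finset.sum_congr rfl fun ρ _ => ?_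
    have hprod : ∏ k, N (π k) (ρ⁻¹ k) = ∏ i, N ((π * ρ) i) i := by
      rw [← Equiv.prod_comp ρ]
      simp
    simp only [Equiv.inv_apply, Equiv.coe_mulLeft, Equiv.Perm.sign_inv, hprod,
      Equiv.Perm.sign_mul]
    rw [Units.smul_def, ← Int.cast_smul_eq_zsmul ℝ]
    push_cast
    rfl
  simp only [hπ]
  rw [Finset.sum_const, Finset.card_univ, Fintype.card_perm, Fintype.card_fin,
    ← Nat.cast_smul_eq_nsmul ℝ]

theorem multiIntegrand_eq (n : ℕ) (p : (Fin n → ℝ) × (Fin n → ℝ)) :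
    multiIntegrand U V T S n p = ∑ π : Equiv.Perm (Fin n), ∑ ρ : Equiv.Perm (Fin n),
      (((Equiv.Perm.sign π : ℤ) : ℝ) * ((Equiv.Perm.sign ρ : ℤ) : ℝ)) •
        ∏ k, momentIntegrand U V T S (π k) (ρ k) (p.1 k, p.2 k) := by
  rw [multiIntegrand, ← Matrix.det_transpose, Matrix.det_apply', ← Matrix.det_transpose
    (Matrix.vandermonde p.2), Matrix.det_apply', Finset.sum_mul_sum, Finset.sum_smul]
  refine Finset.sum_congr rfl fun π _ => ?_
  rw [Finset.sum_smul]
  refine Finset.sum_congr rfl fun ρ _ => ?_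
  simp only [momentIntegrand, Matrix.transpose_apply, Matrix.vandermonde_apply]
  rw [Finset.prod_smul, smul_smul, Finset.prod_mul_distrib]
  congr 1
  ring

theorem formallyIntegrable_multi_prod (hT : HasMoments U V T) (hS : HasMoments U V (-S)) {n : ℕ}
    (π ρ : Equiv.Perm (Fin n)) :
    FormallyIntegrable fun p : (Fin n → ℝ) × (Fin n → ℝ) =>
      ∏ k, momentIntegrand U V T S (π k) (ρ k) (p.1 k, p.2 k) :=
  formallyIntegrable_prod_pair fun k : Fin n =>
    formallyIntegrable_momentIntegrand hT hS (π k) (ρ k)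

theorem formallyIntegrable_multiIntegrand (hT : HasMoments U V T) (hS : HasMoments U V (-S))
    (n : ℕ) : FormallyIntegrable (multiIntegrand U V T S n) := by
  have h : multiIntegrand U V T S n = _ := funext fun p => multiIntegrand_eq n p
  rw [h]
  exact FormallyIntegrable.finsetSum fun π _ => FormallyIntegrable.finsetSum fun ρ _ =>
    (formallyIntegrable_multi_prod hT hS π ρ).smul _

/-- Andréief's formula: expand both Vandermonde determinants and integrate each product of moments.
-/
theorem tau_eq_formalIntegral (hT : HasMoments U V T) (hS : HasMoments U V (-S)) (n : ℕ) :
    tau U V T S n = (1 / (n.factorial : ℝ)) • formalIntegral (multiIntegrand U V T S n) := by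
  have h : multiIntegrand U V T S n = _ := funext fun p => multiIntegrand_eq n p
  rw [h, formalIntegral_finsetSum fun π _ => FormallyIntegrable.finsetSum fun ρ _ =>
    (formallyIntegrable_multi_prod hT hS π ρ).smul _]
  have hπ : ∀ π : Equiv.Perm (Fin n), (formalIntegral fun p : (Fin n → ℝ) × (Fin n → ℝ) =>
      ∑ ρ : Equiv.Perm (Fin n),
      (((Equiv.Perm.sign π : ℤ) : ℝ) * ((Equiv.Perm.sign ρ : ℤ) : ℝ)) •
        ∏ k, momentIntegrand U V T S (π k) (ρ k) (p.1 k, p.2 k)) =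
      ∑ ρ : Equiv.Perm (Fin n), (((Equiv.Perm.sign π : ℤ) : ℝ) * ((Equiv.Perm.sign ρ : ℤ) : ℝ)) •
        ∏ k, momentMatrix U V T S n (π k) (ρ k) := by
    intro π
    rw [formalIntegral_finsetSum fun ρ _ => (formallyIntegrable_multi_prod hT hS π ρ).smul _]
    refine Finset.sum_congr rfl fun ρ _ => ?_
    rw [formalIntegral_smul]
    congr 1
    exact formalIntegral_prod_pair fun k : Fin n =>
      formallyIntegrable_momentIntegrand hT hS (π k) (ρ k)
  simp only [hπ]
  rw [sum_sum_sign_smul_prod, smul_smul, one_div_mul_cancel (by positivity), one_smul, tau]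

end RealMoments

/-! ### The de Bruijn identity -/

section DeBruijn

open Equiv

theorem pfaffian_submatrix {R : Type*} [CommRing R] [Algebra ℝ R] {n : ℕ}
    (A : Matrix (Fin (2 * n)) (Fin (2 * n)) R) (σ : Perm (Fin (2 * n))) :
    pfaffian (A.submatrix σ σ) = ((Perm.sign σ : ℤ) : R) * pfaffian A := by
  rw [pfaffian_eq_sum_pfTerm, pfaffian_eq_sum_pfTerm, mul_smul_comm,
    ← Equiv.sum_comp (Equiv.mulLeft σ) (pfTerm A), Finset.mul_sum]
  congr 1
  refine Finset.sum_congr rfl fun ρ _ => ?_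
  have hs : ((Perm.sign σ : ℤ) : R) * ((Perm.sign σ : ℤ) : R) = 1 := by
    rw [← Int.cast_mul, ← Units.val_mul, Int.units_mul_self]
    simp
  simp only [pfTerm, Equiv.coe_mulLeft, Perm.sign_mul, Matrix.submatrix_apply, Perm.mul_apply]
  push_cast
  rw [← mul_assoc, ← mul_assoc, hs, one_mul]

/-- For increasing arguments all signs above the diagonal are `1`, and the expansion along the first
row is an alternating sum of an odd number of equal Pfaffians. -/
theorem pfaffian_sign_of_strictMono {n : ℕ} {y : Fin (2 * n) → ℝ} (hy : StrictMono y) :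
    pfaffian (Matrix.of fun i j => Real.sign (y j - y i)) = 1 := by
  induction n with
  | zero => simp [pfaffian]
  | succ n ih =>
    rw [pfaffian_succ fun i j => by
      rw [Matrix.of_apply, Matrix.of_apply, ← Real.sign_neg, neg_sub]]
    have hterm : ∀ j : Fin (2 * n + 1), (-1 : ℝ) ^ (j : ℕ) *
        (Matrix.of fun i j => Real.sign (y j - y i)) 0 j.succ *
        pfaffian (Matrix.of fun a b : Fin (2 * n) => (Matrix.of fun i j =>
          Real.sign (y j - y i)) (j.succAbove a).succ (j.succAbove b).succ) =
        (-1 : ℝ) ^ (j : ℕ) := by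
      intro j
      have h1 := ih (y := fun a => y (j.succAbove a).succ) fun a b hab =>
        hy (Fin.succ_lt_succ_iff.2 (Fin.strictMono_succAbove j hab))
      have h2 : (Matrix.of fun i j => Real.sign (y j - y i)) 0 j.succ = 1 :=
        Real.sign_of_pos (sub_pos.2 (hy (Fin.succ_pos j)))
      rw [h2, mul_one]
      refine Eq.trans (congrArg (_ * ·) ?_) (mul_one _)
      exact h1
    rw [Finset.sum_congr rfl fun j _ => hterm j,
      Fin.sum_univ_eq_sum_range (fun j => (-1 : ℝ) ^ j), Finset.sum_range_succ]
    have hz : ∑ j ∈ Finset.range (2 * n), (-1 : ℝ) ^ j = 0 := by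
      rw [neg_one_geom_sum, if_pos (even_two_mul n)]
    rw [hz, zero_add, pow_mul]
    simp

theorem vandermonde_det_comp_perm {n : ℕ} (x : Fin n → ℝ) (σ : Perm (Fin n)) :
    (Matrix.vandermonde (x ∘ σ)).det = ((Perm.sign σ : ℤ) : ℝ) * (Matrix.vandermonde x).det := by
  rw [← Matrix.det_permute]
  rfl

/-- The sign of the Vandermonde determinant is a Pfaffian. -/
theorem abs_vandermonde_det {n : ℕ} (x : Fin (2 * n) → ℝ) :
    |(Matrix.vandermonde x).det| =
      (Matrix.vandermonde x).det * pfaffian (Matrix.of fun i j => Real.sign (x j - x i)) := by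
  by_cases hx : Function.Injective x
  · set σ := Tuple.sort x
    have hy : StrictMono (x ∘ σ) :=
      (Tuple.monotone_sort x).strictMono_of_injective (hx.comp σ.injective)
    have h1 := pfaffian_sign_of_strictMono hy
    have h2 := pfaffian_submatrix (Matrix.of fun i j => Real.sign (x j - x i)) σ
    have h3 : (Matrix.of fun i j => Real.sign (x j - x i)).submatrix σ σ =
        Matrix.of fun i j => Real.sign ((x ∘ σ) j - (x ∘ σ) i) := rfl
    rw [h3, h1] at h2
    have h4 := vandermonde_det_comp_perm x σ
    have h5 : 0 ≤ (Matrix.vandermonde (x ∘ σ)).det := by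
      rw [Matrix.det_vandermonde]
      refine Finset.prod_nonneg fun i _ => Finset.prod_nonneg fun j hj => ?_
      exact sub_nonneg.2 (hy (Finset.mem_Ioi.1 hj)).le
    rcases Int.units_eq_one_or (Perm.sign σ) with hs | hs
    · simp only [hs, Units.val_one, Int.cast_one, one_mul] at h2 h4
      rw [← h2, mul_one, ← h4, abs_of_nonneg h5]
    · simp only [hs, Units.val_neg, Units.val_one, Int.cast_neg, Int.cast_one, neg_mul,
        one_mul] at h2 h4
      rw [show pfaffian (Matrix.of fun i j => Real.sign (x j - x i)) = -1 by linarith, mul_neg_one,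
        ← h4, abs_of_nonpos (by linarith), h4]
  · have h0 : (Matrix.vandermonde x).det = 0 := by
      rw [Matrix.det_vandermonde_eq_zero_iff]
      simpa [Function.Injective] using hx
    rw [h0, abs_zero, zero_mul]

/-- The function `w(x) e^{∑ x^i X_i}`. -/
def weightSeries (w : ℝ → ℝ) (x : ℝ) : MvPowerSeries ℕ+ ℝ :=
  w x • linExp fun i : ℕ+ => x ^ (i : ℕ)

/-- The integrand of `μ_{kl}(t, -t)`. -/
def diagIntegrand (w : ℝ → ℝ) (k l : ℕ) (p : ℝ × ℝ) : MvPowerSeries ℕ+ ℝ :=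
  (p.1 ^ k * p.2 ^ l * Real.sign (p.1 - p.2)) • (weightSeries w p.1 * weightSeries w p.2)

theorem linExp_pow (x : ℝ) (d : ℕ+ →₀ ℕ) :
    linExp (fun i : ℕ+ => x ^ (i : ℕ)) d =
      linExp (fun _ => 1) d * x ^ wt (ι := id) Function.injective_id d := by
  have hwt : wt (ι := id) Function.injective_id d = d.sum fun i e => (i : ℕ) * e := by
    rw [wt]
    congr 1
    ext i
    simp
  rw [hwt, Finsupp.sum, ← Finset.prod_pow_eq_pow_sum]
  simp only [linExp, Finsupp.prod, ← Finset.prod_mul_distrib]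
  refine Finset.prod_congr rfl fun i _ => ?_
  rw [one_pow, pow_mul]
  ring

theorem coeff_diagMoment [DecidableEq ℕ+] (M : ℕ → ℕ → ℝ) (k l : ℕ) (d : ℕ+ →₀ ℕ) :
    MvPowerSeries.coeff d (diagMoment M k l) =
      ∑ p ∈ Finset.HasAntidiagonal.antidiagonal d,
        linExp (fun _ => 1) p.1 * linExp (fun _ => 1) p.2 *
          M (k + wt (ι := id) Function.injective_id p.1)
            (l + wt (ι := id) Function.injective_id p.2) := by
  have hX : ∀ (r : ℕ) (e : ℕ+ →₀ ℕ), MvPowerSeries.coeff e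
      (schur (MvPowerSeries.X : ℕ+ → MvPowerSeries ℕ+ ℝ) r) =
        if wt (ι := id) Function.injective_id e = r then linExp (fun _ => 1) e else 0 := by
    intro r e
    have := coeff_schur_smul_X (fun _ => 1) r e
    simpa only [one_smul] using this
  rw [diagMoment, momentPairing, coeff_fsum]
  simp only [map_smul, MvPowerSeries.coeff_mul, hX, smul_eq_mul, Finset.mul_sum]
  rw [finsum_sum_comm]
  · refine Finset.sum_congr rfl fun p _ => ?_
    rw [finsum_eq_single _ (wt (ι := id) Function.injective_id p.1,
      wt (ι := id) Function.injective_id p.2)]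
    · rw [if_pos rfl, if_pos rfl, mul_comm]
    · rintro ⟨r, s⟩ hrs
      by_cases h : wt (ι := id) Function.injective_id p.1 = r
      · rw [if_neg (c := _ = s) fun h' => hrs (by rw [h, h']), mul_zero, mul_zero]
      · rw [if_neg h, zero_mul, mul_zero]
  · intro p _
    refine (Set.finite_singleton (wt (ι := id) Function.injective_id p.1,
      wt (ι := id) Function.injective_id p.2)).subset ?_
    rintro ⟨r, s⟩ hrs
    simp only [Function.mem_support, ne_eq, mul_eq_zero, not_or, ite_eq_right_iff,
      Classical.not_imp] at hrs
    exact Prod.ext hrs.2.1.1.symm hrs.2.2.1.symm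

theorem coeff_diagIntegrand [DecidableEq ℕ+] (w : ℝ → ℝ) (k l : ℕ) (p : ℝ × ℝ) (d : ℕ+ →₀ ℕ) :
    MvPowerSeries.coeff d (diagIntegrand w k l p) =
      ∑ q ∈ Finset.HasAntidiagonal.antidiagonal d,
        linExp (fun _ => 1) q.1 * linExp (fun _ => 1) q.2 *
          (p.1 ^ (k + wt (ι := id) Function.injective_id q.1) *
            p.2 ^ (l + wt (ι := id) Function.injective_id q.2) *
              (w p.1 * w p.2 * Real.sign (p.1 - p.2))) := by
  rw [diagIntegrand, map_smul, MvPowerSeries.coeff_mul, smul_eq_mul, Finset.mul_sum]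
  refine Finset.sum_congr rfl fun q _ => ?_
  rw [weightSeries, weightSeries, map_smul, map_smul]
  change _ * ((_ * linExp _ q.1) * (_ * linExp _ q.2)) = _
  rw [linExp_pow, linExp_pow]
  ring

theorem formallyIntegrable_diagIntegrand {w : ℝ → ℝ} (hw : FiniteMoments w) (k l : ℕ) :
    FormallyIntegrable (diagIntegrand w k l) := fun d => by
  classical
  simp only [coeff_diagIntegrand]
  exact integrable_finsetSum _ fun q _ => (integrable_realMoment hw hw _ _).const_mul _

theorem formalIntegral_diagIntegrand {w : ℝ → ℝ} (hw : FiniteMoments w) (k l : ℕ) :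
    formalIntegral (diagIntegrand w k l) = diagMoment (realMoment w w) k l := by
  classical
  ext d
  rw [coeff_formalIntegral, coeff_diagMoment]
  simp only [coeff_diagIntegrand]
  rw [integral_finsetSum _ fun q _ => (integrable_realMoment hw hw _ _).const_mul _]
  refine Finset.sum_congr rfl fun q _ => ?_
  rw [integral_const_mul]
  rfl

/-- The first and the second members of the pairs. -/
def sumPairEquiv (n : ℕ) : Fin n ⊕ Fin n ≃ Fin n × Fin 2 where
  toFun := Sum.elim (fun i => (i, 0)) fun i => (i, 1)
  invFun p := if p.2 = 0 then Sum.inl p.1 else Sum.inr p.1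
  left_inv := by rintro (i | i) <;> simp
  right_inv := by
    rintro ⟨i, b⟩
    fin_cases b <;> simp

variable {w : ℝ → ℝ} {n : ℕ}

/-- The part of the integrand that belongs to a permutation `σ` in the Pfaffian of the signs and a
permutation `π` in the Vandermonde determinant. -/
theorem deBruijn_term (σ π : Perm (Fin (2 * n))) (x : Fin (2 * n) → ℝ) :
    ((∏ i : Fin n, Real.sign (x (σ (pairEquiv n (i, 1))) - x (σ (pairEquiv n (i, 0))))) *
        ∏ k, x k ^ (π k : ℕ)) • ∏ k, weightSeries w (x k) =
      (-1 : ℝ) ^ n • ∏ i : Fin n, diagIntegrand w (π (σ (pairEquiv n (i, 0))))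
        (π (σ (pairEquiv n (i, 1)))) (x (σ (pairEquiv n (i, 0))), x (σ (pairEquiv n (i, 1)))) := by
  have hsplit : ∀ {A : Type} [CommMonoid A] (f : Fin (2 * n) → A), ∏ k, f k =
      ∏ i : Fin n, (f (σ (pairEquiv n (i, 0))) * f (σ (pairEquiv n (i, 1)))) := by
    intro A _ f
    rw [← Equiv.prod_comp ((pairEquiv n).trans σ), Fintype.prod_prod_type]
    simp only [Fin.prod_univ_two, Equiv.trans_apply]
  rw [hsplit fun k => x k ^ (π k : ℕ), hsplit fun k => weightSeries w (x k)]
  simp only [diagIntegrand]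
  rw [Finset.prod_smul, smul_smul, Finset.prod_mul_distrib (f := fun i => _ * _)]
  congr 1
  have h1 : (-1 : ℝ) ^ n = ∏ _i : Fin n, (-1 : ℝ) := by simp
  rw [h1, ← Finset.prod_mul_distrib, ← Finset.prod_mul_distrib, ← Finset.prod_mul_distrib]
  refine Finset.prod_congr rfl fun i _ => ?_
  rw [← neg_sub, Real.sign_neg]
  ring

theorem pfIntegrand_eq_sum (U : Set ℝ) (V : ℝ → ℝ) (T : ℕ+ →₀ ℝ) (x : Fin (2 * n) → ℝ) :
    pfIntegrand U V T (2 * n) x = ∑ σ : Perm (Fin (2 * n)), ∑ π : Perm (Fin (2 * n)),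
      ((1 / (2 ^ n * (n.factorial : ℝ))) * (((Perm.sign (π * σ) : ℤ) : ℝ) * (-1) ^ n)) •
        ∏ i : Fin n, diagIntegrand (weight U V T) (π (σ (pairEquiv n (i, 0))))
          (π (σ (pairEquiv n (i, 1))))
            (x (σ (pairEquiv n (i, 0))), x (σ (pairEquiv n (i, 1)))) := by
  change |(Matrix.vandermonde x).det| • ∏ k, weightSeries (weight U V T) (x k) = _
  rw [abs_vandermonde_det, pfaffian_eq_sum_pfTerm, ← Matrix.det_transpose, Matrix.det_apply',
    mul_comm, smul_eq_mul, mul_assoc, Finset.sum_mul_sum, Finset.mul_sum, Finset.sum_smul]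
  refine Finset.sum_congr rfl fun σ _ => ?_
  rw [Finset.mul_sum, Finset.sum_smul]
  refine Finset.sum_congr rfl fun π _ => ?_
  have h1 : 1 / (2 ^ n * (n.factorial : ℝ)) * (((Perm.sign (π * σ) : ℤ) : ℝ) * (-1) ^ n) =
      1 / (2 ^ n * (n.factorial : ℝ)) * ((Perm.sign (π * σ) : ℤ) : ℝ) * (-1) ^ n := by ring
  rw [h1, mul_smul (_ * _) ((-1 : ℝ) ^ n), ← deBruijn_term, smul_smul]
  refine congrArg (· • _) ?_
  change 1 / _ * ((((Perm.sign σ : ℤ) : ℝ) * ∏ i : Fin n,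
      Real.sign (x (σ (pairEquiv n (i, 1))) - x (σ (pairEquiv n (i, 0))))) *
    (((Perm.sign π : ℤ) : ℝ) * ∏ k, x k ^ (π k : ℕ))) = _
  rw [Perm.sign_mul]
  push_cast
  ring

variable {U : Set ℝ} {V : ℝ → ℝ} {T : ℕ+ →₀ ℝ}

theorem formallyIntegrable_deBruijn_prod (hw : FiniteMoments w) (σ π : Perm (Fin (2 * n))) :
    FormallyIntegrable fun x : Fin (2 * n) → ℝ =>
      ∏ i : Fin n, diagIntegrand w (π (σ (pairEquiv n (i, 0)))) (π (σ (pairEquiv n (i, 1))))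
        (x (σ (pairEquiv n (i, 0))), x (σ (pairEquiv n (i, 1)))) :=
  formallyIntegrable_prod_pairCoords ((sumPairEquiv n).trans ((pairEquiv n).trans σ))
    (F := fun i => diagIntegrand w (π (σ (pairEquiv n (i, 0)))) (π (σ (pairEquiv n (i, 1)))))
    fun _ => formallyIntegrable_diagIntegrand hw _ _

theorem formallyIntegrable_pfIntegrand (hT : HasMoments U V T) (n : ℕ) :
    FormallyIntegrable (pfIntegrand U V T (2 * n)) := by
  have h : pfIntegrand U V T (2 * n) = _ := funext fun x => pfIntegrand_eq_sum U V T x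
  rw [h]
  exact FormallyIntegrable.finsetSum fun σ _ => FormallyIntegrable.finsetSum fun π _ =>
    (formallyIntegrable_deBruijn_prod hT σ π).smul _

/-- De Bruijn's formula: with `|Δ|` written as a Vandermonde determinant times a Pfaffian of signs,
the integral factors into moments for each pair of permutations. -/
theorem pfTau_eq_pfSeries (hT : HasMoments U V T) (n : ℕ) :
    pfTau U V T (2 * n) = pfSeries (realMoment (weight U V T) (weight U V T)) n := by
  have h : pfIntegrand U V T (2 * n) = _ := funext fun x => pfIntegrand_eq_sum U V T x
  rw [pfTau, h, formalIntegral_finsetSum fun σ _ => FormallyIntegrable.finsetSum fun π _ =>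
    (formallyIntegrable_deBruijn_prod hT σ π).smul _]
  have hσ : ∀ σ : Perm (Fin (2 * n)), (formalIntegral fun x : Fin (2 * n) → ℝ =>
      ∑ π : Perm (Fin (2 * n)),
        ((1 / (2 ^ n * (n.factorial : ℝ))) * (((Perm.sign (π * σ) : ℤ) : ℝ) * (-1) ^ n)) •
          ∏ i : Fin n, diagIntegrand (weight U V T) (π (σ (pairEquiv n (i, 0))))
            (π (σ (pairEquiv n (i, 1))))
              (x (σ (pairEquiv n (i, 0))), x (σ (pairEquiv n (i, 1))))) =
      pfSeries (realMoment (weight U V T) (weight U V T)) n := by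
    intro σ
    rw [formalIntegral_finsetSum fun π _ => (formallyIntegrable_deBruijn_prod hT σ π).smul _]
    have hπ : ∀ π : Perm (Fin (2 * n)), (formalIntegral fun x : Fin (2 * n) → ℝ =>
        ((1 / (2 ^ n * (n.factorial : ℝ))) * (((Perm.sign (π * σ) : ℤ) : ℝ) * (-1) ^ n)) •
          ∏ i : Fin n, diagIntegrand (weight U V T) (π (σ (pairEquiv n (i, 0))))
            (π (σ (pairEquiv n (i, 1))))
              (x (σ (pairEquiv n (i, 0))), x (σ (pairEquiv n (i, 1))))) =
        ((1 / (2 ^ n * (n.factorial : ℝ))) * (-1) ^ n) • pfTerm (Matrix.of fun i j : Fin (2 * n) =>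
          diagMoment (realMoment (weight U V T) (weight U V T)) i j) (π * σ) := by
      intro π
      have hint := formalIntegral_prod_pairCoords
        ((sumPairEquiv n).trans ((pairEquiv n).trans σ))
        (F := fun i => diagIntegrand (weight U V T) (π (σ (pairEquiv n (i, 0))))
          (π (σ (pairEquiv n (i, 1))))) fun _ => formallyIntegrable_diagIntegrand hT _ _
      simp only [formalIntegral_diagIntegrand hT] at hint
      rw [formalIntegral_smul]
      refine (congrArg (_ • ·) hint).trans ?_
      rw [pfTerm, ← mul_assoc, mul_right_comm, mul_smul]
      congr 1
      rw [Int.cast_smul_eq_zsmul ℝ, zsmul_eq_mul]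
      rfl
    simp only [hπ]
    refine (Equiv.sum_comp (Equiv.mulRight σ) fun ρ =>
      ((1 / (2 ^ n * (n.factorial : ℝ))) * (-1) ^ n) • pfTerm (Matrix.of fun i j : Fin (2 * n) =>
        diagMoment (realMoment (weight U V T) (weight U V T)) i j) ρ).trans ?_
    rw [← Finset.smul_sum, mul_comm, mul_smul, ← pfaffian_eq_sum_pfTerm, pfSeries, pfSeq]
    rcases Nat.even_or_odd n with h1 | h1
    · rw [h1.neg_one_pow, h1.neg_one_pow, one_smul, one_mul]
    · rw [h1.neg_one_pow, h1.neg_one_pow, neg_one_smul, neg_one_mul]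
  simp only [hσ]
  rw [Finset.sum_const, Finset.card_univ, Fintype.card_perm, Fintype.card_fin,
    ← Nat.cast_smul_eq_nsmul ℝ, smul_smul, one_div_mul_cancel (by positivity), one_smul]

end DeBruijn

/-! ### The Pfaffian τ-functions -/

section PfTau

variable {U : Set ℝ} {V : ℝ → ℝ} {T : ℕ+ →₀ ℝ}

theorem pfTau_eq_pfaffian (hT : HasMoments U V T) (n : ℕ) :
    pfTau U V T (2 * n) =
      (-1) ^ n * pfaffian ((momentMatrix U V T (-T) (2 * n)).map restrictDiag) := by
  rw [pfTau_eq_pfSeries hT, pfSeries, pfSeq]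
  congr 2
  ext1 i j
  rw [Matrix.map_apply, momentMatrix, Matrix.of_apply, Matrix.of_apply, moment_eq_formalMoment,
    formalMoment_subst_diag, neg_neg]

theorem weight_nonneg (x : ℝ) : 0 ≤ weight U V T x :=
  Set.indicator_nonneg (fun _ _ => (Real.exp_pos _).le) x

theorem weight_pos {x : ℝ} (hx : x ∈ U) : 0 < weight U V T x := by
  rw [weight, Set.indicator_of_mem hx]
  exact Real.exp_pos _

theorem coeff_zero_pfIntegrand (N : ℕ) (x : Fin N → ℝ) :
    MvPowerSeries.coeff 0 (pfIntegrand U V T N x) =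
      |(Matrix.vandermonde x).det| * ∏ k, weight U V T (x k) := by
  rw [pfIntegrand, map_smul, smul_eq_mul, MvPowerSeries.coeff_zero_eq_constantCoeff, map_prod]
  congr 1
  refine Finset.prod_congr rfl fun k _ => ?_
  rw [← MvPowerSeries.coeff_zero_eq_constantCoeff, map_smul, smul_eq_mul]
  change _ * linExp (fun i : ℕ+ => x k ^ (i : ℕ)) 0 = _
  rw [linExp_zero, mul_one]

theorem constantCoeff_pfTau_pos (hU : IsOpen U) (hne : U.Nonempty) (hT : HasMoments U V T) (n : ℕ) :
    0 < MvPowerSeries.constantCoeff (pfTau U V T (2 * n)) := by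
  rw [← MvPowerSeries.coeff_zero_eq_constantCoeff_apply, pfTau, map_smul, smul_eq_mul,
    coeff_formalIntegral]
  refine mul_pos (by positivity) ?_
  have hnn : 0 ≤ fun x : Fin (2 * n) → ℝ => MvPowerSeries.coeff 0 (pfIntegrand U V T (2 * n) x) :=
    fun x => by
      simp only [coeff_zero_pfIntegrand, Pi.zero_apply]
      exact mul_nonneg (abs_nonneg _) (Finset.prod_nonneg fun k _ => weight_nonneg _)
  rw [integral_pos_iff_support_of_nonneg hnn (formallyIntegrable_pfIntegrand hT n 0)]
  have hopen : IsOpen ((Set.univ.pi fun _ : Fin (2 * n) => U) ∩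
      {x : Fin (2 * n) → ℝ | (Matrix.vandermonde x).det ≠ 0}) := by
    refine (isOpen_set_pi Set.finite_univ fun _ _ => hU).inter (isOpen_ne_fun ?_ continuous_const)
    simp only [Matrix.det_vandermonde]
    fun_prop
  obtain ⟨x₀, hx₀⟩ := hne
  have hinf : U.Infinite := infinite_of_mem_nhds x₀ (hU.mem_nhds hx₀)
  refine (hopen.measure_pos volume ⟨fun i => hinf.natEmbedding _ (i : ℕ), fun i _ =>
    (hinf.natEmbedding _ (i : ℕ)).2, ?_⟩).trans_le (measure_mono ?_)
  · exact Matrix.det_vandermonde_ne_zero_iff.2 (Subtype.val_injective.comp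
      ((hinf.natEmbedding _).injective.comp Fin.val_injective))
  · rintro x ⟨hx, hdet⟩
    rw [Function.mem_support, coeff_zero_pfIntegrand]
    exact mul_ne_zero (abs_ne_zero.2 hdet)
      (Finset.prod_ne_zero_iff.2 fun k _ => (weight_pos (hx k trivial)).ne')

theorem diagMoment_skew {M : ℕ → ℕ → ℝ} (hM : ∀ k l, M k l = -M l k) (k l : ℕ) :
    diagMoment M k l = -diagMoment M l k := momentPairing_skew hM _ k l

/-- A nondegenerate Pfaffian series squares to the determinant of the moments. -/
theorem pfSeries_sq {M : ℕ → ℕ → ℝ} (hM : ∀ k l, M k l = -M l k) (n : ℕ)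
    (hpos : ∀ m < n, MvPowerSeries.constantCoeff (pfSeries M m) ≠ 0) :
    pfSeries M n ^ 2 = (Matrix.of fun i j : Fin (2 * n) => diagMoment M i j).det := by
  have h := fun m => gramPf_desc_eq_pfSeq
    (adjoinForm_momentVec (N := diagMoment M) (c := fun _ _ => 0)) m
  have hsq := gramPf_desc_sq (adjoinForm_skew (c := fun _ _ => 0) (diagMoment_skew hM)) momentVec n
    fun m hm => by
      rw [h]
      exact MvPowerSeries.isUnit_iff_constantCoeff.2 (hpos m hm).isUnit
  rw [h] at hsq
  rw [pfSeries, hsq, ← Matrix.det_submatrix_equiv_self Fin.revPerm]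
  congr 1
  ext1 i j
  simp only [Matrix.of_apply, Matrix.submatrix_apply, desc, adjoinForm_momentVec,
    Fin.revPerm_apply, Fin.val_rev]
  congr 1 <;> omega

theorem realMoment_zero : realMoment 0 0 = 0 := by
  funext k l
  simp [realMoment]

theorem diagMoment_zero : diagMoment 0 = 0 := by
  classical
  funext k l
  ext d
  rw [coeff_diagMoment]
  simp

theorem restrictDiag_tau (n : ℕ) : restrictDiag (tau U V T (-T) n) =
    (Matrix.of fun i j : Fin n =>
      diagMoment (realMoment (weight U V T) (weight U V T)) i j).det := by
  rw [tau_eq_det, neg_neg]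
  refine (det_subst (hasSubst_sumElim hasSubst_X (hasSubst_neg hasSubst_X)) _).trans ?_
  congr 1
  ext1 i j
  exact formalMoment_subst_diag _ _ _

theorem weight_empty : weight ∅ V T = 0 := by
  funext x
  simp [weight]

theorem pfSeries_zero_right (M : ℕ → ℕ → ℝ) : pfSeries M 0 = 1 := by
  simp [pfSeries, pfSeq, pfaffian]

theorem pfSeries_of_zero {n : ℕ} (hn : n ≠ 0) : pfSeries 0 n = 0 := by
  rw [pfSeries, pfSeq, diagMoment_zero, pfaffian]
  simp [hn]

/-- For nonempty `U` all the constant terms are positive, so that `pfSeries_sq` applies; for empty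
`U` both sides are `1` (`n = 0`) or `0`. -/
theorem pfTau_sq (hU : IsOpen U) (hT : HasMoments U V T) (n : ℕ) :
    pfTau U V T (2 * n) ^ 2 = restrictDiag (tau U V T (-T) (2 * n)) := by
  rw [restrictDiag_tau, pfTau_eq_pfSeries hT]
  rcases U.eq_empty_or_nonempty with rfl | hne
  · rw [weight_empty, realMoment_zero]
    rcases eq_or_ne n 0 with rfl | hn
    · simp [pfSeries_zero_right]
    · rw [pfSeries_of_zero hn, diagMoment_zero, zero_pow two_ne_zero]
      have : Nonempty (Fin (2 * n)) := ⟨⟨0, by omega⟩⟩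
      exact Matrix.det_zero.symm
  · refine pfSeries_sq (realMoment_skew _) n fun m _ => ?_
    rw [← pfTau_eq_pfSeries hT]
    exact (constantCoeff_pfTau_pos hU hne hT m).ne'

/-- The degenerate case of an empty support. -/
theorem fayIdentity_zero (fm : MvPowerSeries ℕ+ ℝ) : FayIdentity fm 0 0 := by
  have h : ∀ a : ℕ+ → MvPowerSeries FayVar ℝ, MvPowerSeries.HasSubst a →
      (0 : MvPowerSeries ℕ+ ℝ).subst a = 0 := fun a ha => (coeffFinite_subst ha).map_zero
  have ht : MvPowerSeries.HasSubst fun i => (MvPowerSeries.X (FayVar.t i) :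
    MvPowerSeries FayVar ℝ) := hasSubst_X_comp FayVar.t_injective
  simp only [FayIdentity]
  rw [h _ ht, h _ (hasSubst_sub ht (hasSubst_miwa_X _)),
    h _ (hasSubst_sub ht (hasSubst_miwa_X _))]
  simp

theorem fayIdentity_pfTau (hU : IsOpen U) (hT : HasMoments U V T) (n : ℕ) :
    FayIdentity (if n = 0 then 0 else pfTau U V T (2 * n - 2)) (pfTau U V T (2 * n))
      (pfTau U V T (2 * n + 2)) := by
  rw [show 2 * n - 2 = 2 * (n - 1) by omega, show 2 * n + 2 = 2 * (n + 1) by omega,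
    pfTau_eq_pfSeries hT, pfTau_eq_pfSeries hT, pfTau_eq_pfSeries hT]
  by_cases h : MvPowerSeries.constantCoeff
      (pfSeries (realMoment (weight U V T) (weight U V T)) n) = 0
  · rcases U.eq_empty_or_nonempty with rfl | hne
    · have hn : n ≠ 0 := by
        rintro rfl
        rw [pfSeries_zero_right, map_one] at h
        exact one_ne_zero h
      rw [weight_empty, realMoment_zero, pfSeries_of_zero hn, pfSeries_of_zero n.succ_ne_zero]
      exact fayIdentity_zero _
    · rw [← pfTau_eq_pfSeries hT] at h
      exact absurd h (constantCoeff_pfTau_pos hU hne hT n).ne'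
  · exact fayIdentity_pfSeries (realMoment_skew _) n h

end PfTau

/-! ### Derivatives with respect to the base point -/

section BasePoint

/-- Differentiation under the integral sign; integrability for both signs of a small `h` dominates
`|q| e^{h q}`. -/
theorem hasDerivAt_integral_mul_exp {α : Type*} [MeasurableSpace α] {μ : Measure α}
    {F q : α → ℝ} (hq : Measurable q)
    (hF : ∀ᶠ h in 𝓝 (0 : ℝ), Integrable (fun x => F x * Real.exp (h * q x)) μ) :
    HasDerivAt (fun h : ℝ => ∫ x, F x * Real.exp (h * q x) ∂μ) (∫ x, F x * q x ∂μ) 0 := by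
  obtain ⟨δ, hδ, hball⟩ := Metric.eventually_nhds_iff.1 hF
  have hint : ∀ h : ℝ, |h| < δ → Integrable (fun x => F x * Real.exp (h * q x)) μ := fun h hh =>
    hball (by rwa [Real.dist_eq, sub_zero])
  have h0 : Integrable F μ := by simpa using hint 0 (by simpa using hδ)
  set ε := δ / 2 with hε
  have hεpos : 0 < ε := by positivity
  have h1 := hint ε (by rw [abs_of_pos hεpos]; linarith)
  have h2 := hint (-ε) (by rw [abs_neg, abs_of_pos hεpos]; linarith)
  have hm : ∀ h : ℝ, AEStronglyMeasurable (fun x => F x * Real.exp (h * q x)) μ := fun h =>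
    h0.aestronglyMeasurable.mul (Real.measurable_exp.comp (hq.const_mul h)).aestronglyMeasurable
  have hd := (hasDerivAt_integral_of_dominated_loc_of_deriv_le (μ := μ) (x₀ := (0 : ℝ))
    (s := Metric.ball 0 (ε / 2)) (F := fun h x => F x * Real.exp (h * q x))
    (F' := fun h x => F x * (Real.exp (h * q x) * q x))
    (bound := fun x => 2 / ε * (‖F x * Real.exp (ε * q x)‖ + ‖F x * Real.exp (-ε * q x)‖))
    (Metric.ball_mem_nhds _ (by positivity)) (Eventually.of_forall hm) (by simpa using h0) ?_ ?_
    ((h1.norm.add h2.norm).const_mul _) ?_).2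
  · simpa using hd
  · exact h0.aestronglyMeasurable.mul
      (((Real.measurable_exp.comp (hq.const_mul 0)).mul hq).aestronglyMeasurable)
  · refine Eventually.of_forall fun x h hh => ?_
    have hh : |h| < ε / 2 := by simpa [Real.dist_eq] using hh
    simp only [norm_mul, Real.norm_eq_abs, Real.abs_exp]
    rw [← mul_add, mul_left_comm (2 / ε)]
    refine mul_le_mul_of_nonneg_left ?_ (abs_nonneg (F x))
    -- half of the exponent absorbs the factor `q`
    have e1 : |q x| ≤ 2 / ε * Real.exp (ε / 2 * |q x|) := by
      have := Real.add_one_le_exp (ε / 2 * |q x|)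
      rw [div_mul_eq_mul_div, le_div_iff₀ hεpos]
      linarith
    have e2 : Real.exp (h * q x) ≤ Real.exp (ε / 2 * |q x|) := by
      refine Real.exp_le_exp.2 ((le_abs_self _).trans ?_)
      rw [abs_mul]
      exact mul_le_mul_of_nonneg_right hh.le (abs_nonneg _)
    have e3 : Real.exp (ε * |q x|) ≤ Real.exp (ε * q x) + Real.exp (-ε * q x) := by
      rcases abs_choice (q x) with h' | h' <;> rw [h']
      · exact le_add_of_nonneg_right (Real.exp_pos _).le
      · rw [mul_neg, neg_mul]
        exact le_add_of_nonneg_left (Real.exp_pos _).le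
    calc Real.exp (h * q x) * |q x|
        ≤ Real.exp (ε / 2 * |q x|) * (2 / ε * Real.exp (ε / 2 * |q x|)) :=
          mul_le_mul e2 e1 (abs_nonneg _) (Real.exp_pos _).le
      _ = 2 / ε * Real.exp (ε * |q x|) := by
          rw [mul_left_comm, ← Real.exp_add]
          ring_nf
      _ ≤ _ := mul_le_mul_of_nonneg_left e3 (by positivity)
  · refine Eventually.of_forall fun x h _ => ?_
    refine HasDerivAt.const_mul _ ?_
    have := ((hasDerivAt_id h).mul_const (q x)).exp
    simpa using this

variable {U : Set ℝ} {V : ℝ → ℝ} {T S : ℕ+ →₀ ℝ}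

theorem timePoly_add (T T' : ℕ+ →₀ ℝ) (x : ℝ) :
    timePoly (T + T') x = timePoly T x + timePoly T' x :=
  Finsupp.sum_add_index' (fun _ => zero_mul _) fun _ _ _ => add_mul _ _ _

theorem timePoly_single (l : ℕ+) (h x : ℝ) :
    timePoly (Finsupp.single l h) x = h * x ^ (l : ℕ) :=
  Finsupp.sum_single_index (zero_mul _)

theorem timePoly_neg (T : ℕ+ →₀ ℝ) (x : ℝ) : timePoly (-T) x = -timePoly T x := by
  rw [timePoly, timePoly, Finsupp.sum_neg_index fun _ => zero_mul _, Finsupp.sum,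
    Finsupp.sum, ← Finset.sum_neg_distrib]
  simp only [neg_mul]

theorem weight_add (T T' : ℕ+ →₀ ℝ) (x : ℝ) :
    weight U V (T + T') x = weight U V T x * Real.exp (timePoly T' x) := by
  rw [weight, weight]
  by_cases hx : x ∈ U
  · rw [Set.indicator_of_mem hx, Set.indicator_of_mem hx, timePoly_add, ← add_assoc,
      Real.exp_add]
  · rw [Set.indicator_of_notMem hx, Set.indicator_of_notMem hx, zero_mul]

theorem weight_add_single (T : ℕ+ →₀ ℝ) (l : ℕ+) (h x : ℝ) :
    weight U V (T + Finsupp.single l h) x = weight U V T x * Real.exp (h * x ^ (l : ℕ)) := by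
  rw [weight_add, timePoly_single]

theorem hasDerivAt_realMoment_left (l : ℕ+)
    (hT : ∀ᶠ h in 𝓝 (0 : ℝ), HasMoments U V (T + Finsupp.single l h)) {w : ℝ → ℝ}
    (hw : FiniteMoments w) (k m : ℕ) :
    HasDerivAt (fun h => realMoment (weight U V (T + Finsupp.single l h)) w k m)
      (realMoment (weight U V T) w (k + l) m) 0 := by
  have h := hasDerivAt_integral_mul_exp (μ := (volume : Measure (ℝ × ℝ)))
    (F := fun p => p.1 ^ k * p.2 ^ m * (weight U V T p.1 * w p.2 * Real.sign (p.1 - p.2)))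
    (q := fun p => p.1 ^ (l : ℕ)) (measurable_fst.pow_const _) ?_
  · convert h using 1
    · funext h
      rw [realMoment]
      congr 1
      funext p
      rw [weight_add_single]
      ring
    · rw [realMoment]
      congr 1
      funext p
      ring
  · filter_upwards [hT] with h hh
    refine (integrable_realMoment hh hw k m).congr (Eventually.of_forall fun p => ?_)
    simp only [weight_add_single]
    ring

theorem hasDerivAt_realMoment_right (l : ℕ+)
    (hS : ∀ᶠ h in 𝓝 (0 : ℝ), HasMoments U V (-(S + Finsupp.single l h))) {w : ℝ → ℝ}
    (hw : FiniteMoments w) (k m : ℕ) :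
    HasDerivAt (fun h => realMoment w (weight U V (-(S + Finsupp.single l h))) k m)
      (-realMoment w (weight U V (-S)) k (m + l)) 0 := by
  have hwt : ∀ h x, weight U V (-(S + Finsupp.single l h)) x =
      weight U V (-S) x * Real.exp (h * -x ^ (l : ℕ)) := fun h x => by
    rw [neg_add, weight_add, timePoly_neg, timePoly_single, mul_neg]
  have h := hasDerivAt_integral_mul_exp (μ := (volume : Measure (ℝ × ℝ)))
    (F := fun p => p.1 ^ k * p.2 ^ m * (w p.1 * weight U V (-S) p.2 * Real.sign (p.1 - p.2)))
    (q := fun p => -p.2 ^ (l : ℕ)) (measurable_snd.pow_const _).neg ?_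
  · convert h using 1
    · funext h
      rw [realMoment]
      congr 1
      funext p
      rw [hwt]
      ring
    · rw [realMoment, ← integral_neg]
      congr 1
      funext p
      ring
  · filter_upwards [hS] with h hh
    refine (integrable_realMoment hw hh k m).congr (Eventually.of_forall fun p => ?_)
    simp only [hwt]
    ring

theorem hasDerivAt_realMoment_diag (l : ℕ+) (h0 : HasMoments U V T)
    (hT : ∀ᶠ h in 𝓝 (0 : ℝ), HasMoments U V (T + Finsupp.single l h)) (k m : ℕ) :
    HasDerivAt (fun h => realMoment (weight U V (T + Finsupp.single l h))
        (weight U V (T + Finsupp.single l h)) k m)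
      (realMoment (weight U V T) (weight U V T) (k + l) m +
        realMoment (weight U V T) (weight U V T) k (m + l)) 0 := by
  have h := hasDerivAt_integral_mul_exp (μ := (volume : Measure (ℝ × ℝ)))
    (F := fun p => p.1 ^ k * p.2 ^ m *
      (weight U V T p.1 * weight U V T p.2 * Real.sign (p.1 - p.2)))
    (q := fun p => p.1 ^ (l : ℕ) + p.2 ^ (l : ℕ))
    ((measurable_fst.pow_const _).add (measurable_snd.pow_const _)) ?_
  · convert h using 1
    · funext h
      rw [realMoment]
      congr 1
      funext p
      rw [weight_add_single, weight_add_single, mul_add, Real.exp_add]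
      ring
    · rw [realMoment, realMoment, ← integral_add (integrable_realMoment h0 h0 _ _)
        (integrable_realMoment h0 h0 _ _)]
      congr 1
      funext p
      ring
  · filter_upwards [hT] with h hh
    refine (integrable_realMoment hh hh k m).congr (Eventually.of_forall fun p => ?_)
    simp only [weight_add_single, mul_add, Real.exp_add]
    ring

variable {σ : Type*}

/-- The coefficients of `φ h` are differentiable in `h` at `0`, and their derivatives are the
coefficients of `δ (φ 0)`. -/
def HasCoeffDeriv (δ : Derivation ℝ (MvPowerSeries σ ℝ) (MvPowerSeries σ ℝ))
    (φ : ℝ → MvPowerSeries σ ℝ) : Prop :=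
  ∀ m, HasDerivAt (fun h => MvPowerSeries.coeff m (φ h)) (MvPowerSeries.coeff m (δ (φ 0))) 0

variable {δ : Derivation ℝ (MvPowerSeries σ ℝ) (MvPowerSeries σ ℝ)}

theorem HasCoeffDeriv.mul {φ ψ : ℝ → MvPowerSeries σ ℝ} (hφ : HasCoeffDeriv δ φ)
    (hψ : HasCoeffDeriv δ ψ) : HasCoeffDeriv δ fun h => φ h * ψ h := fun m => by
  classical
  simp only [Derivation.leibniz, map_add, smul_eq_mul]
  rw [mul_comm (ψ 0)]
  simp only [MvPowerSeries.coeff_mul]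
  rw [← Finset.sum_add_distrib]
  refine HasDerivAt.fun_sum fun p _ => ?_
  rw [add_comm]
  exact (hφ p.1).mul (hψ p.2)

theorem hasCoeffDeriv_one : HasCoeffDeriv δ fun _ => 1 := fun m => by
  simpa using hasDerivAt_const (0 : ℝ) _

theorem HasCoeffDeriv.smul {φ : ℝ → MvPowerSeries σ ℝ} (hφ : HasCoeffDeriv δ φ) (c : ℝ) :
    HasCoeffDeriv δ fun h => c • φ h := fun m => by
  simpa only [Derivation.map_smul, map_smul, smul_eq_mul] using (hφ m).const_mul c

theorem HasCoeffDeriv.prod {ι : Type*} {s : Finset ι} {φ : ι → ℝ → MvPowerSeries σ ℝ}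
    (hφ : ∀ i ∈ s, HasCoeffDeriv δ (φ i)) : HasCoeffDeriv δ fun h => ∏ i ∈ s, φ i h := by
  classical
  induction s using Finset.induction_on with
  | empty => simpa using hasCoeffDeriv_one
  | insert i s hi ih =>
    simp only [Finset.prod_insert hi]
    exact (hφ i (Finset.mem_insert_self _ _)).mul
      (ih fun j hj => hφ j (Finset.mem_insert_of_mem hj))

theorem HasCoeffDeriv.sum {ι : Type*} {s : Finset ι} {φ : ι → ℝ → MvPowerSeries σ ℝ}
    (hφ : ∀ i ∈ s, HasCoeffDeriv δ (φ i)) : HasCoeffDeriv δ fun h => ∑ i ∈ s, φ i h := fun m => by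
  simp only [map_sum]
  exact HasDerivAt.fun_sum fun i hi => hφ i hi m

theorem intCast_mul_eq_smul (z : ℤ) (φ : MvPowerSeries σ ℝ) :
    (z : MvPowerSeries σ ℝ) * φ = (z : ℝ) • φ := by
  rw [← zsmul_eq_mul, Int.cast_smul_eq_zsmul]

theorem HasCoeffDeriv.det {n : ℕ} {N : ℝ → Matrix (Fin n) (Fin n) (MvPowerSeries σ ℝ)}
    (hN : ∀ i j, HasCoeffDeriv δ fun h => N h i j) : HasCoeffDeriv δ fun h => (N h).det := by
  simp only [Matrix.det_apply', intCast_mul_eq_smul]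
  exact HasCoeffDeriv.sum fun ρ _ => (HasCoeffDeriv.prod fun i _ => hN _ _).smul _

theorem HasCoeffDeriv.pfSeq {N : ℝ → ℕ → ℕ → MvPowerSeries σ ℝ}
    (hN : ∀ i j, HasCoeffDeriv δ fun h => N h i j) (n : ℕ) :
    HasCoeffDeriv δ fun h => pfSeq (N h) n := by
  have hsign : ((-1 : MvPowerSeries σ ℝ)) ^ n = (((-1) ^ n : ℤ) : MvPowerSeries σ ℝ) := by
    push_cast
    rfl
  simp only [PfaffToda.pfSeq, pfaffian, hsign, intCast_mul_eq_smul]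
  exact ((HasCoeffDeriv.sum fun ρ _ => (HasCoeffDeriv.prod fun i _ => hN _ _).smul _).smul _).smul _

theorem hasDerivAt_coeff_tau_left (l : ℕ+) (hS : HasMoments U V (-S))
    (hT : ∀ᶠ h in 𝓝 (0 : ℝ), HasMoments U V (T + Finsupp.single l h)) (n : ℕ)
    (m : ℕ+ ⊕ ℕ+ →₀ ℕ) :
    HasDerivAt (fun h => MvPowerSeries.coeff m (tau U V (T + Finsupp.single l h) S n))
      (MvPowerSeries.coeff m (MvPowerSeries.pderiv ℝ (Sum.inl l) (tau U V T S n))) 0 := by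
  have h : HasCoeffDeriv (MvPowerSeries.pderiv ℝ (Sum.inl l))
      fun h => tau U V (T + Finsupp.single l h) S n := by
    simp only [tau_eq_det]
    refine HasCoeffDeriv.det fun i j d => ?_
    simp only [Matrix.of_apply, Finsupp.single_zero, add_zero, pderiv_formalMoment_inl]
    simp only [formalMoment, coeff_momentPairing]
    rw [add_right_comm]
    exact (hasDerivAt_realMoment_left l hT hS _ _).const_mul _
  simpa using h m

theorem hasDerivAt_coeff_tau_right (l : ℕ+) (hT : HasMoments U V T)
    (hS : ∀ᶠ h in 𝓝 (0 : ℝ), HasMoments U V (-(S + Finsupp.single l h))) (n : ℕ)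
    (m : ℕ+ ⊕ ℕ+ →₀ ℕ) :
    HasDerivAt (fun h => MvPowerSeries.coeff m (tau U V T (S + Finsupp.single l h) n))
      (MvPowerSeries.coeff m (MvPowerSeries.pderiv ℝ (Sum.inr l) (tau U V T S n))) 0 := by
  have h : HasCoeffDeriv (MvPowerSeries.pderiv ℝ (Sum.inr l))
      fun h => tau U V T (S + Finsupp.single l h) n := by
    simp only [tau_eq_det]
    refine HasCoeffDeriv.det fun i j d => ?_
    simp only [Matrix.of_apply, Finsupp.single_zero, add_zero, pderiv_formalMoment_inr, map_neg]
    simp only [formalMoment, coeff_momentPairing]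
    rw [add_right_comm, ← mul_neg]
    exact (hasDerivAt_realMoment_right l hS hT _ _).const_mul _
  simpa using h m

theorem hasDerivAt_coeff_pfTau (l : ℕ+) (h0 : HasMoments U V T)
    (hT : ∀ᶠ h in 𝓝 (0 : ℝ), HasMoments U V (T + Finsupp.single l h)) (n : ℕ) (m : ℕ+ →₀ ℕ) :
    HasDerivAt (fun h => MvPowerSeries.coeff m (pfTau U V (T + Finsupp.single l h) (2 * n)))
      (MvPowerSeries.coeff m (MvPowerSeries.pderiv ℝ l (pfTau U V T (2 * n)))) 0 := by
  classical
  have h : HasCoeffDeriv (MvPowerSeries.pderiv ℝ l)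
      fun h => pfSeries (realMoment (weight U V (T + Finsupp.single l h))
        (weight U V (T + Finsupp.single l h))) n := by
    refine HasCoeffDeriv.pfSeq (fun i j d => ?_) n
    simp only [Finsupp.single_zero, add_zero, pderiv_diagMoment, map_add, coeff_diagMoment]
    rw [← Finset.sum_add_distrib]
    refine HasDerivAt.fun_sum fun p _ => ?_
    rw [← mul_add, add_right_comm, add_right_comm j]
    exact (hasDerivAt_realMoment_diag l h0 hT _ _).const_mul _
  have h' := h m
  simp only [Finsupp.single_zero, add_zero, ← pfTau_eq_pfSeries h0] at h'
  refine h'.congr_of_eventuallyEq ?_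
  filter_upwards [hT] with h hh
  rw [pfTau_eq_pfSeries hh]

end BasePoint

/-! ### Integration of a derivative on an open set with vanishing boundary values -/

section Boundary

theorem hasDerivAt_max_zero_sq (t : ℝ) : HasDerivAt (fun t : ℝ => max t 0 ^ 2) (2 * max t 0) t := by
  rcases lt_trichotomy t 0 with ht | rfl | ht
  · rw [max_eq_right ht.le, mul_zero]
    refine (hasDerivAt_const t (0 : ℝ)).congr_of_eventuallyEq ?_
    filter_upwards [gt_mem_nhds ht] with s hs
    rw [max_eq_right hs.le]
    norm_num
  · rw [max_self, mul_zero, hasDerivAt_iff_isLittleO]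
    refine (Asymptotics.IsBigO.of_bound 1 (Eventually.of_forall fun s => ?_)).trans_isLittleO
      (Asymptotics.isLittleO_pow_id (𝕜 := ℝ) one_lt_two) |>.congr_right fun s => (sub_zero s).symm
    rw [max_self, smul_zero, sub_zero, zero_pow two_ne_zero, sub_zero, one_mul, norm_pow, norm_pow]
    refine pow_le_pow_left₀ (norm_nonneg _) ?_ 2
    rw [Real.norm_eq_abs, Real.norm_eq_abs, abs_of_nonneg (le_max_right _ _)]
    exact max_le (le_abs_self _) (abs_nonneg _)
  · rw [max_eq_left ht.le]
    have h := hasDerivAt_pow 2 t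
    simp only [Nat.cast_ofNat, Nat.add_one_sub_one, pow_one] at h
    refine h.congr_of_eventuallyEq ?_
    filter_upwards [lt_mem_nhds ht] with s hs
    rw [max_eq_left hs.le]

/-- A continuously differentiable approximation of the identity that vanishes near `0`. -/
def truncId (ε s : ℝ) : ℝ := max (|s| - ε) 0 ^ 2 / s

/-- The derivative of `truncId`. -/
def truncId' (ε s : ℝ) : ℝ := 2 * (max (|s| - ε) 0 / |s|) - (max (|s| - ε) 0 / |s|) ^ 2

theorem hasDerivAt_truncId {ε : ℝ} (hε : 0 < ε) (s : ℝ) :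
    HasDerivAt (truncId ε) (truncId' ε s) s := by
  rcases eq_or_ne s 0 with rfl | hs
  · have h0 : truncId' ε 0 = 0 := by simp [truncId']
    rw [h0]
    refine (hasDerivAt_const (0 : ℝ) (0 : ℝ)).congr_of_eventuallyEq ?_
    filter_upwards [Metric.ball_mem_nhds (0 : ℝ) hε] with s hs
    have hs : |s| < ε := by simpa using hs
    rw [truncId, max_eq_right (by linarith)]
    simp
  · have h1 : HasDerivAt (fun s : ℝ => |s| - ε) (SignType.sign s : ℝ) s :=
      (hasDerivAt_abs hs).sub_const ε
    have h2 := ((hasDerivAt_max_zero_sq (|s| - ε)).comp s h1).div (hasDerivAt_id s) hs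
    refine h2.congr_deriv ?_
    have h3 : (SignType.sign s : ℝ) * s = |s| := by rw [mul_comm]; exact self_mul_sign s
    have h4 : s ^ 2 = |s| ^ 2 := (sq_abs s).symm
    have h5 : |s| ≠ 0 := abs_ne_zero.2 hs
    simp only [Function.comp_apply, id, truncId', mul_one]
    rw [mul_assoc, h3, h4]
    field_simp

theorem truncId_zero (ε : ℝ) : truncId ε 0 = 0 := by simp [truncId]

theorem abs_truncId'_le {ε : ℝ} (hε : 0 < ε) (s : ℝ) : |truncId' ε s| ≤ 1 := by
  have h0 : 0 ≤ max (|s| - ε) 0 / |s| := by positivity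
  have h1 : max (|s| - ε) 0 / |s| ≤ 1 :=
    div_le_one_of_le₀ (max_le (by linarith) (abs_nonneg _)) (abs_nonneg _)
  rw [truncId', abs_le]
  constructor <;> nlinarith

theorem tendsto_truncId (s : ℝ) : Tendsto (fun ε => truncId ε s) (𝓝[>] 0) (𝓝 s) := by
  have hc : Continuous fun ε => truncId ε s := by unfold truncId; fun_prop
  have h := (hc.tendsto 0).mono_left (nhdsWithin_le_nhds (s := Set.Ioi 0))
  convert h using 2
  rw [truncId, sub_zero, max_eq_left (abs_nonneg s), sq_abs, pow_two, mul_self_div_self]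

theorem tendsto_truncId' {s : ℝ} (hs : s ≠ 0) :
    Tendsto (fun ε => truncId' ε s) (𝓝[>] 0) (𝓝 1) := by
  have hc : Continuous fun ε => truncId' ε s := by unfold truncId'; fun_prop
  have h := (hc.tendsto 0).mono_left (nhdsWithin_le_nhds (s := Set.Ioi 0))
  convert h using 2
  rw [truncId', sub_zero, max_eq_left (abs_nonneg s), div_self (abs_ne_zero.2 hs)]
  norm_num

theorem measurable_truncId' (ε : ℝ) : Measurable (truncId' ε) := by
  unfold truncId'
  fun_prop

theorem tendsto_zero_of_inf_principal {α : Type*} {l : Filter α} {F : α → ℝ} {U : Set α}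
    (hF : ∀ x ∉ U, F x = 0) (h : Tendsto F (l ⊓ 𝓟 U) (𝓝 0)) : Tendsto F l (𝓝 0) := by
  have hl : l = (l ⊓ 𝓟 U) ⊔ (l ⊓ 𝓟 Uᶜ) := by
    rw [← inf_sup_left, sup_principal, Set.union_compl_self, principal_univ, inf_top_eq]
  rw [hl]
  refine h.sup (tendsto_const_nhds.congr' ?_)
  filter_upwards [mem_inf_of_right (mem_principal_self Uᶜ)] with x hx
  exact (hF x hx).symm

/-- A differentiable function has derivative `0` almost everywhere on its zero set. -/
theorem ae_eq_zero_of_hasDerivAt {F G : ℝ → ℝ} {U : Set ℝ}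
    (hd : ∀ x ∈ U, HasDerivAt F (G x) x) : ∀ᵐ x, x ∈ U → F x = 0 → G x = 0 := by
  have hc : {x | x ∈ {x | F x = 0} ∧ 𝓝[{x | F x = 0} ∩ Set.Ioi x] x = ⊥}.Countable :=
    countable_setOfPred_isolated_right_within
  filter_upwards [hc.ae_notMem volume] with x hx hxU hFx
  by_contra hG
  refine hx ⟨hFx, ?_⟩
  have h := (hd x hxU).eventually_ne (c := 0) hG
  rw [eventually_nhdsWithin_iff] at h
  rw [← empty_mem_iff_bot, mem_nhdsWithin_iff_eventually]
  filter_upwards [h] with z hz hzZ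
  exact hz (ne_of_gt hzZ.2) hzZ.1

variable {U : Set ℝ} {F G : ℝ → ℝ}

theorem continuous_of_boundary (hF0 : ∀ x ∉ U, F x = 0)
    (hd : ∀ x ∈ U, HasDerivAt F (G x) x)
    (hb : ∀ c ∈ frontier U, Tendsto F (𝓝[U] c) (𝓝 0)) : Continuous F := by
  rw [continuous_iff_continuousAt]
  intro x
  by_cases hx : x ∈ U
  · exact (hd x hx).continuousAt
  rw [ContinuousAt, hF0 x hx]
  refine tendsto_zero_of_inf_principal hF0 ?_
  by_cases hcl : x ∈ closure U
  · exact hb x ⟨hcl, fun h => hx (interior_subset h)⟩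
  · have : 𝓝 x ⊓ 𝓟 U = ⊥ := by
      exact not_neBot.1 (mem_closure_iff_nhdsWithin_neBot.not.1 hcl)
    rw [this]
    exact tendsto_bot

/-- The fundamental theorem of calculus for a function that vanishes at the boundary of `U` and
outside `U`. The boundary may have positive measure and `F` need not be differentiable there; the
truncations of `F` are differentiable everywhere, with derivatives dominated by `|G|`. -/
theorem integral_eq_of_boundary (hF0 : ∀ x ∉ U, F x = 0)
    (hG0 : ∀ x ∉ U, G x = 0) (hd : ∀ x ∈ U, HasDerivAt F (G x) x)
    (hb : ∀ c ∈ frontier U, Tendsto F (𝓝[U] c) (𝓝 0))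
    (hinf : Tendsto F (cocompact ℝ ⊓ 𝓟 U) (𝓝 0)) (hG : Integrable G) :
    (∀ y, ∫ x in Set.Iic y, G x = F y) ∧ ∫ x, G x = 0 := by
  have hcont := continuous_of_boundary hF0 hd hb
  have hlim : Tendsto F (cocompact ℝ) (𝓝 0) := tendsto_zero_of_inf_principal hF0 hinf
  rw [cocompact_eq_atBot_atTop, tendsto_sup] at hlim
  have hder : ∀ ε > 0, ∀ x, HasDerivAt (fun x => truncId ε (F x)) (truncId' ε (F x) * G x) x := by
    intro ε hε x
    by_cases hx : x ∈ U
    · exact (hasDerivAt_truncId hε _).comp x (hd x hx)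
    · rw [hG0 x hx, mul_zero]
      refine (hasDerivAt_const x (0 : ℝ)).congr_of_eventuallyEq ?_
      have h1 : Tendsto F (𝓝 x) (𝓝 0) := by simpa [hF0 x hx] using hcont.tendsto x
      filter_upwards [h1 (Metric.ball_mem_nhds (0 : ℝ) hε)] with s hs
      have hs : |F s| < ε := by simpa using hs
      rw [truncId, max_eq_right (by linarith)]
      simp
  have hmeas : ∀ ε, AEStronglyMeasurable (fun x => truncId' ε (F x) * G x) volume := fun ε =>
    ((measurable_truncId' ε).comp hcont.measurable).aestronglyMeasurable.mul hG.1
  have hbound : ∀ ε > 0, ∀ x, ‖truncId' ε (F x) * G x‖ ≤ ‖G x‖ := fun ε hε x => by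
    rw [norm_mul]
    exact mul_le_of_le_one_left (norm_nonneg _) (abs_truncId'_le hε _)
  have hint : ∀ ε > 0, Integrable fun x => truncId' ε (F x) * G x := fun ε hε =>
    hG.mono (hmeas ε) (Eventually.of_forall (hbound ε hε))
  have hpt : ∀ᵐ x, Tendsto (fun ε => truncId' ε (F x) * G x) (𝓝[>] 0) (𝓝 (G x)) := by
    filter_upwards [ae_eq_zero_of_hasDerivAt hd] with x hx
    by_cases hxU : x ∈ U
    · by_cases hFx : F x = 0
      · simp [hx hxU hFx]
      · simpa using (tendsto_truncId' hFx).mul_const (G x)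
    · simp [hG0 x hxU]
  have htrunc0 : ∀ ε > 0, ∀ l : Filter ℝ, Tendsto F l (𝓝 0) →
      Tendsto (fun x => truncId ε (F x)) l (𝓝 0) := fun ε hε l h => by
    have := (hasDerivAt_truncId hε 0).continuousAt.tendsto.comp h
    rwa [truncId_zero] at this
  constructor
  · intro y
    have h1 : Tendsto (fun ε => ∫ x in Set.Iic y, truncId' ε (F x) * G x) (𝓝[>] 0)
        (𝓝 (∫ x in Set.Iic y, G x)) :=
      tendsto_integral_filter_of_dominated_convergence (fun x => ‖G x‖)
        (Eventually.of_forall fun ε => (hmeas ε).restrict)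
        (eventually_mem_nhdsWithin.mono fun ε hε => Eventually.of_forall (hbound ε hε))
        hG.norm.integrableOn (ae_restrict_of_ae hpt)
    refine tendsto_nhds_unique h1 ((tendsto_truncId (F y)).congr' ?_)
    filter_upwards [eventually_mem_nhdsWithin] with ε hε
    rw [integral_Iic_of_hasDerivAt_of_tendsto' (fun x _ => hder ε hε x) (hint ε hε).integrableOn
      (htrunc0 ε hε _ hlim.1), sub_zero]
  · have h1 : Tendsto (fun ε => ∫ x, truncId' ε (F x) * G x) (𝓝[>] 0) (𝓝 (∫ x, G x)) :=
      tendsto_integral_filter_of_dominated_convergence (fun x => ‖G x‖)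
        (Eventually.of_forall hmeas)
        (eventually_mem_nhdsWithin.mono fun ε hε => Eventually.of_forall (hbound ε hε))
        hG.norm hpt
    refine tendsto_nhds_unique h1 (tendsto_const_nhds.congr' ?_)
    filter_upwards [eventually_mem_nhdsWithin] with ε hε
    rw [integral_of_hasDerivAt_of_tendsto (hder ε hε) (hint ε hε)
      (htrunc0 ε hε _ hlim.1) (htrunc0 ε hε _ hlim.2), sub_zero]

/-- The kernel `ε(x - y)` jumps by `2` at `x = y`. -/
theorem integral_mul_sign_of_boundary (hF0 : ∀ x ∉ U, F x = 0)
    (hG0 : ∀ x ∉ U, G x = 0) (hd : ∀ x ∈ U, HasDerivAt F (G x) x)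
    (hb : ∀ c ∈ frontier U, Tendsto F (𝓝[U] c) (𝓝 0))
    (hinf : Tendsto F (cocompact ℝ ⊓ 𝓟 U) (𝓝 0)) (hG : Integrable G) (y : ℝ) :
    ∫ x, G x * Real.sign (x - y) = -2 * F y := by
  obtain ⟨h1, h2⟩ := integral_eq_of_boundary hF0 hG0 hd hb hinf hG
  have hae : ∀ᵐ x, G x * Real.sign (x - y) = G x - 2 * (Set.Iic y).indicator G x := by
    filter_upwards [(Set.countable_singleton y).ae_notMem volume] with x hx
    rcases lt_or_gt_of_ne (show x ≠ y from hx) with h | h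
    · rw [Set.indicator_of_mem (Set.mem_Iic.2 h.le), Real.sign_of_neg (sub_neg.2 h)]
      ring
    · rw [Set.indicator_of_notMem (by simpa using h), Real.sign_of_pos (sub_pos.2 h)]
      ring
  rw [integral_congr_ae hae, integral_sub hG ((hG.indicator measurableSet_Iic).const_mul 2), h2,
    integral_const_mul, integral_indicator measurableSet_Iic, h1]
  ring

end Boundary

/-! ### Power series on the support of the weight -/

section PowerSeries

variable {U : Set ℝ} {a b : ℕ → ℝ}

theorem summable_mul_pow_of_lt {x y : ℝ} (hy : Summable fun i => a i * y ^ i) (hxy : |x| < |y|) :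
    Summable fun i : ℕ => ((i : ℝ) + 1) * |a i| * |x| ^ i := by
  have hy0 : 0 < |y| := (abs_nonneg x).trans_lt hxy
  obtain ⟨C, hC⟩ := hy.tendsto_atTop_zero.norm.bddAbove_range
  have hC : ∀ i, |a i| * |y| ^ i ≤ C := fun i => by
    have := hC (Set.mem_range_self i)
    rwa [norm_mul, norm_pow] at this
  have hr : ‖|x| / |y|‖ < 1 := by
    rw [Real.norm_of_nonneg (by positivity), div_lt_one hy0]
    exact hxy
  have hs : Summable fun i : ℕ => C * (((i : ℝ) ^ 1 * (|x| / |y|) ^ i) + (|x| / |y|) ^ i) :=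
    ((summable_pow_mul_geometric_of_norm_lt_one 1 hr).add
      (summable_geometric_of_norm_lt_one hr)).mul_left C
  refine Summable.of_nonneg_of_le (fun i => by positivity) (fun i => ?_) hs
  have h1 : |x| ^ i = |y| ^ i * (|x| / |y|) ^ i := by
    rw [← mul_pow, mul_div_cancel₀ _ hy0.ne']
  calc ((i : ℝ) + 1) * |a i| * |x| ^ i = (|a i| * |y| ^ i) * (((i : ℝ) + 1) * (|x| / |y|) ^ i) := by
        rw [h1]; ring
    _ ≤ C * (((i : ℝ) + 1) * (|x| / |y|) ^ i) :=
        mul_le_mul_of_nonneg_right (hC i) (by positivity)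
    _ = _ := by ring

/-- An open set contains with every point one of larger absolute value, so that its points lie
inside the disc of convergence. -/
theorem exists_abs_lt (hU : IsOpen U) {x : ℝ} (hx : x ∈ U) : ∃ y ∈ U, |x| < |y| := by
  obtain ⟨δ, hδ, hball⟩ := Metric.isOpen_iff.1 hU x hx
  rcases le_total 0 x with h | h
  · refine ⟨x + δ / 2, hball ?_, ?_⟩
    · rw [Metric.mem_ball, Real.dist_eq, add_sub_cancel_left, abs_of_pos (by positivity)]
      linarith
    · rw [abs_of_nonneg h, abs_of_nonneg (by positivity)]
      linarith
  · refine ⟨x - δ / 2, hball ?_, ?_⟩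
    · rw [Metric.mem_ball, Real.dist_eq, sub_sub_cancel_left, abs_neg, abs_of_pos (by positivity)]
      linarith
    · rw [abs_of_nonpos h, abs_of_nonpos (by linarith)]
      linarith

theorem summable_mul_pow (hU : IsOpen U) (ha : ∀ x ∈ U, Summable fun i => a i * x ^ i) {x : ℝ}
    (hx : x ∈ U) : Summable fun i : ℕ => ((i : ℝ) + 1) * |a i| * |x| ^ i := by
  obtain ⟨y, hy, hxy⟩ := exists_abs_lt hU hx
  exact summable_mul_pow_of_lt (ha y hy) hxy

theorem summable_abs_mul_pow (ha : ∀ x ∈ U, Summable fun i => a i * x ^ i) {x : ℝ}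
    (hx : x ∈ U) : Summable fun i : ℕ => |a i| * |x| ^ i := by
  simpa [abs_mul, abs_pow] using (ha x hx).abs

/-- The terms of the derived series are bounded by those of the series at `x` and at a fixed
point. -/
theorem deriv_term_le {r : ℝ} (hr : 0 < r) (x : ℝ) (i : ℕ) :
    |a i| * (i * |x| ^ (i - 1)) ≤
      r⁻¹ * (((i : ℝ) + 1) * |a i| * |x| ^ i + ((i : ℝ) + 1) * |a i| * |r| ^ i) := by
  rcases i with _ | i
  · simp only [CharP.cast_eq_zero, zero_mul, mul_zero]
    positivity
  rw [Nat.add_sub_cancel]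
  have h : |x| ^ i ≤ r⁻¹ * (|x| ^ (i + 1) + |r| ^ (i + 1)) := by
    rw [inv_mul_eq_div, le_div_iff₀ hr, abs_of_pos hr]
    rcases le_total r |x| with h | h
    · calc |x| ^ i * r ≤ |x| ^ i * |x| := by gcongr
        _ ≤ _ := by rw [← pow_succ]; exact le_add_of_nonneg_right (by positivity)
    · calc |x| ^ i * r ≤ r ^ i * r := by gcongr
        _ ≤ _ := by rw [← pow_succ]; exact le_add_of_nonneg_left (by positivity)
  calc |a (i + 1)| * (((i + 1 : ℕ) : ℝ) * |x| ^ i)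
      ≤ |a (i + 1)| * ((((i + 1 : ℕ) : ℝ) + 1) * (r⁻¹ * (|x| ^ (i + 1) + |r| ^ (i + 1)))) := by
        gcongr
        linarith
    _ = _ := by ring

theorem exists_radius (hU : IsOpen U) (hne : U.Nonempty)
    (ha : ∀ x ∈ U, Summable fun i => a i * x ^ i) :
    ∃ r > 0, Summable fun i : ℕ => ((i : ℝ) + 1) * |a i| * |r| ^ i := by
  obtain ⟨x, hx⟩ := hne
  obtain ⟨y, hy, hxy⟩ := exists_abs_lt hU hx
  have hy0 : 0 < |y| := (abs_nonneg x).trans_lt hxy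
  exact ⟨|y| / 2, by positivity, summable_mul_pow_of_lt (ha y hy) (by
    rw [abs_of_pos (by positivity)]; linarith)⟩

theorem summable_deriv_term (hU : IsOpen U) (ha : ∀ x ∈ U, Summable fun i => a i * x ^ i) {x : ℝ}
    (hx : x ∈ U) : Summable fun i : ℕ => |a i| * (i * |x| ^ (i - 1)) := by
  obtain ⟨r, hr, hs⟩ := exists_radius hU ⟨x, hx⟩ ha
  exact Summable.of_nonneg_of_le (fun i => by positivity) (deriv_term_le hr x)
    (((summable_mul_pow hU ha hx).add hs).mul_left _)

theorem hasDerivAt_pser (hU : IsOpen U) (ha : ∀ x ∈ U, Summable fun i => a i * x ^ i) {x : ℝ}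
    (hx : x ∈ U) : HasDerivAt (pser a) (∑' i : ℕ, a i * (i * x ^ (i - 1))) x := by
  obtain ⟨y, hy, hxy⟩ := exists_abs_lt hU hx
  have habs : |(|y|)| = |y| := abs_abs y
  have hs : Summable fun i : ℕ => |a i| * (i * |y| ^ (i - 1)) := summable_deriv_term hU ha hy
  refine hasDerivAt_tsum_of_isPreconnected (t := Metric.ball 0 |y|) (y₀ := x) hs Metric.isOpen_ball
    (convex_ball (0 : ℝ) |y|).isPreconnected (fun n z _ => (hasDerivAt_pow n z).const_mul _)
    (fun n z hz => ?_) (by simpa using hxy) (ha x hx) (by simpa using hxy)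
  have hz : |z| ≤ |y| := by simpa using (Metric.mem_ball.1 hz).le
  rw [norm_mul, norm_mul, norm_pow, Real.norm_eq_abs, Real.norm_eq_abs z, RCLike.norm_natCast]
  gcongr

end PowerSeries

/-! ### The derivative of the weight -/

section Weight

variable {U : Set ℝ} {V : ℝ → ℝ} {a b : ℕ → ℝ} {T S : ℕ+ →₀ ℝ}

/-- The derivative `∑ i T_i x^{i-1}` of `timePoly T`. -/
def timePolyDeriv (T : ℕ+ →₀ ℝ) (x : ℝ) : ℝ :=
  T.sum fun i c => (i : ℝ) * c * x ^ ((i : ℕ) - 1)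

theorem hasDerivAt_timePoly (T : ℕ+ →₀ ℝ) (x : ℝ) :
    HasDerivAt (timePoly T) (timePolyDeriv T x) x := by
  refine (HasDerivAt.fun_sum fun (i : ℕ+) _ =>
    (hasDerivAt_pow (i : ℕ) x).const_mul (T i)).congr_deriv ?_
  exact Finset.sum_congr rfl fun i _ => by ring

theorem hasDerivAt_weight (hU : IsOpen U) (hV : ∀ x ∈ U, DifferentiableAt ℝ V x) {x : ℝ}
    (hx : x ∈ U) :
    HasDerivAt (weight U V T) ((deriv V x + timePolyDeriv T x) * weight U V T x) x := by
  have h := ((hV x hx).hasDerivAt.add (hasDerivAt_timePoly T x)).exp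
  rw [weight, Set.indicator_of_mem hx, mul_comm]
  refine h.congr_of_eventuallyEq ?_
  filter_upwards [hU.mem_nhds hx] with y hy
  rw [weight, Set.indicator_of_mem hy]
  rfl

theorem weight_of_notMem {x : ℝ} (hx : x ∉ U) : weight U V T x = 0 := Set.indicator_of_notMem hx _

/-- The term with index `l` of the derivative of `x^p f(x) e^{V(x) + ∑ T_i x^i}`, `f = ∑ a_l x^l`,
divided by the weight. By `f V' = g` the derivative of `V` contributes `b_l x^{p+l}`. -/
def fluxTerm (a b : ℕ → ℝ) (T : ℕ+ →₀ ℝ) (p l : ℕ) (x : ℝ) : ℝ :=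
  a l * (((p + l : ℕ) : ℝ) * x ^ (p + l - 1) + x ^ (p + l) * timePolyDeriv T x) +
    b l * x ^ (p + l)

theorem natCast_mul_pow_add_sub_one (p l : ℕ) (x : ℝ) :
    ((p + l : ℕ) : ℝ) * x ^ (p + l - 1) = p * x ^ (p - 1) * x ^ l + x ^ p * (l * x ^ (l - 1)) := by
  have h := ((hasDerivAt_pow p x).mul (hasDerivAt_pow l x)).unique
    ((hasDerivAt_pow (p + l) x).congr_of_eventuallyEq (Eventually.of_forall fun y => by
      simp only [Pi.mul_apply, pow_add]))
  exact h.symm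

/-- The derivative of `x^p f(x) e^{V(x) + ∑ T_i x^i}`. -/
def flux (U : Set ℝ) (V : ℝ → ℝ) (a b : ℕ → ℝ) (T : ℕ+ →₀ ℝ) (p : ℕ) (x : ℝ) : ℝ :=
  (p * x ^ (p - 1) * pser a x + x ^ p * (∑' i : ℕ, a i * (i * x ^ (i - 1))) +
    x ^ p * timePolyDeriv T x * pser a x + x ^ p * pser b x) * weight U V T x

theorem hasSum_fluxTerm (hU : IsOpen U) (ha : ∀ x ∈ U, Summable fun i => a i * x ^ i)
    (hb : ∀ x ∈ U, Summable fun i => b i * x ^ i) (p : ℕ) (x : ℝ) :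
    HasSum (fun l => fluxTerm a b T p l x * weight U V T x) (flux U V a b T p x) := by
  by_cases hx : x ∈ U
  · have h1 : HasSum (fun i => a i * x ^ i) (pser a x) := (ha x hx).hasSum
    have h2 : HasSum (fun i => b i * x ^ i) (pser b x) := (hb x hx).hasSum
    have h3 : HasSum (fun i : ℕ => a i * (i * x ^ (i - 1))) (∑' i : ℕ, a i * (i * x ^ (i - 1))) := by
      refine (Summable.of_norm ?_).hasSum
      simpa [abs_mul, abs_pow] using summable_deriv_term hU ha hx
    have h := ((((h1.mul_left (p * x ^ (p - 1))).add (h3.mul_left (x ^ p))).add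
      (h1.mul_left (x ^ p * timePolyDeriv T x))).add (h2.mul_left (x ^ p))).mul_right
        (weight U V T x)
    refine h.congr_fun ?_
    intro l
    rw [fluxTerm, natCast_mul_pow_add_sub_one, pow_add]
    ring
  · simp only [flux, weight_of_notMem hx, mul_zero]
    exact hasSum_zero

theorem hasDerivAt_flux (hU : IsOpen U) (ha : ∀ x ∈ U, Summable fun i => a i * x ^ i)
    (hV : ∀ x ∈ U, DifferentiableAt ℝ V x ∧ pser a x * deriv V x = pser b x) (p : ℕ) {x : ℝ}
    (hx : x ∈ U) :
    HasDerivAt (fun x => x ^ p * pser a x * weight U V T x) (flux U V a b T p x) x := by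
  refine (((hasDerivAt_pow p x).mul (hasDerivAt_pser hU ha hx)).mul
    (hasDerivAt_weight hU (fun y hy => (hV y hy).1) hx)).congr_deriv ?_
  rw [flux, ← (hV x hx).2]
  simp only [Pi.mul_apply]
  ring

theorem abs_timePolyDeriv_le (T : ℕ+ →₀ ℝ) (x : ℝ) :
    |timePolyDeriv T x| ≤ ∑ i ∈ T.support, (i : ℝ) * |T i| * |x| ^ ((i : ℕ) - 1) := by
  refine (Finset.abs_sum_le_sum_abs _ _).trans (Finset.sum_le_sum fun i _ => ?_)
  simp only [abs_mul, abs_pow, Nat.abs_cast, le_refl]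

/-- An integrable function that dominates the sum of all `fluxTerm`s. -/
theorem exists_bound_fluxTerm (hU : IsOpen U) (ha : ∀ x ∈ U, Summable fun i => a i * x ^ i)
    (hb : ∀ x ∈ U, Summable fun i => b i * x ^ i) (hT : DecaysFast U V a b T) (p : ℕ) :
    ∃ D : ℝ → ℝ, Integrable D ∧ ∀ (s : Finset ℕ) (x : ℝ),
      ∑ l ∈ s, |fluxTerm a b T p l x * weight U V T x| ≤ D x := by
  rcases U.eq_empty_or_nonempty with rfl | hne
  · exact ⟨0, integrable_zero _ _ _, fun s x => by
      simp [weight_of_notMem (Set.notMem_empty x)]⟩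
  obtain ⟨r, hr, hs⟩ := exists_radius hU hne ha
  set A : ℝ → ℝ := fun x => ∑' i : ℕ, ((i : ℝ) + 1) * |a i| * |x| ^ i with hA
  set B : ℝ → ℝ := fun x => ∑' i : ℕ, |b i| * |x| ^ i with hB
  set C := ∑' i : ℕ, ((i : ℝ) + 1) * |a i| * |r| ^ i with hC
  set w := weight U V T with hw
  have hiA : ∀ q : ℕ, Integrable fun x => |x| ^ q * A x * w x := hT.moments_f
  have hiB : ∀ q : ℕ, Integrable fun x => |x| ^ q * B x * w x := hT.moments_g
  have hi1 : ∀ q : ℕ, Integrable fun x => |x| ^ q * w x := fun q => by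
    refine (hT.moments q).norm.congr (Eventually.of_forall fun x => ?_)
    simp only [norm_mul, norm_pow, Real.norm_eq_abs]
    rw [abs_of_nonneg (weight_nonneg x)]
  refine ⟨fun x => (p * (|x| ^ (p - 1) * A x * w x) +
    ∑ i ∈ T.support, (i : ℝ) * |T i| * (|x| ^ (p + ((i : ℕ) - 1)) * A x * w x) +
      r⁻¹ * (|x| ^ p * A x * w x) + r⁻¹ * C * (|x| ^ p * w x)) + |x| ^ p * B x * w x, ?_, ?_⟩
  · exact (((((hiA _).const_mul _).add (integrable_finsetSum _ fun i _ =>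
      (hiA _).const_mul _)).add ((hiA _).const_mul _)).add ((hi1 _).const_mul _)).add (hiB _)
  · intro s x
    by_cases hx : x ∈ U
    · have hA' : ∑ l ∈ s, ((l : ℝ) + 1) * |a l| * |x| ^ l ≤ A x :=
        (summable_mul_pow hU ha hx).sum_le_tsum s fun i _ => by positivity
      have hB' : ∑ l ∈ s, |b l| * |x| ^ l ≤ B x :=
        (summable_abs_mul_pow hb hx).sum_le_tsum s fun i _ => by positivity
      have hC' : ∑ l ∈ s, ((l : ℝ) + 1) * |a l| * |r| ^ l ≤ C :=
        hs.sum_le_tsum s fun i _ => by positivity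
      have hw0 : 0 ≤ w x := weight_nonneg x
      set Θ := ∑ i ∈ T.support, (i : ℝ) * |T i| * |x| ^ ((i : ℕ) - 1) with hΘ
      have hΘ0 : 0 ≤ Θ := Finset.sum_nonneg fun i _ => by positivity
      have hterm : ∀ l, |fluxTerm a b T p l x| ≤
          (p * |x| ^ (p - 1) + |x| ^ p * Θ + r⁻¹ * |x| ^ p) * (((l : ℝ) + 1) * |a l| * |x| ^ l) +
            r⁻¹ * |x| ^ p * (((l : ℝ) + 1) * |a l| * |r| ^ l) + |x| ^ p * (|b l| * |x| ^ l) := by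
        intro l
        have e1 : |fluxTerm a b T p l x| ≤ |a l| * (p * |x| ^ (p - 1) * |x| ^ l +
            |x| ^ p * (l * |x| ^ (l - 1)) + |x| ^ p * |x| ^ l * Θ) + |b l| * (|x| ^ p * |x| ^ l) := by
          rw [fluxTerm, natCast_mul_pow_add_sub_one, pow_add]
          refine (abs_add_le _ _).trans ?_
          rw [abs_mul, abs_mul]
          refine add_le_add (mul_le_mul_of_nonneg_left ?_ (abs_nonneg _)) ?_
          · refine (abs_add_le _ _).trans (add_le_add ((abs_add_le _ _).trans ?_) ?_)
            · simp [abs_mul, abs_pow]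
            · rw [abs_mul, abs_mul, abs_pow, abs_pow]
              exact mul_le_mul_of_nonneg_left (abs_timePolyDeriv_le T x) (by positivity)
          · simp [abs_mul, abs_pow]
        have e2 := mul_le_mul_of_nonneg_left (deriv_term_le (a := a) hr x l)
          (by positivity : 0 ≤ |x| ^ p)
        have e3 : |a l| * |x| ^ l ≤ ((l : ℝ) + 1) * |a l| * |x| ^ l := by
          have : 0 ≤ (l : ℝ) * (|a l| * |x| ^ l) := by positivity
          linarith
        have e4 := mul_le_mul_of_nonneg_left e3
          (by positivity : 0 ≤ p * |x| ^ (p - 1) + |x| ^ p * Θ)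
        linarith
      calc ∑ l ∈ s, |fluxTerm a b T p l x * w x|
          = (∑ l ∈ s, |fluxTerm a b T p l x|) * w x := by
            rw [Finset.sum_mul]
            exact Finset.sum_congr rfl fun l _ => by rw [abs_mul, abs_of_nonneg hw0]
        _ ≤ ((p * |x| ^ (p - 1) + |x| ^ p * Θ + r⁻¹ * |x| ^ p) * A x + r⁻¹ * |x| ^ p * C +
              |x| ^ p * B x) * w x := by
            refine mul_le_mul_of_nonneg_right ((Finset.sum_le_sum fun l _ => hterm l).trans ?_) hw0
            rw [Finset.sum_add_distrib, Finset.sum_add_distrib, ← Finset.mul_sum,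
              ← Finset.mul_sum, ← Finset.mul_sum]
            gcongr
        _ = _ := by
            have hsum : ∑ i ∈ T.support, (i : ℝ) * |T i| * (|x| ^ (p + ((i : ℕ) - 1)) * A x * w x) =
                |x| ^ p * Θ * A x * w x := by
              rw [hΘ, Finset.mul_sum, Finset.sum_mul, Finset.sum_mul]
              exact Finset.sum_congr rfl fun i _ => by rw [pow_add]; ring
            simp only [hsum]
            ring
    · have hw0 : w x = 0 := weight_of_notMem hx
      simp [hw0]

theorem integrable_fluxTerm (hT : HasMoments U V T) (p l : ℕ) :
    Integrable fun x => fluxTerm a b T p l x * weight U V T x := by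
  have h : ∀ x, fluxTerm a b T p l x * weight U V T x =
      a l * ((p + l : ℕ) : ℝ) * (x ^ (p + l - 1) * weight U V T x) +
        ∑ i ∈ T.support, a l * ((i : ℝ) * T i) * (x ^ (p + l + ((i : ℕ) - 1)) * weight U V T x) +
        b l * (x ^ (p + l) * weight U V T x) := by
    intro x
    have hsum : ∑ i ∈ T.support, a l * ((i : ℝ) * T i) *
        (x ^ (p + l + ((i : ℕ) - 1)) * weight U V T x) =
          a l * x ^ (p + l) * timePolyDeriv T x * weight U V T x := by
      rw [timePolyDeriv, Finsupp.sum, Finset.mul_sum, Finset.sum_mul]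
      exact Finset.sum_congr rfl fun i _ => by rw [pow_add _ (p + l)]; ring
    rw [hsum, fluxTerm]
    ring
  simp only [h]
  exact ((hT _).const_mul _ |>.add (integrable_finsetSum _ fun i _ => (hT _).const_mul _)).add
    ((hT _).const_mul _)

theorem summable_integral_fluxTerm (hU : IsOpen U)
    (ha : ∀ x ∈ U, Summable fun i => a i * x ^ i) (hb : ∀ x ∈ U, Summable fun i => b i * x ^ i)
    (hT : DecaysFast U V a b T) (p : ℕ) :
    Summable fun l => ∫ x, ‖fluxTerm a b T p l x * weight U V T x‖ := by
  obtain ⟨D, hD, hle⟩ := exists_bound_fluxTerm hU ha hb hT p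
  refine summable_of_sum_le (c := ∫ x, D x) (fun l => integral_nonneg fun x => norm_nonneg _)
    fun s => ?_
  rw [← integral_finsetSum _ fun l _ => (integrable_fluxTerm hT.moments p l).norm]
  exact integral_mono (integrable_finsetSum _ fun l _ => (integrable_fluxTerm hT.moments p l).norm)
    hD (hle s)

theorem integrable_flux (hU : IsOpen U) (ha : ∀ x ∈ U, Summable fun i => a i * x ^ i)
    (hb : ∀ x ∈ U, Summable fun i => b i * x ^ i) (hT : DecaysFast U V a b T) (p : ℕ) :
    Integrable (flux U V a b T p) := by
  obtain ⟨D, hD, hle⟩ := exists_bound_fluxTerm hU ha hb hT p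
  refine hD.mono' ?_ (Eventually.of_forall fun x => ?_)
  · exact aestronglyMeasurable_of_tendsto_ae atTop
      (fun n => (integrable_finsetSum (Finset.range n) fun l _ =>
        integrable_fluxTerm (a := a) (b := b) hT.moments p l).1)
      (Eventually.of_forall fun x => (hasSum_fluxTerm hU ha hb p x).tendsto_sum_nat)
  · refine le_of_tendsto (hasSum_fluxTerm hU ha hb p x).tendsto_sum_nat.norm
      (Eventually.of_forall fun n => ?_)
    exact (norm_sum_le _ _).trans (hle _ x)

/-- Integration by parts against the kernel `ε(x - y)`, term by term. -/
theorem hasSum_integral_fluxTerm (hU : IsOpen U) (ha : ∀ x ∈ U, Summable fun i => a i * x ^ i)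
    (hb : ∀ x ∈ U, Summable fun i => b i * x ^ i)
    (hV : ∀ x ∈ U, DifferentiableAt ℝ V x ∧ pser a x * deriv V x = pser b x)
    (hT : DecaysFast U V a b T) (p : ℕ) {h : ℝ → ℝ} (hh : Integrable h) :
    HasSum (fun l => ∫ q : ℝ × ℝ,
        fluxTerm a b T p l q.1 * weight U V T q.1 * h q.2 * Real.sign (q.1 - q.2))
      (∫ y, -2 * (y ^ p * pser a y * weight U V T y * h y)) := by
  have hint := fun l => integrable_mul_mul_sign
    (integrable_fluxTerm (a := a) (b := b) hT.moments p l) hh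
  have hG := integrable_flux hU ha hb hT p
  have hsum := hasSum_integral_of_summable_integral_norm hint ?_
  · refine (congrArg (HasSum _ · _) ?_).mp hsum
    have htsum : ∀ q : ℝ × ℝ, ∑' l, fluxTerm a b T p l q.1 * weight U V T q.1 * h q.2 *
        Real.sign (q.1 - q.2) = flux U V a b T p q.1 * h q.2 * Real.sign (q.1 - q.2) := fun q =>
      (((hasSum_fluxTerm hU ha hb p q.1).mul_right _).mul_right _).tsum_eq
    refine (integral_congr_ae (Eventually.of_forall htsum)).trans ?_
    rw [Measure.volume_eq_prod, integral_prod_symm _ (integrable_mul_mul_sign hG hh)]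
    refine integral_congr_ae (Eventually.of_forall fun y => Eq.symm ?_)
    have hs := integral_mul_sign_of_boundary (F := fun x => x ^ p * pser a x * weight U V T x)
      (fun x hx => by rw [weight_of_notMem hx, mul_zero])
      (fun x hx => by rw [flux, weight_of_notMem hx, mul_zero])
      (fun x hx => hasDerivAt_flux hU ha hV p hx) (hT.boundary p) (hT.infinity p) hG y
    have hfun : ∀ x, flux U V a b T p x * h y * Real.sign (x - y) =
        flux U V a b T p x * Real.sign (x - y) * h y := fun x => mul_right_comm _ _ _
    refine Eq.trans ?_ (integral_congr_ae (Eventually.of_forall fun x => (hfun x).symm))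
    rw [integral_mul_const, hs]
    ring
  · refine Summable.of_nonneg_of_le (fun l => integral_nonneg fun q => norm_nonneg _) (fun l => ?_)
      ((summable_integral_fluxTerm hU ha hb hT p).mul_right (∫ y, ‖h y‖))
    rw [← integral_prod_mul]
    refine integral_mono (hint l).norm
      ((integrable_fluxTerm hT.moments p l).norm.mul_prod hh.norm) fun q => ?_
    simp only [norm_mul]
    exact mul_le_of_le_one_right (by positivity) (abs_real_sign_le _)

/-- The term with index `ℓ` of the linear relations between the moments. -/
def momentRelation (a b : ℕ → ℝ) (T S : ℕ+ →₀ ℝ) (M : ℕ → ℕ → ℝ) (q i k l : ℕ) : ℝ :=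
  a i * ((((k + q : ℕ) : ℝ) * M (k + q - 1) l + T.sum fun j c => j * c * M (k + q + (j - 1)) l) +
    (((l + q : ℕ) : ℝ) * M k (l + q - 1) - S.sum fun j c => j * c * M k (l + q + (j - 1)))) +
      b i * (M (k + q) l + M k (l + q))

theorem integral_fluxTerm_eq {w : ℝ → ℝ} (hT : HasMoments U V T) (hw : FiniteMoments w)
    (p i l : ℕ) :
    ∫ q : ℝ × ℝ, fluxTerm a b T p i q.1 * weight U V T q.1 * (q.2 ^ l * w q.2) *
        Real.sign (q.1 - q.2) =
      a i * (((p + i : ℕ) : ℝ) * realMoment (weight U V T) w (p + i - 1) l +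
          T.sum fun j c => j * c * realMoment (weight U V T) w (p + i + (j - 1)) l) +
        b i * realMoment (weight U V T) w (p + i) l := by
  have hint := fun k => (integrable_realMoment hT hw k l)
  set m : ℕ → ℝ × ℝ → ℝ := fun k q =>
    q.1 ^ k * q.2 ^ l * (weight U V T q.1 * w q.2 * Real.sign (q.1 - q.2)) with hm
  have hsumint : Integrable fun q : ℝ × ℝ =>
      ∑ j ∈ T.support, a i * (j * T j) * m (p + i + ((j : ℕ) - 1)) q :=
    integrable_finsetSum _ fun j _ => (hint _).const_mul _
  have h1 : Integrable fun q : ℝ × ℝ => a i * ((p + i : ℕ) : ℝ) * m (p + i - 1) q +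
      ∑ j ∈ T.support, a i * (j * T j) * m (p + i + ((j : ℕ) - 1)) q :=
    ((hint _).const_mul _).add hsumint
  have h : ∀ q : ℝ × ℝ, fluxTerm a b T p i q.1 * weight U V T q.1 * (q.2 ^ l * w q.2) *
      Real.sign (q.1 - q.2) =
      (a i * ((p + i : ℕ) : ℝ) * m (p + i - 1) q +
        ∑ j ∈ T.support, a i * (j * T j) * m (p + i + ((j : ℕ) - 1)) q) + b i * m (p + i) q := by
    intro q
    have hsum : ∑ j ∈ T.support, a i * (j * T j) * m (p + i + ((j : ℕ) - 1)) q =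
        a i * q.1 ^ (p + i) * timePolyDeriv T q.1 * (q.2 ^ l *
          (weight U V T q.1 * w q.2 * Real.sign (q.1 - q.2))) := by
      rw [timePolyDeriv, Finsupp.sum, Finset.mul_sum, Finset.sum_mul]
      exact Finset.sum_congr rfl fun j _ => by simp only [hm]; rw [pow_add _ (p + i)]; ring
    rw [hsum, fluxTerm]
    simp only [hm]
    ring
  simp only [h]
  rw [integral_add h1 ((hint _).const_mul _), integral_add ((hint _).const_mul _) hsumint,
    integral_finsetSum _ fun j _ => (hint _).const_mul _]
  simp only [integral_const_mul]
  simp only [realMoment, Finsupp.sum, mul_add, Finset.mul_sum, mul_assoc]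

/-- The moments satisfy linear relations, by integration by parts in `x` and in `y`; the two
contributions of the jump of `ε(x - y)` cancel. -/
theorem hasSum_momentRelation (hU : IsOpen U) (ha : ∀ x ∈ U, Summable fun i => a i * x ^ i)
    (hb : ∀ x ∈ U, Summable fun i => b i * x ^ i)
    (hV : ∀ x ∈ U, DifferentiableAt ℝ V x ∧ pser a x * deriv V x = pser b x)
    (hT : DecaysFast U V a b T) (hS : DecaysFast U V a b (-S)) (j k l : ℕ) :
    HasSum (fun i => momentRelation a b T S (realMoment (weight U V T) (weight U V (-S)))
      (i + j) i k l) 0 := by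
  have h1 := hasSum_integral_fluxTerm hU ha hb hV hT (k + j) (hS.moments l)
  have h2 := hasSum_integral_fluxTerm hU ha hb hV hS (l + j) (hT.moments k)
  simp only [integral_fluxTerm_eq hT.moments hS.moments] at h1
  simp only [integral_fluxTerm_eq hS.moments hT.moments] at h2
  have h := h1.sub h2
  have hzero : (∫ y, -2 * (y ^ (k + j) * pser a y * weight U V T y *
      (y ^ l * weight U V (-S) y))) - ∫ y, -2 * (y ^ (l + j) * pser a y * weight U V (-S) y *
        (y ^ k * weight U V T y)) = 0 := by
    rw [sub_eq_zero]
    refine integral_congr_ae (Eventually.of_forall fun y => ?_)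
    simp only [pow_add]
    ring
  rw [hzero] at h
  refine h.congr_fun fun i => ?_
  rw [momentRelation, Finsupp.sum_neg_index fun _ => by simp]
  simp only [realMoment_swap (weight U V (-S)) (weight U V T), Finsupp.sum, neg_mul, mul_neg,
    neg_neg, Nat.add_assoc, Nat.add_comm i j]
  ring

end Weight

/-! ### Polynomials under the integral sign -/

section PairFunctional

set_option linter.unusedSectionVars false

open MvPolynomial

variable {ι : Type*} [Fintype ι] [DecidableEq ι] {A : Type*} [CommRing A] [Algebra ℝ A]

/-- The linear functional `∏_r x_r^{k_r} y_r^{l_r} ↦ ∏_r μ_{k_r l_r}` on polynomials in the pairs of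
variables `x_r` (index `(r, 0)`) and `y_r` (index `(r, 1)`). -/
def pairFunctional (μ : ℕ → ℕ → A) : MvPolynomial (ι × Fin 2) ℝ →ₗ[ℝ] A :=
  (basisMonomials (ι × Fin 2) ℝ).constr ℝ fun d => ∏ r, μ (d (r, 0)) (d (r, 1))

/-- The functional `∏_r x_r^{k_r} y_r^{l_r} ↦ ∑_r e_{k_r l_r} ∏_{r' ≠ r} μ_{k_{r'} l_{r'}}`, the
variation of `pairFunctional μ` under a change `e` of `μ`. -/
def pairVariation (μ e : ℕ → ℕ → A) : MvPolynomial (ι × Fin 2) ℝ →ₗ[ℝ] A :=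
  (basisMonomials (ι × Fin 2) ℝ).constr ℝ fun d =>
    ∑ r, e (d (r, 0)) (d (r, 1)) * ∏ r' ∈ Finset.univ.erase r, μ (d (r', 0)) (d (r', 1))

variable {μ e e' : ℕ → ℕ → A}

theorem pairFunctional_monomial (d : ι × Fin 2 →₀ ℕ) :
    pairFunctional μ (monomial d 1) = ∏ r, μ (d (r, 0)) (d (r, 1)) := by
  have h := (basisMonomials (ι × Fin 2) ℝ).constr_basis ℝ
    (fun d => ∏ r, μ (d (r, 0)) (d (r, 1))) d
  rwa [coe_basisMonomials] at h

theorem pairVariation_monomial (d : ι × Fin 2 →₀ ℕ) :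
    pairVariation μ e (monomial d 1) = ∑ r, e (d (r, 0)) (d (r, 1)) *
      ∏ r' ∈ Finset.univ.erase r, μ (d (r', 0)) (d (r', 1)) := by
  have h := (basisMonomials (ι × Fin 2) ℝ).constr_basis ℝ (fun d => ∑ r, e (d (r, 0)) (d (r, 1)) *
    ∏ r' ∈ Finset.univ.erase r, μ (d (r', 0)) (d (r', 1))) d
  rwa [coe_basisMonomials] at h

theorem linearMap_ext_monomial {M : Type*} [AddCommMonoid M] [Module ℝ M] {σ : Type*}
    {f g : MvPolynomial σ ℝ →ₗ[ℝ] M} (h : ∀ d, f (monomial d 1) = g (monomial d 1)) : f = g :=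
  (basisMonomials σ ℝ).ext fun d => by simpa using h d

theorem pairVariation_add (Q : MvPolynomial (ι × Fin 2) ℝ) :
    pairVariation μ (fun k l => e k l + e' k l) Q = pairVariation μ e Q + pairVariation μ e' Q := by
  have h : pairVariation (ι := ι) μ (fun k l => e k l + e' k l) =
      pairVariation μ e + pairVariation μ e' := linearMap_ext_monomial fun d => by
    simp only [LinearMap.add_apply, pairVariation_monomial, add_mul, Finset.sum_add_distrib]
  rw [h, LinearMap.add_apply]

theorem pairVariation_smul (c : ℝ) (Q : MvPolynomial (ι × Fin 2) ℝ) :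
    pairVariation μ (fun k l => c • e k l) Q = c • pairVariation μ e Q := by
  have h : pairVariation (ι := ι) μ (fun k l => c • e k l) = c • pairVariation μ e :=
    linearMap_ext_monomial fun d => by
      simp only [LinearMap.smul_apply, pairVariation_monomial, smul_mul_assoc, Finset.smul_sum]
  rw [h, LinearMap.smul_apply]

theorem pairVariation_mul (x : A) (Q : MvPolynomial (ι × Fin 2) ℝ) :
    pairVariation μ (fun k l => x * e k l) Q = x * pairVariation μ e Q := by
  have h : pairVariation (ι := ι) μ (fun k l => x * e k l) =
      (LinearMap.mulLeft ℝ x).comp (pairVariation μ e) :=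
    linearMap_ext_monomial fun d => by
      simp only [LinearMap.comp_apply, LinearMap.mulLeft_apply, pairVariation_monomial,
        mul_assoc, Finset.mul_sum]
  rw [h, LinearMap.comp_apply, LinearMap.mulLeft_apply]

theorem derivation_pairFunctional (δ : Derivation ℝ A A) (Q : MvPolynomial (ι × Fin 2) ℝ) :
    δ (pairFunctional μ Q) = pairVariation μ (fun k l => δ (μ k l)) Q := by
  have h : (δ : A →ₗ[ℝ] A).comp (pairFunctional (ι := ι) μ) =
      pairVariation μ fun k l => δ (μ k l) := linearMap_ext_monomial fun d => by
    rw [LinearMap.comp_apply, pairFunctional_monomial, pairVariation_monomial]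
    exact derivation_prod δ _ _
  exact LinearMap.congr_fun h Q

variable (χ : Fin 2 → ℝ)

/-- The power sum `∑_r (χ₀ x_r^i + χ₁ y_r^i)`. -/
def powerSum (i : ℕ) : MvPolynomial (ι × Fin 2) ℝ := ∑ z : ι × Fin 2, χ z.2 • X z ^ i

/-- The effect of the power sum `powerSum χ i` on a single pair. -/
def shiftSum (i : ℕ) (μ : ℕ → ℕ → A) (k l : ℕ) : A :=
  χ 0 • μ (k + i) l + χ 1 • μ k (l + i)

theorem pairFunctional_monomial_of_eq {d d' : ι × Fin 2 →₀ ℕ} (r : ι)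
    (h : ∀ r' ≠ r, ∀ b, d' (r', b) = d (r', b)) :
    pairFunctional μ (monomial d' 1) = μ (d' (r, 0)) (d' (r, 1)) *
      ∏ r' ∈ Finset.univ.erase r, μ (d (r', 0)) (d (r', 1)) := by
  rw [pairFunctional_monomial, ← Finset.mul_prod_erase _ _ (Finset.mem_univ r)]
  congr 1
  exact Finset.prod_congr rfl fun r' hr' => by
    rw [h r' (Finset.ne_of_mem_erase hr'), h r' (Finset.ne_of_mem_erase hr')]

theorem X_pow_mul_monomial {σ : Type*} (z : σ) (i : ℕ) (d : σ →₀ ℕ) :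
    (X z ^ i * monomial d 1 : MvPolynomial σ ℝ) = monomial (d + Finsupp.single z i) 1 := by
  rw [X_pow_eq_monomial, monomial_mul, one_mul, add_comm]

theorem pairFunctional_powerSum_mul (i : ℕ) (Q : MvPolynomial (ι × Fin 2) ℝ) :
    pairFunctional μ (powerSum χ i * Q) = pairVariation μ (shiftSum χ i μ) Q := by
  have h : (pairFunctional (ι := ι) μ).comp (LinearMap.mulLeft ℝ (powerSum χ i)) =
      pairVariation μ (shiftSum χ i μ) := linearMap_ext_monomial fun d => by
    rw [LinearMap.comp_apply, LinearMap.mulLeft_apply, powerSum, Finset.sum_mul, map_sum,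
      pairVariation_monomial, Fintype.sum_prod_type]
    refine Finset.sum_congr rfl fun r _ => ?_
    rw [Fin.sum_univ_two, smul_mul_assoc, smul_mul_assoc, map_smul, map_smul,
      X_pow_mul_monomial, X_pow_mul_monomial,
      pairFunctional_monomial_of_eq (d := d) r, pairFunctional_monomial_of_eq (d := d) r]
    · simp [shiftSum, add_mul]
    all_goals
      intro r' hr' b
      simp [hr'.symm]
  exact LinearMap.congr_fun h Q

/-- The vector field `∑_r (χ₀ x_r^P ∂/∂x_r + χ₁ y_r^P ∂/∂y_r)`. -/
def powerField (P : ℕ) : Derivation ℝ (MvPolynomial (ι × Fin 2) ℝ) (MvPolynomial (ι × Fin 2) ℝ) :=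
  mkDerivation ℝ fun z => χ z.2 • X z ^ P

/-- The effect of the divergence `Q ↦ ∑ ∂/∂z (z^P Q)` on a single pair. -/
def divergenceTerm (P : ℕ) (μ : ℕ → ℕ → A) (k l : ℕ) : A :=
  (χ 0 * ((k + P : ℕ) : ℝ)) • μ (k + P - 1) l + (χ 1 * ((l + P : ℕ) : ℝ)) • μ k (l + P - 1)

theorem powerField_monomial (P : ℕ) (d : ι × Fin 2 →₀ ℕ) :
    powerField χ P (monomial d 1) = ∑ z : ι × Fin 2,
      (χ z.2 * d z) • monomial (d - Finsupp.single z 1 + Finsupp.single z P) (1 : ℝ) := by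
  rw [powerField, mkDerivation_monomial, one_smul, Finsupp.sum_fintype _ _ (by simp)]
  refine Finset.sum_congr rfl fun z _ => ?_
  have h : monomial (d - Finsupp.single z 1) (d z : ℝ) =
      (d z : ℝ) • monomial (d - Finsupp.single z 1) (1 : ℝ) := by
    rw [smul_monomial, smul_eq_mul, mul_one]
  rw [h, ← X_pow_mul_monomial, smul_eq_mul, smul_mul_smul_comm, mul_comm (d z : ℝ),
    mul_comm (monomial _ _)]

theorem pairFunctional_divergence_single (P : ℕ) (d : ι × Fin 2 →₀ ℕ) (r : ι) (b : Fin 2) :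
    (χ b * d (r, b)) • pairFunctional μ (monomial
        (d - Finsupp.single (r, b) 1 + Finsupp.single (r, b) P) 1) +
      (P : ℝ) • χ b • pairFunctional μ (monomial (d + Finsupp.single (r, b) (P - 1)) 1) =
    (χ b * ((d (r, b) + P : ℕ) : ℝ)) • pairFunctional μ (monomial
      (d.update (r, b) (d (r, b) + P - 1)) 1) := by
  -- a negative exponent occurs only with coefficient `0`
  have e1 : (d (r, b) : ℝ) • pairFunctional μ (monomial
      (d - Finsupp.single (r, b) 1 + Finsupp.single (r, b) P) 1) =
      (d (r, b) : ℝ) • pairFunctional μ (monomial (d.update (r, b) (d (r, b) + P - 1)) 1) := by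
    rcases Nat.eq_zero_or_pos (d (r, b)) with h0 | h0
    · rw [h0, Nat.cast_zero, zero_smul, zero_smul]
    · have h : d - Finsupp.single (r, b) 1 + Finsupp.single (r, b) P =
          d.update (r, b) (d (r, b) + P - 1) := by
        ext z
        rw [Finsupp.add_apply, Finsupp.tsub_apply, Finsupp.update_apply]
        by_cases hz : z = (r, b)
        · rw [hz, if_pos rfl, Finsupp.single_eq_same, Finsupp.single_eq_same]
          omega
        · rw [if_neg hz, Finsupp.single_eq_of_ne hz, Finsupp.single_eq_of_ne hz]
          omega
      rw [h]
  have e2 : (P : ℝ) • pairFunctional μ (monomial (d + Finsupp.single (r, b) (P - 1)) 1) =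
      (P : ℝ) • pairFunctional μ (monomial (d.update (r, b) (d (r, b) + P - 1)) 1) := by
    rcases Nat.eq_zero_or_pos P with h0 | h0
    · rw [h0, Nat.cast_zero, zero_smul, zero_smul]
    · have h : d + Finsupp.single (r, b) (P - 1) = d.update (r, b) (d (r, b) + P - 1) := by
        ext z
        rw [Finsupp.add_apply, Finsupp.update_apply]
        by_cases hz : z = (r, b)
        · rw [hz, if_pos rfl, Finsupp.single_eq_same]
          omega
        · rw [if_neg hz, Finsupp.single_eq_of_ne hz, add_zero]
      rw [h]
  rw [mul_smul, e1, smul_comm (P : ℝ), e2, ← smul_add, ← add_smul, Nat.cast_add, mul_smul]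

theorem pairFunctional_divergence_monomial (P : ℕ) (d : ι × Fin 2 →₀ ℕ) :
    pairFunctional μ (powerField χ P (monomial d 1)) +
        (P : ℝ) • pairFunctional μ (powerSum χ (P - 1) * monomial d 1) =
      pairVariation μ (divergenceTerm χ P μ) (monomial d 1) := by
  rw [powerField_monomial, pairVariation_monomial, powerSum, Finset.sum_mul, map_sum, map_sum,
    Finset.smul_sum, ← Finset.sum_add_distrib, Fintype.sum_prod_type]
  refine Finset.sum_congr rfl fun r _ => ?_
  simp only [map_smul, smul_mul_assoc, X_pow_mul_monomial, pairFunctional_divergence_single]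
  rw [Fin.sum_univ_two,
    pairFunctional_monomial_of_eq (d := d) r, pairFunctional_monomial_of_eq (d := d) r]
  · simp [divergenceTerm, add_mul]
  all_goals
    intro r' hr' b
    rw [Finsupp.update_apply, if_neg fun h => hr' (congrArg Prod.fst h)]

/-- The Leibniz rule `∂(z^P Q)/∂z = z^P ∂Q/∂z + P z^{P-1} Q`, the left side being
`(k + P) z^{k+P-1}` for `Q = z^k`. -/
theorem pairFunctional_divergence (P : ℕ) (Q : MvPolynomial (ι × Fin 2) ℝ) :
    pairFunctional μ (powerField χ P Q) + (P : ℝ) • pairFunctional μ (powerSum χ (P - 1) * Q) =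
      pairVariation μ (divergenceTerm χ P μ) Q := by
  let f : MvPolynomial (ι × Fin 2) ℝ →ₗ[ℝ] A :=
    { toFun := fun Q => pairFunctional μ (powerField χ P Q) +
        (P : ℝ) • pairFunctional μ (powerSum χ (P - 1) * Q)
      map_add' := fun Q Q' => by
        rw [map_add, map_add, mul_add, map_add, smul_add]
        abel
      map_smul' := fun c Q => by
        rw [Derivation.map_smul, map_smul, mul_smul_comm, map_smul, RingHom.id_apply, smul_add,
          smul_comm (P : ℝ)] }
  have h : f = pairVariation μ (divergenceTerm χ P μ) :=
    linearMap_ext_monomial fun d => pairFunctional_divergence_monomial χ P d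
  exact LinearMap.congr_fun h Q

end PairFunctional

/-! ### The Vandermonde determinant under the vector fields `∑ x^P ∂/∂x` -/

section Vandermonde

variable {B : Type*} [CommRing B] [Algebra ℝ B]

theorem derivation_prod_of_eq_mul (D : Derivation ℝ B B) {κ : Type*} {s : Finset κ} {f g : κ → B}
    (h : ∀ i ∈ s, D (f i) = f i * g i) : D (∏ i ∈ s, f i) = (∏ i ∈ s, f i) * ∑ i ∈ s, g i := by
  classical
  rw [derivation_prod, Finset.mul_sum]
  refine Finset.sum_congr rfl fun i hi => ?_
  rw [h i hi, ← Finset.mul_prod_erase _ _ hi]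
  ring

/-- The logarithmic derivative of the Vandermonde determinant along `∑ v_k^P ∂/∂v_k` is `∑_{i<j}
(v_j^P - v_i^P) / (v_j - v_i)`, a quadratic expression in the power sums. -/
theorem two_mul_derivation_vandermonde {N : ℕ} (D : Derivation ℝ B B) (v : Fin N → B) (P : ℕ)
    (hv : ∀ k, D (v k) = v k ^ P) :
    2 * D (Matrix.vandermonde v).det =
      (∑ i ∈ Finset.range P, (∑ k, v k ^ i) * (∑ k, v k ^ (P - 1 - i)) -
        P * ∑ k, v k ^ (P - 1)) * (Matrix.vandermonde v).det := by
  set h : Fin N → Fin N → B := fun j i => ∑ u ∈ Finset.range P, v j ^ u * v i ^ (P - 1 - u) with hh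
  have hsymm : ∀ i j, h i j = h j i := fun i j => by
    rw [hh]
    simp only
    rw [← Finset.sum_range_reflect]
    refine Finset.sum_congr rfl fun u hu => ?_
    rw [mul_comm, Nat.sub_sub_self (by have := Finset.mem_range.1 hu; omega)]
  have hD : D (Matrix.vandermonde v).det =
      (Matrix.vandermonde v).det * ∑ i, ∑ j ∈ Finset.Ioi i, h j i := by
    rw [Matrix.det_vandermonde]
    refine derivation_prod_of_eq_mul D fun i _ => derivation_prod_of_eq_mul D fun j _ => ?_
    rw [map_sub, hv, hv, mul_comm]
    exact (geom_sum₂_mul (v j) (v i) P).symm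
  have hdiag : ∀ i, h i i = P * v i ^ (P - 1) := fun i => by
    have : ∀ u ∈ Finset.range P, v i ^ u * v i ^ (P - 1 - u) = v i ^ (P - 1) := fun u hu => by
      rw [← pow_add]
      congr 1
      have := Finset.mem_range.1 hu
      omega
    rw [hh]
    simp only
    rw [Finset.sum_congr rfl this, Finset.sum_const, Finset.card_range, nsmul_eq_mul]
  have hsum : 2 * ∑ i, ∑ j ∈ Finset.Ioi i, h j i = ∑ i, ∑ j, h j i - ∑ i, h i i := by
    have h1 := Finset.sum_sum_Ioi_add_eq_sum_sum_off_diag h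
    have h2 : ∀ i, ∑ j, h j i = h i i + ∑ j ∈ {i}ᶜ, h j i := fun i =>
      Fintype.sum_eq_add_sum_compl i fun j => h j i
    simp only [h2, Finset.sum_add_distrib, ← h1, hsymm _ _]
    rw [add_sub_cancel_left, two_mul]
  have hall : ∑ i, ∑ j, h j i =
      ∑ i ∈ Finset.range P, (∑ k, v k ^ i) * (∑ k, v k ^ (P - 1 - i)) := by
    simp only [hh, Finset.sum_mul_sum]
    rw [Finset.sum_comm' (t' := Finset.univ) (s' := fun _ => Finset.univ) (by simp),
      Finset.sum_comm' (s := Finset.range P) (t' := Finset.univ)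
        (s' := fun _ => Finset.range P) (by simp)]
    refine Finset.sum_congr rfl fun j _ => ?_
    rw [Finset.sum_comm]
  rw [hD, mul_left_comm, hsum, hall, mul_comm, Finset.mul_sum]
  simp only [hdiag]

end Vandermonde

/-! ### The Virasoro generators on the series -/

section Species

set_option linter.unusedSectionVars false

variable {σ : Type*} {ι : ℕ+ → σ}

theorem locallyFinite_timeVar_mul (hι : Function.Injective ι) (T : ℕ+ →₀ ℝ)
    (ψ : ℕ+ → MvPowerSeries σ ℝ) : LocallyFinite fun i => timeVar ι T i * ψ i := fun d => by
  classical
  refine (T.support.finite_toSet.union (d.support.finite_toSet.preimage hι.injOn)).subset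
    fun i hi => ?_
  by_contra h
  rw [Set.mem_union, not_or, Set.mem_preimage, Finset.mem_coe, Finset.mem_coe,
    Finsupp.notMem_support_iff, Finsupp.notMem_support_iff] at h
  refine hi ?_
  simp only [timeVar, add_mul, map_add, coeff_X_mul_eq, h.1, h.2, map_zero, zero_mul, if_true,
    add_zero]

theorem fsum_graph {β γ : Type*} {F : β × γ → MvPowerSeries σ ℝ} {j : γ → β × γ}
    (hj : Function.Injective j) (h : ∀ q ∉ Set.range j, F q = 0) :
    fsum F = fsum fun c => F (j c) := by
  ext m
  rw [coeff_fsum, coeff_fsum,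
    ← finsum_mem_range (f := fun q => MvPowerSeries.coeff m (F q)) hj, finsum_mem_def]
  refine finsum_congr fun q => ?_
  by_cases hq : q ∈ Set.range j
  · rw [Set.indicator_of_mem hq]
  · rw [Set.indicator_of_notMem hq, h q hq, map_zero]

variable {κ : Type*} [Fintype κ] [DecidableEq κ] {μ : ℕ → ℕ → MvPowerSeries σ ℝ}

theorem pairVariation_eq_sum {A : Type*} [CommRing A] [Algebra ℝ A] (μ e : ℕ → ℕ → A)
    (Q : MvPolynomial (κ × Fin 2) ℝ) :
    pairVariation μ e Q = ∑ d ∈ Q.support, ∑ r, e (d (r, 0)) (d (r, 1)) *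
      (Q.coeff d • ∏ r' ∈ Finset.univ.erase r, μ (d (r', 0)) (d (r', 1))) := by
  conv_lhs => rw [← MvPolynomial.support_sum_monomial_coeff Q]
  rw [map_sum]
  refine Finset.sum_congr rfl fun d _ => ?_
  have h : MvPolynomial.monomial d (Q.coeff d) = Q.coeff d • MvPolynomial.monomial d (1 : ℝ) := by
    rw [MvPolynomial.smul_monomial, smul_eq_mul, mul_one]
  rw [h, map_smul, pairVariation_monomial, Finset.smul_sum]
  exact Finset.sum_congr rfl fun r _ => by rw [mul_smul_comm]

theorem pairVariation_fsum {β : Type*} {F : β → ℕ → ℕ → MvPowerSeries σ ℝ}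
    (hF : ∀ k l, LocallyFinite fun q => F q k l) (Q : MvPolynomial (κ × Fin 2) ℝ) :
    pairVariation μ (fun k l => fsum fun q => F q k l) Q =
      fsum fun q => pairVariation μ (F q) Q := by
  simp only [pairVariation_eq_sum]
  rw [fsum_finsetSum _ fun d _ => LocallyFinite.finsetSum fun r _ => (hF _ _).mul_right _]
  refine Finset.sum_congr rfl fun d _ => ?_
  rw [fsum_finsetSum _ fun r _ => (hF _ _).mul_right _]
  exact Finset.sum_congr rfl fun r _ => fsum_mul_right (hF _ _) _

/-- A convergent family of relations between the moments gives a convergent family of relations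
between the integrals of a polynomial. -/
theorem SumsToZero.pairVariation {E : ℕ → ℕ → ℕ → MvPowerSeries σ ℝ}
    (hE : ∀ k l, SumsToZero fun i => E i k l) (Q : MvPolynomial (κ × Fin 2) ℝ) :
    SumsToZero fun i => pairVariation μ (E i) Q := by
  simp only [pairVariation_eq_sum]
  exact SumsToZero.finsetSum fun d _ => SumsToZero.finsetSum fun r _ =>
    (coeffFinite_mul_right _).sumsToZero (hE _ _)

variable {χ : Fin 2 → ℝ} {ε : ℝ} {N : ℕ} {T : ℕ+ →₀ ℝ} {Q : MvPolynomial (κ × Fin 2) ℝ} {P : ℕ}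

/-- The effect of `ε ∑_i i t_i powerSum χ (P + i - 1)` on a single pair. -/
def flowTerm (ι : ℕ+ → σ) (T : ℕ+ →₀ ℝ) (ε : ℝ) (χ : Fin 2 → ℝ) (P : ℕ)
    (μ : ℕ → ℕ → MvPowerSeries σ ℝ) (k l : ℕ) : MvPowerSeries σ ℝ :=
  fsum fun i : ℕ+ => (ε * i) • (timeVar ι T i * shiftSum χ (P + (i - 1)) μ k l)

theorem locallyFinite_flow (hι : Function.Injective ι) (T : ℕ+ →₀ ℝ) (ε : ℝ)
    (ψ : ℕ+ → MvPowerSeries σ ℝ) :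
    LocallyFinite fun i : ℕ+ => (ε * i) • (timeVar ι T i * ψ i) :=
  (locallyFinite_timeVar_mul hι T ψ).smul fun i => ε * i

theorem pairVariation_flowTerm (hι : Function.Injective ι) (Q : MvPolynomial (κ × Fin 2) ℝ) :
    pairVariation μ (flowTerm ι T ε χ P μ) Q = fsum fun i : ℕ+ =>
      (ε * i) • (timeVar ι T i * pairFunctional μ (powerSum χ (P + (i - 1)) * Q)) := by
  have h := pairVariation_fsum (μ := μ) (F := fun (i : ℕ+) k l =>
    (ε * i) • (timeVar ι T i * shiftSum χ (P + (i - 1)) μ k l))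
    (fun k l => locallyFinite_flow hι T ε _) Q
  refine h.trans (congrArg fsum (funext fun i => ?_))
  rw [pairVariation_smul, pairVariation_mul, pairFunctional_powerSum_mul]

theorem pderiv_pairFunctional
    (hμ : ∀ (i : ℕ+) k l, MvPowerSeries.pderiv ℝ (ι i) (μ k l) = ε • shiftSum χ i μ k l) (i : ℕ+)
    (Q : MvPolynomial (κ × Fin 2) ℝ) :
    MvPowerSeries.pderiv ℝ (ι i) (pairFunctional μ Q) =
      ε • pairFunctional μ (powerSum χ i * Q) := by
  rw [derivation_pairFunctional, pairFunctional_powerSum_mul, ← pairVariation_smul]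
  simp only [hμ]

theorem pairFunctional_powerSum_zero_mul (hN : (N : ℝ) = Fintype.card κ * (χ 0 + χ 1))
    (Q : MvPolynomial (κ × Fin 2) ℝ) :
    pairFunctional μ (powerSum χ 0 * Q) = (N : ℝ) • pairFunctional μ Q := by
  have h : powerSum χ 0 = MvPolynomial.C (σ := κ × Fin 2) (N : ℝ) := by
    simp only [powerSum, pow_zero, ← MvPolynomial.C_mul', mul_one, ← map_sum]
    rw [Fintype.sum_prod_type, hN]
    simp only [Fin.sum_univ_two, Finset.sum_const, Finset.card_univ, nsmul_eq_mul, map_mul, map_add,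
      map_natCast]
  rw [h, MvPolynomial.C_mul', map_smul]

theorem J1_of_pos (T : ℕ+ →₀ ℝ) (p : ℕ+) (φ : MvPowerSeries σ ℝ) :
    J1 ι T (p : ℕ) φ = MvPowerSeries.pderiv ℝ (ι p) φ := by
  rw [J1, dif_pos (by exact_mod_cast p.pos)]
  rfl

/-- The generator `J^{(1)}_P` inserts the power sum of degree `P` under the integral sign. -/
theorem J1_pairFunctional (hε : ε * ε = 1)
    (hμ : ∀ (i : ℕ+) k l, MvPowerSeries.pderiv ℝ (ι i) (μ k l) = ε • shiftSum χ i μ k l)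
    (hN : (N : ℝ) = Fintype.card κ * (χ 0 + χ 1)) (Q : MvPolynomial (κ × Fin 2) ℝ) (P : ℕ) :
    ε • J1 ι T P (pairFunctional μ Q) + ((N : ℝ) * J0 P) • pairFunctional μ Q =
      pairVariation μ (shiftSum χ P μ) Q := by
  rw [← pairFunctional_powerSum_mul]
  rcases Nat.eq_zero_or_pos P with rfl | hP
  · rw [pairFunctional_powerSum_zero_mul hN]
    simp [J1, J0]
  · obtain ⟨p, rfl⟩ : ∃ p : ℕ+, (p : ℕ) = P := ⟨⟨P, hP⟩, rfl⟩
    rw [J1_of_pos, pderiv_pairFunctional hμ, smul_smul, hε, one_smul, J0,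
      if_neg (by exact_mod_cast hP.ne'), mul_zero, zero_smul, add_zero]

/-- The first order part of `J_{P-1}^{(2)}`. For `P = 0` the time `t_1` has no partner. -/
theorem fsum_flow (hι : Function.Injective ι)
    (hμ : ∀ (i : ℕ+) k l, MvPowerSeries.pderiv ℝ (ι i) (μ k l) = ε • shiftSum χ i μ k l)
    (Q : MvPolynomial (κ × Fin 2) ℝ) {P : ℕ} {m : ℤ} (hm : m + 1 = P) :
    fsum (fun q : ℕ+ × ℕ+ => if -(q.1 : ℤ) + (q.2 : ℤ) = m then (q.1 : ℝ) •
      (timeVar ι T q.1 * MvPowerSeries.pderiv ℝ (ι q.2) (pairFunctional μ Q)) else 0) +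
      (if P = 0 then ε • (timeVar ι T 1 * pairFunctional μ (powerSum χ 0 * Q)) else 0) =
    pairVariation μ (flowTerm ι T ε χ P μ) Q := by
  rw [pairVariation_flowTerm hι]
  set H : ℕ+ → MvPowerSeries σ ℝ := fun i =>
    (ε * i) • (timeVar ι T i * pairFunctional μ (powerSum χ (P + (i - 1)) * Q)) with hH
  have hHf : LocallyFinite H := locallyFinite_flow hι T ε _
  set g : ℕ+ → ℕ+ := fun i => (P + (i - 1 : ℕ)).toPNat' with hg
  have hg0 : ∀ i : ℕ+, 0 < P + (i - 1 : ℕ) → ((g i : ℕ+) : ℕ) = P + (i - 1 : ℕ) := fun i h => by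
    simp only [hg, Nat.toPNat'_coe, if_pos h]
  have hpos : ∀ i : ℕ+, 0 < (i : ℕ) := fun i => i.pos
  rw [fsum_graph (j := fun i => (i, g i)) (fun i j h => (Prod.ext_iff.1 h).1)]
  · set G : ℕ+ → MvPowerSeries σ ℝ := fun i => if 0 < P + (i - 1 : ℕ) then H i else 0 with hG
    have e1 : ∀ i : ℕ+, (if -(i : ℤ) + (g i : ℤ) = m then (i : ℝ) • (timeVar ι T i *
        MvPowerSeries.pderiv ℝ (ι (g i)) (pairFunctional μ Q)) else 0) = G i := by
      intro i
      have := hpos i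
      by_cases h : 0 < P + (i - 1 : ℕ)
      · have h' := hg0 i h
        rw [if_pos (by omega)]
        simp only [hG, if_pos h, hH]
        rw [pderiv_pairFunctional hμ, h', mul_smul_comm, smul_smul, mul_comm]
      · have h' : g i = 1 := PNat.coe_inj.1 (by simp only [hg, Nat.toPNat'_coe, if_neg h]; rfl)
        simp only [hG, if_neg h]
        rw [if_neg]
        rw [h', PNat.one_coe]
        omega
    simp only [e1]
    set K : ℕ+ → MvPowerSeries σ ℝ := fun i => if i = 1 then
      (if P = 0 then ε • (timeVar ι T 1 * pairFunctional μ (powerSum χ 0 * Q)) else 0) else 0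
      with hK
    have hKsum : fsum K = _ := fsum_eq_single 1 fun i hi => by simp only [hK, if_neg hi]
    have hK1 : K 1 =
      (if P = 0 then ε • (timeVar ι T 1 * pairFunctional μ (powerSum χ 0 * Q)) else 0) := if_pos rfl
    rw [← hK1, ← hKsum, ← fsum_add]
    · refine congrArg fsum (funext fun i => ?_)
      have := hpos i
      by_cases h : 0 < P + (i - 1 : ℕ)
      · simp only [hG, hK, if_pos h]
        by_cases hi : i = 1
        · subst hi
          rw [if_pos rfl, if_neg (by rintro rfl; simp at h), add_zero]
        · rw [if_neg hi, add_zero]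
      · have hi : i = 1 := PNat.coe_inj.1 (by rw [PNat.one_coe]; omega)
        have hP : P = 0 := by omega
        subst hi
        subst hP
        simp [hG, hK, hH]
    · exact hHf.mono fun d i h => by
        simp only [hG]
        split_ifs
        · exact h
        · exact map_zero _
    · refine LocallyFinite.of_finite_support ((Set.finite_singleton (1 : ℕ+)).subset fun i hi => ?_)
      by_contra h
      exact hi (if_neg h)
  · rintro ⟨i, j⟩ hij
    refine if_neg fun h => hij ⟨i, ?_⟩
    have := hpos i
    have := hpos j
    simp only at h
    have h2 : 0 < P + (i - 1 : ℕ) := by omega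
    have h3 := hg0 i h2
    exact Prod.ext rfl (PNat.coe_inj.1 (by simp only; omega))

theorem fsum_second_order (hε : ε * ε = 1)
    (hμ : ∀ (i : ℕ+) k l, MvPowerSeries.pderiv ℝ (ι i) (μ k l) = ε • shiftSum χ i μ k l)
    (Q : MvPolynomial (κ × Fin 2) ℝ) {P : ℕ} {m : ℤ} (hm : m + 1 = P) :
    fsum (fun q : ℕ+ × ℕ+ => if (q.1 : ℤ) + (q.2 : ℤ) = m then MvPowerSeries.pderiv ℝ (ι q.1)
      (MvPowerSeries.pderiv ℝ (ι q.2) (pairFunctional μ Q)) else 0) =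
    ∑ i ∈ Finset.range (P - 2), pairFunctional μ
      (powerSum χ (i + 1) * (powerSum χ (P - 2 - i) * Q)) := by
  classical
  have hinj : Set.InjOn (fun i : ℕ => (i.succPNat, (P - 3 - i).succPNat))
      (Finset.range (P - 2) : Set ℕ) := fun i _ j _ h =>
    Nat.succPNat_injective (Prod.ext_iff.1 h).1
  rw [fsum_eq_sum ((Finset.range (P - 2)).image fun i : ℕ => (i.succPNat, (P - 3 - i).succPNat)),
    Finset.sum_image hinj]
  · refine Finset.sum_congr rfl fun i hi => ?_
    have hi := Finset.mem_range.1 hi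
    have h1 : ((P - 3 - i).succPNat : ℕ) = P - 2 - i := by rw [Nat.succPNat_coe]; omega
    have h2 : (i.succPNat : ℕ) = i + 1 := Nat.succPNat_coe i
    rw [if_pos (by simp only; omega), pderiv_pairFunctional hμ, Derivation.map_smul,
      pderiv_pairFunctional hμ, smul_smul, hε, one_smul, h1, h2]
  · rintro ⟨i, j⟩ hij
    refine if_neg fun h => hij (Finset.mem_image.2 ⟨i - 1, ?_, ?_⟩)
    · have := i.pos
      have := j.pos
      simp only at h
      rw [Finset.mem_range]
      omega
    · have := i.pos
      have := j.pos
      simp only at h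
      refine Prod.ext (PNat.coe_inj.1 ?_) (PNat.coe_inj.1 ?_) <;>
      · simp only [Nat.succPNat_coe]
        omega

/-- The generator `J^{(2)}_{P-1} + (2N + P) J^{(1)}_{P-1} + N (N + 1) J^{(0)}_{P-1}` acts under the
integral sign by a divergence and the variation of the exponential. -/
theorem J2_pairFunctional (hι : Function.Injective ι) (hε : ε * ε = 1)
    (hμ : ∀ (i : ℕ+) k l, MvPowerSeries.pderiv ℝ (ι i) (μ k l) = ε • shiftSum χ i μ k l)
    (hN : (N : ℝ) = Fintype.card κ * (χ 0 + χ 1)) {m : ℤ} (hm : m + 1 = P)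
    (hQ : 2 * powerField χ P Q = (∑ i ∈ Finset.range P, powerSum χ i * powerSum χ (P - 1 - i) -
      (P : MvPolynomial (κ × Fin 2) ℝ) * powerSum χ (P - 1)) * Q) :
    J2 ι T m (pairFunctional μ Q) + (ε * (2 * N + m + 1)) • J1 ι T m (pairFunctional μ Q) +
        ((N : ℝ) * (N + 1) * J0 m) • pairFunctional μ Q =
      (2 : ℝ) • pairVariation μ (fun k l => divergenceTerm χ P μ k l + flowTerm ι T ε χ P μ k l) Q
        := by
  set φ := pairFunctional μ Q with hφ
  have h3 : fsum (fun q : ℕ+ × ℕ+ => if -(q.1 : ℤ) - (q.2 : ℤ) = m then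
      ((q.1 : ℝ) * (q.2 : ℝ)) • (timeVar ι T q.1 * timeVar ι T q.2 * φ) else 0) = 0 := by
    rw [fsum_eq_sum ∅]
    · rfl
    · rintro ⟨i, j⟩ -
      have := i.pos
      have := j.pos
      exact if_neg (by simp only; omega)
  have hdiv : (2 : ℝ) • pairVariation μ (divergenceTerm χ P μ) Q =
      ∑ i ∈ Finset.range P, pairFunctional μ (powerSum χ i * (powerSum χ (P - 1 - i) * Q)) +
        (P : ℝ) • pairFunctional μ (powerSum χ (P - 1) * Q) := by
    have h2 : (2 : ℝ) • pairFunctional μ (powerField χ P Q) =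
        pairFunctional μ (2 * powerField χ P Q) := by
      rw [two_mul, map_add, two_smul]
    have h4 : pairFunctional μ ((P : MvPolynomial (κ × Fin 2) ℝ) * powerSum χ (P - 1) * Q) =
        (P : ℝ) • pairFunctional μ (powerSum χ (P - 1) * Q) := by
      rw [mul_assoc, ← nsmul_eq_mul, map_nsmul, Nat.cast_smul_eq_nsmul]
    rw [← pairFunctional_divergence, smul_add, h2, hQ, sub_mul, map_sub, h4, Finset.sum_mul,
      map_sum, two_smul]
    simp only [mul_assoc]
    abel
  rw [pairVariation_add, smul_add, hdiv, ← fsum_flow hι hμ Q hm, J2, h3, add_zero,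
    fsum_second_order hε hμ Q hm]
  have hz := fun Q' => pairFunctional_powerSum_zero_mul (μ := μ) hN Q'
  rcases P with _ | _ | P
  · obtain rfl : m = -1 := by push_cast at hm; omega
    have hJ1 : J1 ι T (-1) φ = timeVar ι T 1 * φ := by
      rw [J1, dif_neg (by norm_num), dif_pos (by norm_num)]
      simp only [Int.reduceNeg, Int.cast_neg, Int.cast_one, neg_neg, one_smul]
      rfl
    rw [hJ1, hz, J0]
    rw [if_pos rfl, if_neg (by norm_num), mul_smul_comm, ← hφ]
    simp only [zero_tsub, Finset.range_zero, Finset.sum_empty]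
    generalize fsum _ = F
    push_cast
    module
  · obtain rfl : m = 0 := by push_cast at hm; omega
    have hJ1 : J1 ι T 0 φ = 0 := by simp [J1]
    rw [hJ1, J0]
    rw [if_pos rfl, if_neg (by norm_num), hz, ← hφ]
    simp only [zero_add, Nat.reduceSub, Finset.range_zero, Finset.range_one, Finset.sum_empty,
      Finset.sum_singleton, Nat.sub_self, hz, ← hφ]
    generalize fsum _ = F
    push_cast
    module
  · obtain rfl : m = (P + 1 : ℕ) := by push_cast at hm ⊢; omega
    have hJ1 : J1 ι T (P + 1 : ℕ) φ = ε • pairFunctional μ (powerSum χ (P + 1) * Q) := by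
      have h := J1_of_pos (ι := ι) T P.succPNat φ
      rwa [Nat.succPNat_coe, pderiv_pairFunctional hμ, Nat.succPNat_coe] at h
    rw [hJ1, J0, if_neg (by positivity), Finset.sum_range_succ, Finset.sum_range_succ']
    simp only [Nat.add_sub_cancel, Nat.sub_zero, Nat.sub_self, hz, smul_smul]
    have h5 : pairFunctional μ (powerSum χ (P + 1) * (powerSum χ 0 * Q)) =
        (N : ℝ) • pairFunctional μ (powerSum χ (P + 1) * Q) := by
      rw [mul_left_comm, hz]
    rw [h5, if_neg (by omega), ← hφ, show P + 1 + 1 - 2 = P from rfl,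
      show ε * (2 * N + ((P + 1 : ℕ) : ℤ) + 1) * ε = 2 * N + P + 2 by
        push_cast
        linear_combination (2 * N + P + 2 : ℝ) * hε]
    simp only [Nat.add_sub_add_right]
    generalize fsum _ = F
    push_cast
    module

end Species

/-! ### The linear relations between the moments, as functions of the times -/

section MomentFlow

variable {σ : Type*} {ι : ℕ+ → σ}

theorem coeff_fsum_timeVar_mul (hι : Function.Injective ι) (T : ℕ+ →₀ ℝ) (ε : ℝ)
    {ψ : ℕ+ → MvPowerSeries σ ℝ} {d : σ →₀ ℕ} {α : ℕ+ → ℝ} {β : ℝ}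
    (hα : ∀ i, MvPowerSeries.coeff d (ψ i) = α i)
    (hβ : ∀ i, d (ι i) ≠ 0 → MvPowerSeries.coeff (d - Finsupp.single (ι i) 1) (ψ i) =
      d (ι i) * β) :
    MvPowerSeries.coeff d (fsum fun i : ℕ+ => (ε * i) • (timeVar ι T i * ψ i)) =
      ε * (T.sum fun i c => i * c * α i) + ε * (wt hι d * β) := by
  classical
  have h : ∀ i : ℕ+, MvPowerSeries.coeff d ((ε * i) • (timeVar ι T i * ψ i)) =
      ε * (i * T i * α i) + ε * ((i : ℕ) * (d (ι i) : ℕ) * β) := fun i => by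
    rw [map_smul, timeVar, add_mul, map_add, MvPowerSeries.coeff_C_mul, coeff_X_mul_eq, hα,
      smul_eq_mul]
    by_cases hd : d (ι i) = 0
    · rw [if_pos hd, hd, Nat.cast_zero]
      ring
    · rw [if_neg hd, hβ i hd]
      ring
  set s : Finset ℕ+ := T.support ∪ (d.comapDomain ι hι.injOn).support with hs
  have hT : ∀ i ∉ s, T i = 0 := fun i hi => Finsupp.notMem_support_iff.1 fun h =>
    hi (Finset.mem_union_left _ h)
  have hd : ∀ i ∉ s, d (ι i) = 0 := fun i hi => Finsupp.notMem_support_iff.1 fun h =>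
    hi (Finset.mem_union_right _ (by simpa using h))
  rw [coeff_fsum, finsum_eq_sum_of_support_subset (s := s)]
  · simp only [h]
    rw [Finset.sum_add_distrib, ← Finset.mul_sum, ← Finset.mul_sum, ← Finset.sum_mul]
    congr 2
    · refine (Finset.sum_subset Finset.subset_union_left fun i _ hi => ?_).symm
      rw [Finsupp.notMem_support_iff.1 hi, mul_zero, zero_mul]
    · congr 1
      rw [wt, Finsupp.sum]
      push_cast
      refine (Finset.sum_subset Finset.subset_union_right fun i _ hi => ?_).symm
      have : d (ι i) = 0 := by simpa using hi
      rw [this, Nat.cast_zero, mul_zero]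
  · intro i hi
    by_contra hi'
    refine hi ?_
    simp only
    rw [h, hT i hi', hd i hi', Nat.cast_zero]
    ring

end MomentFlow

section MomentField

variable {M : ℕ → ℕ → ℝ}

theorem coeff_formalMoment (k l : ℕ) (d : ℕ+ ⊕ ℕ+ →₀ ℕ) :
    MvPowerSeries.coeff d (formalMoment M k l) =
      linExp (Sum.elim (fun _ => 1) (fun _ => -1) : ℕ+ ⊕ ℕ+ → ℝ) d *
        M (k + wt (ι := Sum.inl) Sum.inl_injective d) (l + wt (ι := Sum.inr) Sum.inr_injective d) :=
  coeff_momentPairing M k l d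

theorem linExp_sub_single {σ : Type*} (c : σ → ℝ) {s : σ} {d : σ →₀ ℕ} (h : d s ≠ 0) :
    c s * linExp c (d - Finsupp.single s 1) = d s * linExp c d := by
  obtain ⟨d', rfl⟩ : ∃ d', d = d' + Finsupp.single s 1 :=
    ⟨d - Finsupp.single s 1, (tsub_add_cancel_of_le (by
      classical rw [Finsupp.single_le_iff]; omega)).symm⟩
  have := linExp_add_single c s d'
  rw [add_tsub_cancel_right, ← this, Finsupp.add_apply, Finsupp.single_eq_same]
  push_cast
  ring

theorem wt_sub_single {σ : Type*} {ι : ℕ+ → σ} (hι : Function.Injective ι) {i : ℕ+} {d : σ →₀ ℕ}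
    (h : d (ι i) ≠ 0) : wt hι (d - Finsupp.single (ι i) 1) + i = wt hι d := by
  conv_rhs => rw [← tsub_add_cancel_of_le (a := Finsupp.single (ι i) 1) (b := d) (by
    classical rw [Finsupp.single_le_iff]; omega)]
  rw [wt_add, wt_single, mul_one]

theorem wt_sub_single_of_notMem {σ : Type*} {ι : ℕ+ → σ} (hι : Function.Injective ι) {s : σ}
    {d : σ →₀ ℕ} (hs : s ∉ Set.range ι) (h : d s ≠ 0) :
    wt hι (d - Finsupp.single s 1) = wt hι d := by
  conv_rhs => rw [← tsub_add_cancel_of_le (a := Finsupp.single s 1) (b := d) (by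
    classical rw [Finsupp.single_le_iff]; omega)]
  rw [wt_add, wt_single_of_notMem hι hs, add_zero]

theorem shiftSum_zero_one {A : Type*} [CommRing A] [Algebra ℝ A] (μ : ℕ → ℕ → A) (i k l : ℕ) :
    shiftSum ![1, 0] i μ k l = μ (k + i) l := by
  simp [shiftSum]

theorem shiftSum_one_zero {A : Type*} [CommRing A] [Algebra ℝ A] (μ : ℕ → ℕ → A) (i k l : ℕ) :
    shiftSum ![0, 1] i μ k l = μ k (l + i) := by
  simp [shiftSum]

theorem coeff_flowTerm_inl (T : ℕ+ →₀ ℝ) (P k l : ℕ) (d : ℕ+ ⊕ ℕ+ →₀ ℕ) :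
    MvPowerSeries.coeff d (flowTerm Sum.inl T 1 ![1, 0] P (formalMoment M) k l) =
      linExp (Sum.elim (fun _ => 1) (fun _ => -1) : ℕ+ ⊕ ℕ+ → ℝ) d *
        ((T.sum fun j c => j * c *
          M (k + wt (ι := Sum.inl) Sum.inl_injective d + P + (j - 1))
            (l + wt (ι := Sum.inr) Sum.inr_injective d)) +
        (wt (ι := Sum.inl) Sum.inl_injective d : ℝ) *
          M (k + wt (ι := Sum.inl) Sum.inl_injective d + P - 1)
            (l + wt (ι := Sum.inr) Sum.inr_injective d)) := by
  set L := linExp (Sum.elim (fun _ => 1) (fun _ => -1) : ℕ+ ⊕ ℕ+ → ℝ) d with hL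
  set w₁ := wt (ι := Sum.inl) Sum.inl_injective d with hw₁
  set w₂ := wt (ι := Sum.inr) Sum.inr_injective d with hw₂
  rw [flowTerm, coeff_fsum_timeVar_mul (ι := Sum.inl) Sum.inl_injective T 1
    (α := fun i => L * M (k + w₁ + P + (i - 1)) (l + w₂)) (β := L * M (k + w₁ + P - 1) (l + w₂))]
  · simp only [Finsupp.sum, one_mul, mul_add, Finset.mul_sum]
    congr 1
    · exact Finset.sum_congr rfl fun j _ => by ring
    · ring
  · intro i
    rw [shiftSum_zero_one, coeff_formalMoment]
    congr 2
    omega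
  · intro i hi
    have h1 := linExp_sub_single (Sum.elim (fun _ => 1) (fun _ => -1) : ℕ+ ⊕ ℕ+ → ℝ) hi
    rw [Sum.elim_inl, one_mul] at h1
    have h2 := wt_sub_single (ι := Sum.inl) Sum.inl_injective hi
    have h3 := wt_sub_single_of_notMem (ι := Sum.inr) Sum.inr_injective (s := Sum.inl i) (by simp)
      hi
    have := i.pos
    rw [shiftSum_zero_one, coeff_formalMoment, h1, h3, mul_assoc]
    congr 3
    omega

theorem coeff_flowTerm_inr (S : ℕ+ →₀ ℝ) (P k l : ℕ) (d : ℕ+ ⊕ ℕ+ →₀ ℕ) :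
    MvPowerSeries.coeff d (flowTerm Sum.inr S (-1) ![0, 1] P (formalMoment M) k l) =
      linExp (Sum.elim (fun _ => 1) (fun _ => -1) : ℕ+ ⊕ ℕ+ → ℝ) d *
        (-(S.sum fun j c => j * c *
          M (k + wt (ι := Sum.inl) Sum.inl_injective d)
            (l + wt (ι := Sum.inr) Sum.inr_injective d + P + (j - 1))) +
        (wt (ι := Sum.inr) Sum.inr_injective d : ℝ) *
          M (k + wt (ι := Sum.inl) Sum.inl_injective d)
            (l + wt (ι := Sum.inr) Sum.inr_injective d + P - 1)) := by
  set L := linExp (Sum.elim (fun _ => 1) (fun _ => -1) : ℕ+ ⊕ ℕ+ → ℝ) d with hL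
  set w₁ := wt (ι := Sum.inl) Sum.inl_injective d with hw₁
  set w₂ := wt (ι := Sum.inr) Sum.inr_injective d with hw₂
  rw [flowTerm, coeff_fsum_timeVar_mul (ι := Sum.inr) Sum.inr_injective S (-1)
    (α := fun i => L * M (k + w₁) (l + w₂ + P + (i - 1)))
    (β := -L * M (k + w₁) (l + w₂ + P - 1))]
  · simp only [Finsupp.sum, neg_mul, one_mul, mul_add, mul_neg, neg_neg, Finset.mul_sum]
    congr 1
    · rw [← Finset.sum_neg_distrib]
      exact Finset.sum_congr rfl fun j _ => by ring
    · ring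
  · intro i
    rw [shiftSum_one_zero, coeff_formalMoment]
    congr 2
    omega
  · intro i hi
    have h1 := linExp_sub_single (Sum.elim (fun _ => 1) (fun _ => -1) : ℕ+ ⊕ ℕ+ → ℝ) hi
    rw [Sum.elim_inr] at h1
    have h1' : linExp (Sum.elim (fun _ => 1) (fun _ => -1) : ℕ+ ⊕ ℕ+ → ℝ)
        (d - Finsupp.single (Sum.inr i) 1) = d (Sum.inr i) * -L := by
      rw [mul_neg, ← h1]
      ring
    have h2 := wt_sub_single (ι := Sum.inr) Sum.inr_injective hi
    have h3 := wt_sub_single_of_notMem (ι := Sum.inl) Sum.inl_injective (s := Sum.inr i) (by simp)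
      hi
    have := i.pos
    rw [shiftSum_one_zero, coeff_formalMoment, h1', h3, mul_assoc]
    congr 3
    omega

/-- The change of the moments `μ_{kl}(t, s)` under the vector field `a x^P ∂/∂x + a y^P ∂/∂y`, the
exponentials and the contribution `b x^P + b y^P` of the potential included. -/
def momentField (a b : ℝ) (T S : ℕ+ →₀ ℝ) (M : ℕ → ℕ → ℝ) (P k l : ℕ) :
    MvPowerSeries (ℕ+ ⊕ ℕ+) ℝ :=
  a • ((divergenceTerm ![1, 0] P (formalMoment M) k l +
      flowTerm Sum.inl T 1 ![1, 0] P (formalMoment M) k l) +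
    (divergenceTerm ![0, 1] P (formalMoment M) k l +
      flowTerm Sum.inr S (-1) ![0, 1] P (formalMoment M) k l)) +
  b • (shiftSum ![1, 0] P (formalMoment M) k l + shiftSum ![0, 1] P (formalMoment M) k l)

/-- The coefficients of the change of `μ_{kl}(t, s)` are the relations between the moments at the
base point, with shifted indices. -/
theorem coeff_momentField (a b : ℕ → ℝ) (T S : ℕ+ →₀ ℝ) (P i k l : ℕ) (d : ℕ+ ⊕ ℕ+ →₀ ℕ) :
    MvPowerSeries.coeff d (momentField (a i) (b i) T S M P k l) =
      linExp (Sum.elim (fun _ => 1) (fun _ => -1) : ℕ+ ⊕ ℕ+ → ℝ) d *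
        momentRelation a b T S M P i (k + wt (ι := Sum.inl) Sum.inl_injective d)
          (l + wt (ι := Sum.inr) Sum.inr_injective d) := by
  have h1 : MvPowerSeries.coeff d (divergenceTerm ![1, 0] P (formalMoment M) k l) =
      linExp (Sum.elim (fun _ => 1) (fun _ => -1) : ℕ+ ⊕ ℕ+ → ℝ) d * (((k + P : ℕ) : ℝ) *
        M (k + wt (ι := Sum.inl) Sum.inl_injective d + P - 1)
          (l + wt (ι := Sum.inr) Sum.inr_injective d)) := by
    simp only [divergenceTerm, Matrix.cons_val_zero, Matrix.cons_val_one, Matrix.cons_val_fin_one,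
      one_mul, zero_mul, zero_smul, add_zero, map_smul, smul_eq_mul]
    -- the subtraction truncates only when the coefficient vanishes
    rcases Nat.eq_zero_or_pos (k + P) with h | h
    · rw [h]; simp
    · rw [coeff_formalMoment, show k + P - 1 + wt (ι := Sum.inl) Sum.inl_injective d =
        k + wt (ι := Sum.inl) Sum.inl_injective d + P - 1 by omega]
      ring
  have h2 : MvPowerSeries.coeff d (divergenceTerm ![0, 1] P (formalMoment M) k l) =
      linExp (Sum.elim (fun _ => 1) (fun _ => -1) : ℕ+ ⊕ ℕ+ → ℝ) d * (((l + P : ℕ) : ℝ) *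
        M (k + wt (ι := Sum.inl) Sum.inl_injective d)
          (l + wt (ι := Sum.inr) Sum.inr_injective d + P - 1)) := by
    simp only [divergenceTerm, Matrix.cons_val_zero, Matrix.cons_val_one, Matrix.cons_val_fin_one,
      one_mul, zero_mul, zero_smul, zero_add, map_smul, smul_eq_mul]
    rcases Nat.eq_zero_or_pos (l + P) with h | h
    · rw [h]; simp
    · rw [coeff_formalMoment, show l + P - 1 + wt (ι := Sum.inr) Sum.inr_injective d =
        l + wt (ι := Sum.inr) Sum.inr_injective d + P - 1 by omega]
      ring
  simp only [momentField, map_add, map_smul, smul_eq_mul, h1, h2, coeff_flowTerm_inl,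
    coeff_flowTerm_inr, shiftSum_zero_one, shiftSum_one_zero, coeff_formalMoment, momentRelation]
  rw [add_right_comm k P, add_right_comm l P]
  push_cast
  ring

theorem sumsToZero_momentField {a b : ℕ → ℝ} {T S : ℕ+ →₀ ℝ} {j : ℕ}
    (h : ∀ k l, HasSum (fun i => momentRelation a b T S M (i + j) i k l) 0) (k l : ℕ) :
    SumsToZero fun i => momentField (a i) (b i) T S M (i + j) k l := fun d => by
  simp only [coeff_momentField]
  have := (h (k + wt (ι := Sum.inl) Sum.inl_injective d)
    (l + wt (ι := Sum.inr) Sum.inr_injective d)).mul_left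
      (linExp (Sum.elim (fun _ => 1) (fun _ => -1) : ℕ+ ⊕ ℕ+ → ℝ) d)
  rwa [mul_zero] at this

theorem hasSubst_restrictDiag : MvPowerSeries.HasSubst (Sum.elim (fun i => MvPowerSeries.X i)
    (fun i => -MvPowerSeries.X i) : ℕ+ ⊕ ℕ+ → MvPowerSeries ℕ+ ℝ) :=
  hasSubst_sumElim hasSubst_X (hasSubst_neg hasSubst_X)

theorem restrictDiag_mul (φ ψ : MvPowerSeries (ℕ+ ⊕ ℕ+) ℝ) :
    restrictDiag (φ * ψ) = restrictDiag φ * restrictDiag ψ := by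
  simp only [restrictDiag, ← MvPowerSeries.coe_substAlgHom hasSubst_restrictDiag, map_mul]

theorem restrictDiag_timeVar_inl (T : ℕ+ →₀ ℝ) (i : ℕ+) :
    restrictDiag (timeVar Sum.inl T i) = timeVar id T i := by
  rw [timeVar, coeffFinite_restrictDiag.map_add]
  simp only [restrictDiag, MvPowerSeries.subst_X hasSubst_restrictDiag, Sum.elim_inl,
    MvPowerSeries.subst_C]
  rfl

theorem restrictDiag_timeVar_inr (T : ℕ+ →₀ ℝ) (i : ℕ+) :
    restrictDiag (timeVar Sum.inr (-T) i) = -timeVar id T i := by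
  rw [timeVar, coeffFinite_restrictDiag.map_add]
  simp only [restrictDiag, MvPowerSeries.subst_X hasSubst_restrictDiag, Sum.elim_inr,
    MvPowerSeries.subst_C, timeVar]
  simp
  ring

/-- On `s = -t` the flows in `t` and in `s` combine to the flow of the Pfaffian time. -/
theorem restrictDiag_momentField (a b : ℝ) (T : ℕ+ →₀ ℝ) (P k l : ℕ) :
    restrictDiag (momentField a b T (-T) M P k l) =
      a • (divergenceTerm ![1, 1] P (diagMoment M) k l +
        flowTerm id T 1 ![1, 1] P (diagMoment M) k l) +
      b • shiftSum ![1, 1] P (diagMoment M) k l := by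
  have hc := coeffFinite_restrictDiag
  have hf1 : restrictDiag (flowTerm Sum.inl T 1 ![1, 0] P (formalMoment M) k l) =
      fsum fun i : ℕ+ => ((1 : ℝ) * i) • (timeVar id T i * diagMoment M (k + (P + (i - 1))) l) := by
    rw [flowTerm, hc.map_fsum (locallyFinite_flow Sum.inl_injective _ _ _)]
    refine congrArg fsum (funext fun i => ?_)
    rw [hc.map_smul, restrictDiag_mul, restrictDiag_timeVar_inl, shiftSum_zero_one,
      formalMoment_subst_diag]
  have hf2 : restrictDiag (flowTerm Sum.inr (-T) (-1) ![0, 1] P (formalMoment M) k l) =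
      fsum fun i : ℕ+ => ((1 : ℝ) * i) • (timeVar id T i * diagMoment M k (l + (P + (i - 1)))) := by
    rw [flowTerm, hc.map_fsum (locallyFinite_flow Sum.inr_injective _ _ _)]
    refine congrArg fsum (funext fun i => ?_)
    rw [hc.map_smul, restrictDiag_mul, restrictDiag_timeVar_inr, shiftSum_one_zero,
      formalMoment_subst_diag, neg_mul, neg_mul, neg_smul, smul_neg, neg_neg]
  have hf : flowTerm id T 1 ![1, 1] P (diagMoment M) k l =
      (fsum fun i : ℕ+ => ((1 : ℝ) * i) • (timeVar id T i * diagMoment M (k + (P + (i - 1))) l)) +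
      fsum fun i : ℕ+ => ((1 : ℝ) * i) • (timeVar id T i * diagMoment M k (l + (P + (i - 1))))
        := by
    rw [← fsum_add (locallyFinite_flow Function.injective_id _ _ _)
      (locallyFinite_flow Function.injective_id _ _ _), flowTerm]
    refine congrArg fsum (funext fun i => ?_)
    rw [← smul_add, ← mul_add]
    simp [shiftSum]
  have hd : restrictDiag (divergenceTerm ![1, 0] P (formalMoment M) k l) +
      restrictDiag (divergenceTerm ![0, 1] P (formalMoment M) k l) =
        divergenceTerm ![1, 1] P (diagMoment M) k l := by
    simp only [divergenceTerm, hc.map_add, hc.map_smul, formalMoment_subst_diag]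
    simp
  have hs : restrictDiag (shiftSum ![1, 0] P (formalMoment M) k l) +
      restrictDiag (shiftSum ![0, 1] P (formalMoment M) k l) =
        shiftSum ![1, 1] P (diagMoment M) k l := by
    simp only [shiftSum, hc.map_add, hc.map_smul, formalMoment_subst_diag]
    simp
  simp only [momentField, hc.map_add, hc.map_smul, hf1, hf2, hs]
  rw [hf, ← hd]
  congr 2
  abel

end MomentField

/-! ### The Virasoro constraints -/

section VandermondeFunctional

set_option linter.unusedSectionVars false

open MvPolynomial

variable {κ : Type*} [Fintype κ] [DecidableEq κ] {A : Type*} [CommRing A] [Algebra ℝ A]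

theorem pairFunctional_prod_X_pow (μ : ℕ → ℕ → A) (f : κ × Fin 2 → ℕ) :
    pairFunctional μ (∏ z, X z ^ f z) = ∏ r, μ (f (r, 0)) (f (r, 1)) := by
  have h : (∏ z, X z ^ f z : MvPolynomial (κ × Fin 2) ℝ) =
      monomial (Finsupp.equivFunOnFinite.symm f) 1 := by
    rw [monomial_eq, C_1, one_mul, Finsupp.prod_fintype _ _ (by simp)]
    rfl
  rw [h, pairFunctional_monomial]
  rfl

theorem det_vandermonde_eq_sum {B : Type*} [CommRing B] [Algebra ℝ B] {N : ℕ} (v : Fin N → B) :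
    (Matrix.vandermonde v).det = ∑ σ : Equiv.Perm (Fin N),
      ((Equiv.Perm.sign σ : ℤ) : ℝ) • ∏ k, v k ^ (σ k : ℕ) := by
  rw [← Matrix.det_transpose, Matrix.det_apply]
  refine Finset.sum_congr rfl fun σ _ => ?_
  rw [Units.smul_def, ← Int.cast_smul_eq_zsmul ℝ]
  rfl

/-- The product `Δ_n(x) Δ_n(y)`. -/
def vandermondePair (n : ℕ) : MvPolynomial (Fin n × Fin 2) ℝ :=
  (Matrix.vandermonde fun r : Fin n => X (r, 0)).det *
    (Matrix.vandermonde fun r : Fin n => X (r, 1)).det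

/-- Andréief's formula for the functional. -/
theorem pairFunctional_vandermondePair (μ : ℕ → ℕ → A) (n : ℕ) :
    pairFunctional μ (vandermondePair n) =
      (n.factorial : ℝ) • (Matrix.of fun i j : Fin n => μ i j).det := by
  rw [← sum_sum_sign_smul_prod, vandermondePair, det_vandermonde_eq_sum, det_vandermonde_eq_sum,
    Finset.sum_mul_sum, map_sum]
  refine Finset.sum_congr rfl fun π _ => ?_
  rw [map_sum]
  refine Finset.sum_congr rfl fun ρ _ => ?_
  rw [smul_mul_smul_comm, map_smul]
  have h := pairFunctional_prod_X_pow μ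
    (fun z : Fin n × Fin 2 => (![(π z.1 : ℕ), (ρ z.1 : ℕ)] : Fin 2 → ℕ) z.2)
  rw [Fintype.prod_prod_type] at h
  simp only [Fin.prod_univ_two, Matrix.cons_val_zero, Matrix.cons_val_one,
    Matrix.cons_val_fin_one, Finset.prod_mul_distrib] at h
  rw [h]
  rfl

/-- The Vandermonde determinant of the `2n` variables `x_0, y_0, x_1, y_1, …`. -/
def vandermondeMerge (n : ℕ) : MvPolynomial (Fin n × Fin 2) ℝ :=
  (Matrix.vandermonde fun k : Fin (2 * n) => X ((pairEquiv n).symm k)).det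

/-- De Bruijn's formula for the functional. -/
theorem pairFunctional_vandermondeMerge (μ : ℕ → ℕ → A) (n : ℕ) :
    pairFunctional μ (vandermondeMerge n) =
      ∑ σ, pfTerm (Matrix.of fun i j : Fin (2 * n) => μ i j) σ := by
  rw [vandermondeMerge, det_vandermonde_eq_sum, map_sum]
  refine Finset.sum_congr rfl fun σ _ => ?_
  have h : ∏ k : Fin (2 * n), (X ((pairEquiv n).symm k) : MvPolynomial (Fin n × Fin 2) ℝ) ^
      (σ k : ℕ) = ∏ z, X z ^ (σ (pairEquiv n z) : ℕ) := by
    rw [← Equiv.prod_comp (pairEquiv n)]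
    simp only [Equiv.symm_apply_apply]
  rw [map_smul, h, pairFunctional_prod_X_pow, pfTerm, Int.cast_smul_eq_zsmul, zsmul_eq_mul]
  rfl

theorem derivation_vandermonde_eq_zero {B : Type*} [CommRing B] [Algebra ℝ B]
    (D : Derivation ℝ B B) {N : ℕ} {v : Fin N → B} (hv : ∀ k, D (v k) = 0) :
    D (Matrix.vandermonde v).det = 0 := by
  have h : ∀ i, ∀ j ∈ Finset.Ioi i, D (v j - v i) = (v j - v i) * 0 := fun i j _ => by
    rw [map_sub, hv, hv, sub_zero, mul_zero]
  rw [Matrix.det_vandermonde,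
    derivation_prod_of_eq_mul D fun i _ => derivation_prod_of_eq_mul D (h i)]
  simp

theorem powerField_X (χ : Fin 2 → ℝ) (P : ℕ) (z : κ × Fin 2) :
    powerField χ P (X z) = χ z.2 • X z ^ P := by
  rw [powerField, mkDerivation_X]

theorem powerField_smul_of_eq {χ : Fin 2 → ℝ} {P : ℕ} {Q q : MvPolynomial (κ × Fin 2) ℝ}
    (h : 2 * powerField χ P Q = q * Q) (c : ℝ) : 2 * powerField χ P (c • Q) = q * c • Q := by
  rw [Derivation.map_smul, mul_smul_comm, h, mul_smul_comm]

/-- The field in the `x_r` leaves `Δ_n(y)` alone. -/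
theorem powerField_vandermondePair_left (n P : ℕ) :
    2 * powerField ![1, 0] P (vandermondePair n) =
      (∑ i ∈ Finset.range P, powerSum ![1, 0] i * powerSum ![1, 0] (P - 1 - i) -
        (P : MvPolynomial (Fin n × Fin 2) ℝ) * powerSum ![1, 0] (P - 1)) * vandermondePair n := by
  have hp : ∀ i, powerSum ![1, 0] i = ∑ r : Fin n, (X (r, 0) : MvPolynomial (Fin n × Fin 2) ℝ) ^ i
      := fun i => by simp [powerSum, Fintype.sum_prod_type]
  have h0 := two_mul_derivation_vandermonde (powerField ![1, 0] P)
    (fun r : Fin n => (X (r, 0) : MvPolynomial (Fin n × Fin 2) ℝ)) P fun r => by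
      simp [powerField_X]
  have h1 := derivation_vandermonde_eq_zero (powerField ![1, 0] P)
    (v := fun r : Fin n => (X (r, 1) : MvPolynomial (Fin n × Fin 2) ℝ)) fun r => by
      simp [powerField_X]
  simp only [hp]
  rw [vandermondePair, Derivation.leibniz, h1, smul_zero, zero_add, smul_eq_mul, mul_left_comm, h0]
  ring

theorem powerField_vandermondePair_right (n P : ℕ) :
    2 * powerField ![0, 1] P (vandermondePair n) =
      (∑ i ∈ Finset.range P, powerSum ![0, 1] i * powerSum ![0, 1] (P - 1 - i) -
        (P : MvPolynomial (Fin n × Fin 2) ℝ) * powerSum ![0, 1] (P - 1)) * vandermondePair n := by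
  have hp : ∀ i, powerSum ![0, 1] i = ∑ r : Fin n, (X (r, 1) : MvPolynomial (Fin n × Fin 2) ℝ) ^ i
      := fun i => by simp [powerSum, Fintype.sum_prod_type]
  have h0 := derivation_vandermonde_eq_zero (powerField ![0, 1] P)
    (v := fun r : Fin n => (X (r, 0) : MvPolynomial (Fin n × Fin 2) ℝ)) fun r => by
      simp [powerField_X]
  have h1 := two_mul_derivation_vandermonde (powerField ![0, 1] P)
    (fun r : Fin n => (X (r, 1) : MvPolynomial (Fin n × Fin 2) ℝ)) P fun r => by
      simp [powerField_X]
  simp only [hp]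
  rw [vandermondePair, Derivation.leibniz, h0, smul_zero, add_zero, smul_eq_mul, mul_left_comm, h1]
  ring

theorem powerField_vandermondeMerge (n P : ℕ) :
    2 * powerField ![1, 1] P (vandermondeMerge n) =
      (∑ i ∈ Finset.range P, powerSum ![1, 1] i * powerSum ![1, 1] (P - 1 - i) -
        (P : MvPolynomial (Fin n × Fin 2) ℝ) * powerSum ![1, 1] (P - 1)) * vandermondeMerge n := by
  have hχ : ∀ b, (![1, 1] : Fin 2 → ℝ) b = 1 := fun b => by fin_cases b <;> rfl
  have hp : ∀ i, powerSum ![1, 1] i =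
      ∑ k : Fin (2 * n), (X ((pairEquiv n).symm k) : MvPolynomial (Fin n × Fin 2) ℝ) ^ i :=
    fun i => by
      rw [Equiv.sum_comp (pairEquiv n).symm
        fun z => (X z : MvPolynomial (Fin n × Fin 2) ℝ) ^ i]
      simp only [powerSum, hχ, one_smul]
  simp only [hp]
  exact two_mul_derivation_vandermonde (powerField ![1, 1] P)
    (fun k : Fin (2 * n) => (X ((pairEquiv n).symm k) : MvPolynomial (Fin n × Fin 2) ℝ)) P
      fun k => by rw [powerField_X, hχ, one_smul]

end VandermondeFunctional

section Constraints

variable {U : Set ℝ} {V : ℝ → ℝ} {a b : ℕ → ℝ} {T S : ℕ+ →₀ ℝ} {M : ℕ → ℕ → ℝ}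

theorem pairVariation_momentField {κ : Type*} [Fintype κ] [DecidableEq κ] (a b : ℝ)
    (T S : ℕ+ →₀ ℝ) (P : ℕ) (Q : MvPolynomial (κ × Fin 2) ℝ) :
    pairVariation (formalMoment M) (momentField a b T S M P) Q =
      a • (pairVariation (formalMoment M) (fun k l =>
          divergenceTerm ![1, 0] P (formalMoment M) k l +
            flowTerm Sum.inl T 1 ![1, 0] P (formalMoment M) k l) Q +
        pairVariation (formalMoment M) (fun k l =>
          divergenceTerm ![0, 1] P (formalMoment M) k l +
            flowTerm Sum.inr S (-1) ![0, 1] P (formalMoment M) k l) Q) +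
      b • (pairVariation (formalMoment M) (shiftSum ![1, 0] P (formalMoment M)) Q +
        pairVariation (formalMoment M) (shiftSum ![0, 1] P (formalMoment M)) Q) := by
  rw [← pairVariation_add, ← pairVariation_add, ← pairVariation_smul, ← pairVariation_smul,
    ← pairVariation_add]
  rfl

/-- A term of the constraint is the variation of `τ_n` under the vector field `a_i x^P ∂/∂x + a_i
y^P ∂/∂y` on pairs. -/
theorem todaVirasoroTerm_det (k : ℤ) (n i : ℕ) {P : ℕ} (hP : (i : ℤ) + k + 1 = P) :
    todaVirasoroTerm a b T S k n i (Matrix.of fun r s : Fin n => formalMoment M r s).det =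
      pairVariation (formalMoment M) (momentField (a i) (b i) T S M P)
        ((1 / (n.factorial : ℝ)) • vandermondePair n) := by
  have hdet : (Matrix.of fun r s : Fin n => formalMoment M r s).det =
      pairFunctional (formalMoment M) ((1 / (n.factorial : ℝ)) • vandermondePair n) := by
    rw [map_smul, pairFunctional_vandermondePair, smul_smul, one_div_mul_cancel (by positivity),
      one_smul]
  have hl : ∀ (i : ℕ+) k l, MvPowerSeries.pderiv ℝ (Sum.inl i) (formalMoment M k l) =
      (1 : ℝ) • shiftSum ![1, 0] i (formalMoment M) k l := fun i k l => by
    rw [pderiv_formalMoment_inl, shiftSum_zero_one, one_smul]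
  have hr : ∀ (i : ℕ+) k l, MvPowerSeries.pderiv ℝ (Sum.inr i) (formalMoment M k l) =
      (-1 : ℝ) • shiftSum ![0, 1] i (formalMoment M) k l := fun i k l => by
    rw [pderiv_formalMoment_inr, shiftSum_one_zero, neg_one_smul]
  have hNl : (n : ℝ) = Fintype.card (Fin n) * ((![1, 0] : Fin 2 → ℝ) 0 + (![1, 0] : Fin 2 → ℝ) 1) :=
    by simp
  have hNr : (n : ℝ) = Fintype.card (Fin n) * ((![0, 1] : Fin 2 → ℝ) 0 + (![0, 1] : Fin 2 → ℝ) 1) :=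
    by simp
  have h2l := J2_pairFunctional (T := T) Sum.inl_injective (one_mul 1) hl hNl hP
    (powerField_smul_of_eq (powerField_vandermondePair_left n P) (1 / (n.factorial : ℝ)))
  have h2r := J2_pairFunctional (T := S) Sum.inr_injective (by norm_num) hr hNr hP
    (powerField_smul_of_eq (powerField_vandermondePair_right n P) (1 / (n.factorial : ℝ)))
  have h1l := J1_pairFunctional (T := T) (one_mul 1) hl hNl
    ((1 / (n.factorial : ℝ)) • vandermondePair n) P
  have h1r := J1_pairFunctional (T := S) (by norm_num) hr hNr
    ((1 / (n.factorial : ℝ)) • vandermondePair n) P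
  have hE := pairVariation_momentField (M := M) (a i) (b i) T S P
    ((1 / (n.factorial : ℝ)) • vandermondePair n)
  rw [hdet, hE, ← h1l, ← h1r, todaVirasoroTerm, hP]
  generalize pairFunctional (formalMoment M) ((1 / (n.factorial : ℝ)) • vandermondePair n) = φ
    at h2l h2r ⊢
  have h2 := congrArg₂ (· + ·) h2l h2r
  rw [← smul_add] at h2
  have hbracket : J2 Sum.inl T (i + k) φ + J2 Sum.inr S (i + k) φ
      + (2 * (n : ℝ) + (i : ℝ) + (k : ℝ) + 1) •
          (J1 Sum.inl T (i + k) φ - J1 Sum.inr S (i + k) φ)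
      + (2 * (n : ℝ) * ((n : ℝ) + 1) * J0 (i + k)) • φ = _ := Eq.trans (by
        push_cast
        module) h2
  rw [hbracket, smul_smul, div_mul_cancel₀ _ two_ne_zero]
  congr 1
  module

theorem sumsToZero_todaVirasoroTerm (hU : IsOpen U) (ha : ∀ x ∈ U, Summable fun i => a i * x ^ i)
    (hb : ∀ x ∈ U, Summable fun i => b i * x ^ i)
    (hV : ∀ x ∈ U, DifferentiableAt ℝ V x ∧ pser a x * deriv V x = pser b x)
    (hT : DecaysFast U V a b T) (hS : DecaysFast U V a b (-S)) (n : ℕ) {k : ℤ} (hk : -1 ≤ k) :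
    SumsToZero fun i => todaVirasoroTerm a b T S k n i (tau U V T S n) := by
  have h := SumsToZero.pairVariation
    (μ := formalMoment (realMoment (weight U V T) (weight U V (-S))))
    (sumsToZero_momentField fun k' l =>
      hasSum_momentRelation hU ha hb hV hT hS (k + 1).toNat k' l)
    ((1 / (n.factorial : ℝ)) • vandermondePair n)
  rw [tau_eq_det]
  have e : ∀ i, _ := fun i : ℕ => todaVirasoroTerm_det (a := a) (b := b) (T := T) (S := S)
    (M := realMoment (weight U V T) (weight U V (-S))) k n i (P := i + (k + 1).toNat)
      (by push_cast; rw [Int.toNat_of_nonneg (by omega)]; ring)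
  simp only [e]
  exact h

/-- A term of the constraint is the variation of `τ̃_{2n}` under the vector field of the 2-Toda
case, restricted to `s = -t`. -/
theorem pfVirasoroTerm_pfSeries (k : ℤ) (n i : ℕ) {P : ℕ} (hP : k + i + 1 = P) :
    pfVirasoroTerm a b T k (2 * n) i (pfSeries M n) =
      pairVariation (diagMoment M)
        (fun r s => restrictDiag (momentField (a i) (b i) T (-T) M P r s))
        (((-1) ^ n * (1 / (2 ^ n * (n.factorial : ℝ)))) • vandermondeMerge n) := by
  set c : ℝ := (-1) ^ n * (1 / (2 ^ n * (n.factorial : ℝ))) with hc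
  have hpf : pfSeries M n = pairFunctional (diagMoment M) (c • vandermondeMerge n) := by
    rw [map_smul, pairFunctional_vandermondeMerge, pfSeries, pfSeq, pfaffian_eq_sum_pfTerm, hc,
      mul_smul]
    have h := intCast_mul_eq_smul ((-1) ^ n) ((1 / (2 ^ n * (n.factorial : ℝ))) •
      ∑ σ, pfTerm (Matrix.of fun i j : Fin (2 * n) => diagMoment M i j) σ)
    push_cast at h
    exact h
  have hμ : ∀ (i : ℕ+) k l, MvPowerSeries.pderiv ℝ (id i) (diagMoment M k l) =
      (1 : ℝ) • shiftSum ![1, 1] i (diagMoment M) k l := fun i k l => by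
    rw [id, pderiv_diagMoment, one_smul]
    simp [shiftSum]
  have hN : ((2 * n : ℕ) : ℝ) =
      Fintype.card (Fin n) * ((![1, 1] : Fin 2 → ℝ) 0 + (![1, 1] : Fin 2 → ℝ) 1) := by
    simp
    ring
  have h2 := J2_pairFunctional (T := T) Function.injective_id (one_mul 1) hμ hN hP
    (powerField_smul_of_eq (powerField_vandermondeMerge n P) c)
  have h1 := J1_pairFunctional (T := T) (one_mul 1) hμ hN (c • vandermondeMerge n) P
  have hE : pairVariation (diagMoment M) _ (c • vandermondeMerge n) = _ :=
    (pairVariation_add (e := fun r s => a i • (divergenceTerm ![1, 1] P (diagMoment M) r s +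
        flowTerm id T 1 ![1, 1] P (diagMoment M) r s))
      (e' := fun r s => b i • shiftSum ![1, 1] P (diagMoment M) r s) _).trans
      (congrArg₂ (· + ·) (pairVariation_smul _ _) (pairVariation_smul _ _))
  simp only [restrictDiag_momentField]
  rw [hpf, hE, ← h1, pfVirasoroTerm, BJ1, BJ2, hP]
  generalize pairFunctional (diagMoment M) (c • vandermondeMerge n) = φ at h2 ⊢
  have hbracket : J2 id T (k + i) φ + (2 * ((2 * n : ℕ) : ℝ) + ((k + i : ℤ) : ℝ) + 1) •
      J1 id T (k + i) φ + (((2 * n : ℕ) : ℝ) * (((2 * n : ℕ) : ℝ) + 1) * J0 (k + i)) • φ = _ :=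
    Eq.trans (by rw [one_mul]) h2
  rw [hbracket, smul_smul, div_mul_cancel₀ _ two_ne_zero, one_smul]

theorem sumsToZero_pfVirasoroTerm (hU : IsOpen U) (ha : ∀ x ∈ U, Summable fun i => a i * x ^ i)
    (hb : ∀ x ∈ U, Summable fun i => b i * x ^ i)
    (hV : ∀ x ∈ U, DifferentiableAt ℝ V x ∧ pser a x * deriv V x = pser b x)
    (hT : DecaysFast U V a b T) (n : ℕ) {k : ℤ} (hk : -1 ≤ k) :
    SumsToZero fun i => pfVirasoroTerm a b T k (2 * n) i (pfTau U V T (2 * n)) := by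
  have hr := hasSum_momentRelation (S := -T) hU ha hb hV hT (by rwa [neg_neg]) (k + 1).toNat
  rw [neg_neg] at hr
  have h := SumsToZero.pairVariation (μ := diagMoment (realMoment (weight U V T) (weight U V T)))
    (fun r s => coeffFinite_restrictDiag.sumsToZero (sumsToZero_momentField hr r s))
    (((-1) ^ n * (1 / (2 ^ n * (n.factorial : ℝ)))) • vandermondeMerge n)
  rw [pfTau_eq_pfSeries hT.moments]
  have e : ∀ i, _ := fun i : ℕ => pfVirasoroTerm_pfSeries (a := a) (b := b) (T := T)
    (M := realMoment (weight U V T) (weight U V T)) k n i (P := i + (k + 1).toNat)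
      (by push_cast; rw [Int.toNat_of_nonneg (by omega)]; ring)
  simp only [e]
  exact h

end Constraints

end PfaffToda

end

theorem theorem6p2
    (U : Set ℝ) (hU : IsOpen U) (V : ℝ → ℝ) (a b : ℕ → ℝ)
    (ha : ∀ x ∈ U, Summable fun i : ℕ => a i * x ^ i)
    (hb : ∀ x ∈ U, Summable fun i : ℕ => b i * x ^ i)
    (hV : ∀ x ∈ U, DifferentiableAt ℝ V x ∧
      PfaffToda.pser a x * deriv V x = PfaffToda.pser b x) :
    -- the 2-Toda part, at every base point `(T, S)` of the times `(t, s)`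
    (∀ T S : ℕ+ →₀ ℝ, PfaffToda.DecaysFast U V a b T → PfaffToda.DecaysFast U V a b (-S) →
      (∀ k l : ℕ, PfaffToda.FormallyIntegrable (PfaffToda.momentIntegrand U V T S k l)) ∧
      (∀ n : ℕ, PfaffToda.FormallyIntegrable (PfaffToda.multiIntegrand U V T S n) ∧
        PfaffToda.tau U V T S n = (1 / (n.factorial : ℝ)) •
          PfaffToda.formalIntegral (PfaffToda.multiIntegrand U V T S n)) ∧
      -- formal derivatives are derivatives wherever the integrals exist around `(T, S)`
      (∀ l : ℕ+, (∀ᶠ h in 𝓝 (0 : ℝ), PfaffToda.HasMoments U V (T + Finsupp.single l h)) →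
        ∀ (n : ℕ) (m : ℕ+ ⊕ ℕ+ →₀ ℕ), HasDerivAt
          (fun h => MvPowerSeries.coeff m
            (PfaffToda.tau U V (T + Finsupp.single l h) S n))
          (MvPowerSeries.coeff m
            (MvPowerSeries.pderiv ℝ (Sum.inl l) (PfaffToda.tau U V T S n))) 0) ∧
      (∀ l : ℕ+, (∀ᶠ h in 𝓝 (0 : ℝ), PfaffToda.HasMoments U V (-(S + Finsupp.single l h))) →
        ∀ (n : ℕ) (m : ℕ+ ⊕ ℕ+ →₀ ℕ), HasDerivAt
          (fun h => MvPowerSeries.coeff m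
            (PfaffToda.tau U V T (S + Finsupp.single l h) n))
          (MvPowerSeries.coeff m
            (MvPowerSeries.pderiv ℝ (Sum.inr l) (PfaffToda.tau U V T S n))) 0) ∧
      PfaffToda.IsTwoTodaTauVector (PfaffToda.tau U V T S) ∧
      (∀ (n : ℕ) (k : ℤ), -1 ≤ k →
        PfaffToda.SumsToZero fun i =>
          PfaffToda.todaVirasoroTerm a b T S k n i (PfaffToda.tau U V T S n))) ∧
    -- the Pfaffian part, at every base point `T` of the times `t`, with `N = 2 n`
    (∀ T : ℕ+ →₀ ℝ, PfaffToda.DecaysFast U V a b T → ∀ n : ℕ,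
      PfaffToda.FormallyIntegrable (PfaffToda.pfIntegrand U V T (2 * n)) ∧
      PfaffToda.pfTau U V T (2 * n) ^ 2 =
        PfaffToda.restrictDiag (PfaffToda.tau U V T (-T) (2 * n)) ∧
      (U.Nonempty → 0 < MvPowerSeries.constantCoeff (PfaffToda.pfTau U V T (2 * n))) ∧
      PfaffToda.pfTau U V T (2 * n) = (-1) ^ n * PfaffToda.pfaffian
        ((PfaffToda.momentMatrix U V T (-T) (2 * n)).map PfaffToda.restrictDiag) ∧
      (∀ l : ℕ+, (∀ᶠ h in 𝓝 (0 : ℝ), PfaffToda.HasMoments U V (T + Finsupp.single l h)) →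
        ∀ m : ℕ+ →₀ ℕ, HasDerivAt
          (fun h => MvPowerSeries.coeff m
            (PfaffToda.pfTau U V (T + Finsupp.single l h) (2 * n)))
          (MvPowerSeries.coeff m
            (MvPowerSeries.pderiv ℝ l (PfaffToda.pfTau U V T (2 * n)))) 0) ∧
      -- the Pfaffian KP hierarchy, with `τ̃_{-2} = 0`
      PfaffToda.FayIdentity
        (if n = 0 then 0 else PfaffToda.pfTau U V T (2 * n - 2))
        (PfaffToda.pfTau U V T (2 * n)) (PfaffToda.pfTau U V T (2 * n + 2)) ∧
      PfaffToda.HirotaEquations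
        (if n = 0 then 0 else PfaffToda.pfTau U V T (2 * n - 2))
        (PfaffToda.pfTau U V T (2 * n)) (PfaffToda.pfTau U V T (2 * n + 2)) ∧
      -- the Virasoro constraints
      (∀ k : ℤ, -1 ≤ k →
        PfaffToda.SumsToZero fun l =>
          PfaffToda.pfVirasoroTerm a b T k (2 * n) l (PfaffToda.pfTau U V T (2 * n)))) := by
  refine ⟨fun T S hT hS => ⟨fun k l => ?_, fun n => ⟨?_, ?_⟩, fun l hl n m => ?_,
    fun l hl n m => ?_, ?_, fun n k hk => ?_⟩, fun T hT n =>
    have hfay := PfaffToda.fayIdentity_pfTau hU hT.moments n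
    ⟨?_, ?_, fun hne => ?_, ?_, fun l hl m => ?_, hfay,
      PfaffToda.hirotaEquations_of_fayIdentity hfay, fun k hk => ?_⟩⟩
  · exact PfaffToda.formallyIntegrable_momentIntegrand hT.moments hS.moments k l
  · exact PfaffToda.formallyIntegrable_multiIntegrand hT.moments hS.moments n
  · exact PfaffToda.tau_eq_formalIntegral hT.moments hS.moments n
  · exact PfaffToda.hasDerivAt_coeff_tau_left l hS.moments hl n m
  · exact PfaffToda.hasDerivAt_coeff_tau_right l hT.moments hl n m
  · exact PfaffToda.isTwoTodaTauVector_tau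
  · exact PfaffToda.sumsToZero_todaVirasoroTerm hU ha hb hV hT hS n hk
  · exact PfaffToda.formallyIntegrable_pfIntegrand hT.moments n
  · exact PfaffToda.pfTau_sq hU hT.moments n
  · exact PfaffToda.constantCoeff_pfTau_pos hU hne hT.moments n
  · exact PfaffToda.pfTau_eq_pfaffian hT.moments n
  · exact PfaffToda.hasDerivAt_coeff_pfTau l hT.moments hl n m
  · exact PfaffToda.sumsToZero_pfVirasoroTerm hU ha hb hV hT n hk
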